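/- Let $\varepsilon>0$ be real and $t\in\mathbb N$. Consider the following dynamic problems. Directed graphs under edge insertions and deletions (with $n$ vertices and at most $m$ edges at any time): (#SSR) for a fixed source $s$ and a given $\ell$, are fewer than $\ell$ vertices reachable from $s$? (SC2) are there more than $2$ strongly connected components (SCCs)? (AppxSCC, for a constant $k\ge 2$) promised that the number of SCCs is $2$ or more than $k$, which is the case? (MaxSCC) what is the size of the largest SCC? ($ST$-Reach) for fixed vertex sets $S,T$, is some $t'\in T$ unreachable from some $s'\in S$? Undirected graphs: (ConnSub) for a fixed graph with $n$ vertices and at most $m$ edges and a vertex set $S$ under insertions and deletions of vertices, is the subgraph induced by $S$ (nonempty) connected? ($4/3$-Diam) for a graph under edge insertions and deletions, promised that the diameter is $3$ or $4$, which is the case? (This is decided by every $(4/3-\varepsilon')$-approximation of the diameter.) Set systems, where $n$ is the size of the universe plus the number of initial sets, and $m$ bounds the total size of the initial sets: (SubUnion) for a fixed collection of sets that covers the universe, and a subcollection under insertions and deletions of sets, does the subcollection cover the universe? ($\emptyset$-PP) for a collection $X_1,X_2,\dots$ of subsets of a universe, where an update, given $i,j$, adds $X_i\cap X_j$ to the collection: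 given $i$, is $X_i=\emptyset$? The bound $m$ is always assumed to be at least $n\ge 1$. Algorithms are deterministic word RAM programs; in a session of $k$ updates and queries their words have $O(\log(n+m+k))$ bits. Amortized time $O(m^{e})$ after preprocessing time $O(n^t)$ means: the preprocessing takes $O(n^t)$ steps, and after it any sequence of $k$ updates and queries takes $O(n^t+k\,m^{e})$ steps in total (so an initial cost may be charged to the preprocessing). The strong exponential time hypothesis (SETH) is the statement that for every $\gamma>0$ there is a $k$ such that satisfiability of $k$-CNF formulas (at most $k$ literals per clause, distinct clauses) on $n$ variables cannot be decided in time $O(2^{(1-\gamma)n}\,\mathrm{poly}(n))$, on a word RAM with words of $O(n)$ bits. Theorem. Suppose that at least one of the following can be solved: 1. fully dynamic #SSR, SC2, AppxSCC (for some constant $k\ge2$), MaxSCC, SubUnion, $\emptyset$-PP or ConnSub, with preprocessing time $O(n^t)$ and amortized update and query time $O(m^{1-\varepsilon})$; 2. incremental (insertions only) or decremental (deletions only) #SSR, SC2, AppxSCC (for some constant $k\ge2$), MaxSCC, SubUnion or ConnSub, or $\emptyset$-PP (whose updates are insertions only), with preprocessing time $O(n^t)$ and worst case update and query time $O(m^{1-\varepsilon})$;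 3. fully dynamic $ST$-Reach or $4/3$-Diam with preprocessing time $O(n^t)$ and amortized update and query time $O(m^{2-\varepsilon})$; 4. incremental or decremental $ST$-Reach or $4/3$-Diam with preprocessing time $O(n^t)$ and worst case update and query time $O(m^{2-\varepsilon})$. Then SETH is false. -/

import Mathlib

/-! ## The machine model: a word RAM

A program uses finitely many registers and finitely many arrays, indexed by words. All words are
natural numbers below a bound `W` (so a word has `log W` bits); an instruction whose operand or
result would not fit into a word cannot be executed. Every instruction and every test takes one
step. Control flow is structured (sequence, branch, loop). -/

/-- Binary operations on words; comparisons return `1` or `0`. -/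
inductive BinOp where
  | add | sub | mul | div | mod | land | lor | xor | shl | shr | eq | lt

def BinOp.eval : BinOp → ℕ → ℕ → ℕ
  | .add, x, y => x + y
  | .sub, x, y => x - y
  | .mul, x, y => x * y
  | .div, x, y => x / y
  | .mod, x, y => x % y
  | .land, x, y => x &&& y
  | .lor, x, y => x ||| y
  | .xor, x, y => x ^^^ y
  | .shl, x, y => x <<< y
  | .shr, x, y => x >>> y
  | .eq, x, y => if x = y then 1 else 0
  | .lt, x, y => if x < y then 1 else 0

/-- The contents of the registers and of the arrays: `arr k j` is entry `j` of array `k`. -/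
structure Store where
  reg : ℕ → ℕ
  arr : ℕ → ℕ → ℕ

def Store.setReg (s : Store) (d x : ℕ) : Store :=
  { s with reg := Function.update s.reg d x }

def Store.setArr (s : Store) (k j x : ℕ) : Store :=
  { s with arr := Function.update s.arr k (Function.update (s.arr k) j x) }

/-- The store in which a program starts on input `L`: array `0` holds `L`, the rest is zero. -/
def Store.input (L : List ℕ) : Store where
  reg := fun _ => 0
  arr := fun k j => if k = 0 then L.getD j 0 else 0

/-- An operand is a register or a constant. -/
inductive Operand where
  | reg (i : ℕ)
  | const (c : ℕ)

def Operand.val (s : Store) : Operand → ℕ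
  | .reg i => s.reg i
  | .const c => c

inductive Prog where
  | skip
  /-- `reg d := f a b` -/
  | op (d : ℕ) (f : BinOp) (a b : Operand)
  /-- `reg d := arr k a` -/
  | load (d k : ℕ) (a : Operand)
  /-- `arr k a := b` -/
  | store (k : ℕ) (a b : Operand)
  | seq (p q : Prog)
  /-- if `a ≠ 0` then `p` else `q` -/
  | ite (a : Operand) (p q : Prog)
  /-- while `a ≠ 0` do `p` -/
  | loop (a : Operand) (p : Prog)

/-- `Run W p s s' c`: with words below `W`, program `p` started in store `s` halts in store `s'`
after `c` steps. -/
inductive Run (W : ℕ) : Prog → Store → Store → ℕ → Prop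
  | skip (s : Store) : Run W .skip s s 1
  | op (s : Store) (d : ℕ) (f : BinOp) (a b : Operand) (ha : a.val s < W) (hb : b.val s < W)
      (hf : f.eval (a.val s) (b.val s) < W) :
      Run W (.op d f a b) s (s.setReg d (f.eval (a.val s) (b.val s))) 1
  | load (s : Store) (d k : ℕ) (a : Operand) (ha : a.val s < W) (hv : s.arr k (a.val s) < W) :
      Run W (.load d k a) s (s.setReg d (s.arr k (a.val s))) 1
  | store (s : Store) (k : ℕ) (a b : Operand) (ha : a.val s < W) (hb : b.val s < W) :
      Run W (.store k a b) s (s.setArr k (a.val s) (b.val s)) 1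
  | seq {p q : Prog} {s s₁ s₂ : Store} {c₁ c₂ : ℕ} (h₁ : Run W p s s₁ c₁)
      (h₂ : Run W q s₁ s₂ c₂) : Run W (.seq p q) s s₂ (c₁ + c₂)
  | ite_true {a : Operand} {p q : Prog} {s s' : Store} {c : ℕ} (ha : a.val s ≠ 0)
      (h : Run W p s s' c) : Run W (.ite a p q) s s' (c + 1)
  | ite_false {a : Operand} {p q : Prog} {s s' : Store} {c : ℕ} (ha : a.val s = 0)
      (h : Run W q s s' c) : Run W (.ite a p q) s s' (c + 1)
  | loop_done {a : Operand} {p : Prog} {s : Store} (ha : a.val s = 0) :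
      Run W (.loop a p) s s 1
  | loop_step {a : Operand} {p : Prog} {s s₁ s₂ : Store} {c₁ c₂ : ℕ} (ha : a.val s ≠ 0)
      (h₁ : Run W p s s₁ c₁) (h₂ : Run W (.loop a p) s₁ s₂ c₂) :
      Run W (.loop a p) s s₂ (c₁ + c₂ + 1)

/-! ## Satisfiability and the strong exponential time hypothesis -/

/-- A CNF formula is a list of clauses, a clause a list of literals; the literal `(x, b)` says that
variable `x` has value `b`. -/
abbrev CNF := List (List (ℕ × Bool))

/-- `F` is a set of clauses of at most `k` literals each, over the variables `0, …, n - 1`. -/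
def CNF.IsKCNF (F : CNF) (k n : ℕ) : Prop :=
  F.Nodup ∧ ∀ c ∈ F, c.length ≤ k ∧ ∀ l ∈ c, l.1 < n

def CNF.Satisfiable (F : CNF) : Prop :=
  ∃ v : ℕ → Bool, ∀ c ∈ F, ∃ l ∈ c, v l.1 = l.2

def CNF.encode (F : CNF) (n : ℕ) : List ℕ :=
  n :: F.length :: F.flatMap fun c => c.length :: c.map fun l => 2 * l.1 + l.2.toNat

/-- SAT on `k`-CNF formulas on `n` variables can be solved in time `O(2 ^ ((1 - ε) n) poly n)`,
on a word RAM with words of `O(n)` bits. -/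
def KSATSolvable (k : ℕ) (ε : ℝ) : Prop :=
  ∃ (p : Prog) (C : ℕ), ∀ (n : ℕ) (F : CNF), F.IsKCNF k n →
    ∃ (s : Store) (c : ℕ), Run (2 ^ (C * (n + 1))) p (Store.input (F.encode n)) s c ∧
      (s.reg 0 ≠ 0 ↔ F.Satisfiable) ∧
      (c : ℝ) ≤ C * (2 : ℝ) ^ ((1 - ε) * n) * ((n : ℝ) + 1) ^ C

def SETH : Prop := ∀ ε : ℝ, 0 < ε → ∃ k : ℕ, ¬ KSATSolvable k ε

/-! ## Dynamic problems and dynamic algorithms -/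

/-- A dynamic problem. `Valid σ`: `σ` may be the initial instance; `Enc σ L`: `L` is a description
of `σ` as a list of words; `n`, `m`: the size parameters of the initial instance. An insertion or
deletion has two word arguments, a query has one; `insOK`, `delOK`, `askOK` say which requests may
be made. `good σ q a`: `a` is a correct answer to the query `q` on `σ`. -/
structure DynProblem where
  State : Type
  Valid : State → Prop
  Enc : State → List ℕ → Prop
  n : State → ℕ
  m : State → ℕ
  insOK : State → ℕ → ℕ → Prop
  ins : State → ℕ → ℕ → State
  delOK : State → ℕ → ℕ → Prop
  del : State → ℕ → ℕ → State
  askOK : State → ℕ → Prop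
  good : State → ℕ → ℕ → Prop

inductive Request where
  | ins (a b : ℕ)
  | del (a b : ℕ)
  | ask (q : ℕ)

inductive Mode where
  | full | incremental | decremental

def Mode.Allows : Mode → Request → Prop
  | .incremental, .del _ _ => False
  | .decremental, .ins _ _ => False
  | _, _ => True

def DynProblem.RequestOK (P : DynProblem) (σ : P.State) : Request → Prop
  | .ins a b => P.insOK σ a b
  | .del a b => P.delOK σ a b
  | .ask q => P.askOK σ q

def DynProblem.next (P : DynProblem) (σ : P.State) : Request → P.State
  | .ins a b => P.ins σ a b
  | .del a b => P.del σ a b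
  | .ask _ => σ

/-- `rs` is a sequence of requests that may be made, one after the other, from `σ` on. -/
def DynProblem.Legal (P : DynProblem) (μ : Mode) : P.State → List Request → Prop
  | _, [] => True
  | σ, r :: rs => μ.Allows r ∧ P.RequestOK σ r ∧ DynProblem.Legal P μ (P.next σ r) rs

/-- A dynamic algorithm: a program for the preprocessing and one for each kind of request. The
store is kept from one request to the next. The arguments of a request are passed in the registers
`0` and `1`, and the answer to a query is returned in register `0`. -/
structure DynAlg where
  pre : Prog
  ins : Prog
  del : Prog
  ask : Prog

def DynAlg.code (A : DynAlg) : Request → Prog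
  | .ins _ _ => A.ins
  | .del _ _ => A.del
  | .ask _ => A.ask

def Store.call (s : Store) : Request → Store
  | .ins a b => (s.setReg 0 a).setReg 1 b
  | .del a b => (s.setReg 0 a).setReg 1 b
  | .ask q => s.setReg 0 q

def DynProblem.AnswerOK (P : DynProblem) (σ : P.State) (a : ℕ) : Request → Prop
  | .ask q => P.good σ q a
  | _ => True

/-- `Serves P A W σ s rs cs`: with words below `W`, from the store `s` on, which stands for the
instance `σ`, the algorithm `A` processes the requests `rs` one after the other, answers all queries
among them correctly, and spends `cs` steps on them, respectively. -/
inductive Serves (P : DynProblem) (A : DynAlg) (W : ℕ) :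
    P.State → Store → List Request → List ℕ → Prop
  | nil (σ : P.State) (s : Store) : Serves P A W σ s [] []
  | cons {σ : P.State} {s s' : Store} {r : Request} {rs : List Request} {c : ℕ} {cs : List ℕ}
      (hrun : Run W (A.code r) (s.call r) s' c) (hans : P.AnswerOK σ (s'.reg 0) r)
      (hrest : Serves P A W (P.next σ r) s' rs cs) : Serves P A W σ s (r :: rs) (c :: cs)

/-- The bound on the words, for words of `O(log (n + m + k))` bits: `k` is the number of requests
to be served. -/
def DynProblem.wordBound (P : DynProblem) (C : ℕ) (σ : P.State) (k : ℕ) : ℕ :=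
  (P.n σ + P.m σ + k + 2) ^ C

/-- `P` has an algorithm with preprocessing time `O(n ^ t)` and amortized update and query time
`O(m ^ e)`: after the preprocessing, any sequence of `k` requests takes `O(n ^ t + k m ^ e)` steps
in total. -/
def DynProblem.SolvableAmortized (P : DynProblem) (μ : Mode) (t : ℕ) (e : ℝ) : Prop :=
  ∃ (A : DynAlg) (C : ℕ), ∀ (σ : P.State) (L : List ℕ), P.Valid σ → P.Enc σ L →
    ∃ (s : Store) (c₀ : ℕ), Run (P.wordBound C σ 0) A.pre (Store.input L) s c₀ ∧
      c₀ ≤ C * P.n σ ^ t ∧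
      ∀ rs : List Request, P.Legal μ σ rs →
        ∃ cs : List ℕ, Serves P A (P.wordBound C σ rs.length) σ s rs cs ∧
          (cs.sum : ℝ) ≤ C * ((P.n σ : ℝ) ^ t + rs.length * (P.m σ : ℝ) ^ e)

/-- `P` has an algorithm with preprocessing time `O(n ^ t)` and worst case update and query time
`O(m ^ e)`. -/
def DynProblem.SolvableWorstCase (P : DynProblem) (μ : Mode) (t : ℕ) (e : ℝ) : Prop :=
  ∃ (A : DynAlg) (C : ℕ), ∀ (σ : P.State) (L : List ℕ), P.Valid σ → P.Enc σ L →
    ∃ (s : Store) (c₀ : ℕ), Run (P.wordBound C σ 0) A.pre (Store.input L) s c₀ ∧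
      c₀ ≤ C * P.n σ ^ t ∧
      ∀ rs : List Request, P.Legal μ σ rs →
        ∃ cs : List ℕ, Serves P A (P.wordBound C σ rs.length) σ s rs cs ∧
          ∀ c ∈ cs, (c : ℝ) ≤ C * (P.m σ : ℝ) ^ e

/-! ## Descriptions of finite sets as lists of words -/

/-- `l` lists the elements of `A`, each once. -/
def Enumerates {α : Type} (l : List α) (A : Finset α) : Prop :=
  l.Nodup ∧ ∀ x, x ∈ l ↔ x ∈ A

/-- A set of numbers: its size, then its elements. -/
def EncSet (A : Finset ℕ) (L : List ℕ) : Prop :=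
  ∃ l : List ℕ, Enumerates l A ∧ L = l.length :: l

/-- A set of pairs: its size, then its elements. -/
def EncPairs (E : Finset (ℕ × ℕ)) (L : List ℕ) : Prop :=
  ∃ l : List (ℕ × ℕ), Enumerates l E ∧ L = l.length :: l.flatMap fun e => [e.1, e.2]

/-- A list of sets: its length, then the sets one after the other. -/
def EncFamily (X : List (Finset ℕ)) (L : List ℕ) : Prop :=
  ∃ Ls : List (List ℕ), List.Forall₂ EncSet X Ls ∧ L = X.length :: Ls.flatten

/-! ## Graphs -/

/-- A graph with vertices `0, …, n - 1` and edge set `E`; `m` is an upper bound on the number of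
edges at any time. In a directed graph `(a, b)` is the edge from `a` to `b`; in an undirected graph
the edge between `a < b` is given as `(a, b)`. -/
structure DynGraph where
  n : ℕ
  m : ℕ
  E : Finset (ℕ × ℕ)

/-- Simple directed graphs. The bound `m` is taken to be at least `n`. -/
def DynGraph.ValidDirected (G : DynGraph) : Prop :=
  1 ≤ G.n ∧ G.n ≤ G.m ∧ G.E.card ≤ G.m ∧ ∀ e ∈ G.E, e.1 < G.n ∧ e.2 < G.n ∧ e.1 ≠ e.2

/-- Simple undirected graphs. The bound `m` is taken to be at least `n`. -/
def DynGraph.ValidUndirected (G : DynGraph) : Prop :=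
  1 ≤ G.n ∧ G.n ≤ G.m ∧ G.E.card ≤ G.m ∧ ∀ e ∈ G.E, e.1 < e.2 ∧ e.2 < G.n

def DynGraph.Enc (G : DynGraph) (L : List ℕ) : Prop :=
  ∃ L' : List ℕ, EncPairs G.E L' ∧ L = G.n :: G.m :: L'

def DynGraph.Reach (G : DynGraph) : Fin G.n → Fin G.n → Prop :=
  Relation.ReflTransGen fun u v => (u.1, v.1) ∈ G.E

/-- The strongly connected component of `v`. -/
def DynGraph.scc (G : DynGraph) (v : Fin G.n) : Set (Fin G.n) :=
  {u | G.Reach u v ∧ G.Reach v u}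

noncomputable def DynGraph.numSCC (G : DynGraph) : ℕ := (Set.range G.scc).ncard

noncomputable def DynGraph.maxSCC (G : DynGraph) : ℕ := Finset.univ.sup fun v => (G.scc v).ncard

/-- The number of vertices that are reachable from the vertex `s` (including `s`). -/
noncomputable def DynGraph.numReach (G : DynGraph) (s : ℕ) : ℕ :=
  {v : Fin G.n | ∃ h : s < G.n, G.Reach ⟨s, h⟩ v}.ncard

def DynGraph.toSimpleGraph (G : DynGraph) : SimpleGraph (Fin G.n) :=
  SimpleGraph.fromRel fun u v => (u.1, v.1) ∈ G.E

/-! ## The problems. In a yes-no query every nonzero answer means yes. -/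

/-- A problem about a directed graph under edge insertions and deletions, together with fixed data
of type `D`. -/
def directedProblem (D : Type) (dataOK : DynGraph → D → Prop) (dataEnc : D → List ℕ → Prop)
    (askOK : DynGraph → D → ℕ → Prop) (good : DynGraph → D → ℕ → ℕ → Prop) : DynProblem where
  State := DynGraph × D
  Valid := fun σ => σ.1.ValidDirected ∧ dataOK σ.1 σ.2
  Enc := fun σ L => ∃ L₁ L₂, σ.1.Enc L₁ ∧ dataEnc σ.2 L₂ ∧ L = L₁ ++ L₂
  n := fun σ => σ.1.n
  m := fun σ => σ.1.m
  insOK := fun σ a b => a < σ.1.n ∧ b < σ.1.n ∧ a ≠ b ∧ (a, b) ∉ σ.1.E ∧ σ.1.E.card < σ.1.m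
  ins := fun σ a b => ({ σ.1 with E := insert (a, b) σ.1.E }, σ.2)
  delOK := fun σ a b => (a, b) ∈ σ.1.E
  del := fun σ a b => ({ σ.1 with E := σ.1.E.erase (a, b) }, σ.2)
  askOK := fun σ q => askOK σ.1 σ.2 q
  good := fun σ q a => good σ.1 σ.2 q a

/-- `#SSR`: for the fixed source `s` and given `ℓ`, are fewer than `ℓ` vertices reachable? -/
noncomputable def SSRCount : DynProblem :=
  directedProblem ℕ (fun G s => s < G.n) (fun s L => L = [s]) (fun G _ l => l ≤ G.n)
    (fun G s l a => a ≠ 0 ↔ G.numReach s < l)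

/-- SC2: are there more than two strongly connected components? -/
noncomputable def SC2 : DynProblem :=
  directedProblem Unit (fun _ _ => True) (fun _ L => L = []) (fun _ _ q => q = 0)
    (fun G _ _ a => a ≠ 0 ↔ 2 < G.numSCC)

/-- AppxSCC with constant `k`: promised that the number of strongly connected components is `2` or
more than `k`, is it more than `k`? -/
noncomputable def AppxSCC (k : ℕ) : DynProblem :=
  directedProblem Unit (fun _ _ => True) (fun _ L => L = [])
    (fun G _ q => q = 0 ∧ (G.numSCC = 2 ∨ k < G.numSCC))
    (fun G _ _ a => a ≠ 0 ↔ k < G.numSCC)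

/-- MaxSCC: what is the size of the largest strongly connected component? -/
noncomputable def MaxSCC : DynProblem :=
  directedProblem Unit (fun _ _ => True) (fun _ L => L = []) (fun _ _ q => q = 0)
    (fun G _ _ a => a = G.maxSCC)

/-- `ST`-Reach: for the fixed vertex sets `S` and `T`, is some `t ∈ T` unreachable from some
`s ∈ S`? -/
def STReach : DynProblem :=
  directedProblem (Finset ℕ × Finset ℕ)
    (fun G D => (∀ x ∈ D.1, x < G.n) ∧ ∀ x ∈ D.2, x < G.n)
    (fun D L => ∃ L₁ L₂, EncSet D.1 L₁ ∧ EncSet D.2 L₂ ∧ L = L₁ ++ L₂)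
    (fun _ _ q => q = 0)
    (fun G D _ a => a ≠ 0 ↔ ∃ s t : Fin G.n, s.1 ∈ D.1 ∧ t.1 ∈ D.2 ∧ ¬ G.Reach s t)

/-- `4/3`-Diam: an undirected graph under edge insertions and deletions; promised that the diameter
is `3` or `4`, which of them is it? The answer `a` only has to separate the two cases, so every
integer estimate that is off by a factor of less than `4/3` (on one side) will do. -/
noncomputable def Diam43 : DynProblem where
  State := DynGraph
  Valid := DynGraph.ValidUndirected
  Enc := DynGraph.Enc
  n := DynGraph.n
  m := DynGraph.m
  insOK := fun G a b => a < b ∧ b < G.n ∧ (a, b) ∉ G.E ∧ G.E.card < G.m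
  ins := fun G a b => { G with E := insert (a, b) G.E }
  delOK := fun G a b => (a, b) ∈ G.E
  del := fun G a b => { G with E := G.E.erase (a, b) }
  askOK := fun G q => q = 0 ∧ (G.toSimpleGraph.ediam = 3 ∨ G.toSimpleGraph.ediam = 4)
  good := fun G _ a =>
    (G.toSimpleGraph.ediam = 3 → a ≤ 3) ∧ (G.toSimpleGraph.ediam = 4 → 4 ≤ a)

/-- ConnSub: a fixed undirected graph and a vertex set `S` under insertions and deletions of
vertices; is the subgraph induced by `S` connected? (Asked for nonempty `S` only. The second
argument of an update is not used.) -/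
def ConnSub : DynProblem where
  State := DynGraph × Finset ℕ
  Valid := fun σ => σ.1.ValidUndirected ∧ ∀ x ∈ σ.2, x < σ.1.n
  Enc := fun σ L => ∃ L₁ L₂, σ.1.Enc L₁ ∧ EncSet σ.2 L₂ ∧ L = L₁ ++ L₂
  n := fun σ => σ.1.n
  m := fun σ => σ.1.m
  insOK := fun σ a b => a < σ.1.n ∧ a ∉ σ.2 ∧ b = 0
  ins := fun σ a _ => (σ.1, insert a σ.2)
  delOK := fun σ a b => a ∈ σ.2 ∧ b = 0
  del := fun σ a _ => (σ.1, σ.2.erase a)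
  askOK := fun σ q => q = 0 ∧ σ.2.Nonempty
  good := fun σ _ a => a ≠ 0 ↔ (σ.1.toSimpleGraph.induce {v | v.1 ∈ σ.2}).Connected

/-- A family `X` of subsets of the universe `{0, …, u - 1}`; `m` is an upper bound on the total
size. -/
structure SetFamily where
  u : ℕ
  m : ℕ
  X : List (Finset ℕ)

/-- The parameter `n` of a family bounds both the size of the universe and the number of sets (up
to a factor of two it is the larger of these). -/
def SetFamily.n (F : SetFamily) : ℕ := F.u + F.X.length

/-- The bound `m` is taken to be at least `n`. -/
def SetFamily.Valid (F : SetFamily) : Prop :=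
  1 ≤ F.u ∧ F.n ≤ F.m ∧ (F.X.map Finset.card).sum ≤ F.m ∧ ∀ A ∈ F.X, ∀ x ∈ A, x < F.u

def SetFamily.Enc (F : SetFamily) (L : List ℕ) : Prop :=
  ∃ L' : List ℕ, EncFamily F.X L' ∧ L = F.u :: F.m :: L'

/-- SubUnion: a fixed family that covers the universe, and a subfamily (given by the set `S` of the
indices) under insertions and deletions of sets; does the subfamily cover the universe? (The
second argument of an update is not used.) -/
def SubUnion : DynProblem where
  State := SetFamily × Finset ℕ
  Valid := fun σ => σ.1.Valid ∧ (∀ x < σ.1.u, ∃ A ∈ σ.1.X, x ∈ A) ∧ ∀ i ∈ σ.2, i < σ.1.X.length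
  Enc := fun σ L => ∃ L₁ L₂, σ.1.Enc L₁ ∧ EncSet σ.2 L₂ ∧ L = L₁ ++ L₂
  n := fun σ => σ.1.n
  m := fun σ => σ.1.m
  insOK := fun σ a b => a < σ.1.X.length ∧ a ∉ σ.2 ∧ b = 0
  ins := fun σ a _ => (σ.1, insert a σ.2)
  delOK := fun σ a b => a ∈ σ.2 ∧ b = 0
  del := fun σ a _ => (σ.1, σ.2.erase a)
  askOK := fun _ q => q = 0
  good := fun σ _ a => a ≠ 0 ↔ ∀ x < σ.1.u, ∃ i ∈ σ.2, x ∈ σ.1.X.getD i ∅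

/-- `∅`-PP: a growing family of sets; an update appends the intersection of the sets with indices
`i` and `j` to the family, and a query asks whether the set with index `i` is empty. There are no
deletions. The sizes `n` and `m` are those of the initial family. -/
def EmptyPP : DynProblem where
  State := SetFamily
  Valid := SetFamily.Valid
  Enc := SetFamily.Enc
  n := SetFamily.n
  m := SetFamily.m
  insOK := fun F i j => i < F.X.length ∧ j < F.X.length
  ins := fun F i j => { F with X := F.X ++ [F.X.getD i ∅ ∩ F.X.getD j ∅] }
  delOK := fun _ _ _ => False
  del := fun F _ _ => F
  askOK := fun F i => i < F.X.length
  good := fun F i a => a ≠ 0 ↔ F.X.getD i ∅ = ∅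

/-- Fully dynamic with amortized bounds, or incremental or decremental with worst case bounds. -/
def DynProblem.Solvable (P : DynProblem) (t : ℕ) (e : ℝ) : Prop :=
  P.SolvableAmortized .full t e ∨ P.SolvableWorstCase .incremental t e ∨
    P.SolvableWorstCase .decremental t e

/-! ## Elementary facts about runs -/

/-! All reductions follow one scheme. The `n` variables of a `k`-CNF formula with `M` clauses are
cut into a left block of `N₁ = n / q` variables, a right block that is empty (`two = 0`) or of the
same size (`two = 1`), and the rest. The table of the clauses satisfied by each of the `2 ^ N₁`
assignments to a block is turned into a dynamic instance of size `m = 2 ^ N₁ * poly n`. Each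
assignment to the remaining variables then gets one stage: one update per clause tells the data
structure whether the clause is already satisfied, and one query reveals whether the assignment
extends to a satisfying one.

There are `2 ^ (n - (1 + two) * N₁)` stages, and one takes `M * m ^ (1 + two - ε)` steps up to
constants. Up to polynomial factors this makes `2 ^ (n - ε * N₁)`, that is `2 ^ ((1 - ε / q) * n)`.
Writing the instance and preprocessing it are polynomial in `2 ^ N₁` with a degree independent of
the formula, and `q` is so large that they take about `2 ^ (n / 2)` steps at most. Neither `q` nor
the saving depends on `k`, so SETH fails. As `k` is fixed, `M` is polynomial in `n`, and no
sparsification is needed. This computation is `Gadget.kSATSolvable`.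

Between stages one has to get back to the initial instance. In the fully dynamic case the updates
are undone, all stages form a single sequence, and amortized bounds suffice. In the incremental and
decremental cases the memory of the data structure is set back to what it was after the
preprocessing, and then the bounds have to be worst case bounds. To make this cheap, the data
structure runs as a guest whose arrays carry time stamps; raising the epoch forgets all changes at
once (`Run.guest`, `resetGuest_spec`). For `∅`-PP nothing has to be taken back, because new sets are
only appended. The whole program is verified in `solver_run` by a calculus of weakest preconditions
with a clock.

The gadgets all detect a clause that is falsified by every part of an assignment. With one block,
each left assignment is tested for such a clause: by being pulled into the component of a source
(`sccGraph_facts`), by being covered (`cover_iff`), by being attached to a root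
(`induce_connected_iff`), or by dropping out of an intersection (`meetCode_spec`). With two blocks,
a falsified clause gives a path with three edges between a left and a right assignment
(`stGraph_unreachable_iff`, `ediam_diamGraph`). All but the intersections use two switches per
clause, of which one is on; `Toggle.not_seth` treats the three modes for all of these at once. -/

theorem Run.mono {W W' : ℕ} (h : W ≤ W') {p : Prog} {s s' : Store} {c : ℕ}
    (r : Run W p s s' c) : Run W' p s s' c := by
  induction r with
  | skip s => exact .skip s
  | op s d f a b ha hb hf => exact .op s d f a b (by omega) (by omega) (by omega)
  | load s d k a ha hv => exact .load s d k a (by omega) (by omega)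
  | store s k a b ha hb => exact .store s k a b (by omega) (by omega)
  | seq _ _ h₁ h₂ => exact .seq h₁ h₂
  | ite_true ha _ h => exact .ite_true ha h
  | ite_false ha _ h => exact .ite_false ha h
  | loop_done ha => exact .loop_done ha
  | loop_step ha _ _ h₁ h₂ => exact .loop_step ha h₁ h₂

/-- An instruction whose result does not fit into a word cannot be executed. Because of this the
registers of the guest can later be copied into an array. -/
theorem Run.reg_lt {W : ℕ} {p : Prog} {s s' : Store} {c : ℕ} (r : Run W p s s' c)
    (h : ∀ i, s.reg i < W) : ∀ i, s'.reg i < W := by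
  induction r with
  | skip s => exact h
  | op s d f a b ha hb hf =>
    intro i; by_cases hi : i = d
    · subst hi; simpa [Store.setReg] using hf
    · simpa [Store.setReg, Function.update_of_ne hi] using h i
  | load s d k a ha hv =>
    intro i; by_cases hi : i = d
    · subst hi; simpa [Store.setReg] using hv
    · simpa [Store.setReg, Function.update_of_ne hi] using h i
  | store s k a b ha hb => exact h
  | seq _ _ h₁ h₂ => exact h₂ (h₁ h)
  | ite_true ha _ h₁ => exact h₁ h
  | ite_false ha _ h₁ => exact h₁ h
  | loop_done ha => exact h
  | loop_step ha _ _ h₁ h₂ => exact h₂ (h₁ h)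

@[simp] theorem Store.setReg_reg_self (s : Store) (d x : ℕ) : (s.setReg d x).reg d = x :=
  Function.update_self _ _ _

theorem Store.setReg_reg_of_ne (s : Store) {d i : ℕ} (x : ℕ) (h : i ≠ d) :
    (s.setReg d x).reg i = s.reg i :=
  Function.update_of_ne h _ _

/-- A bound on the registers that a program writes to. -/
def Prog.regBound : Prog → ℕ
  | .skip => 0
  | .op d _ _ _ => d + 1
  | .load d _ _ => d + 1
  | .store _ _ _ => 0
  | .seq p q => max p.regBound q.regBound
  | .ite _ p q => max p.regBound q.regBound
  | .loop _ p => p.regBound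

/-- A program names finitely many registers, so a reset has to restore only a constant number of
them. -/
theorem Run.reg_eq_of_regBound_le {W : ℕ} {p : Prog} {s s' : Store} {c : ℕ}
    (r : Run W p s s' c) {i : ℕ} (hi : p.regBound ≤ i) : s'.reg i = s.reg i := by
  induction r with
  | skip s => rfl
  | op s d f a b ha hb hf =>
    simp only [Prog.regBound] at hi
    exact Function.update_of_ne (by omega) _ _
  | load s d k a ha hv =>
    simp only [Prog.regBound] at hi
    exact Function.update_of_ne (by omega) _ _
  | store s k a b ha hb => rfl
  | seq _ _ h₁ h₂ =>
    simp only [Prog.regBound] at hi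
    rw [h₂ (by omega), h₁ (by omega)]
  | ite_true ha _ h₁ => simp only [Prog.regBound] at hi; exact h₁ (by omega)
  | ite_false ha _ h₁ => simp only [Prog.regBound] at hi; exact h₁ (by omega)
  | loop_done ha => rfl
  | loop_step ha _ _ h₁ h₂ => rw [h₂ hi, h₁ hi]

/-! ## Simulating a program on separate registers and arrays, with rollback

The registers of the host are divided into variables `3 i`, temporaries `3 i + 1` and the registers
`3 i + 2` of the guest; array `4 k` belongs to the host. Array `k` of the guest is kept in three
arrays: the base contents `4 k + 1`, the current contents `4 k + 2`, and stamps `4 k + 3` which say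
whether an entry of the second array is valid: it is when the stamp equals the nonzero epoch in
variable `epochVar`. In epoch zero the guest works on its base contents directly. -/

notation "epochVar" => (44 : ℕ)

def Operand.guest : Operand → Operand
  | .reg i => .reg (3 * i + 2)
  | .const c => .const c

def Prog.guest : Prog → Prog
  | .skip => .skip
  | .op d f a b => .op (3 * d + 2) f a.guest b.guest
  | .load d k a =>
    -- Register `1` becomes the epoch times the truth value of "the stamp equals the epoch". This is
    -- nonzero exactly if the epoch is nonzero and the current entry is valid.
    .seq (.load 1 (4 * k + 3) a.guest) (.seq (.op 1 .eq (.reg 1) (.reg (3 * epochVar)))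
      (.seq (.op 1 .mul (.reg 1) (.reg (3 * epochVar)))
        (.ite (.reg 1) (.load (3 * d + 2) (4 * k + 2) a.guest)
          (.load (3 * d + 2) (4 * k + 1) a.guest))))
  | .store k a b =>
    .ite (.reg (3 * epochVar))
      (.seq (.store (4 * k + 3) a.guest (.reg (3 * epochVar))) (.store (4 * k + 2) a.guest b.guest))
      (.store (4 * k + 1) a.guest b.guest)
  | .seq p q => .seq p.guest q.guest
  | .ite a p q => .ite a.guest p.guest q.guest
  | .loop a p => .loop a.guest p.guest

/-- The host store `s` represents the guest store `a`. -/
structure Hosts (s a : Store) : Prop where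
  reg : ∀ i, s.reg (3 * i + 2) = a.reg i
  arr : ∀ k j, a.arr k j = if s.reg (3 * epochVar) ≠ 0 ∧ s.arr (4 * k + 3) j = s.reg (3 * epochVar)
    then s.arr (4 * k + 2) j else s.arr (4 * k + 1) j
  -- No stamp exceeds the epoch, so raising the epoch by one invalidates all current entries at
  -- once.
  stamp : ∀ k j, s.arr (4 * k + 3) j ≤ s.reg (3 * epochVar)

/-- What the simulation leaves unchanged. -/
structure HostFrame (s s' : Store) : Prop where
  var : ∀ i, s'.reg (3 * i) = s.reg (3 * i)
  arr : ∀ k, s'.arr (4 * k) = s.arr (4 * k)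
  -- In a nonzero epoch the base contents are a snapshot that the guest cannot alter.
  base : s.reg (3 * epochVar) ≠ 0 → ∀ k, s'.arr (4 * k + 1) = s.arr (4 * k + 1)

theorem HostFrame.refl (s : Store) : HostFrame s s := ⟨fun _ => rfl, fun _ => rfl, fun _ _ => rfl⟩

theorem HostFrame.trans {s s' s'' : Store} (h : HostFrame s s') (h' : HostFrame s' s'') :
    HostFrame s s'' :=
  ⟨fun i => (h'.var i).trans (h.var i), fun k => (h'.arr k).trans (h.arr k), fun he k =>
    (h'.base (by rw [h.var]; exact he) k).trans (h.base he k)⟩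

theorem Hosts.operand {s a : Store} (h : Hosts s a) (o : Operand) : o.guest.val s = o.val a := by
  cases o with
  | reg i => exact h.reg i
  | const c => rfl

theorem Hosts.setReg {s a : Store} (h : Hosts s a) (d x : ℕ) :
    Hosts (s.setReg (3 * d + 2) x) (a.setReg d x) := by
  have e : (s.setReg (3 * d + 2) x).reg (3 * epochVar) = s.reg (3 * epochVar) :=
    Function.update_of_ne (by omega) _ _
  refine ⟨fun i => ?_, fun k j => ?_, fun k j => ?_⟩
  · by_cases hi : i = d
    · subst hi; simp [Store.setReg]
    · have : 3 * i + 2 ≠ 3 * d + 2 := by omega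
      simp only [Store.setReg, Function.update_of_ne hi, Function.update_of_ne this, h.reg]
  · rw [e]; exact h.arr k j
  · rw [e]; exact h.stamp k j

theorem Hosts.setTemp {s a : Store} (h : Hosts s a) (d x : ℕ) :
    Hosts (s.setReg (3 * d + 1) x) a := by
  have e : (s.setReg (3 * d + 1) x).reg (3 * epochVar) = s.reg (3 * epochVar) :=
    Function.update_of_ne (by omega) _ _
  refine ⟨fun i => ?_, fun k j => ?_, fun k j => ?_⟩
  · exact (Function.update_of_ne (by omega) _ _).trans (h.reg i)
  · rw [e]; exact h.arr k j
  · rw [e]; exact h.stamp k j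

theorem HostFrame.setReg (s : Store) {d : ℕ} (x : ℕ) (hd : d % 3 ≠ 0) :
    HostFrame s (s.setReg d x) :=
  ⟨fun i => Function.update_of_ne (by omega) _ _, fun _ => rfl, fun _ _ => rfl⟩

theorem Store.setArr_arr (s : Store) (k j x k' j' : ℕ) :
    (s.setArr k j x).arr k' j' = if k' = k ∧ j' = j then x else s.arr k' j' := by
  simp only [Store.setArr, Function.update_apply]
  by_cases h : k' = k
  · subst h; simp [Function.update_apply]
  · simp [h]

/-- The worst case is a load, which takes five steps: stamp, comparison, product, test, access. The
epoch is a variable of the host, which the guest never changes, so it is the same throughout the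
run. -/
theorem Run.guest {W : ℕ} {p : Prog} {a a' : Store} {c : ℕ} (r : Run W p a a' c) {s : Store}
    (h : Hosts s a) (hW : 1 < W) (he : s.reg (3 * epochVar) < W) :
    ∃ s' c', Run W p.guest s s' c' ∧ c' ≤ 5 * c ∧ Hosts s' a' ∧ HostFrame s s' := by
  induction r generalizing s with
  | skip a => exact ⟨s, 1, .skip s, by omega, h, .refl s⟩
  | op a d f x y hx hy hf =>
    rw [← h.operand] at hx hf; rw [← h.operand] at hy hf
    refine ⟨_, 1, .op s _ f _ _ hx hy hf, by omega, ?_, .setReg s _ (by omega)⟩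
    rw [h.operand, h.operand]
    exact h.setReg _ _
  | load a d k x hx hv =>
    rw [← h.operand] at hx hv
    set j := x.guest.val s with hj
    have hst := h.stamp k j
    have hjt : ∀ y : ℕ, x.guest.val (s.setReg 1 y) = j := by
      intro y
      rw [(h.setTemp 0 y).operand, hj, h.operand]
    have hjt2 : ∀ y z : ℕ, x.guest.val ((s.setReg 1 y).setReg 1 z) = j := by
      intro y z
      rw [((h.setTemp 0 y).setTemp 0 z).operand, hj, h.operand]
    have hjt3 : ∀ y z w : ℕ, x.guest.val (((s.setReg 1 y).setReg 1 z).setReg 1 w) = j := by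
      intro y z w
      rw [(((h.setTemp 0 y).setTemp 0 z).setTemp 0 w).operand, hj, h.operand]
    have r1 := Run.load (W := W) s 1 (4 * k + 3) x.guest hx (by rw [← hj]; omega)
    rw [← hj] at r1
    set s1 := s.setReg 1 (s.arr (4 * k + 3) j) with hs1
    have e1 : s1.reg (3 * epochVar) = s.reg (3 * epochVar) := s.setReg_reg_of_ne _ (by omega)
    have t1 : s1.reg 1 = s.arr (4 * k + 3) j := s.setReg_reg_self _ _
    have r2 := Run.op (W := W) s1 1 .eq (.reg 1) (.reg (3 * epochVar))
      (by simp only [Operand.val, t1]; omega) (by simp only [Operand.val, e1]; omega)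
      (by simp only [BinOp.eval, Operand.val, t1, e1]; split_ifs <;> omega)
    simp only [BinOp.eval, Operand.val, t1, e1] at r2
    set q := (if s.arr (4 * k + 3) j = s.reg (3 * epochVar) then 1 else 0) with hq
    set s2 := s1.setReg 1 q with hs2
    have e2 : s2.reg (3 * epochVar) = s.reg (3 * epochVar) :=
      (s1.setReg_reg_of_ne _ (by omega)).trans e1
    have t2 : s2.reg 1 = q := s1.setReg_reg_self _ _
    have hq1 : q ≤ 1 := by rw [hq]; split_ifs <;> omega
    have r3 := Run.op (W := W) s2 1 .mul (.reg 1) (.reg (3 * epochVar))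
      (by simp only [Operand.val, t2]; rw [hq]; split_ifs <;> omega)
      (by simp only [Operand.val, e2]; omega)
      (by
        simp only [BinOp.eval, Operand.val, t2, e2]
        exact lt_of_le_of_lt (Nat.mul_le_mul_right _ hq1) (by omega))
    simp only [BinOp.eval, Operand.val, t2, e2] at r3
    set s3 := s2.setReg 1 (q * s.reg (3 * epochVar)) with hs3
    have t3 : s3.reg 1 = q * s.reg (3 * epochVar) := s2.setReg_reg_self _ _
    have h3 : Hosts s3 a := ((h.setTemp 0 _).setTemp 0 _).setTemp 0 _
    have f3 : HostFrame s s3 :=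
      ((HostFrame.setReg s _ (by omega)).trans (.setReg _ _ (by omega))).trans
        (.setReg _ _ (by omega))
    have hj3 : x.guest.val s3 = j := hjt3 _ _ _
    have harr : ∀ k j, s3.arr k j = s.arr k j := fun _ _ => rfl
    have ha := h.arr k j
    have hxa : x.val a = j := (h.operand x).symm
    rw [hxa]
    by_cases hc : s.reg (3 * epochVar) ≠ 0 ∧ s.arr (4 * k + 3) j = s.reg (3 * epochVar)
    · have hq' : q * s.reg (3 * epochVar) ≠ 0 := by simp [hq, hc.2, hc.1]
      rw [if_pos hc] at ha
      refine ⟨_, _, .seq r1 (.seq r2 (.seq r3 (.ite_true (a := .reg 1) (by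
        simpa only [Operand.val, t3] using hq')
          (.load s3 _ _ _ (by rw [hj3]; exact hx) (by rw [hj3, harr, ← ha]; exact hv))))),
          by omega, ?_, f3.trans (.setReg _ _ (by omega))⟩
      rw [hj3, harr, ← ha]
      exact h3.setReg _ _
    · have hq' : q * s.reg (3 * epochVar) = 0 := by
        simp only [hq]; split_ifs with hh
        · simp only [hh, and_true, not_not] at hc; simp [hc]
        · simp
      rw [if_neg hc] at ha
      refine ⟨_, _, .seq r1 (.seq r2 (.seq r3 (.ite_false (a := .reg 1) (by
        simpa only [Operand.val, t3] using hq')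
          (.load s3 _ _ _ (by rw [hj3]; exact hx) (by rw [hj3, harr, ← ha]; exact hv))))),
          by omega, ?_, f3.trans (.setReg _ _ (by omega))⟩
      rw [hj3, harr, ← ha]
      exact h3.setReg _ _
  | store a k x y hx hy =>
    rw [← h.operand] at hx hy
    rw [← h.operand, ← h.operand]
    by_cases hc : s.reg (3 * epochVar) = 0
    · refine ⟨_, _, .ite_false (a := .reg _) hc (.store s _ _ _ hx hy), by omega, ?_, ?_⟩
      · refine ⟨h.reg, fun k' j' => ?_, fun k' j' => ?_⟩
        · have : (s.setArr (4 * k + 1) (x.guest.val s) (y.guest.val s)).reg (3 * epochVar) = 0 := hc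
          simp only [this, Store.setArr_arr, h.arr k' j', hc]
          by_cases hk : k' = k
          · subst hk; simp
          · have : 4 * k' ≠ 4 * k := by omega
            simp [hk]
        · have := h.stamp k' j'
          simp only [Store.setArr_arr]
          rw [if_neg (by omega)]; exact this
      · refine ⟨fun _ => rfl, fun k' => ?_, fun hh => absurd hc hh⟩
        exact Function.update_of_ne (by omega) _ _
    · refine ⟨_, _, .ite_true (a := .reg _) hc (.seq (.store s _ _ _ hx he)
        (.store _ _ _ _ (by exact hx) (by exact hy))), by omega, ?_, ?_⟩
      · refine ⟨h.reg, fun k' j' => ?_, fun k' j' => ?_⟩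
        · have e : ∀ z w u z' w' u', ((s.setArr z w u).setArr z' w' u').reg (3 * epochVar) =
            s.reg (3 * epochVar) := fun _ _ _ _ _ _ => rfl
          rw [e]
          simp only [Store.setArr_arr, h.arr k' j']
          have e2 : ∀ z w u, y.guest.val (s.setArr z w u) = y.guest.val s := by
            intro z w u; cases y <;> rfl
          have e3 : ∀ z w u, x.guest.val (s.setArr z w u) = x.guest.val s := by
            intro z w u; cases x <;> rfl
          have ev' : (Operand.reg (3 * epochVar)).val s = s.reg (3 * epochVar) := rfl
          have h1 : ¬ 4 * k' + 3 = 4 * k + 2 := by omega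
          have h2 : ¬ 4 * k' + 1 = 4 * k + 2 := by omega
          have h3 : ¬ 4 * k' + 1 = 4 * k + 3 := by omega
          have h4 : ¬ 4 * k' + 2 = 4 * k + 3 := by omega
          by_cases hk : k' = k ∧ j' = x.guest.val s
          · obtain ⟨rfl, rfl⟩ := hk
            simp only [e2, e3, hc, h1, ev', and_self, not_false_eq_true, ne_eq, if_true, false_and,
              if_false]
          · have h5 : ¬ (4 * k' + 2 = 4 * k + 2 ∧ j' = x.guest.val s) := by omega
            have h6 : ¬ (4 * k' + 3 = 4 * k + 3 ∧ j' = x.guest.val s) := by omega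
            simp only [e2, e3, h1, h2, h3, h4, h5, h6, hk, false_and, if_false]
        · have e : ∀ z w u z' w' u', ((s.setArr z w u).setArr z' w' u').reg (3 * epochVar) =
            s.reg (3 * epochVar) := fun _ _ _ _ _ _ => rfl
          rw [e]
          simp only [Store.setArr_arr]
          rw [if_neg (by omega)]
          split_ifs
          · exact le_rfl
          · exact h.stamp k' j'
      · refine ⟨fun _ => rfl, fun k' => ?_, fun _ k' => ?_⟩
        · exact (Function.update_of_ne (by omega) _ _).trans (Function.update_of_ne (by omega) _ _)
        · exact (Function.update_of_ne (by omega) _ _).trans (Function.update_of_ne (by omega) _ _)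
  | seq _ _ h₁ h₂ =>
    obtain ⟨s1, c1, r1, b1, H1, F1⟩ := h₁ h he
    obtain ⟨s2, c2, r2, b2, H2, F2⟩ := h₂ H1 (by rw [F1.var]; exact he)
    exact ⟨s2, _, .seq r1 r2, by omega, H2, F1.trans F2⟩
  | ite_true ha _ h₁ =>
    obtain ⟨s1, c1, r1, b1, H1, F1⟩ := h₁ h he
    exact ⟨s1, _, .ite_true (by rw [h.operand]; exact ha) r1, by omega, H1, F1⟩
  | ite_false ha _ h₁ =>
    obtain ⟨s1, c1, r1, b1, H1, F1⟩ := h₁ h he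
    exact ⟨s1, _, .ite_false (by rw [h.operand]; exact ha) r1, by omega, H1, F1⟩
  | loop_done ha =>
    exact ⟨s, 1, .loop_done (by rw [h.operand]; exact ha), by omega, h, .refl s⟩
  | loop_step ha _ _ h₁ h₂ =>
    obtain ⟨s1, c1, r1, b1, H1, F1⟩ := h₁ h he
    obtain ⟨s2, c2, r2, b2, H2, F2⟩ := h₂ H1 (by rw [F1.var]; exact he)
    exact ⟨s2, _, .loop_step (by rw [h.operand]; exact ha) r1 r2, by omega, H2, F1.trans F2⟩

/-! ## Expressions -/

inductive Exp where
  | var (i : ℕ)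
  | lit (c : ℕ)
  | bin (f : BinOp) (a b : Exp)
  | get (k : ℕ) (e : Exp)

/-- The host part of a store, without the temporaries. -/
structure HState where
  var : ℕ → ℕ
  areg : ℕ → ℕ
  arr : ℕ → ℕ → ℕ

def Store.high (s : Store) : HState := ⟨fun i => s.reg (3 * i), fun i => s.reg (3 * i + 2), s.arr⟩

def HState.set (h : HState) (i x : ℕ) : HState := { h with var := Function.update h.var i x }

def HState.setGuest (h : HState) (i x : ℕ) : HState := { h with areg := Function.update h.areg i x }

def HState.put (h : HState) (k j x : ℕ) : HState :=
  { h with arr := Function.update h.arr k (Function.update (h.arr k) j x) }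

@[simp] theorem HState.set_var_self (h : HState) (i x : ℕ) : (h.set i x).var i = x :=
  Function.update_self _ _ _
theorem HState.set_var (h : HState) (i x j : ℕ) :
    (h.set i x).var j = if j = i then x else h.var j := by
  simp [HState.set, Function.update_apply]
@[simp] theorem HState.set_arr (h : HState) (i x : ℕ) : (h.set i x).arr = h.arr := rfl
@[simp] theorem HState.set_areg (h : HState) (i x : ℕ) : (h.set i x).areg = h.areg := rfl
@[simp] theorem HState.put_var (h : HState) (k j x : ℕ) : (h.put k j x).var = h.var := rfl
@[simp] theorem HState.put_areg (h : HState) (k j x : ℕ) : (h.put k j x).areg = h.areg := rfl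
@[simp] theorem HState.put_arr_self (h : HState) (k j x : ℕ) :
    (h.put k j x).arr k = Function.update (h.arr k) j x := Function.update_self _ _ _
theorem HState.put_arr_of_ne (h : HState) {k k' : ℕ} (j x : ℕ) (hk : k' ≠ k) :
    (h.put k j x).arr k' = h.arr k' := Function.update_of_ne hk _ _
@[simp] theorem HState.setGuest_var (h : HState) (i x : ℕ) : (h.setGuest i x).var = h.var := rfl
@[simp] theorem HState.setGuest_arr (h : HState) (i x : ℕ) : (h.setGuest i x).arr = h.arr := rfl

def Exp.eval (h : HState) : Exp → ℕ
  | .var i => h.var i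
  | .lit c => c
  | .bin f a b => f.eval (a.eval h) (b.eval h)
  | .get k e => h.arr (4 * k) (e.eval h)

instance : Add Exp := ⟨.bin .add⟩
instance : Sub Exp := ⟨.bin .sub⟩
instance : Mul Exp := ⟨.bin .mul⟩
instance : Div Exp := ⟨.bin .div⟩
instance : Mod Exp := ⟨.bin .mod⟩
instance (n : ℕ) : OfNat Exp n := ⟨.lit n⟩

@[simp] theorem Exp.eval_var (h : HState) (i : ℕ) : (Exp.var i).eval h = h.var i := rfl
@[simp] theorem Exp.eval_lit (h : HState) (c : ℕ) : (Exp.lit c).eval h = c := rfl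
@[simp] theorem Exp.eval_ofNat (h : HState) (c : ℕ) : (ofNat(c) : Exp).eval h = c := rfl
@[simp] theorem Exp.eval_add (h : HState) (a b : Exp) : (a + b).eval h = a.eval h + b.eval h := rfl
@[simp] theorem Exp.eval_sub (h : HState) (a b : Exp) : (a - b).eval h = a.eval h - b.eval h := rfl
@[simp] theorem Exp.eval_mul (h : HState) (a b : Exp) : (a * b).eval h = a.eval h * b.eval h := rfl
@[simp] theorem Exp.eval_div (h : HState) (a b : Exp) : (a / b).eval h = a.eval h / b.eval h := rfl
@[simp] theorem Exp.eval_mod (h : HState) (a b : Exp) : (a % b).eval h = a.eval h % b.eval h := rfl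
@[simp] theorem Exp.eval_lt (h : HState) (a b : Exp) :
    (Exp.bin .lt a b).eval h = if a.eval h < b.eval h then 1 else 0 := rfl
@[simp] theorem Exp.eval_eq (h : HState) (a b : Exp) :
    (Exp.bin .eq a b).eval h = if a.eval h = b.eval h then 1 else 0 := rfl
@[simp] theorem Exp.eval_shr (h : HState) (a b : Exp) :
    (Exp.bin .shr a b).eval h = a.eval h >>> b.eval h := rfl
@[simp] theorem Exp.eval_get (h : HState) (k : ℕ) (e : Exp) :
    (Exp.get k e).eval h = h.arr (4 * k) (e.eval h) := rfl

/-- The operations whose result is at most the product of the operands, if these are at least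
two. -/
def BinOp.tame : BinOp → Bool
  | .add | .sub | .mul | .div | .mod | .shr | .eq | .lt => true
  | _ => false

theorem BinOp.eval_le_mul {f : BinOp} (hf : f.tame = true) {x y X Y : ℕ} (hx : x ≤ X) (hy : y ≤ Y)
    (hX : 2 ≤ X) (hY : 2 ≤ Y) : f.eval x y ≤ X * Y := by
  have h1 : X ≤ X * Y := Nat.le_mul_of_pos_right _ (by omega)
  have h2 : Y ≤ X * Y := Nat.le_mul_of_pos_left _ (by omega)
  cases f <;> simp only [BinOp.tame, Bool.false_eq_true] at hf <;> simp only [BinOp.eval]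
  · nlinarith
  · omega
  · exact Nat.mul_le_mul hx hy
  · exact (Nat.div_le_self _ _).trans (by omega)
  · exact (Nat.mod_le _ _).trans (by omega)
  · rw [Nat.shiftRight_eq_div_pow]; exact (Nat.div_le_self _ _).trans (by omega)
  · split_ifs <;> omega
  · split_ifs <;> omega

def Exp.size : Exp → ℕ
  | .var _ => 1
  | .lit _ => 1
  | .bin _ a b => a.size + b.size + 1
  | .get _ e => e.size + 1

/-- Only the four host arrays whose entries `HState.Bdd` bounds may be read: the input, the two
tables and the current row of truth values. Array `16`, with the saved registers of the guest, is
not among them. -/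
def Exp.Fits (B : ℕ) : Exp → Prop
  | .var _ => True
  | .lit c => c ≤ B
  | .bin f a b => f.tame = true ∧ a.Fits B ∧ b.Fits B
  | .get k e => k < 4 ∧ e.Fits B

section simpLemmas

variable (B : ℕ) (a b : Exp)

@[simp] theorem Exp.size_var (i : ℕ) : (Exp.var i).size = 1 := rfl
@[simp] theorem Exp.size_lit (c : ℕ) : (Exp.lit c).size = 1 := rfl
@[simp] theorem Exp.size_ofNat (c : ℕ) : (ofNat(c) : Exp).size = 1 := rfl
@[simp] theorem Exp.size_add : (a + b).size = a.size + b.size + 1 := rfl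
@[simp] theorem Exp.size_sub : (a - b).size = a.size + b.size + 1 := rfl
@[simp] theorem Exp.size_mul : (a * b).size = a.size + b.size + 1 := rfl
@[simp] theorem Exp.size_div : (a / b).size = a.size + b.size + 1 := rfl
@[simp] theorem Exp.size_mod : (a % b).size = a.size + b.size + 1 := rfl
@[simp] theorem Exp.size_bin (f : BinOp) : (Exp.bin f a b).size = a.size + b.size + 1 := rfl
@[simp] theorem Exp.size_get (k : ℕ) : (Exp.get k a).size = a.size + 1 := rfl
@[simp] theorem Exp.fits_var (i : ℕ) : (Exp.var i).Fits B := trivial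
@[simp] theorem Exp.fits_lit (c : ℕ) : (Exp.lit c).Fits B ↔ c ≤ B := Iff.rfl
@[simp] theorem Exp.fits_ofNat (c : ℕ) : (ofNat(c) : Exp).Fits B ↔ c ≤ B := Iff.rfl
@[simp] theorem Exp.fits_add : (a + b).Fits B ↔ a.Fits B ∧ b.Fits B := by
  simp [HAdd.hAdd, Add.add, Exp.Fits, BinOp.tame]
@[simp] theorem Exp.fits_sub : (a - b).Fits B ↔ a.Fits B ∧ b.Fits B := by
  simp [HSub.hSub, Sub.sub, Exp.Fits, BinOp.tame]
@[simp] theorem Exp.fits_mul : (a * b).Fits B ↔ a.Fits B ∧ b.Fits B := by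
  simp [HMul.hMul, Mul.mul, Exp.Fits, BinOp.tame]
@[simp] theorem Exp.fits_div : (a / b).Fits B ↔ a.Fits B ∧ b.Fits B := by
  simp [HDiv.hDiv, Div.div, Exp.Fits, BinOp.tame]
@[simp] theorem Exp.fits_mod : (a % b).Fits B ↔ a.Fits B ∧ b.Fits B := by
  simp [HMod.hMod, Mod.mod, Exp.Fits, BinOp.tame]
@[simp] theorem Exp.fits_lt : (Exp.bin .lt a b).Fits B ↔ a.Fits B ∧ b.Fits B := by
  simp [Exp.Fits, BinOp.tame]
@[simp] theorem Exp.fits_eq : (Exp.bin .eq a b).Fits B ↔ a.Fits B ∧ b.Fits B := by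
  simp [Exp.Fits, BinOp.tame]
@[simp] theorem Exp.fits_shr : (Exp.bin .shr a b).Fits B ↔ a.Fits B ∧ b.Fits B := by
  simp [Exp.Fits, BinOp.tame]
@[simp] theorem Exp.fits_get (k : ℕ) : (Exp.get k a).Fits B ↔ k < 4 ∧ a.Fits B := Iff.rfl

end simpLemmas

/-- All variables and all entries of the first four host arrays are at most `B`. -/
structure HState.Bdd (B : ℕ) (h : HState) : Prop where
  var : ∀ i, h.var i ≤ B
  arr : ∀ k < 4, ∀ j, h.arr (4 * k) j ≤ B

/-- A tame operation at most multiplies the bounds on its operands, while their sizes add up in the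
exponent. -/
theorem Exp.eval_le_pow {B : ℕ} (hB : 2 ≤ B) {h : HState} (hh : h.Bdd B) {e : Exp}
    (he : e.Fits B) : e.eval h ≤ B ^ e.size := by
  have one : ∀ n, 2 ≤ B ^ (n + 1) := fun n =>
    hB.trans (Nat.le_self_pow (by omega) _)
  have pos : ∀ e : Exp, 2 ≤ B ^ e.size := by
    intro e; cases e <;> exact one _
  induction e with
  | var i => simpa [Exp.size] using hh.var i
  | lit c => simpa [Exp.size, Exp.eval, Exp.Fits] using he
  | bin f a b iha ihb =>
    obtain ⟨hf, ha, hb⟩ := he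
    refine (BinOp.eval_le_mul hf (iha ha) (ihb hb) (pos a) (pos b)).trans ?_
    rw [← pow_add]
    exact Nat.pow_le_pow_right (by omega) (by simp [Exp.size])
  | get k e ih =>
    exact (hh.arr k he.1 _).trans (Nat.le_self_pow (by simp [Exp.size]) _)

/-- Evaluation on a stack of temporaries: the value is left in temporary `t`, and no temporary below
`t` is touched. -/
def Exp.compile (t : ℕ) : Exp → Prog
  | .var i => .op (3 * t + 1) .add (.reg (3 * i)) (.const 0)
  | .lit c => .op (3 * t + 1) .add (.const c) (.const 0)
  | .bin f a b => .seq (a.compile t) (.seq (b.compile (t + 1))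
      (.op (3 * t + 1) f (.reg (3 * t + 1)) (.reg (3 * (t + 1) + 1))))
  | .get k e => .seq (e.compile t) (.load (3 * t + 1) (4 * k) (.reg (3 * t + 1)))

theorem Exp.run {B W : ℕ} (hB : 2 ≤ B) {e : Exp} (he : e.Fits B) (hW : B ^ e.size < W) (t : ℕ)
    {s : Store} (hs : s.high.Bdd B) :
    ∃ s', Run W (e.compile t) s s' e.size ∧ s'.reg (3 * t + 1) = e.eval s.high ∧ s'.arr = s.arr ∧
      ∀ r, (∀ u ≥ t, r ≠ 3 * u + 1) → s'.reg r = s.reg r := by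
  induction e generalizing t s with
  | var i =>
    have h1 := Exp.eval_le_pow hB hs he
    simp only [Exp.eval, Store.high] at h1
    refine ⟨_, .op s _ .add _ _ (by simp only [Operand.val]; omega)
      (by simp only [Operand.val]; omega)
      (by simp only [Operand.val, BinOp.eval]; omega), ?_, rfl, fun r hr => ?_⟩
    · simp [Operand.val, BinOp.eval, Store.high, Exp.eval]
    · exact s.setReg_reg_of_ne _ (hr t le_rfl)
  | lit c =>
    have h1 := Exp.eval_le_pow hB hs he
    simp only [Exp.eval] at h1
    refine ⟨_, .op s _ .add _ _ (by simp only [Operand.val]; omega)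
      (by simp only [Operand.val]; omega)
      (by simp only [Operand.val, BinOp.eval]; omega), ?_, rfl, fun r hr => ?_⟩
    · simp [Operand.val, BinOp.eval, Exp.eval]
    · exact s.setReg_reg_of_ne _ (hr t le_rfl)
  | bin f a b iha ihb =>
    have hv := Exp.eval_le_pow hB hs he
    obtain ⟨hf, ha, hb⟩ := he
    have mono : ∀ {m n}, m ≤ n → B ^ m ≤ B ^ n := fun h => Nat.pow_le_pow_right (by omega) h
    have la : B ^ a.size ≤ B ^ (Exp.bin f a b).size := mono (by simp only [Exp.size]; omega)
    have lb : B ^ b.size ≤ B ^ (Exp.bin f a b).size := mono (by simp only [Exp.size]; omega)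
    obtain ⟨s1, r1, v1, a1, f1⟩ := iha ha (by omega) t hs
    have e1 : s1.high = s.high := by
      simp only [Store.high, a1]
      congr 1 <;> funext i <;> exact f1 _ fun u _ => by omega
    obtain ⟨s2, r2, v2, a2, f2⟩ := ihb hb (by omega) (t + 1) (s := s1) (by rw [e1]; exact hs)
    rw [e1] at v2
    have v3 : s2.reg (3 * t + 1) = a.eval s.high := by
      rw [f2 _ fun u _ => by omega, v1]
    have b1 := Exp.eval_le_pow hB hs ha
    have b2 := Exp.eval_le_pow hB hs hb
    have r3 := Run.seq r1 (.seq r2 (.op (W := W) s2 (3 * t + 1) f (.reg (3 * t + 1))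
      (.reg (3 * (t + 1) + 1)) (by simp only [Operand.val]; omega)
      (by simp only [Operand.val]; omega) (by
        simp only [Operand.val, v2, v3]
        simp only [Exp.eval] at hv; omega)))
    have : a.size + (b.size + 1) = (Exp.bin f a b).size := by simp only [Exp.size]; omega
    rw [this] at r3
    refine ⟨_, r3, ?_, ?_, fun r hr => ?_⟩
    · simp only [Store.setReg_reg_self, Operand.val, v2, v3, Exp.eval]
    · exact a2.trans a1
    · rw [Store.setReg_reg_of_ne _ _ (hr t le_rfl), f2 r fun u hu => hr u (by omega), f1 r hr]
  | get k e ih =>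
    have hv := Exp.eval_le_pow hB hs he
    have la : B ^ e.size ≤ B ^ (Exp.get k e).size :=
      Nat.pow_le_pow_right (by omega) (by simp only [Exp.size]; omega)
    obtain ⟨s1, r1, v1, a1, f1⟩ := ih he.2 (by omega) t hs
    have b1 := Exp.eval_le_pow hB hs (e := e) he.2
    simp only [Exp.eval, Store.high] at hv
    refine ⟨_, .seq r1 (.load s1 _ _ _ (by simp only [Operand.val]; omega) (by
      simp only [Operand.val, v1, a1]; exact lt_of_le_of_lt hv hW)), ?_, a1, fun r hr => ?_⟩
    · simp only [Store.setReg_reg_self, Operand.val, v1, a1, Exp.eval]; rfl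
    · rw [Store.setReg_reg_of_ne _ _ (hr t le_rfl), f1 r hr]

/-! ## Weakest preconditions with a clock -/

structure Room (B W : ℕ) : Prop where
  two_le : 2 ≤ B
  pow_lt : B ^ 60 < W

theorem Room.lt {B W : ℕ} (h : Room B W) : B < W :=
  lt_of_le_of_lt (Nat.le_self_pow (by norm_num) B) h.pow_lt

/-- Started in `h` at time `t`, within the bound `B` on the host's values, program `p` halts in a
state that together with the time then satisfies `Q`. -/
def WP (B W : ℕ) (p : Prog) (h : HState) (t : ℕ) (Q : HState → ℕ → Prop) : Prop :=
  h.Bdd B → ∀ s : Store, s.high = h → ∃ s' c t', Run W p s s' c ∧ t + c ≤ t' ∧ s'.high.Bdd B ∧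
    Q s'.high t'

/-! ### Rules for assignments, branches, loops and calls of the guest -/

section rules

variable {B W : ℕ} {p q : Prog} {h : HState} {t : ℕ} {Q : HState → ℕ → Prop}

theorem WP.of_bdd (H : h.Bdd B → WP B W p h t Q) : WP B W p h t Q := fun hb => H hb hb

theorem WP.mono {Q' : HState → ℕ → Prop} (H : WP B W p h t Q) (hQ : ∀ h' t', Q h' t' → Q' h' t') :
    WP B W p h t Q' := by
  intro hb s hs
  obtain ⟨s', c, t', r, ht, hb', hq⟩ := H hb s hs
  exact ⟨s', c, t', r, ht, hb', hQ _ _ hq⟩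

theorem WP.seq (H : WP B W p h t fun h' t' => WP B W q h' t' Q) : WP B W (.seq p q) h t Q := by
  intro hb s hs
  obtain ⟨s1, c1, t1, r1, ht1, hb1, H1⟩ := H hb s hs
  obtain ⟨s2, c2, t2, r2, ht2, hb2, H2⟩ := H1 hb1 s1 rfl
  exact ⟨s2, _, t2, .seq r1 r2, by omega, hb2, H2⟩

theorem WP.skip (H : Q h (t + 1)) : WP B W .skip h t Q := by
  intro hb s hs
  subst hs
  exact ⟨s, 1, t + 1, .skip s, le_rfl, hb, H⟩

theorem HState.Bdd.set (hb : h.Bdd B) (i : ℕ) {x : ℕ} (hx : x ≤ B) : (h.set i x).Bdd B :=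
  ⟨fun j => by rw [HState.set_var]; split_ifs; exacts [hx, hb.var j], hb.arr⟩

theorem HState.Bdd.put (hb : h.Bdd B) (k j : ℕ) {x : ℕ} (hx : k % 4 = 0 → x ≤ B) :
    (h.put k j x).Bdd B := by
  refine ⟨hb.var, fun k' hk' j' => ?_⟩
  simp only [HState.put, Function.update_apply]
  by_cases hk : 4 * k' = k
  · simp only [hk, if_true, Function.update_apply]
    split_ifs
    · exact hx (by omega)
    · rw [← hk]; exact hb.arr k' hk' j'
  · simp only [hk, if_false]; exact hb.arr k' hk' j'

theorem HState.Bdd.setGuest (hb : h.Bdd B) (i x : ℕ) : (h.setGuest i x).Bdd B := ⟨hb.var, hb.arr⟩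

theorem Store.high_setReg_var (s : Store) (i x : ℕ) :
    (s.setReg (3 * i) x).high = s.high.set i x := by
  simp only [Store.high, Store.setReg, HState.set, HState.mk.injEq, and_true]
  refine ⟨?_, ?_⟩ <;> funext j <;> simp only [Function.update_apply]
  · split_ifs <;> first | rfl | omega
  · rw [if_neg (by omega)]

theorem Store.high_setReg_guest (s : Store) (i x : ℕ) :
    (s.setReg (3 * i + 2) x).high = s.high.setGuest i x := by
  simp only [Store.high, Store.setReg, HState.setGuest, HState.mk.injEq, and_true]
  refine ⟨?_, ?_⟩ <;> funext j <;> simp only [Function.update_apply]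
  · rw [if_neg (by omega)]
  · split_ifs <;> first | rfl | omega

theorem Room.exp_run (hR : Room B W) {e : Exp} (he : e.Fits B) (hs : e.size ≤ 60) (u : ℕ)
    {s : Store} (hb : s.high.Bdd B) :
    ∃ s', Run W (e.compile u) s s' e.size ∧ s'.reg (3 * u + 1) = e.eval s.high ∧
      s'.high = s.high ∧ e.eval s.high < W ∧ ∀ v < u, s'.reg (3 * v + 1) = s.reg (3 * v + 1) := by
  have hp : B ^ e.size < W := lt_of_le_of_lt
    (Nat.pow_le_pow_right (by have := hR.two_le; omega) hs) hR.pow_lt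
  obtain ⟨s', r, v, a, f⟩ := Exp.run hR.two_le he hp u hb
  refine ⟨s', r, v, ?_, lt_of_le_of_lt (Exp.eval_le_pow hR.two_le hb he) hp,
    fun v hv => f _ fun w hw => by omega⟩
  simp only [Store.high, a]
  congr 1 <;> funext i <;> exact f _ fun u _ => by omega

def assign (x : ℕ) (e : Exp) : Prog :=
  .seq (e.compile 0) (.op (3 * x) .add (.reg 1) (.const 0))

/-- The evaluation takes at most `60` steps and the assignment one more. The clock only has to bound
the time from above, so it advances by the round number `64`. -/
theorem WP.assign (hR : Room B W) {x : ℕ} {e : Exp} (he : e.Fits B) (hs : e.size ≤ 60)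
    (hv : h.Bdd B → e.eval h ≤ B) (H : Q (h.set x (e.eval h)) (t + 64)) :
    WP B W (_root_.assign x e) h t Q := by
  intro hb s hsh
  subst hsh
  obtain ⟨s1, r1, v1, h1, l1, -⟩ := hR.exp_run he hs 0 hb
  simp only [Nat.mul_zero, Nat.zero_add] at v1
  have e1 : (Operand.reg 1).val s1 = e.eval s.high := v1
  refine ⟨_, _, t + 64, .seq r1 (.op s1 _ .add _ _ (by rw [e1]; exact l1)
    (by simp only [Operand.val]; omega) (by rw [e1]; simpa [BinOp.eval, Operand.val] using l1)),
    by omega, ?_⟩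
  rw [Store.high_setReg_var, h1, e1]
  simp only [Operand.val, BinOp.eval, Nat.add_zero]
  exact ⟨hb.set x (hv hb), H⟩

def setGuest (x : ℕ) (e : Exp) : Prog :=
  .seq (e.compile 0) (.op (3 * x + 2) .add (.reg 1) (.const 0))

theorem WP.setGuest (hR : Room B W) {x : ℕ} {e : Exp} (he : e.Fits B) (hs : e.size ≤ 60)
    (H : e.eval h < W → Q (h.setGuest x (e.eval h)) (t + 64)) :
    WP B W (_root_.setGuest x e) h t Q := by
  intro hb s hsh
  subst hsh
  obtain ⟨s1, r1, v1, h1, l1, -⟩ := hR.exp_run he hs 0 hb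
  simp only [Nat.mul_zero, Nat.zero_add] at v1
  have e1 : (Operand.reg 1).val s1 = e.eval s.high := v1
  refine ⟨_, _, t + 64, .seq r1 (.op s1 _ .add _ _ (by rw [e1]; exact l1)
    (by simp only [Operand.val]; omega) (by rw [e1]; simpa [BinOp.eval, Operand.val] using l1)),
    by omega, ?_⟩
  rw [Store.high_setReg_guest, h1, e1]
  simp only [Operand.val, BinOp.eval, Nat.add_zero]
  exact ⟨hb.setGuest x _, H l1⟩

/-- Set variable `x` to whether the guest's register `0` is less than `e`. -/
def guestLt (x : ℕ) (e : Exp) : Prog :=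
  .seq (e.compile 0) (.op (3 * x) .lt (.reg 2) (.reg 1))

theorem WP.guestLt (hR : Room B W) {x : ℕ} {e : Exp} (he : e.Fits B) (hs : e.size ≤ 60)
    (ha : h.areg 0 < W) (H : Q (h.set x (if h.areg 0 < e.eval h then 1 else 0)) (t + 64)) :
    WP B W (_root_.guestLt x e) h t Q := by
  intro hb s hsh
  subst hsh
  obtain ⟨s1, r1, v1, h1, l1, -⟩ := hR.exp_run he hs 0 hb
  simp only [Nat.mul_zero, Nat.zero_add] at v1
  have e1 : (Operand.reg 1).val s1 = e.eval s.high := v1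
  have e2 : (Operand.reg 2).val s1 = s.high.areg 0 := congrFun (congrArg HState.areg h1) 0
  have := hR.two_le
  have := hR.lt
  refine ⟨_, _, t + 64, .seq r1 (.op s1 _ .lt _ _ (by rw [e2]; exact ha) (by rw [e1]; exact l1)
    (by simp only [BinOp.eval]; split_ifs <;> omega)), by omega, ?_⟩
  rw [Store.high_setReg_var, h1, e1, e2]
  exact ⟨hb.set x (by simp only [BinOp.eval]; split_ifs <;> omega), H⟩

def put (k : ℕ) (a b : Exp) : Prog :=
  .seq (a.compile 0) (.seq (b.compile 1) (.store k (.reg 1) (.reg 4)))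

theorem WP.put (hR : Room B W) {k : ℕ} {a b : Exp} (ha : a.Fits B) (hb : b.Fits B)
    (hsa : a.size ≤ 60) (hsb : b.size ≤ 60) (hv : k % 4 = 0 → h.Bdd B → b.eval h ≤ B)
    (H : Q (h.put k (a.eval h) (b.eval h)) (t + 128)) : WP B W (_root_.put k a b) h t Q := by
  intro hbd s hsh
  subst hsh
  obtain ⟨s1, r1, v1, h1, l1, -⟩ := hR.exp_run ha hsa 0 hbd
  obtain ⟨s2, r2, v2, h2, l2, k2⟩ := hR.exp_run hb hsb 1 (s := s1) (by rw [h1]; exact hbd)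
  simp only [Nat.mul_zero, Nat.zero_add] at v1
  rw [h1] at v2 l2
  have e1 : (Operand.reg 1).val s2 = a.eval s.high := (k2 0 (by omega)).trans v1
  have e2 : (Operand.reg 4).val s2 = b.eval s.high := v2
  refine ⟨_, _, t + 128, .seq r1 (.seq r2 (.store s2 k _ _ (by rw [e1]; exact l1)
    (by rw [e2]; exact l2))), by omega, ?_⟩
  have e3 : (s2.setArr k ((Operand.reg 1).val s2) ((Operand.reg 4).val s2)).high =
      s.high.put k (a.eval s.high) (b.eval s.high) := by
    rw [e1, e2, ← h1, ← h2]; rfl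
  rw [e3]
  exact ⟨hbd.put k _ fun hk => hv hk hbd, H⟩

def branch (e : Exp) (p q : Prog) : Prog := .seq (e.compile 0) (.ite (.reg 1) p q)

theorem WP.branch (hR : Room B W) {e : Exp} (he : e.Fits B) (hs : e.size ≤ 60)
    (h1 : e.eval h ≠ 0 → WP B W p h (t + 64) Q) (h0 : e.eval h = 0 → WP B W q h (t + 64) Q) :
    WP B W (_root_.branch e p q) h t Q := by
  intro hb s hsh
  subst hsh
  obtain ⟨s1, r1, v1, hh1, l1, -⟩ := hR.exp_run he hs 0 hb
  simp only [Nat.mul_zero, Nat.zero_add] at v1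
  have e1 : (Operand.reg 1).val s1 = e.eval s.high := v1
  by_cases hc : e.eval s.high = 0
  · obtain ⟨s2, c2, t2, r2, ht, H⟩ := h0 hc hb s1 hh1
    exact ⟨s2, _, t2, .seq r1 (.ite_false (by rw [e1]; exact hc) r2), by omega, H⟩
  · obtain ⟨s2, c2, t2, r2, ht, H⟩ := h1 hc hb s1 hh1
    exact ⟨s2, _, t2, .seq r1 (.ite_true (by rw [e1]; exact hc) r2), by omega, H⟩

/-- The test is computed into register `1`, a temporary, before the loop and again at the end of
every pass; hence the body is free to overwrite this register. -/
def forLoop (x : ℕ) (e : Exp) (p : Prog) : Prog :=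
  .seq (assign x 0) (.seq ((Exp.bin .lt (.var x) e).compile 0) (.loop (.reg 1)
    (.seq p (.seq (assign x (.var x + 1)) ((Exp.bin .lt (.var x) e).compile 0)))))

/-- The loop runs `N` times if `N` is the value of `e` throughout. -/
theorem WP.forLoop (hR : Room B W) {x : ℕ} {e : Exp} (he : e.Fits B) (hs : e.size ≤ 50) {N : ℕ}
    (I : ℕ → HState → ℕ → Prop) (h0 : I 0 (h.set x 0) (t + 128))
    (hI : ∀ i ≤ N, ∀ h t, I i h t → h.var x = i ∧ e.eval h = N ∧ N ≤ B)
    (hstep : ∀ i < N, ∀ h t, I i h t → WP B W p h t fun h' t' =>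
      h'.var x = i ∧ I (i + 1) (h'.set x (i + 1)) (t' + 192))
    (hQ : ∀ h t, I N h t → Q h t) : WP B W (_root_.forLoop x e p) h t Q := by
  have hB := hR.two_le
  have hfit : (Exp.bin .lt (.var x) e).Fits B := ⟨rfl, trivial, he⟩
  -- The test is larger than `e` by two, which is why `e` is restricted to size `50`.
  have hsz : (Exp.bin .lt (.var x) e).size ≤ 60 := by simp only [Exp.size]; omega
  have fit1 : (Exp.var x + 1).Fits B := ⟨rfl, trivial, show 1 ≤ B by omega⟩
  -- Induction on the number `d` of passes to come, with the outcome of the test in register `1`.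
  have main : ∀ d i, i + d = N → ∀ h t, I i h t → h.Bdd B → ∀ s : Store, s.high = h →
      s.reg 1 = (if i < N then 1 else 0) → ∃ s' c t', Run W (.loop (.reg 1)
        (.seq p (.seq (_root_.assign x (.var x + 1)) ((Exp.bin .lt (.var x) e).compile 0)))) s s' c ∧
        t + c ≤ t' + 1 ∧ s'.high.Bdd B ∧ Q s'.high t' := by
    intro d
    induction d with
    | zero =>
      intro i hi h t hIi hb s hsh hr
      obtain rfl : i = N := by omega
      rw [if_neg (by omega)] at hr
      exact ⟨s, 1, t, .loop_done hr, by omega, by rw [hsh]; exact hb, by rw [hsh]; exact hQ _ _ hIi⟩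
    | succ d ih =>
      intro i hi h t hIi hb s hsh hr
      rw [if_pos (by omega)] at hr
      obtain ⟨s1, c1, t1, r1, ht1, hb1, hx1, H1⟩ := hstep i (by omega) h t hIi hb s hsh
      have hx := hI (i + 1) (by omega) _ _ H1
      obtain ⟨s2, c2, t2, r2, ht2, hb2, e2, H2⟩ :=
        (WP.assign hR (x := x) (t := t1 + 64) (e := .var x + 1) (h := s1.high)
          (Q := fun h' t' => h' = s1.high.set x (i + 1) ∧ t' = t1 + 128) fit1
          (by simp) (by simp; omega) (by simp [hx1])) hb1 s1 rfl
      obtain ⟨s3, r3, v3, h3, l3, -⟩ := hR.exp_run hfit hsz 0 hb2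
      rw [e2] at h3 v3
      simp only [Nat.mul_zero, Nat.zero_add, Exp.eval_lt, hx.2.1, Exp.eval_var, hx.1] at v3
      obtain ⟨s4, c4, t4, r4, ht4, hb4, H4⟩ := ih (i + 1) (by omega) _ _ H1
        (by rw [← e2]; exact hb2) s3 h3 v3
      refine ⟨s4, _, t4, .loop_step (by simp [Operand.val, hr]) (.seq r1 (.seq r2 r3)) r4, ?_, hb4,
        H4⟩
      omega
  intro hb s hsh
  have hx := hI 0 (by omega) _ _ h0
  obtain ⟨s2, c2, t2, r2, ht2, hb2, e2, H2⟩ :=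
    (WP.assign hR (x := x) (t := t) (e := 0) (h := h)
      (Q := fun h' t' => h' = h.set x 0 ∧ t' = t + 64) (show 0 ≤ B by omega)
      (by simp) (by simp) (by simp)) hb s hsh
  obtain ⟨s3, r3, v3, h3, l3, -⟩ := hR.exp_run hfit hsz 0 hb2
  rw [e2] at h3 v3
  simp only [Nat.mul_zero, Nat.zero_add, Exp.eval_lt, hx.2.1, Exp.eval_var, hx.1] at v3
  obtain ⟨s4, c4, t4, r4, ht4, hb4, H4⟩ := main N 0 (by omega) _ _ h0 (by rw [← e2]; exact hb2) s3
    h3 v3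
  exact ⟨s4, _, t4, .seq r2 (.seq r3 r4), by omega, hb4, H4⟩

/-- The host state `h` represents the guest store `a`. -/
structure HState.Hosts (h : HState) (a : Store) : Prop where
  reg : ∀ i, h.areg i = a.reg i
  arr : ∀ k j, a.arr k j = if h.var epochVar ≠ 0 ∧ h.arr (4 * k + 3) j = h.var epochVar
    then h.arr (4 * k + 2) j else h.arr (4 * k + 1) j
  stamp : ∀ k j, h.arr (4 * k + 3) j ≤ h.var epochVar

theorem WP.guest (hR : Room B W) {p : Prog} {a a' : Store} {c : ℕ} (r : Run W p a a' c)
    (ha : h.Hosts a)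
    (H : ∀ h' t', h'.Hosts a' → h'.var = h.var → (∀ k, h'.arr (4 * k) = h.arr (4 * k)) →
      (h.var epochVar ≠ 0 → ∀ k, h'.arr (4 * k + 1) = h.arr (4 * k + 1)) → t' = t + 5 * c →
      Q h' t') : WP B W p.guest h t Q := by
  intro hb s hsh
  subst hsh
  have hB := hR.two_le
  have hBW := hR.lt
  obtain ⟨s', c', r', hc, hh, hf⟩ := r.guest (s := s) ⟨ha.reg, ha.arr, ha.stamp⟩ (by omega)
    (lt_of_le_of_lt (hb.var epochVar) hR.lt)
  have ev : s'.high.var = s.high.var := funext hf.var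
  refine ⟨s', c', t + 5 * c, r', by omega, ⟨?_, ?_⟩, H _ _ ⟨hh.reg, hh.arr, hh.stamp⟩ ev
    hf.arr hf.base rfl⟩
  · rw [ev]; exact hb.var
  · intro k hk j
    have : s'.high.arr (4 * k) = s.high.arr (4 * k) := hf.arr k
    rw [this]; exact hb.arr k hk j

end rules

/-! ## A small language for writing lists of words -/

/-- A description of a list of words. `loop e g`: the concatenation of `g` over all values less than
`e` of a fresh variable; `counted u g`: the list `g`, preceded by its length divided by `u`. -/
inductive Gen where
  | emit (e : Exp)
  | seq (g g' : Gen)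
  | when (e : Exp) (g : Gen)
  | loop (e : Exp) (g : Gen)
  | counted (u : ℕ) (g : Gen)

/-- The list described by `g`, whose loops use the variables from `L` on. -/
def Gen.out : Gen → ℕ → HState → List ℕ
  | .emit e, _, h => [e.eval h]
  | .seq g g', L, h => g.out L h ++ g'.out L h
  | .when e g, L, h => if e.eval h ≠ 0 then g.out L h else []
  | .loop e g, L, h => (List.range (e.eval h)).flatMap fun i => g.out (L + 1) (h.set L i)
  | .counted u g, L, h => (g.out L h).length / u :: g.out L h

notation "lenVar" => (40 : ℕ)
notation "posVar" => (41 : ℕ)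

def Gen.compile : Gen → ℕ → Prog
  | .emit e, _ => .seq (put 1 (.var lenVar) e) (assign lenVar (.var lenVar + 1))
  | .seq g g', L => .seq (g.compile L) (g'.compile L)
  | .when e g, L => branch e (g.compile L) .skip
  | .loop e g, L => forLoop L e (g.compile (L + 1))
  | .counted u g, L => .seq (assign posVar (.var lenVar)) (.seq (put 1 (.var lenVar) 0)
      (.seq (assign lenVar (.var lenVar + 1)) (.seq (g.compile L)
        (put 1 (.var posVar) ((.var lenVar - .var posVar - 1) / .lit u)))))

/-- The cost of a loop body is taken in the initial state. For generators that satisfy `Gen.Good`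
this is legitimate, because the bounds of loops read only variables below `3` and host arrays, and
the generated code changes neither. -/
def Gen.cost (h : HState) : Gen → ℕ
  | .emit _ => 192
  | .seq g g' => g.cost h + g'.cost h
  | .when _ g => g.cost h + 65
  | .loop e g => 128 + e.eval h * (g.cost h + 193)
  | .counted _ g => g.cost h + 384

/-- All variables of the expression are less than `L`. -/
def Exp.Below (L : ℕ) : Exp → Prop
  | .var i => i < L
  | .lit _ => True
  | .bin _ a b => a.Below L ∧ b.Below L
  | .get _ e => e.Below L

section simpLemmas

variable (L : ℕ) (a b : Exp)

@[simp] theorem Exp.below_var (i : ℕ) : (Exp.var i).Below L ↔ i < L := Iff.rfl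
@[simp] theorem Exp.below_lit (c : ℕ) : (Exp.lit c).Below L := trivial
@[simp] theorem Exp.below_ofNat (c : ℕ) : (ofNat(c) : Exp).Below L := trivial
@[simp] theorem Exp.below_add : (a + b).Below L ↔ a.Below L ∧ b.Below L := Iff.rfl
@[simp] theorem Exp.below_sub : (a - b).Below L ↔ a.Below L ∧ b.Below L := Iff.rfl
@[simp] theorem Exp.below_mul : (a * b).Below L ↔ a.Below L ∧ b.Below L := Iff.rfl
@[simp] theorem Exp.below_div : (a / b).Below L ↔ a.Below L ∧ b.Below L := Iff.rfl
@[simp] theorem Exp.below_mod : (a % b).Below L ↔ a.Below L ∧ b.Below L := Iff.rfl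
@[simp] theorem Exp.below_bin (f : BinOp) : (Exp.bin f a b).Below L ↔ a.Below L ∧ b.Below L :=
  Iff.rfl
@[simp] theorem Exp.below_get (k : ℕ) : (Exp.get k a).Below L ↔ a.Below L := Iff.rfl

end simpLemmas

/-- `h` and `h'` agree on the variables below `L` and the host arrays. -/
structure HState.Agree (L : ℕ) (h h' : HState) : Prop where
  var : ∀ i < L, h'.var i = h.var i
  arr : ∀ k, h'.arr (4 * k) = h.arr (4 * k)

theorem HState.Agree.mono {L L' : ℕ} {h h' : HState} (H : h.Agree L h') (hL : L' ≤ L) :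
    h.Agree L' h' :=
  ⟨fun i hi => H.var i (by omega), H.arr⟩

theorem HState.Agree.set {L : ℕ} {h h' : HState} (H : h.Agree L h') (x : ℕ) :
    (h.set L x).Agree (L + 1) (h'.set L x) := by
  refine ⟨fun i hi => ?_, H.arr⟩
  rw [HState.set_var, HState.set_var]
  split_ifs
  · rfl
  · exact H.var i (by omega)

theorem HState.agree_set {L i : ℕ} (h : HState) (x : ℕ) (hi : L ≤ i) : h.Agree L (h.set i x) :=
  ⟨fun j hj => by rw [HState.set_var, if_neg (by omega)], fun _ => rfl⟩

theorem Exp.eval_congr {L : ℕ} {h h' : HState} (H : h.Agree L h') {e : Exp} (he : e.Below L) :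
    e.eval h' = e.eval h := by
  induction e with
  | var i => exact H.var i he
  | lit c => rfl
  | bin f a b iha ihb => simp only [Exp.eval, iha he.1, ihb he.2]
  | get k e ih => simp only [Exp.eval, ih he, H.arr]

/-- Conditions for `g` to be compiled correctly; the flag says whether it is inside a `counted`. -/
def Gen.Good (B : ℕ) : Gen → Bool → ℕ → Prop
  | .emit e, _, L => e.Below L ∧ e.Fits B ∧ e.size ≤ 60
  | .seq g g', c, L => g.Good B c L ∧ g'.Good B c L
  | .when e g, c, L => e.Below L ∧ e.Fits B ∧ e.size ≤ 60 ∧ g.Good B c L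
  | .loop e g, c, L => e.Below 3 ∧ e.Fits B ∧ e.size ≤ 50 ∧ L < 30 ∧ g.Good B c (L + 1)
  | .counted u g, c, L => c = false ∧ u ≤ B ∧ g.Good B true L

theorem Gen.cost_congr {B L : ℕ} {h h' : HState} (H : h.Agree 3 h') {g : Gen} {c : Bool}
    (hg : g.Good B c L) : g.cost h' = g.cost h := by
  induction g generalizing c L with
  | emit e => rfl
  | seq g g' ih ih' => simp only [Gen.cost, ih hg.1, ih' hg.2]
  | when e g ih => simp only [Gen.cost, ih hg.2.2.2]
  | loop e g ih => simp only [Gen.cost, ih hg.2.2.2.2, Exp.eval_congr H hg.1]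
  | counted u g ih => simp only [Gen.cost, ih hg.2.2]

theorem Gen.out_congr {B L : ℕ} {h h' : HState} (H : h.Agree L h') (hL : 3 ≤ L) {g : Gen} {c : Bool}
    (hg : g.Good B c L) : g.out L h' = g.out L h := by
  induction g generalizing c L h h' with
  | emit e => simp only [Gen.out, Exp.eval_congr H hg.1]
  | seq g g' ih ih' => simp only [Gen.out, ih H hL hg.1, ih' H hL hg.2]
  | when e g ih => simp only [Gen.out, Exp.eval_congr H hg.1, ih H hL hg.2.2.2]
  | loop e g ih =>
    simp only [Gen.out, Exp.eval_congr (H.mono hL) hg.1]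
    congr 1; funext i
    exact ih (H.set i) (by omega) hg.2.2.2.2
  | counted u g ih => simp only [Gen.out, ih H hL hg.2.2]

/-- Every emitted word is paid for, so a cost within `B` also keeps the write position in `lenVar`
within `B`. -/
theorem Gen.length_out_le {B L : ℕ} (h : HState) (hL : 3 ≤ L) {g : Gen} {c : Bool}
    (hg : g.Good B c L) : (g.out L h).length ≤ g.cost h := by
  induction g generalizing c L h with
  | emit e => simp [Gen.out, Gen.cost]
  | seq g g' ih ih' =>
    have := ih h hL hg.1
    have := ih' h hL hg.2
    simp only [Gen.out, Gen.cost, List.length_append]; omega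
  | when e g ih =>
    have := ih h hL hg.2.2.2
    simp only [Gen.out, Gen.cost]; split_ifs <;> simp <;> omega
  | loop e g ih =>
    simp only [Gen.out, Gen.cost, List.length_flatMap]
    have : ∀ n, ((List.range n).map fun i => (g.out (L + 1) (h.set L i)).length).sum ≤
        n * (g.cost h + 193) := by
      intro n
      induction n with
      | zero => simp
      | succ n ihn =>
        have h1 := ih (h.set L n) (by omega) hg.2.2.2.2
        rw [Gen.cost_congr (h.agree_set n hL) hg.2.2.2.2] at h1
        rw [List.range_succ, List.map_append, List.sum_append, Nat.succ_mul]
        simp only [List.map_cons, List.map_nil, List.sum_cons, List.sum_nil]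
        omega
    exact (this _).trans (by omega)
  | counted u g ih =>
    have := ih h hL hg.2.2
    simp only [Gen.out, Gen.cost, List.length_cons]; omega

/-- The array `f` with `l` written at position `p`. -/
def writeAt (f : ℕ → ℕ) (p : ℕ) (l : List ℕ) : ℕ → ℕ :=
  fun j => if p ≤ j then l.getD (j - p) (f j) else f j

theorem writeAt_nil (f : ℕ → ℕ) (p : ℕ) : writeAt f p [] = f := by
  funext j; simp [writeAt]

theorem writeAt_singleton (f : ℕ → ℕ) (p x : ℕ) : writeAt f p [x] = Function.update f p x := by
  funext j
  rw [Function.update_apply]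
  unfold writeAt
  rcases lt_trichotomy j p with h | h | h
  · rw [if_neg (by omega), if_neg (by omega)]
  · subst h; simp
  · rw [if_pos (by omega), if_neg (by omega), List.getD_eq_default]
    simp; omega

theorem writeAt_append (f : ℕ → ℕ) (p : ℕ) (l l' : List ℕ) :
    writeAt (writeAt f p l) (p + l.length) l' = writeAt f p (l ++ l') := by
  funext j
  unfold writeAt
  by_cases h : p ≤ j
  · by_cases h' : p + l.length ≤ j
    · rw [if_pos h', if_pos h, if_pos h, List.getD_append_right _ _ _ _ (by omega),
        List.getD_eq_default (l := l) _ (by omega)]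
      congr 1; omega
    · rw [if_neg h', if_pos h, if_pos h, List.getD_append _ _ _ _ (by omega)]
  · rw [if_neg (by omega), if_neg h, if_neg h]

theorem writeAt_cons_update (f : ℕ → ℕ) (p x y : ℕ) (l : List ℕ) :
    Function.update (writeAt f p (x :: l)) p y = writeAt f p (y :: l) := by
  funext j
  rw [Function.update_apply]
  unfold writeAt
  by_cases h : j = p
  · subst h; simp
  · rw [if_neg h]
    split_ifs with h1
    · obtain ⟨d, hd⟩ : ∃ d, j - p = d + 1 := ⟨j - p - 1, by omega⟩
      rw [hd]; simp
    · rfl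

/-- What the code of `Gen` at level `L` does to the state. -/
structure Wrote (L : ℕ) (c : Bool) (h h' : HState) (l : List ℕ) : Prop where
  var : ∀ i, i < L ∨ (30 ≤ i ∧ i ≠ lenVar ∧ i ≠ posVar) → h'.var i = h.var i
  -- Inside a `counted`, `posVar` remembers where the length of the enclosing list belongs. There is
  -- only one such variable, so a `counted` must not contain another.
  pos : c = true → h'.var posVar = h.var posVar
  len : h'.var lenVar = h.var lenVar + l.length
  areg : h'.areg = h.areg
  arr : ∀ k ≠ 1, h'.arr k = h.arr k
  out : h'.arr 1 = writeAt (h.arr 1) (h.var lenVar) l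

theorem Wrote.refl (L : ℕ) (c : Bool) (h : HState) : Wrote L c h h [] :=
  ⟨fun _ _ => rfl, fun _ => rfl, rfl, rfl, fun _ _ => rfl, (writeAt_nil _ _).symm⟩

theorem Wrote.trans {L : ℕ} {c : Bool} {h h' h'' : HState} {l l' : List ℕ} (H : Wrote L c h h' l)
    (H' : Wrote L c h' h'' l') : Wrote L c h h'' (l ++ l') where
  var i hi := (H'.var i hi).trans (H.var i hi)
  pos hc := (H'.pos hc).trans (H.pos hc)
  len := by rw [H'.len, H.len, List.length_append]; omega
  areg := H'.areg.trans H.areg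
  arr k hk := (H'.arr k hk).trans (H.arr k hk)
  out := by rw [H'.out, H.len, H.out, writeAt_append]

theorem Wrote.agree {L : ℕ} {c : Bool} {h h' : HState} {l : List ℕ} (H : Wrote L c h h' l) :
    h.Agree L h' :=
  ⟨fun i hi => H.var i (.inl hi), fun k => H.arr _ (by omega)⟩

/-- The code of a subterm runs in a later state than `h`, but this state agrees with the intended
one on everything that the subterm reads (`Gen.out_congr`, `Gen.cost_congr`). -/
theorem Gen.run {B W : ℕ} (hR : Room B W) {g : Gen} {c : Bool} {L : ℕ} (hg : g.Good B c L)
    (hL : 3 ≤ L) (hL' : L ≤ 30) {h : HState} {t : ℕ} (hc : h.var lenVar + g.cost h ≤ B) :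
    WP B W (g.compile L) h t fun h' t' => Wrote L c h h' (g.out L h) ∧ t' ≤ t + g.cost h := by
  have hB := hR.two_le
  induction g generalizing c L h t with
  | emit e =>
    refine .seq (.put hR (by simp) hg.2.1 (by simp) hg.2.2 (by simp) ?_)
    simp only [Gen.cost] at hc
    refine .assign hR (by simp; omega) (by simp) (by simp; omega) ⟨⟨fun i hi => ?_, fun _ => ?_, ?_, rfl,
      fun k hk => ?_, ?_⟩, ?_⟩
    · rw [HState.set_var, if_neg (by omega)]; rfl
    · rw [HState.set_var, if_neg (by omega)]; rfl
    · simp [Gen.out]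
    · exact HState.put_arr_of_ne _ _ _ hk
    · simp [Gen.out, writeAt_singleton]
    · simp [Gen.cost]
  | seq g g' ih ih' =>
    simp only [Gen.cost] at hc
    refine .seq ((ih hg.1 hL hL' (by omega)).mono ?_)
    rintro h1 t1 ⟨w1, ht1⟩
    have hl := Gen.length_out_le h hL hg.1
    have hcc := Gen.cost_congr (w1.agree.mono hL) hg.2
    refine (ih' hg.2 hL hL' (by rw [w1.len, hcc]; omega)).mono ?_
    rintro h2 t2 ⟨w2, ht2⟩
    rw [Gen.out_congr w1.agree hL hg.2] at w2
    exact ⟨w1.trans w2, by simp only [Gen.cost]; omega⟩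
  | when e g ih =>
    simp only [Gen.cost] at hc
    refine .branch hR hg.2.1 hg.2.2.1 (fun he => ?_) (fun he => ?_)
    · refine (ih hg.2.2.2 hL hL' (by omega)).mono ?_
      rintro h1 t1 ⟨w1, ht1⟩
      simp only [Gen.out, if_pos he, Gen.cost]
      exact ⟨w1, by omega⟩
    · refine .skip ?_
      simp only [Gen.out, he, Gen.cost, ne_eq, not_true_eq_false, if_false]
      exact ⟨.refl _ _ _, by omega⟩
  | loop e g ih =>
    obtain ⟨he, hf, hs, hL1, hg⟩ := hg
    simp only [Gen.cost] at hc
    set N := e.eval h with hN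
    have hNle : N ≤ N * (g.cost h + 193) := Nat.le_mul_of_pos_right _ (by omega)
    have hlen : ∀ i, ((List.range i).flatMap fun i => g.out (L + 1) (h.set L i)).length ≤
        i * (g.cost h + 193) := by
      intro i
      induction i with
      | zero => simp
      | succ i ihi =>
        have h1 := Gen.length_out_le (h.set L i) (by omega) hg
        rw [Gen.cost_congr (h.agree_set i hL) hg] at h1
        rw [List.range_succ, List.flatMap_append, List.length_append, Nat.succ_mul]
        simp only [List.flatMap_cons, List.flatMap_nil, List.append_nil]
        omega
    refine .forLoop hR hf hs (N := N) (fun i h' t' => Wrote L c h h'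
        ((List.range i).flatMap fun i => g.out (L + 1) (h.set L i)) ∧ h'.var L = i ∧
        t' ≤ t + 128 + i * (g.cost h + 193)) ?_ ?_ ?_ ?_
    · refine ⟨⟨fun i hi => ?_, fun _ => ?_, ?_, rfl, fun _ _ => rfl, ?_⟩, by simp, by simp⟩
      · rw [HState.set_var, if_neg (by omega)]
      · rw [HState.set_var, if_neg (by omega)]
      · rw [HState.set_var, if_neg (by omega)]; simp
      · simp [writeAt_nil]
    · rintro i - h' t' ⟨w, hv, -⟩
      refine ⟨hv, ?_, by omega⟩
      rw [hN]; exact Exp.eval_congr (w.agree.mono hL) he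
    · rintro i hi h' t' ⟨w, hv, ht⟩
      have hcc := Gen.cost_congr (w.agree.mono hL) hg
      have hi1 : i * (g.cost h + 193) + (g.cost h + 193) ≤ N * (g.cost h + 193) := by
        rw [← Nat.succ_mul]; exact Nat.mul_le_mul_right _ hi
      have := hlen i
      refine (ih hg (by omega) (by omega) (by rw [w.len, hcc]; omega)).mono ?_
      rintro h1 t1 ⟨w1, ht1⟩
      have hag : (h.set L i).Agree (L + 1) h' := by
        refine ⟨fun j hj => ?_, w.agree.arr⟩
        rw [HState.set_var]; split_ifs with hjL
        · rw [hjL, hv]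
        · exact w.var j (.inl (by omega))
      rw [Gen.out_congr hag (by omega) hg] at w1
      refine ⟨by rw [w1.var L (.inl (by omega)), hv], ?_, by simp, ?_⟩
      · have w1' : Wrote L c h' (h1.set L (i + 1)) (g.out (L + 1) (h.set L i)) := by
          refine ⟨fun j hj => ?_, fun hc => ?_, ?_, w1.areg, w1.arr, w1.out⟩
          · rw [HState.set_var, if_neg (by omega)]; exact w1.var j (by omega)
          · rw [HState.set_var, if_neg (by omega)]; exact w1.pos hc
          · rw [HState.set_var, if_neg (by omega)]; exact w1.len
        rw [List.range_succ, List.flatMap_append]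
        simp only [List.flatMap_cons, List.flatMap_nil, List.append_nil]
        exact w.trans w1'
      · rw [Nat.succ_mul]; omega
    · rintro h' t' ⟨w, -, ht⟩
      exact ⟨w, by simp only [Gen.cost, ← hN]; omega⟩
  | counted u g ih =>
    obtain ⟨rfl, hu, hg⟩ := hg
    simp only [Gen.cost] at hc
    refine .seq (.assign hR (by simp) (by simp) (by simp; omega) ?_)
    -- A zero holds the place of the length, which is known only when `g` has been written.
    refine .seq (.put hR (by simp) (by simp) (by simp) (by simp) (by simp) ?_)
    refine .seq (.assign hR (by simp; omega) (by simp) (by simp [HState.set_var]; omega) ?_)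
    simp only [Exp.eval_add, Exp.eval_var, Exp.eval_ofNat, HState.put_var, HState.set_var,
      if_neg (show ¬ lenVar = posVar by decide)]
    set h1 := ((h.set posVar (h.var lenVar)).put 1 (h.var lenVar) 0).set lenVar (h.var lenVar + 1)
      with hh1
    have hag : h.Agree L h1 := by
      refine ⟨fun i hi => ?_, fun k => ?_⟩
      · simp only [hh1, HState.set_var, HState.put_var]
        rw [if_neg (by omega), if_neg (by omega)]
      · simp only [hh1, HState.set_arr]
        rw [HState.put_arr_of_ne _ _ _ (by omega)]; rfl
    have hcc := Gen.cost_congr (hag.mono hL) hg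
    have hl1 : h1.var lenVar = h.var lenVar + 1 := by simp [hh1]
    have hp1 : h1.var posVar = h.var lenVar := by simp [hh1, HState.set_var]
    refine .seq ((ih hg hL hL' (by rw [hcc, hl1]; omega)).mono ?_)
    rintro h2 t2 ⟨w, ht2⟩
    rw [Gen.out_congr hag hL hg] at w
    have hp2 := w.pos rfl
    have hl2 := w.len
    rw [hp1] at hp2
    rw [hl1] at hl2
    refine .put hR (by simp) (by simp; omega) (by simp) (by simp) (by simp) ⟨⟨fun i hi => ?_,
      fun h => absurd h (by simp), ?_, w.areg, fun k hk => ?_, ?_⟩, ?_⟩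
    · rw [HState.put_var, w.var i hi]
      simp only [hh1, HState.set_var, HState.put_var]
      rw [if_neg (by omega), if_neg (by omega)]
    · rw [HState.put_var, hl2]; simp only [Gen.out, List.length_cons]; omega
    · rw [HState.put_arr_of_ne _ _ _ hk, w.arr k hk]
      simp only [hh1, HState.set_arr]
      rw [HState.put_arr_of_ne _ _ _ hk]; rfl
    · rw [HState.put_arr_self, w.out, hl1]
      simp only [Exp.eval_var, Exp.eval_div, Exp.eval_sub, Exp.eval_ofNat, Exp.eval_lit, hp2, hl2]
      have e1 : h1.arr 1 = writeAt (h.arr 1) (h.var lenVar) [0] := by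
        simp [hh1, writeAt_singleton]
      have := writeAt_append (h.arr 1) (h.var lenVar) [0] (g.out L h)
      simp only [List.length_singleton, List.singleton_append] at this
      rw [e1, this, writeAt_cons_update]
      simp only [Gen.out]
      congr 3; omega
    · rw [hcc] at ht2; simp only [Gen.cost]; omega

/-- The cost is polynomial in the values of the low variables. -/
def Exp.MaxLit : Exp → ℕ
  | .var _ => 0
  | .lit c => c
  | .bin _ a b => max a.MaxLit b.MaxLit
  | .get _ e => e.MaxLit

def Exp.Arith : Exp → Prop
  | .var _ => True
  | .lit _ => True
  | .bin f a b => f.tame = true ∧ a.Arith ∧ b.Arith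
  | .get _ _ => False

/-- Without array accesses the value is bounded in terms of the low variables alone. This makes the
cost of writing an instance polynomial in the number of left assignments rather than in `B`. -/
theorem Exp.eval_le_pow_of_arith {B : ℕ} (hB : 2 ≤ B) {h : HState} {L : ℕ} {e : Exp}
    (hv : ∀ i < L, h.var i ≤ B) (he : e.Below L) (ha : e.Arith) (hf : e.MaxLit ≤ B) :
    e.eval h ≤ B ^ e.size := by
  have pos : ∀ e : Exp, 2 ≤ B ^ e.size := by
    intro e; cases e <;> exact hB.trans (Nat.le_self_pow (by simp) _)
  induction e with
  | var i => simpa using hv i he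
  | lit c => simpa [Exp.MaxLit] using hf
  | bin f a b iha ihb =>
    simp only [Exp.MaxLit] at hf
    refine (BinOp.eval_le_mul ha.1 (iha he.1 ha.2.1 (by omega)) (ihb he.2 ha.2.2 (by omega)) (pos a)
      (pos b)).trans ?_
    rw [← pow_add]
    exact Nat.pow_le_pow_right (by omega) (by simp)
  | get k e ih => exact ha.elim

def Gen.BoundsArith : Gen → Prop
  | .emit _ => True
  | .seq g g' => g.BoundsArith ∧ g'.BoundsArith
  | .when _ g => g.BoundsArith
  | .loop e g => e.Arith ∧ g.BoundsArith
  | .counted _ g => g.BoundsArith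

def Gen.maxLit : Gen → ℕ
  | .emit _ => 0
  | .seq g g' => max g.maxLit g'.maxLit
  | .when _ g => g.maxLit
  | .loop e g => max e.MaxLit g.maxLit
  | .counted _ g => g.maxLit

def Gen.degree : Gen → ℕ
  | .emit _ => 1
  | .seq g g' => g.degree + g'.degree
  | .when _ g => g.degree + 1
  | .loop e g => e.size + g.degree + 2
  | .counted _ g => g.degree + 1

theorem Gen.degree_pos (g : Gen) : 1 ≤ g.degree := by
  induction g <;> simp only [Gen.degree] <;> omega

/-- The number `400` exceeds the additive constants in `Gen.cost`, so each of them is absorbed by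
one or two additional factors `X`; sums of large terms are bounded by products. -/
theorem Gen.cost_le {B X L : ℕ} {g : Gen} {c : Bool} (hg : g.Good B c L) (ha : g.BoundsArith)
    (hX : 400 ≤ X) {h : HState} (hv : ∀ i < 3, h.var i ≤ X) (hm : g.maxLit ≤ X) :
    g.cost h ≤ X ^ g.degree := by
  have key : ∀ n, 1 ≤ n → 400 ≤ X ^ n := fun n hn => hX.trans (Nat.le_self_pow (by omega) _)
  induction g generalizing c L with
  | emit e => simp only [Gen.cost, Gen.degree, pow_one]; omega
  | seq g g' ih ih' =>
    simp only [Gen.maxLit] at hm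
    have h1 := ih hg.1 ha.1 (by omega)
    have h2 := ih' hg.2 ha.2 (by omega)
    have h3 := key _ g.degree_pos
    have h4 := key _ g'.degree_pos
    simp only [Gen.cost, Gen.degree, pow_add]
    nlinarith
  | when e g ih =>
    have h1 := ih hg.2.2.2 ha hm
    have h3 := key _ g.degree_pos
    simp only [Gen.cost, Gen.degree, pow_succ]
    nlinarith
  | loop e g ih =>
    simp only [Gen.maxLit] at hm
    have h1 := ih hg.2.2.2.2 ha.2 (by omega)
    have h3 := key _ g.degree_pos
    have h2 := Exp.eval_le_pow_of_arith (by omega) hv hg.1 ha.1 (by omega : e.MaxLit ≤ X)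
    have h4 : 1 ≤ X ^ e.size := Nat.one_le_pow _ _ (by omega)
    simp only [Gen.cost, Gen.degree, pow_add]
    have h5 : e.eval h * (g.cost h + 193) ≤ X ^ e.size * (2 * X ^ g.degree) :=
      Nat.mul_le_mul h2 (by omega)
    have h6 : 1 * 400 ≤ X ^ e.size * X ^ g.degree := Nat.mul_le_mul h4 h3
    have h7 : 3 ≤ X ^ 2 := by nlinarith
    calc 128 + e.eval h * (g.cost h + 193) ≤ 3 * (X ^ e.size * X ^ g.degree) := by linarith
      _ ≤ X ^ e.size * X ^ g.degree * X ^ 2 := by nlinarith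
  | counted u g ih =>
    have h1 := ih hg.2.2 ha hm
    have h3 := key _ g.degree_pos
    simp only [Gen.cost, Gen.degree, pow_succ]
    nlinarith

/-! ## Evaluating the clauses under partial assignments -/

/-- The literal `l` concerns a variable in `[lo, hi)` and is satisfied by the assignment to these
variables given by the bits of `a`. -/
def litTest (lo hi a : ℕ) (l : ℕ × Bool) : Bool :=
  decide (lo ≤ l.1) && decide (l.1 < hi) && (a.testBit (l.1 - lo) == l.2)

def clauseTest (F : CNF) (lo hi a c : ℕ) : Bool := (F.getD c []).any (litTest lo hi a)

theorem exists_testBit_eq (n : ℕ) (f : ℕ → Bool) : ∃ a < 2 ^ n, ∀ i < n, a.testBit i = f i := by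
  refine ⟨Nat.ofBits fun i : Fin n => f i, Nat.ofBits_lt_two_pow _, fun i hi => ?_⟩
  rw [Nat.testBit_ofBits_lt _ _ hi]

/-- An assignment is cut into three blocks, which are coded by the bits of `a`, `a'` and `b`. A
literal that satisfies a clause lies in exactly one of the blocks. -/
theorem CNF.satisfiable_iff {F : CNF} {n N₁ N₂ : ℕ} (hF : ∀ c ∈ F, ∀ l ∈ c, l.1 < n)
    (hN : N₁ + N₂ ≤ n) : F.Satisfiable ↔ ∃ b < 2 ^ (n - N₁ - N₂), ∃ a < 2 ^ N₁, ∃ a' < 2 ^ N₂,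
      ∀ c < F.length, clauseTest F 0 N₁ a c = true ∨ clauseTest F N₁ (N₁ + N₂) a' c = true ∨
        clauseTest F (N₁ + N₂) n b c = true := by
  constructor
  · rintro ⟨v, hv⟩
    obtain ⟨a, ha, hav⟩ := exists_testBit_eq N₁ v
    obtain ⟨a', ha', hav'⟩ := exists_testBit_eq N₂ fun i => v (N₁ + i)
    obtain ⟨b, hb, hbv⟩ := exists_testBit_eq (n - N₁ - N₂) fun i => v (N₁ + N₂ + i)
    refine ⟨b, hb, a, ha, a', ha', fun c hc => ?_⟩
    obtain ⟨l, hl, hvl⟩ := hv F[c] (List.getElem_mem hc)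
    have hln := hF _ (List.getElem_mem hc) l hl
    have hg : F.getD c [] = F[c] := by simp [hc]
    simp only [clauseTest, hg, List.any_eq_true, litTest, Bool.and_eq_true, decide_eq_true_eq,
      beq_iff_eq]
    rcases lt_or_ge l.1 N₁ with h1 | h1
    · exact .inl ⟨l, hl, ⟨by omega, h1⟩, by rw [Nat.sub_zero, hav _ h1, hvl]⟩
    rcases lt_or_ge l.1 (N₁ + N₂) with h2 | h2
    · refine .inr (.inl ⟨l, hl, ⟨h1, h2⟩, ?_⟩)
      rw [hav' _ (by omega), ← hvl]; congr 1; omega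
    · refine .inr (.inr ⟨l, hl, ⟨h2, hln⟩, ?_⟩)
      rw [hbv _ (by omega), ← hvl]; congr 1; omega
  · rintro ⟨b, hb, a, ha, a', ha', H⟩
    refine ⟨fun i => if i < N₁ then a.testBit i else if i < N₁ + N₂ then a'.testBit (i - N₁)
      else b.testBit (i - (N₁ + N₂)), fun cl hcl => ?_⟩
    obtain ⟨c, hc, rfl⟩ := List.mem_iff_getElem.1 hcl
    have hg : F.getD c [] = F[c] := by simp [hc]
    have := H c hc
    simp only [clauseTest, hg, List.any_eq_true, litTest, Bool.and_eq_true, decide_eq_true_eq,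
      beq_iff_eq] at this
    rcases this with ⟨l, hl, ⟨h1, h2⟩, h3⟩ | ⟨l, hl, ⟨h1, h2⟩, h3⟩ | ⟨l, hl, ⟨h1, h2⟩, h3⟩
    · exact ⟨l, hl, by beta_reduce; rw [if_pos h2, ← h3, Nat.sub_zero]⟩
    · exact ⟨l, hl, by beta_reduce; rw [if_neg (by omega), if_pos h2, ← h3]⟩
    · exact ⟨l, hl, by beta_reduce; rw [if_neg (by omega), if_neg (by omega), ← h3]⟩

def clauseCode (c : List (ℕ × Bool)) : List ℕ := c.length :: c.map fun l => 2 * l.1 + l.2.toNat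

/-- The position of clause `c` in the encoding of `F`. -/
def clausePos (F : CNF) (c : ℕ) : ℕ := 2 + ((F.take c).flatMap clauseCode).length

theorem CNF.encode_eq (F : CNF) (n : ℕ) :
    F.encode n = [n, F.length] ++ F.flatMap clauseCode := rfl

theorem flatMap_clauseCode_eq (F : CNF) {c : ℕ} (hc : c < F.length) :
    F.flatMap clauseCode = (F.take c).flatMap clauseCode ++
      (clauseCode F[c] ++ (F.drop (c + 1)).flatMap clauseCode) := by
  rw [← List.flatMap_cons, ← List.drop_eq_getElem_cons hc, ← List.flatMap_append,
    List.take_append_drop]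

theorem encode_getD_pos (F : CNF) (n : ℕ) {c : ℕ} (hc : c < F.length) (i : ℕ) :
    (F.encode n).getD (clausePos F c + i) 0 =
      (clauseCode F[c] ++ (F.drop (c + 1)).flatMap clauseCode).getD i 0 := by
  rw [CNF.encode_eq, flatMap_clauseCode_eq F hc, ← List.append_assoc,
    List.getD_append_right _ _ _ _ (by simp only [clausePos, List.length_append, List.length_cons, List.length_nil]; omega)]
  congr 1
  simp only [clausePos, List.length_append, List.length_cons, List.length_nil]; omega

theorem encode_getD_length (F : CNF) (n : ℕ) {c : ℕ} (hc : c < F.length) :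
    (F.encode n).getD (clausePos F c) 0 = F[c].length := by
  simpa [clauseCode] using encode_getD_pos F n hc 0

theorem encode_getD_lit (F : CNF) (n : ℕ) {c : ℕ} (hc : c < F.length) {i : ℕ}
    (hi : i < F[c].length) :
    (F.encode n).getD (clausePos F c + 1 + i) 0 = 2 * F[c][i].1 + F[c][i].2.toNat := by
  rw [add_assoc, encode_getD_pos F n hc, List.getD_append _ _ _ _ (by simp [clauseCode]; omega),
    clauseCode, add_comm 1 i, List.getD_cons_succ]
  simp [hi]

theorem clausePos_succ (F : CNF) {c : ℕ} (hc : c < F.length) :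
    clausePos F (c + 1) = clausePos F c + 1 + F[c].length := by
  rw [clausePos, clausePos, List.take_succ_eq_append_getElem hc, List.flatMap_append]
  simp only [clauseCode, List.flatMap_cons, List.flatMap_nil, List.append_nil, List.length_append,
    List.length_cons, List.length_map]
  omega

theorem clausePos_le (F : CNF) (n : ℕ) (c : ℕ) : clausePos F c ≤ (F.encode n).length := by
  rw [CNF.encode_eq, clausePos]
  conv_rhs => rw [← List.take_append_drop c F, List.flatMap_append]
  simp only [List.length_append, List.length_cons, List.length_nil]; omega

notation "vM" => (0 : ℕ)
notation "vA₁" => (1 : ℕ)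
notation "vA₂" => (2 : ℕ)
notation "vAsg" => (3 : ℕ)
notation "vC" => (4 : ℕ)
notation "vD" => (5 : ℕ)
notation "vRes" => (6 : ℕ)
notation "vN" => (7 : ℕ)
notation "vN₁" => (8 : ℕ)
notation "vN₂" => (9 : ℕ)
notation "vN₃" => (10 : ℕ)
notation "vS" => (11 : ℕ)
notation "vLo" => (30 : ℕ)
notation "vHi" => (31 : ℕ)
notation "vBase" => (32 : ℕ)
notation "vPtr" => (33 : ℕ)
notation "vAcc" => (34 : ℕ)
notation "vWord" => (35 : ℕ)
notation "vLen" => (36 : ℕ)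
notation "vClause" => (37 : ℕ)
notation "vLit" => (38 : ℕ)

/-- Whether the literal in `vWord` is satisfied. -/
def litExp : Exp :=
  (1 - .bin .lt (.var vWord / 2) (.var vLo)) * .bin .lt (.var vWord / 2) (.var vHi) *
    .bin .eq (.bin .shr (.var vAsg) (.var vWord / 2 - .var vLo) % 2) (.var vWord % 2)

theorem litExp_eval {h : HState} {l : ℕ × Bool} (hw : h.var vWord = 2 * l.1 + l.2.toNat) :
    litExp.eval h = (litTest (h.var vLo) (h.var vHi) (h.var vAsg) l).toNat := by
  have h1 : (2 * l.1 + l.2.toNat) / 2 = l.1 := by have := Bool.toNat_le l.2; omega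
  have h2 : (2 * l.1 + l.2.toNat) % 2 = l.2.toNat := by have := Bool.toNat_le l.2; omega
  simp only [litExp, Exp.eval_mul, Exp.eval_sub, Exp.eval_lt, Exp.eval_eq, Exp.eval_mod,
    Exp.eval_shr, Exp.eval_div, Exp.eval_var, Exp.eval_ofNat, hw, h1, h2,
    Nat.shiftRight_eq_div_pow, ← Nat.toNat_testBit, litTest]
  by_cases ha : l.1 < h.var vLo
  · have : ¬ h.var vLo ≤ l.1 := by omega
    simp [ha, this]
  · have : h.var vLo ≤ l.1 := by omega
    by_cases hb : l.1 < h.var vHi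
    · cases h3 : (h.var vAsg).testBit (l.1 - h.var vLo) <;> cases h4 : l.2 <;> simp [ha, hb, this]
    · simp [ha, hb]

/-- Write the truth values of all clauses to host array `K`. -/
def evalRow (K : ℕ) : Prog :=
  .seq (assign vPtr 2) (forLoop vClause (.var vM)
    (.seq (assign vAcc 0) (.seq (assign vLen (.get 0 (.var vPtr)))
      (.seq (assign vPtr (.var vPtr + 1)) (.seq (forLoop vLit (.var vLen)
        (.seq (assign vWord (.get 0 (.var vPtr))) (.seq (assign vPtr (.var vPtr + 1))
          (assign vAcc (.bin .lt 0 (.var vAcc + litExp))))))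
        (put (4 * K) (.var vBase + .var vClause) (.var vAcc)))))))

/-- Only scratch variables and array `K` are changed. -/
structure RowFrame (K : ℕ) (h h' : HState) : Prop where
  var : ∀ i, i < 33 ∨ 39 ≤ i → h'.var i = h.var i
  areg : h'.areg = h.areg
  arr : ∀ k ≠ K, h'.arr k = h.arr k

theorem RowFrame.refl (K : ℕ) (h : HState) : RowFrame K h h := ⟨fun _ _ => rfl, rfl, fun _ _ => rfl⟩

theorem RowFrame.set {K : ℕ} {h h' : HState} (H : RowFrame K h h') {i : ℕ} (x : ℕ)
    (hi : 33 ≤ i ∧ i < 39) : RowFrame K h (h'.set i x) :=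
  ⟨fun j hj => by rw [HState.set_var, if_neg (by omega)]; exact H.var j hj, H.areg, H.arr⟩

/-- The encoding of the formula is read once from front to back, so all clauses together take time
linear in its length. -/
theorem evalRow_spec {B W : ℕ} (hR : Room B W) (hB : 100 ≤ B) {F : CNF} {n K : ℕ} (hK : K ≠ 0)
    {h : HState} {t : ℕ} (h0 : h.arr 0 = fun j => (F.encode n).getD j 0) (hM : h.var vM = F.length)
    (hlen : (F.encode n).length ≤ B) :
    WP B W (evalRow K) h t fun h' t' => RowFrame (4 * K) h h' ∧
      h'.arr (4 * K) = writeAt (h.arr (4 * K)) (h.var vBase) ((List.range F.length).map fun c =>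
        (clauseTest F (h.var vLo) (h.var vHi) (h.var vAsg) c).toNat) ∧
      t' ≤ t + 1000 * (F.encode n).length := by
  have hK4 : 0 ≠ 4 * K := by omega
  have hMB : F.length ≤ B := by
    have : F.length + 2 ≤ (F.encode n).length := by
      have : ∀ G : CNF, G.length ≤ (G.flatMap clauseCode).length := by
        intro G
        induction G with
        | nil => simp
        | cons c G ih => simp [clauseCode]; omega
      have := this F
      simp only [CNF.encode, List.length_cons]
      exact Nat.add_le_add_right this 2
    omega
  have lfit : litExp.Fits B := by simp [litExp]; omega
  refine .seq (.assign hR (by simp; omega) (by simp) (by simp; omega) ?_)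
  refine .forLoop hR (by simp) (by simp) (N := F.length) (fun c h' t' => RowFrame (4 * K) h h' ∧
    h'.var vClause = c ∧ h'.var vPtr = clausePos F c ∧
    h'.arr (4 * K) = writeAt (h.arr (4 * K)) (h.var vBase) ((List.range c).map fun c =>
        (clauseTest F (h.var vLo) (h.var vHi) (h.var vAsg) c).toNat) ∧
    -- The read position serves as the clock. It starts at `2`, behind the two header words, and
    -- this pays for the setup.
    t' + 1000 ≤ t + 1000 * clausePos F c) ?_ ?_ ?_ ?_
  · refine ⟨((RowFrame.refl _ _).set _ (by omega)).set _ (by omega), by simp, by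
      simp [HState.set_var, clausePos], by simp [writeAt_nil], by simp [clausePos]⟩
  · rintro c hc h' t' ⟨hf, hv, -⟩
    exact ⟨hv, by simpa [hf.var vM (by omega)] using hM, hMB⟩
  · rintro c hc h1 t1 ⟨hf, hv, hp, ha, ht⟩
    have hpB := (clausePos_le F n (c + 1)).trans hlen
    have hps := clausePos_succ F hc
    have hL : h1.arr 0 = fun j => (F.encode n).getD j 0 := (hf.arr 0 hK4).trans h0
    refine .seq (.assign hR (by simp) (by simp) (by simp) ?_)
    refine .seq (.assign hR (by simp) (by simp) (fun hb => ?_) ?_)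
    · exact hb.arr 0 (by omega) _
    refine .seq (.assign hR (by simp; omega) (by simp) (fun _ => ?_) ?_)
    · simp [HState.set_var, hp]; omega
    simp only [Exp.eval_ofNat, Exp.eval_add, Exp.eval_get, Exp.eval_var, HState.set_var,
      HState.set_arr, Nat.mul_zero, hL, hp, if_false,
      show ¬ vPtr = vAcc by decide, show ¬ vPtr = vLen by decide, encode_getD_length F n hc]
    refine .seq (.mono (Q := fun h' t' => RowFrame (4 * K) h h' ∧ h'.var vClause = c ∧
      h'.var vPtr = clausePos F (c + 1) ∧ h'.arr (4 * K) = h1.arr (4 * K) ∧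
      h'.var vAcc = (clauseTest F (h.var vLo) (h.var vHi) (h.var vAsg) c).toNat ∧
      t' ≤ t1 + 320 + 400 * F[c].length) ?_ ?_)
    · refine .forLoop hR (by simp) (by simp) (N := F[c].length) (fun i h' t' =>
        RowFrame (4 * K) h h' ∧ h'.var vClause = c ∧ h'.var vLen = F[c].length ∧
        h'.var vLit = i ∧ h'.var vPtr = clausePos F c + 1 + i ∧
        h'.arr (4 * K) = h1.arr (4 * K) ∧
        h'.var vAcc = ((F[c].take i).any (litTest (h.var vLo) (h.var vHi) (h.var vAsg))).toNat ∧
        t' ≤ t1 + 320 + 400 * i) ?_ ?_ ?_ ?_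
      · refine ⟨(((hf.set _ (by omega)).set _ (by omega)).set _ (by omega)).set _ (by omega), ?_⟩
        simp [HState.set_var, hv]
      · rintro i hi h' t' ⟨-, -, h3, h4, -⟩
        exact ⟨h4, h3, by omega⟩
      · rintro i hi h2 t2 ⟨hf2, hc2, hlen2, hi2, hp2, ha2, hacc2, ht2⟩
        have hL2 : h2.arr 0 = fun j => (F.encode n).getD j 0 := (hf2.arr 0 hK4).trans h0
        refine .seq (.assign hR (by simp) (by simp) (fun hb => hb.arr 0 (by omega) _) ?_)
        refine .seq (.assign hR (by simp; omega) (by simp) (fun _ => ?_) ?_)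
        · simp [HState.set_var, hp2]; omega
        simp only [Exp.eval_ofNat, Exp.eval_add, Exp.eval_get, Exp.eval_var, HState.set_var,
          Nat.mul_zero, hL2, hp2, if_false, show ¬ vPtr = vWord by decide,
          encode_getD_lit F n hc hi]
        refine .assign hR (by simp [lfit]) (by simp [litExp]) (fun _ => ?_) ?_
        · simp only [Exp.eval_lt]; split_ifs <;> omega
        set h3 := (h2.set vWord (2 * F[c][i].1 + F[c][i].2.toNat)).set vPtr
          (clausePos F c + 1 + i + 1) with hh3
        have hlit : litExp.eval h3 =
            (litTest (h.var vLo) (h.var vHi) (h.var vAsg) F[c][i]).toNat := by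
          rw [litExp_eval (l := F[c][i]) (by simp [hh3, HState.set_var])]
          simp [hh3, HState.set_var, hf2.var]
        have hacc3 : h3.var vAcc = h2.var vAcc := by simp [hh3, HState.set_var]
        refine ⟨by simp [hh3, HState.set_var, hi2], ?_⟩
        refine ⟨(((hf2.set _ (by omega)).set _ (by omega)).set _ (by omega)).set _ (by omega), ?_⟩
        simp only [HState.set_var, hh3, HState.set_arr, if_true, if_false,
          show ¬ vClause = vLit by decide, show ¬ vClause = vAcc by decide,
          show ¬ vClause = vPtr by decide, show ¬ vClause = vWord by decide,
          show ¬ vLen = vLit by decide, show ¬ vLen = vAcc by decide,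
          show ¬ vLen = vPtr by decide, show ¬ vLen = vWord by decide,
          show ¬ vPtr = vLit by decide, show ¬ vPtr = vAcc by decide,
          show ¬ vAcc = vLit by decide]
        refine ⟨hc2, hlen2, trivial, by omega, ha2, ?_, by omega⟩
        rw [← hh3, Exp.eval_lt, Exp.eval_add, Exp.eval_var, hlit, hacc3, hacc2,
          List.take_succ_eq_append_getElem hi, List.any_append]
        simp only [Exp.eval_ofNat, List.any_cons, List.any_nil, Bool.or_false]
        cases (F[c].take i).any (litTest (h.var vLo) (h.var vHi) (h.var vAsg)) <;>
          cases litTest (h.var vLo) (h.var vHi) (h.var vAsg) F[c][i] <;> simp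
      · rintro h' t' ⟨a1, a2, a3, a4, a5, a6, a7, a8⟩
        refine ⟨a1, a2, by omega, a6, ?_, a8⟩
        rw [a7, List.take_length, clauseTest]; simp [hc]
    · rintro h2 t2 ⟨a1, a2, a3, a4, a5, a6⟩
      refine .put hR (by simp) (by simp) (by simp) (by simp) (fun _ _ => ?_) ?_
      · simp only [Exp.eval_var, a5]
        have := Bool.toNat_le (clauseTest F (h.var vLo) (h.var vHi) (h.var vAsg) c)
        omega
      refine ⟨a2, ⟨⟨fun i hi => ?_, ?_, fun k hk => ?_⟩, by simp, ?_, ?_, ?_⟩⟩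
      · rw [HState.set_var, if_neg (by omega)]; exact a1.var i hi
      · exact a1.areg
      · rw [HState.set_arr, HState.put_arr_of_ne _ _ _ hk]; exact a1.arr k hk
      · simpa [HState.set_var] using a3
      · beta_reduce
        rw [HState.put_arr_self, a4, ha, List.range_succ, List.map_append,
          ← writeAt_append]
        simp [writeAt_singleton, a2, a5, a1.var]
      · omega
  · rintro h' t' ⟨hf, -, -, ha, ht⟩
    have := clausePos_le F n F.length
    exact ⟨hf, ha, by omega⟩

/-! ## Saving and restoring the registers of the guest -/

/-- The registers of the guest can be arbitrary words, not bounded by `B`. They are therefore copied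
instruction by instruction, without expressions, and into an array that `HState.Bdd` says nothing
about. -/
def saveRegs : ℕ → Prog
  | 0 => .skip
  | R + 1 => .seq (saveRegs R) (.store 16 (.const R) (.reg (3 * R + 2)))

def restoreRegs : ℕ → Prog
  | 0 => .skip
  | R + 1 => .seq (restoreRegs R) (.load (3 * R + 2) 16 (.const R))

theorem HState.Bdd.congr {B : ℕ} {h h' : HState} (hb : h.Bdd B) (hv : h'.var = h.var)
    (ha : ∀ k < 4, h'.arr (4 * k) = h.arr (4 * k)) : h'.Bdd B :=
  ⟨by rw [hv]; exact hb.var, fun k hk => by rw [ha k hk]; exact hb.arr k hk⟩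

theorem WP.saveRegs {B W : ℕ} {h : HState} {t : ℕ} (R : ℕ) (hRW : R ≤ W)
    (hreg : ∀ i, h.areg i < W) : WP B W (saveRegs R) h t fun h' t' => h'.var = h.var ∧
      h'.areg = h.areg ∧ (∀ k ≠ 16, h'.arr k = h.arr k) ∧ (∀ i < R, h'.arr 16 i = h.areg i) ∧
      t' = t + R + 1 := by
  induction R with
  | zero => exact .skip ⟨rfl, rfl, fun _ _ => rfl, fun i hi => by omega, rfl⟩
  | succ R ih =>
    refine .seq ((ih (by omega)).mono ?_)
    rintro h1 t1 ⟨hv, ha, hk, hs, ht⟩ hb s hsh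
    subst hsh
    have e1 : (Operand.reg (3 * R + 2)).val s = h.areg R := congrFun ha R
    refine ⟨_, 1, t1 + 1, .store s 16 _ _ (by simp only [Operand.val]; omega)
      (by rw [e1]; exact hreg R), le_rfl, hb.congr rfl fun k hk => ?_, hv, ha, fun k hk' => ?_,
      fun i hi => ?_, by omega⟩
    · exact Function.update_of_ne (by omega) _ _
    · rw [← hk k hk']; exact Function.update_of_ne hk' _ _
    · rw [e1]
      change (s.setArr 16 R (h.areg R)).arr 16 i = _
      rw [Store.setArr_arr]
      split_ifs with hc
      · rw [hc.2]
      · exact hs i (by omega)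

theorem WP.restoreRegs {B W : ℕ} {h : HState} {t : ℕ} (R : ℕ) (hRW : R ≤ W)
    (hreg : ∀ i < R, h.arr 16 i < W) : WP B W (restoreRegs R) h t fun h' t' => h'.var = h.var ∧
      h'.arr = h.arr ∧ (∀ i < R, h'.areg i = h.arr 16 i) ∧ (∀ i ≥ R, h'.areg i = h.areg i) ∧
      t' = t + R + 1 := by
  induction R with
  | zero => exact .skip ⟨rfl, rfl, fun i hi => by omega, fun _ _ => rfl, rfl⟩
  | succ R ih =>
    refine .seq ((ih (by omega) fun i hi => hreg i (by omega)).mono ?_)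
    rintro h1 t1 ⟨hv, ha, hk, hs, ht⟩ hb s hsh
    subst hsh
    have e1 : s.arr 16 ((Operand.const R).val s) = h.arr 16 R := congrFun (congrFun ha 16) R
    refine ⟨_, 1, t1 + 1, .load s (3 * R + 2) 16 _ (by simp only [Operand.val]; omega)
      (by rw [e1]; exact hreg R (by omega)), le_rfl, ?_⟩
    rw [Store.high_setReg_guest, e1]
    refine ⟨hb.setGuest _ _, hv, ha, fun i hi => ?_, fun i hi => ?_, by omega⟩
    · simp only [HState.setGuest, Function.update_apply]
      split_ifs with hc
      · rw [hc]
      · exact hk i (by omega)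
    · simp only [HState.setGuest, Function.update_apply]
      rw [if_neg (by omega)]
      exact hs i (by omega)

/-! ## Sessions with resets -/

/-- A step of a session: go back to the store after the preprocessing, or make a request whose
answer has to satisfy a condition. -/
inductive Step where
  | reset
  | call (r : Request) (φ : ℕ → Prop)

/-- `Session A W s₀ s l c`: from the store `s` on, the steps `l` are processed in time `c`, where a
reset leads to `s₀`. -/
inductive Session (A : DynAlg) (W : ℕ) (s₀ : Store) : Store → List Step → ℕ → Prop
  | nil (s : Store) : Session A W s₀ s [] 0
  | reset {s : Store} {l : List Step} {c : ℕ} (h : Session A W s₀ s₀ l c) :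
      Session A W s₀ s (.reset :: l) c
  | call {s s' : Store} {r : Request} {φ : ℕ → Prop} {l : List Step} {c c' : ℕ}
      (hrun : Run W (A.code r) (s.call r) s' c') (hφ : φ (s'.reg 0)) (h : Session A W s₀ s' l c) :
      Session A W s₀ s (.call r φ :: l) (c' + c)

/-- What a reduction needs to know about formulas: the number of clauses, the numbers of partial
assignments on both sides, and which clauses they satisfy. -/
structure SatData where
  M : ℕ
  A₁ : ℕ
  A₂ : ℕ
  T₁ : ℕ → ℕ
  T₂ : ℕ → ℕ

structure HState.Models (h : HState) (D : SatData) : Prop where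
  M : h.var vM = D.M
  A₁ : h.var vA₁ = D.A₁
  A₂ : h.var vA₂ = D.A₂
  T₁ : h.arr 4 = D.T₁
  T₂ : h.arr 8 = D.T₂

/-- The values of the variables for the arguments of requests. -/
def SatData.env (D : SatData) (j c d : ℕ) : HState where
  var i := if i = vM then D.M else if i = vA₁ then D.A₁ else if i = vA₂ then D.A₂ else
    if i = vAsg then j else if i = vC then c else if i = vD then d else 0
  areg _ := 0
  arr _ _ := 0

theorem Exp.eval_congr_of_arith {L : ℕ} {h h' : HState} (H : ∀ i < L, h'.var i = h.var i) {e : Exp}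
    (he : e.Below L) (ha : e.Arith) : e.eval h' = e.eval h := by
  induction e with
  | var i => exact H i he
  | lit c => rfl
  | bin f a b iha ihb => simp only [Exp.eval, iha he.1 ha.2.1, ihb he.2 ha.2.2]
  | get k e ih => exact ha.elim

/-- The code of a reduction: how to write the initial instance, the arguments of updates and
queries, and how to read the answer. -/
structure Code where
  gen : Gen
  argA : Exp
  argB : Exp
  query : Exp
  thr : Exp
  low : Bool

def Exp.Usable (B L : ℕ) (e : Exp) : Prop := e.Fits B ∧ e.Below L ∧ e.Arith ∧ e.size ≤ 50

structure Code.Good (K : Code) (B : ℕ) : Prop where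
  gen : K.gen.Good B false 12
  argA : K.argA.Usable B 6
  argB : K.argB.Usable B 6
  query : K.query.Usable B 4
  thr : K.thr.Usable B 4

/-- The update for clause `c` with truth value `b`. -/
def Code.update (K : Code) (D : SatData) (neg del : Bool) (j c b : ℕ) : Request :=
  if del then .del (K.argA.eval (D.env j c (if neg then 1 - b else b)))
      (K.argB.eval (D.env j c (if neg then 1 - b else b)))
    else .ins (K.argA.eval (D.env j c (if neg then 1 - b else b)))
      (K.argB.eval (D.env j c (if neg then 1 - b else b)))

def Code.ask (K : Code) (D : SatData) (j : ℕ) : Request := .ask (K.query.eval (D.env j 0 0))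

/-- An answer is a word of the guest and need not be bounded by `B`; the host does nothing with it
but compare it with a threshold. -/
def Code.Accepts (K : Code) (D : SatData) (j a : ℕ) : Prop :=
  if K.low then a < K.thr.eval (D.env j 0 0) else K.thr.eval (D.env j 0 0) ≤ a

def Code.updates (K : Code) (D : SatData) (neg del : Bool) (j : ℕ) (b : ℕ → ℕ) (l : List ℕ) :
    List Step :=
  l.map fun c => .call (K.update D neg del j c (b c)) fun _ => True

/-- How to get back to the initial instance after each query. -/
inductive Rollback where
  | none | undo | reset

/-- The steps for the assignment `j` to the last variables, under which clause `c` has truth value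
`b c`. -/
def Code.stage (K : Code) (D : SatData) (dec : Bool) (ρ : Rollback) (j : ℕ) (b : ℕ → ℕ)
    (X : Prop) : List Step :=
  (match ρ with | .reset => [.reset] | _ => []) ++ K.updates D dec dec j b (List.range D.M) ++
    .call (K.ask D j) (fun a => K.Accepts D j a ↔ X) ::
    (match ρ with | .undo => K.updates D dec (!dec) j b (List.range D.M) | _ => [])

/-! ## The driver -/

notation "vTest" => (42 : ℕ)

def updateLoop (K : Code) (neg : Bool) (p : Prog) : Prog :=
  forLoop vC (.var vM) (.seq (assign vD (if neg then 1 - .get 3 (.var vC) else .get 3 (.var vC)))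
    (.seq (setGuest 0 K.argA) (.seq (setGuest 1 K.argB) p.guest)))

/-- Raising the epoch discards everything the guest has written to its arrays since the last reset,
in constant time; the registers are copied back. -/
def resetGuest (R : ℕ) : Prog := .seq (assign epochVar (.var epochVar + 1)) (restoreRegs R)

/-- Variable `vRes` accumulates the disjunction of the outcomes of all queries. -/
def queryTest (K : Code) (p : Prog) : Prog :=
  .seq (setGuest 0 K.query) (.seq p.guest (.seq (guestLt vTest K.thr)
    (assign vRes (.bin .lt 0 (.var vRes + if K.low then .var vTest else 1 - .var vTest)))))

/-- The summand `2` covers the registers `0` and `1`, which receive the arguments of a request. The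
preprocessing is left out because resets lead only to the store after it. -/
def DynAlg.regBound (A : DynAlg) : ℕ :=
  2 + max A.ins.regBound (max A.del.regBound A.ask.regBound)

def stageProg (K : Code) (A : DynAlg) (dec : Bool) (ρ : Rollback) : Prog :=
  .seq (evalRow 3) (.seq (match ρ with | .reset => resetGuest A.regBound | _ => .skip)
    (.seq (updateLoop K dec (if dec then A.del else A.ins)) (.seq (queryTest K A.ask)
      (match ρ with | .undo => updateLoop K dec (if dec then A.ins else A.del) | _ => .skip))))

theorem HState.Hosts.setGuest {h : HState} {a : Store} (H : h.Hosts a) (d x : ℕ) :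
    (h.setGuest d x).Hosts (a.setReg d x) := by
  refine ⟨fun i => ?_, H.arr, H.stamp⟩
  simp only [HState.setGuest, Store.setReg, Function.update_apply, H.reg]

theorem HState.Hosts.congr {h h' : HState} {a : Store} (H : h.Hosts a) (ha : h'.areg = h.areg)
    (hr : ∀ k, k % 4 ≠ 0 → h'.arr k = h.arr k) (he : h'.var epochVar = h.var epochVar) :
    h'.Hosts a := by
  refine ⟨fun i => by rw [ha]; exact H.reg i, fun k j => ?_, fun k j => ?_⟩
  · rw [hr _ (by omega), hr _ (by omega), hr _ (by omega), he]; exact H.arr k j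
  · rw [hr _ (by omega), he]; exact H.stamp k j

/-- The invariant of the guest store: registers that are not used keep their contents. -/
structure GuestOK (A : DynAlg) (W : ℕ) (s₀ s : Store) : Prop where
  lt : ∀ i, s.reg i < W
  eq : ∀ i ≥ A.regBound, s.reg i = s₀.reg i

theorem GuestOK.run {A : DynAlg} {W : ℕ} {s₀ s s' : Store} (H : GuestOK A W s₀ s) {r : Request}
    {c : ℕ} (hr : Run W (A.code r) (s.call r) s' c) (h : ∀ i, (s.call r).reg i < W) :
    GuestOK A W s₀ s' := by
  refine ⟨hr.reg_lt h, fun i hi => ?_⟩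
  unfold DynAlg.regBound at hi
  rw [hr.reg_eq_of_regBound_le (i := i) (by cases r <;> simp only [DynAlg.code] <;> omega),
    ← H.eq i hi]
  cases r <;> simp only [Store.call] <;>
    (first | rw [Store.setReg_reg_of_ne _ _ (by omega), Store.setReg_reg_of_ne _ _ (by omega)]
           | rw [Store.setReg_reg_of_ne _ _ (by omega)])

/-- What requests leave unchanged in the state of the host. -/
structure StageFrame (S : Finset ℕ) (h h' : HState) : Prop where
  var : ∀ i ∉ S, h'.var i = h.var i
  arr : ∀ k, h'.arr (4 * k) = h.arr (4 * k)
  base : h.var epochVar ≠ 0 → ∀ k, h'.arr (4 * k + 1) = h.arr (4 * k + 1)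

theorem StageFrame.refl (S : Finset ℕ) (h : HState) : StageFrame S h h :=
  ⟨fun _ _ => rfl, fun _ => rfl, fun _ _ => rfl⟩

theorem StageFrame.trans {S : Finset ℕ} {h h' h'' : HState} (hS : epochVar ∉ S)
    (H : StageFrame S h h') (H' : StageFrame S h' h'') : StageFrame S h h'' :=
  ⟨fun i hi => (H'.var i hi).trans (H.var i hi), fun k => (H'.arr k).trans (H.arr k),
    fun he k => (H'.base (by rw [H.var _ hS]; exact he) k).trans (H.base he k)⟩

theorem StageFrame.set {S : Finset ℕ} {h h' : HState} (H : StageFrame S h h') {i : ℕ} (x : ℕ)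
    (hi : i ∈ S) : StageFrame S h (h'.set i x) :=
  ⟨fun j hj => by rw [HState.set_var, if_neg (by rintro rfl; exact hj hi)]; exact H.var j hj,
    H.arr, H.base⟩

theorem SatData.env_var {D : SatData} {h : HState} (hM : h.Models D) {j c d : ℕ}
    (hj : h.var vAsg = j) (hc : h.var vC = c) (hd : h.var vD = d) :
    ∀ i < 6, h.var i = (D.env j c d).var i := by
  intro i hi
  simp only [SatData.env]
  interval_cases i <;> simp [hM.M, hM.A₁, hM.A₂, hj, hc, hd]

theorem SatData.env_var' {D : SatData} {h : HState} (hM : h.Models D) {j c d : ℕ}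
    (hj : h.var vAsg = j) : ∀ i < 4, h.var i = (D.env j c d).var i := by
  intro i hi
  simp only [SatData.env]
  interval_cases i <;> simp [hM.M, hM.A₁, hM.A₂, hj]

theorem HState.Models.congr {D : SatData} {h h' : HState} (hM : h.Models D)
    (hv : ∀ i < 3, h'.var i = h.var i) (ha : ∀ k, h'.arr (4 * k) = h.arr (4 * k)) :
    h'.Models D :=
  ⟨(hv _ (by omega)).trans hM.M, (hv _ (by omega)).trans hM.A₁, (hv _ (by omega)).trans hM.A₂,
    (ha 1).trans hM.T₁, (ha 2).trans hM.T₂⟩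

theorem DynAlg.code_update (A : DynAlg) (K : Code) (D : SatData) (neg del : Bool) (j c b : ℕ) :
    A.code (K.update D neg del j c b) = if del then A.del else A.ins := by
  unfold Code.update; cases del <;> rfl

theorem Code.call_update (K : Code) (D : SatData) (neg del : Bool) (j c b : ℕ) (s : Store) :
    s.call (K.update D neg del j c b) =
      (s.setReg 0 (K.argA.eval (D.env j c (if neg then 1 - b else b)))).setReg 1
        (K.argB.eval (D.env j c (if neg then 1 - b else b))) := by
  unfold Code.update; cases del <;> rfl

/-! ### The updates, the reset and the query of one stage -/

section driver

variable {B W : ℕ} {A : DynAlg} {K : Code} {D : SatData} {s₀ : Store}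

/-- With `n` the time that the guest still needs for the rest of the session, `t + 5 * n` is a
potential. A simulated step of the guest costs at most five steps, so the potential grows only by
the overhead of the host. -/
theorem updateLoop_spec (hR : Room B W) (hK : K.Good B) (neg del : Bool) (hMB : D.M ≤ B) {j : ℕ}
    {b : ℕ → ℕ} {h : HState} {t : ℕ} (hM : h.Models D) (hj : h.var vAsg = j)
    (hb : ∀ c < D.M, h.arr 12 c = b c) {s : Store} (hs : h.Hosts s) (hok : GuestOK A W s₀ s)
    {l : List Step} {n : ℕ}
    (S : Session A W s₀ s (K.updates D neg del j b (List.range D.M) ++ l) n) :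
    WP B W (updateLoop K neg (if del then A.del else A.ins)) h t fun h' t' =>
      StageFrame {vC, vD} h h' ∧ ∃ s' n', h'.Hosts s' ∧ GuestOK A W s₀ s' ∧
        Session A W s₀ s' l n' ∧ t' + 5 * n' ≤ t + 5 * n + 128 + 500 * D.M := by
  have hB := hR.two_le
  refine .forLoop hR (by simp) (by simp) (N := D.M) (fun c h' t' => StageFrame {vC, vD} h h' ∧
    h'.var vC = c ∧ ∃ s' n', h'.Hosts s' ∧ GuestOK A W s₀ s' ∧
      Session A W s₀ s' (K.updates D neg del j b (List.range' c (D.M - c)) ++ l) n' ∧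
        t' + 5 * n' ≤ t + 5 * n + 128 + 500 * c) ?_ ?_ ?_ ?_
  · refine ⟨(StageFrame.refl _ _).set _ (by simp), by simp, s, n, hs.congr rfl (fun _ _ => rfl)
      (by simp [HState.set_var]), hok, ?_, by omega⟩
    rw [Nat.sub_zero, ← List.range_eq_range']; exact S
  · rintro c hc h' t' ⟨hf, hv, -⟩
    refine ⟨hv, ?_, hMB⟩
    rw [Exp.eval_var, hf.var _ (by decide), hM.M]
  · rintro c hc h1 t1 ⟨hf, hv, s1, n1, hs1, hok1, S1, ht1⟩
    have hrange : List.range' c (D.M - c) = c :: List.range' (c + 1) (D.M - (c + 1)) := by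
      rw [show D.M - c = (D.M - (c + 1)) + 1 by omega, List.range'_succ]
    rw [hrange] at S1
    simp only [Code.updates, List.map_cons, List.cons_append] at S1
    set d := if neg then 1 - b c else b c with hd
    have hbc : h1.arr 12 c = b c := by rw [← hb c hc]; exact congrFun (hf.arr 3) c
    have hde : (if neg then 1 - .get 3 (.var vC) else .get 3 (.var vC) : Exp).eval h1 = d := by
      cases neg <;> simp [hv, hbc, hd]
    refine .of_bdd fun hbd => ?_
    refine .seq (.assign hR ?_ ?_ (fun hbd => ?_) ?_)
    · cases neg <;> simp; omega
    · cases neg <;> simp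
    · have := hbd.arr 3 (by omega) c
      rw [hde, hd]
      have e : 4 * 3 = 12 := rfl
      rw [e, hbc] at this
      split_ifs <;> omega
    rw [hde]
    have hM2 : (h1.set vD d).Models D :=
      hM.congr (fun i hi => by
        rw [HState.set_var, if_neg (by omega)]
        exact hf.var i (by simp; omega)) hf.arr
    have henv : ∀ i < 6, (h1.set vD d).var i = (D.env j c d).var i :=
      SatData.env_var hM2
        (by rw [HState.set_var, if_neg (by omega), hf.var _ (by decide), hj])
        (by rw [HState.set_var, if_neg (by omega), hv]) (by simp)
    have hA : K.argA.eval (h1.set vD d) = K.argA.eval (D.env j c d) :=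
      Exp.eval_congr_of_arith henv hK.argA.2.1 hK.argA.2.2.1
    have hBB : ∀ x, K.argB.eval ((h1.set vD d).setGuest 0 x) = K.argB.eval (D.env j c d) :=
      fun x => Exp.eval_congr_of_arith (h' := (h1.set vD d).setGuest 0 x) henv hK.argB.2.1 hK.argB.2.2.1
    have hsz := hK.argA.2.2.2
    have hsz2 := hK.argB.2.2.2
    refine .seq (.setGuest hR hK.argA.1 (by omega) fun hlt1 => ?_)
    refine .seq (.setGuest hR hK.argB.1 (by omega) fun hlt2 => ?_)
    rw [hBB] at hlt2 ⊢
    rw [hA] at hlt1 ⊢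
    have hcall : s1.call (K.update D neg del j c (b c)) =
        (s1.setReg 0 (K.argA.eval (D.env j c d))).setReg 1 (K.argB.eval (D.env j c d)) :=
      Code.call_update ..
    have hhost : (((h1.set vD d).setGuest 0 (K.argA.eval (D.env j c d))).setGuest 1
        (K.argB.eval (D.env j c d))).Hosts (s1.call (K.update D neg del j c (b c))) := by
      rw [hcall]
      exact ((hs1.congr (h' := h1.set vD d) rfl (fun _ _ => rfl)
        (by simp [HState.set_var])).setGuest _ _).setGuest _ _
    cases S1 with
    | @call _ s2 _ _ _ n2 c2 hrun hφ S2 =>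
      have hlt : ∀ i, (s1.call (K.update D neg del j c (b c))).reg i < W := by
        intro i
        rw [hcall]
        simp only [Store.setReg, Function.update_apply]
        split_ifs
        · exact hlt2
        · exact hlt1
        · exact hok1.lt i
      have hok2 := hok1.run hrun hlt
      rw [DynAlg.code_update] at hrun
      refine .guest hR hrun hhost ?_
      intro h3 t3 hh3 hv3 ha3 hb3 ht3
      have hf3 : StageFrame {vC, vD} h h3 := by
        have : StageFrame {vC, vD} h1 h3 := by
          refine ⟨fun i hi => ?_, ha3, fun he => hb3 ?_⟩
          · rw [hv3]; simp only [HState.setGuest_var]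
            rw [HState.set_var, if_neg (by rintro rfl; simp at hi)]
          · simpa [HState.set_var] using he
        exact hf.trans (by decide) this
      refine ⟨by rw [hv3]; simpa [HState.set_var] using hv, hf3.set _ (by simp), by simp, s2, n2,
        hh3.congr rfl (fun _ _ => rfl) (by simp [HState.set_var]), hok2, S2, by omega⟩
  · rintro h' t' ⟨hf, hv, s', n', h1, h2, h3, h4⟩
    refine ⟨hf, s', n', h1, h2, ?_, h4⟩
    simpa [Code.updates] using h3

/-- All stamps are at most the old epoch, so under the new one the guest sees nothing but its base
contents, which are those after the preprocessing. -/
theorem resetGuest_spec (hR : Room B W) (hAB : A.regBound ≤ B) {h : HState} {t : ℕ}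
    (he : h.var epochVar < B) {s : Store} (hs : h.Hosts s) (hok : GuestOK A W s₀ s)
    (hlt : ∀ i, s₀.reg i < W) (hbase : ∀ k j, h.arr (4 * k + 1) j = s₀.arr k j)
    (hsave : ∀ i < A.regBound, h.arr 16 i = s₀.reg i) :
    WP B W (resetGuest A.regBound) h t fun h' t' =>
      (∀ i ≠ epochVar, h'.var i = h.var i) ∧ h'.var epochVar = h.var epochVar + 1 ∧
      h'.arr = h.arr ∧ h'.Hosts s₀ ∧ t' ≤ t + 65 + A.regBound := by
  have hlB := hR.lt
  have hB := hR.two_le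
  refine .seq (.assign hR (by simp; omega) (by simp) (by simp; omega) ?_)
  refine (WP.restoreRegs (h := h.set epochVar (h.var epochVar + 1)) A.regBound (by omega) fun i hi => by
    rw [HState.set_arr, hsave i hi]; exact hlt i).mono ?_
  rintro h' t' ⟨hv, ha, hr, hr', ht⟩
  refine ⟨fun i hi => ?_, ?_, ha, ⟨fun i => ?_, fun k j => ?_, fun k j => ?_⟩, by omega⟩
  · rw [hv, HState.set_var, if_neg hi]
  · rw [hv]; simp
  · rcases lt_or_ge i A.regBound with hi | hi
    · rw [hr i hi]; exact hsave i hi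
    · rw [hr' i hi, HState.set_areg, hs.reg, hok.eq i hi]
  · rw [hv, ha, HState.set_var_self, HState.set_arr, if_neg, hbase]
    have := hs.stamp k j
    omega
  · rw [hv, ha, HState.set_var_self, HState.set_arr]
    have := hs.stamp k j
    omega

theorem queryTest_spec (hR : Room B W) (hK : K.Good B) {j : ℕ} {X : Prop} {h : HState} {t : ℕ}
    (hM : h.Models D) (hj : h.var vAsg = j) (hres : h.var vRes ≤ 1)
    {s : Store} (hs : h.Hosts s) (hok : GuestOK A W s₀ s) {l : List Step} {n : ℕ}
    (S : Session A W s₀ s (.call (K.ask D j) (fun a => K.Accepts D j a ↔ X) :: l) n) :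
    WP B W (queryTest K A.ask) h t fun h' t' =>
      StageFrame {vTest, vRes} h h' ∧ h'.var vRes ≤ 1 ∧
      (h'.var vRes ≠ 0 ↔ h.var vRes ≠ 0 ∨ X) ∧ ∃ s' n', h'.Hosts s' ∧ GuestOK A W s₀ s' ∧
        Session A W s₀ s' l n' ∧ t' + 5 * n' ≤ t + 5 * n + 192 := by
  have hB := hR.two_le
  have henv := SatData.env_var' (c := 0) (d := 0) hM hj
  have hq : K.query.eval h = K.query.eval (D.env j 0 0) :=
    Exp.eval_congr_of_arith henv hK.query.2.1 hK.query.2.2.1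
  have hsz := hK.query.2.2.2
  have hsz2 := hK.thr.2.2.2
  refine .seq (.setGuest hR hK.query.1 (by omega) fun hlt => ?_)
  rw [hq] at hlt ⊢
  cases S with
  | @call _ s2 _ _ _ n2 c2 hrun hφ S2 =>
    have hok2 : GuestOK A W s₀ s2 := by
      refine hok.run hrun fun i => ?_
      simp only [Code.ask, Store.call, Store.setReg, Function.update_apply]
      split_ifs
      · exact hlt
      · exact hok.lt i
    refine .seq (.guest hR hrun (hs.setGuest 0 _) ?_)
    intro h2 t2 hh2 hv2 ha2 hb2 ht2
    have hthr : K.thr.eval h2 = K.thr.eval (D.env j 0 0) :=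
      Exp.eval_congr_of_arith (fun i hi => by rw [hv2]; exact henv i hi) hK.thr.2.1 hK.thr.2.2.1
    refine .seq (.guestLt hR hK.thr.1 (by omega) (by rw [hh2.reg]; exact hok2.lt 0) ?_)
    rw [hthr, hh2.reg]
    refine .assign hR ?_ ?_ (fun _ => ?_) ?_
    · cases K.low <;> simp; omega
    · cases K.low <;> simp
    · rw [Exp.eval_lt]; split_ifs <;> omega
    have hf : StageFrame {vTest, vRes} h h2 := by
      refine ⟨fun i hi => ?_, ha2, hb2⟩
      rw [hv2]; rfl
    refine ⟨(hf.set _ (by simp)).set _ (by simp), ?_, ?_, s2, n2, ?_, hok2, S2, by omega⟩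
    · simp only [HState.set_var_self, Exp.eval_lt]; split_ifs <;> omega
    · have hres2 : h2.var vRes = h.var vRes := by rw [hv2]; rfl
      simp only [HState.set_var_self, Exp.eval_lt, Exp.eval_add, Exp.eval_var, Exp.eval_ofNat]
      rw [← hφ, Code.Accepts]
      by_cases hlow : K.low = true
      · simp only [hlow, if_true, Exp.eval_var, HState.set_var, hres2]
        by_cases hh : s2.reg 0 < K.thr.eval (D.env j 0 0)
        · simp [hh]
        · simp [hh]
      · simp only [hlow, if_false, Exp.eval_var, Exp.eval_sub, Exp.eval_ofNat, HState.set_var, hres2]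
        by_cases hh : s2.reg 0 < K.thr.eval (D.env j 0 0)
        · simp [hh]
        · simp [hh]; omega
    · exact hh2.congr rfl (fun _ _ => rfl) (by simp [HState.set_var])

end driver

/-! ## The whole program -/

/-- The table of the truth values of the clauses under the first `i` assignments to the variables in
`[lo, hi)`. -/
def satTable (F : CNF) (lo hi i : ℕ) : ℕ → ℕ := fun x =>
  if x < i * F.length then (clauseTest F lo hi (x / F.length) (x % F.length)).toNat else 0

def satData (F : CNF) (N₁ N₂ : ℕ) : SatData where
  M := F.length
  A₁ := 2 ^ N₁
  A₂ := 2 ^ N₂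
  T₁ := satTable F 0 N₁ (2 ^ N₁)
  T₂ := satTable F N₁ (N₁ + N₂) (2 ^ N₂)

theorem satTable_succ (F : CNF) (lo hi i : ℕ) : writeAt (satTable F lo hi i) (i * F.length)
    ((List.range F.length).map fun c => (clauseTest F lo hi i c).toNat) =
      satTable F lo hi (i + 1) := by
  funext x
  unfold writeAt satTable
  rw [Nat.succ_mul]
  split_ifs with h1 h2 h3 h4
  · omega
  · omega
  · have hM : 0 < F.length := by omega
    obtain ⟨c, hc, rfl⟩ : ∃ c < F.length, x = i * F.length + c :=
      ⟨x - i * F.length, by omega, by omega⟩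
    have e1 : (i * F.length + c) / F.length = i := by
      rw [mul_comm, Nat.mul_add_div hM, Nat.div_eq_of_lt hc, add_zero]
    have e2 : (i * F.length + c) % F.length = c := by
      rw [mul_comm, Nat.mul_add_mod, Nat.mod_eq_of_lt hc]
    rw [e1, e2, Nat.add_sub_cancel_left]
    simp [List.getD_eq_getElem?_getD, hc]
  · rw [List.getD_eq_default]; simp; omega
  · rfl
  · omega
  · omega
  · rfl

theorem satTable_apply (F : CNF) {lo hi N a c : ℕ} (ha : a < N) (hc : c < F.length) :
    satTable F lo hi N (a * F.length + c) = (clauseTest F lo hi a c).toNat := by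
  have hM : 0 < F.length := by omega
  have e1 : (a * F.length + c) / F.length = a := by
    rw [mul_comm, Nat.mul_add_div hM, Nat.div_eq_of_lt hc, add_zero]
  have e2 : (a * F.length + c) % F.length = c := by
    rw [mul_comm, Nat.mul_add_mod, Nat.mod_eq_of_lt hc]
  rw [satTable, if_pos, e1, e2]
  have := Nat.mul_le_mul_right F.length (show a + 1 ≤ N from ha)
  rw [Nat.succ_mul] at this
  omega

/-- The loop variable is `vAsg`, the very assignment that `evalRow` evaluates. Row `a` of the table
begins at `a` times the number of clauses. -/
def buildTable (K v : ℕ) (lo hi : Exp) : Prog :=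
  forLoop vAsg (.var v) (.seq (assign vLo lo) (.seq (assign vHi hi)
    (.seq (assign vBase (.var vAsg * .var vM)) (evalRow K))))

/-- The part of the state that the construction of the tables leaves unchanged. -/
structure TableFrame (K : ℕ) (h h' : HState) : Prop where
  var : ∀ i, i ≠ vAsg → (i < 30 ∨ 39 ≤ i) → h'.var i = h.var i
  areg : h'.areg = h.areg
  arr : ∀ k ≠ 4 * K, h'.arr k = h.arr k

section

variable {B W : ℕ}

theorem buildTable_spec (hR : Room B W) (hB : 100 ≤ B) {F : CNF} {n K : ℕ} (hK : K ≠ 0)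
    {v N lo hi : ℕ} {eLo eHi : Exp} (hlo : eLo.Fits B ∧ eLo.size ≤ 60 ∧ eLo.Arith ∧ eLo.Below 12)
    (hhi : eHi.Fits B ∧ eHi.size ≤ 60 ∧ eHi.Arith ∧ eHi.Below 12) (hv : v ≠ vAsg ∧ v < 12) {h : HState} {t : ℕ}
    (h0 : h.arr 0 = fun j => (F.encode n).getD j 0) (hM : h.var vM = F.length)
    (hlen : (F.encode n).length ≤ B) (hN : h.var v = N) (hNB : N ≤ B) (hNM : N * F.length ≤ B)
    (hel : ∀ h' : HState, (∀ i, i ≠ vAsg → i < 30 → h'.var i = h.var i) → eLo.eval h' = lo)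
    (heh : ∀ h' : HState, (∀ i, i ≠ vAsg → i < 30 → h'.var i = h.var i) → eHi.eval h' = hi)
    (hloB : lo ≤ B) (hhiB : hi ≤ B) (hT : h.arr (4 * K) = fun _ => 0) :
    WP B W (buildTable K v eLo eHi) h t fun h' t' => TableFrame K h h' ∧
      h'.arr (4 * K) = satTable F lo hi N ∧
      t' ≤ t + 128 + N * (1000 * (F.encode n).length + 500) := by
  have hK4 : 0 ≠ 4 * K := by omega
  refine .forLoop hR (by simp) (by simp) (N := N) (fun i h' t' => TableFrame K h h' ∧
    h'.var vAsg = i ∧ h'.arr (4 * K) = satTable F lo hi i ∧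
    t' ≤ t + 128 + i * (1000 * (F.encode n).length + 500)) ?_ ?_ ?_ ?_
  · refine ⟨⟨fun i hi _ => by rw [HState.set_var, if_neg hi], rfl, fun _ _ => rfl⟩, by simp, ?_,
      by simp⟩
    rw [HState.set_arr, hT]; funext x; simp [satTable]
  · rintro i hi h' t' ⟨hf, hv', -⟩
    exact ⟨hv', by rw [Exp.eval_var, hf.var v hv.1 (by omega), hN], hNB⟩
  · rintro i hi' h1 t1 ⟨hf, hv1, ha1, ht1⟩
    have hiM : i * F.length ≤ B := (Nat.mul_le_mul_right _ hi'.le).trans hNM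
    have e1 : eLo.eval h1 = lo := hel _ fun i h1 h2 => hf.var i h1 (by omega)
    have e2 : eHi.eval (h1.set vLo lo) = hi := heh _ fun i h1 h2 => by
      rw [HState.set_var, if_neg (by omega)]; exact hf.var i h1 (by omega)
    refine .seq (.assign hR hlo.1 hlo.2.1 (by rw [e1]; exact fun _ => hloB) ?_)
    rw [e1]
    refine .seq (.assign hR hhi.1 hhi.2.1 (by rw [e2]; exact fun _ => hhiB) ?_)
    rw [e2]
    have e3 : (Exp.var vAsg * .var vM).eval ((h1.set vLo lo).set vHi hi) = i * F.length := by
      simp [HState.set_var, hv1, hf.var vM (by omega) (by omega), hM]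
    refine .seq (.assign hR (by simp) (by simp) (by rw [e3]; exact fun _ => hiM) ?_)
    rw [e3]
    refine (evalRow_spec hR hB (F := F) (n := n) hK ?_ ?_ hlen).mono ?_
    · exact (hf.arr 0 hK4).trans h0
    · simp [HState.set_var, hf.var vM (by omega) (by omega), hM]
    · rintro h2 t2 ⟨f2, a2, ht2⟩
      refine ⟨?_, ⟨fun x hx hx' => ?_, ?_, fun k hk => ?_⟩, by simp, ?_, ?_⟩
      · rw [f2.var _ (by omega)]; simp [HState.set_var, hv1]
      · rw [HState.set_var, if_neg hx, f2.var _ (by omega), HState.set_var, if_neg (by omega),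
          HState.set_var, if_neg (by omega), HState.set_var, if_neg (by omega), hf.var x hx hx']
      · exact f2.areg.trans hf.areg
      · exact (f2.arr k hk).trans (hf.arr k hk)
      · rw [HState.set_arr, a2, ← satTable_succ]
        simp [HState.set_var, hv1, ha1]
      · rw [Nat.succ_mul]; omega
  · rintro h' t' ⟨hf, -, ha, ht⟩
    exact ⟨hf, ha, ht⟩

/-- Set variable `x` to two to the power of variable `y`. -/
def powTwo (x y : ℕ) : Prog := .op (3 * x) .shl (.const 1) (.reg (3 * y))

/-- A left shift is not tame, so it is kept out of expressions and its result is bounded by a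
hypothesis instead. -/
theorem WP.powTwo (hR : Room B W) {x y : ℕ} {h : HState} {t : ℕ} {Q : HState → ℕ → Prop}
    (hv : 2 ^ h.var y ≤ B) (H : Q (h.set x (2 ^ h.var y)) (t + 1)) :
    WP B W (_root_.powTwo x y) h t Q := by
  intro hb s hsh
  subst hsh
  have hB := hR.two_le
  have hl := hR.lt
  have e2 : (Operand.reg (3 * y)).val s = s.high.var y := rfl
  have := hb.var y
  have e : BinOp.shl.eval ((Operand.const 1).val s) ((Operand.reg (3 * y)).val s) =
      2 ^ s.high.var y := by
    rw [e2]; simp only [BinOp.eval, Operand.val]; rw [Nat.shiftLeft_eq, one_mul]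
  refine ⟨_, 1, t + 1, .op s _ .shl _ _ (by simp only [Operand.val]; omega)
    (by rw [e2]; omega) (by rw [e]; omega), le_rfl, ?_⟩
  rw [Store.high_setReg_var, e]
  exact ⟨hb.set x hv, H⟩

/-- Split the variables, and tabulate the clauses under the assignments to the first two parts. -/
def prelude (q two : ℕ) : Prog :=
  .seq (assign vN (.get 0 0)) (.seq (assign vM (.get 0 1)) (.seq (assign vN₁ (.var vN / .lit q))
    (.seq (assign vN₂ (.var vN₁ * .lit two)) (.seq (assign vN₃ (.var vN - .var vN₁ - .var vN₂))
      (.seq (powTwo vA₁ vN₁) (.seq (powTwo vA₂ vN₂) (.seq (powTwo vS vN₃)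
        (.seq (buildTable 1 vA₁ 0 (.var vN₁))
          (buildTable 2 vA₂ (.var vN₁) (.var vN₁ + .var vN₂))))))))))

/-- The state after the prelude. -/
structure Prepared (F : CNF) (n N₁ N₂ : ℕ) (h : HState) : Prop where
  models : h.Models (satData F N₁ N₂)
  var_n : h.var vN = n
  var_N₁ : h.var vN₁ = N₁
  var_N₂ : h.var vN₂ = N₂
  S : h.var vS = 2 ^ (n - N₁ - N₂)
  input : h.arr 0 = fun j => (F.encode n).getD j 0
  zero : ∀ i, i = vRes ∨ i = lenVar ∨ i = epochVar → h.var i = 0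
  areg : ∀ i, h.areg i = 0
  arr : ∀ k, k ≠ 0 → k ≠ 4 → k ≠ 8 → ∀ j, h.arr k j = 0

/-- The factor `two` is `0` or `1`: the right block is empty or as large as the left one. With `2 ≤
q` both blocks fit into the `n` variables. -/
theorem prelude_spec (hR : Room B W) (hB : 100 ≤ B) {F : CNF} {n q two : ℕ}
    (hlen : (F.encode n).length ≤ B) (hMB : 2 ^ n * F.length ≤ B) (hnB : 2 ^ n ≤ B) (hq : q ≤ B)
    (htwo : two ≤ 1) (hq2 : 2 ≤ q) {t : ℕ} :
    WP B W (prelude q two) (Store.input (F.encode n)).high t fun h t' =>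
      Prepared F n (n / q) (n / q * two) h ∧
      t' ≤ t + 1000 + (2 ^ (n / q) + 2 ^ (n / q * two)) * (1000 * (F.encode n).length + 500) := by
  set h := (Store.input (F.encode n)).high with hh
  set N₁ := n / q with hN₁
  set N₂ := N₁ * two with hN₂
  have hN1n : N₁ ≤ n / 2 := Nat.div_le_div_left hq2 (by omega)
  have hN2n : N₂ ≤ N₁ := by rw [hN₂]; exact (Nat.mul_le_mul_left _ htwo).trans (by omega)
  have hnn : n < 2 ^ n := Nat.lt_two_pow_self
  have hp1 : 2 ^ N₁ ≤ 2 ^ n := Nat.pow_le_pow_right (by omega) (by omega)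
  have hp2 : 2 ^ N₂ ≤ 2 ^ n := Nat.pow_le_pow_right (by omega) (by omega)
  have hp3 : 2 ^ (n - N₁ - N₂) ≤ 2 ^ n := Nat.pow_le_pow_right (by omega) (by omega)
  have hF : F.length ≤ B := (Nat.le_mul_of_pos_left _ (by positivity)).trans hMB
  have hin : h.arr 0 = fun j => (F.encode n).getD j 0 := by
    funext j; simp [hh, Store.high, Store.input]
  have hvar : ∀ i, h.var i = 0 := fun i => rfl
  have harr : ∀ k, k ≠ 0 → ∀ j, h.arr k j = 0 := fun k hk j => by
    simp [hh, Store.high, Store.input, hk]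
  have e0 : (F.encode n).getD 0 0 = n := rfl
  have e1 : (F.encode n).getD 1 0 = F.length := rfl
  refine .seq (.assign hR (by simp) (by simp) (fun _ => by
    rw [Exp.eval_get, hin]; simp only [Exp.eval_ofNat]; rw [e0]; omega) ?_)
  refine .seq (.assign hR (by simp; omega) (by simp) (fun _ => by
    rw [Exp.eval_get, HState.set_arr, hin]; simp only [Exp.eval_ofNat]; rw [e1]; omega) ?_)
  simp only [Exp.eval_get, Exp.eval_ofNat, Nat.mul_zero, HState.set_arr, hin, e0, e1]
  refine .seq (.assign hR (by simp [hq]) (by simp) (by simp [HState.set_var, ← hN₁]; omega) ?_)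
  refine .seq (.assign hR (by simp; omega) (by simp) (by simp [HState.set_var, ← hN₁, ← hN₂]; omega) ?_)
  refine .seq (.assign hR (by simp) (by simp) (by simp [HState.set_var]; omega) ?_)
  simp only [Exp.eval_div, Exp.eval_mul, Exp.eval_var, Exp.eval_lit, Exp.eval_sub, HState.set_var,
    reduceIte, Nat.reduceEqDiff, ← hN₁, ← hN₂]
  refine .seq (.powTwo hR (by simp [HState.set_var]; omega) ?_)
  refine .seq (.powTwo hR (by simp [HState.set_var]; omega) ?_)
  refine .seq (.powTwo hR (by simp [HState.set_var]; omega) ?_)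
  simp only [HState.set_var, reduceIte, Nat.reduceEqDiff]
  set h1 := (((((((h.set vN n).set vM F.length).set vN₁ N₁).set vN₂ N₂).set vN₃ (n - N₁ - N₂)).set
    vA₁ (2 ^ N₁)).set vA₂ (2 ^ N₂)).set vS (2 ^ (n - N₁ - N₂)) with hh1
  have harr1 : h1.arr = h.arr := rfl
  have hareg1 : ∀ i, h1.areg i = 0 := fun i => rfl
  have hM1 : h1.var vM = F.length := by simp [hh1, HState.set_var]
  have hN11 : h1.var vN₁ = N₁ := by simp [hh1, HState.set_var]
  have hN21 : h1.var vN₂ = N₂ := by simp [hh1, HState.set_var]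
  have hA11 : h1.var vA₁ = 2 ^ N₁ := by simp [hh1, HState.set_var]
  have hA21 : h1.var vA₂ = 2 ^ N₂ := by simp [hh1, HState.set_var]
  have hS1 : h1.var vS = 2 ^ (n - N₁ - N₂) := by simp [hh1, HState.set_var]
  have hn1 : h1.var vN = n := by simp [hh1, HState.set_var]
  have hz1 : ∀ i, i = vRes ∨ i = lenVar ∨ i = epochVar → h1.var i = 0 := by
    rintro i (rfl | rfl | rfl) <;> simp [hh1, HState.set_var, hvar]
  clear_value h1
  refine .seq ((buildTable_spec hR hB (F := F) (n := n) (lo := 0) (hi := N₁) (N := 2 ^ N₁) one_ne_zero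
    (by simp; trivial) (by simp; trivial) (by decide) (by rw [harr1, hin]) hM1 hlen hA11 (by omega)
    ((Nat.mul_le_mul_right _ hp1).trans hMB) (by simp)
    (fun h' hv => by rw [Exp.eval_var, hv _ (by decide) (by decide), hN11]) (by omega) (by omega)
    (by rw [harr1]; funext j; exact harr _ (by decide) j)).mono ?_)
  rintro h2 t2 ⟨f2, a2, ht2⟩
  have hv2 : ∀ i, i ≠ vAsg → i < 30 → h2.var i = h1.var i := fun i h1 h2 => f2.var i h1 (.inl h2)
  refine ((buildTable_spec hR hB (F := F) (n := n) (lo := N₁) (hi := N₁ + N₂) (N := 2 ^ N₂) two_ne_zero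
    (by simp; trivial) (by simp; exact ⟨rfl, trivial, trivial⟩) (by decide)
    (by rw [f2.arr _ (by decide), harr1, hin])
    (by rw [hv2 _ (by decide) (by decide), hM1]) hlen (by rw [hv2 _ (by decide) (by decide), hA21])
    (by omega) ((Nat.mul_le_mul_right _ hp2).trans hMB)
    (fun h' hv => by
      rw [Exp.eval_var, hv _ (by decide) (by decide), hv2 _ (by decide) (by decide), hN11])
    (fun h' hv => by
      rw [Exp.eval_add, Exp.eval_var, Exp.eval_var, hv _ (by decide) (by decide),
        hv _ (by decide) (by decide), hv2 _ (by decide) (by decide), hN11,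
        hv2 _ (by decide) (by decide), hN21]) (by omega) (by omega)
    (by rw [f2.arr _ (by decide), harr1]; funext j; exact harr _ (by decide) j)).mono ?_)
  rintro h3 t3 ⟨f3, a3, ht3⟩
  have hv3 : ∀ i, i ≠ vAsg → (i < 30 ∨ 39 ≤ i) → h3.var i = h1.var i := fun i h1 h2 =>
    (f3.var i h1 h2).trans (f2.var i h1 h2)
  refine ⟨⟨⟨?_, ?_, ?_, ?_, a3⟩, ?_, ?_, ?_, ?_, ?_, fun i hi => ?_, fun i => ?_, fun k h0 h4 h8 j => ?_⟩, ?_⟩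
  · rw [hv3 _ (by decide) (by decide), hM1]; rfl
  · rw [hv3 _ (by decide) (by decide), hA11]; rfl
  · rw [hv3 _ (by decide) (by decide), hA21]; rfl
  · exact (f3.arr _ (by decide)).trans a2
  · rw [hv3 _ (by decide) (by decide), hn1]
  · rw [hv3 _ (by decide) (by decide), hN11]
  · rw [hv3 _ (by decide) (by decide), hN21]
  · rw [hv3 _ (by decide) (by decide), hS1]
  · rw [f3.arr _ (by decide), f2.arr _ (by decide), harr1, hin]
  · rw [hv3 _ (by omega) (by omega), hz1 i hi]
  · rw [f3.areg, f2.areg, hareg1]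
  · rw [f3.arr _ h8, f2.arr _ h4, harr1, harr k h0]
  · rw [Nat.add_mul]; omega

end

/-! ## The main loop -/

/-- The steps for all assignments `j` with `i ≤ j < i + k`. -/
def Code.stages (K : Code) (D : SatData) (dec : Bool) (ρ : Rollback) (b : ℕ → ℕ → ℕ) (X : ℕ → Prop)
    (i k : ℕ) : List Step :=
  (List.range' i k).flatMap fun j => K.stage D dec ρ j (b j) (X j)

/-- Truth values of the clauses under the assignments to the last variables. -/
def lastBits (F : CNF) (n lo : ℕ) (j c : ℕ) : ℕ := (clauseTest F lo n j c).toNat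

/-- What holds between two stages, the guest being in store `s` and the next stage being `j`. -/
structure StageInv (A : DynAlg) (ρ : Rollback) (W : ℕ) (s₀ : Store) (F : CNF) (n lo : ℕ) (D : SatData) (j : ℕ)
    (h : HState) (s : Store) : Prop where
  models : h.Models D
  input : h.arr 0 = fun j => (F.encode n).getD j 0
  lo : h.var vLo = lo
  hi : h.var vHi = n
  base : h.var vBase = 0
  hosts : h.Hosts s
  ok : GuestOK A W s₀ s
  res : h.var vRes ≤ 1
  -- Every stage raises the epoch once, so the epoch stays at most the number of the stage and
  -- thereby within `B`.
  saved : ρ = .reset → (∀ k j, h.arr (4 * k + 1) j = s₀.arr k j) ∧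
    (∀ i < A.regBound, h.arr 16 i = s₀.reg i) ∧ h.var epochVar ≤ j

section

variable {B W : ℕ} {A : DynAlg} {K : Code} {s₀ : Store} {D : SatData}

theorem StageInv.frame {ρ : Rollback} {F : CNF} {n lo j : ℕ} {h h' : HState} {s s' : Store}
    (H : StageInv A ρ W s₀ F n lo D j h s) {S : Finset ℕ} (hf : StageFrame S h h')
    (hS : ∀ i ∈ S, i = vC ∨ i = vD ∨ i = vTest ∨ i = vRes) (hs : h'.Hosts s')
    (hok : GuestOK A W s₀ s') (hres : h'.var vRes ≤ 1)
    (he : ρ = .reset → h.var epochVar ≠ 0) : StageInv A ρ W s₀ F n lo D j h' s' where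
  models := H.models.congr (fun i hi => hf.var i fun hh => by have := hS i hh; omega) hf.arr
  input := (hf.arr 0).trans H.input
  lo := (hf.var _ fun hh => by have := hS _ hh; omega).trans H.lo
  hi := (hf.var _ fun hh => by have := hS _ hh; omega).trans H.hi
  base := (hf.var _ fun hh => by have := hS _ hh; omega).trans H.base
  hosts := hs
  ok := hok
  res := hres
  saved hρ := by
    obtain ⟨h1, h2, h3⟩ := H.saved hρ
    refine ⟨fun k j => ?_, fun i hi => ?_, ?_⟩
    · rw [hf.base (he hρ)]; exact h1 k j
    · have := hf.arr 4
      rw [show (16 : ℕ) = 4 * 4 from rfl, this]; exact h2 i hi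
    · rw [hf.var _ fun hh => by have := hS _ hh; omega]; exact h3

theorem stage_spec (hR : Room B W) (hB : 100 ≤ B) (hK : K.Good B) (hAB : A.regBound ≤ B)
    (hlt : ∀ i, s₀.reg i < W) {F : CNF} {n lo : ℕ} (hDM : D.M = F.length)
    (hlen : (F.encode n).length ≤ B) (hMB : F.length ≤ B)
    {dec : Bool} {ρ : Rollback} {j : ℕ} (hjB : j < B) {X : Prop} {h : HState} {t : ℕ} {s : Store}
    (hj : h.var vAsg = j) (H : StageInv A ρ W s₀ F n lo D j h s) {l : List Step} {m : ℕ}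
    (S : Session A W s₀ s (K.stage D dec ρ j (lastBits F n lo j) X ++ l) m) :
    WP B W (stageProg K A dec ρ) h t fun h' t' => h'.var vAsg = j ∧ h'.var vS = h.var vS ∧
      (h'.var vRes ≠ 0 ↔ h.var vRes ≠ 0 ∨ X) ∧ ∃ s' m', StageInv A ρ W s₀ F n lo D (j + 1) h' s' ∧
        Session A W s₀ s' l m' ∧
        t' + 5 * m' ≤ t + 5 * m + 1000 * (F.encode n).length + 1000 * F.length + 600 + A.regBound := by
  refine .seq ((evalRow_spec hR hB (F := F) (n := n) (K := 3) (by decide) H.input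
    (by rw [H.models.M, hDM]) hlen).mono ?_)
  rintro h1 t1 ⟨f1, a1, ht1⟩
  rw [H.lo, H.hi, H.base, hj] at a1
  have hb1 : ∀ c < D.M, h1.arr 12 c = lastBits F n lo j c := by
    intro c hc
    rw [hDM] at hc
    rw [show (12 : ℕ) = 4 * 3 from rfl, a1]
    simp [writeAt, List.getD_eq_getElem?_getD, hc, lastBits]
  have hS1 : h1.var vS = h.var vS := f1.var _ (by omega)
  have hR1 : h1.var vRes = h.var vRes := f1.var _ (by omega)
  have hj1 : h1.var vAsg = j := (f1.var _ (by omega)).trans hj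
  have H1 : StageInv A ρ W s₀ F n lo D j h1 s := by
    refine ⟨⟨?_, ?_, ?_, ?_, ?_⟩, ?_, ?_, ?_, ?_, ?_, H.ok, ?_, fun hρ => ?_⟩
    · rw [f1.var _ (by omega), H.models.M]
    · rw [f1.var _ (by omega), H.models.A₁]
    · rw [f1.var _ (by omega), H.models.A₂]
    · rw [f1.arr _ (by omega), H.models.T₁]
    · rw [f1.arr _ (by omega), H.models.T₂]
    · rw [f1.arr _ (by omega), H.input]
    · rw [f1.var _ (by omega), H.lo]
    · rw [f1.var _ (by omega), H.hi]
    · rw [f1.var _ (by omega), H.base]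
    · exact H.hosts.congr f1.areg (fun k hk => f1.arr _ (by omega)) (f1.var _ (by omega))
    · rw [f1.var _ (by omega)]; exact H.res
    · obtain ⟨h1, h2, h3⟩ := H.saved hρ
      exact ⟨fun k j => by rw [f1.arr _ (by omega)]; exact h1 k j,
        fun i hi => by rw [f1.arr _ (by omega)]; exact h2 i hi,
        by rw [f1.var _ (by omega)]; exact h3⟩
  -- the reset
  set u1 := K.updates D dec dec j (lastBits F n lo j) (List.range D.M) with hu1
  set qs := Step.call (K.ask D j) (fun a => K.Accepts D j a ↔ X) with hqs
  set tail : List Step := (match (generalizing := false) ρ with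
    | .undo => K.updates D dec (!dec) j (lastBits F n lo j) (List.range D.M) | _ => []) with htail
  -- With `reset` the epoch is nonzero before the guest handles its first request. So no request
  -- ever touches the base contents, on which later resets rely.
  have step1 : WP B W (match (generalizing := false) ρ with | .reset => resetGuest A.regBound | _ => .skip) h1 t1
      fun h2 t2 => h2.var vAsg = j ∧ h2.var vS = h.var vS ∧ h2.var vRes = h.var vRes ∧
        (∀ c < D.M, h2.arr 12 c = lastBits F n lo j c) ∧ (ρ = .reset → h2.var epochVar ≠ 0) ∧
        ∃ s' m', StageInv A ρ W s₀ F n lo D (j + 1) h2 s' ∧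
          Session A W s₀ s' (u1 ++ (qs :: (tail ++ l))) m' ∧
          t2 + 5 * m' ≤ t1 + 5 * m + 65 + A.regBound := by
    have mk : ∀ h2 s', StageInv A ρ W s₀ F n lo D j h2 s' →
        StageInv A ρ W s₀ F n lo D (j + 1) h2 s' := fun h2 s' H =>
      ⟨H.models, H.input, H.lo, H.hi, H.base, H.hosts, H.ok, H.res, fun hρ =>
        ⟨(H.saved hρ).1, (H.saved hρ).2.1, (H.saved hρ).2.2.trans (by omega)⟩⟩
    cases ρ with
    | none =>
      refine .skip ⟨hj1, hS1, hR1, hb1, by simp, s, m, mk _ _ H1, ?_, by omega⟩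
      simpa [Code.stage, List.append_assoc, hu1, hqs, htail] using S
    | undo =>
      refine .skip ⟨hj1, hS1, hR1, hb1, by simp, s, m, mk _ _ H1, ?_, by omega⟩
      simpa [Code.stage, List.append_assoc, hu1, hqs, htail] using S
    | reset =>
      obtain ⟨hs1, hs2, hs3⟩ := H1.saved rfl
      refine (resetGuest_spec hR hAB (by omega) H1.hosts H1.ok hlt hs1 hs2).mono ?_
      rintro h2 t2 ⟨hv2, he2, ha2, hh2, ht2⟩
      simp only [Code.stage, List.append_assoc, List.cons_append, List.nil_append] at S
      cases S with
      | reset S' =>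
        refine ⟨by rw [hv2 _ (by decide), hj1], by rw [hv2 _ (by decide), hS1],
          by rw [hv2 _ (by decide), hR1], by rw [ha2]; exact hb1, fun _ => by omega,
          s₀, m, ⟨H1.models.congr (fun i hi => hv2 i (by omega)) (fun k => by rw [ha2]),
            by rw [ha2]; exact H1.input, by rw [hv2 _ (by decide), H1.lo],
            by rw [hv2 _ (by decide), H1.hi], by rw [hv2 _ (by decide), H1.base], hh2,
            ⟨hlt, fun _ _ => rfl⟩, by rw [hv2 _ (by decide)]; exact H1.res, fun _ =>
            ⟨by rw [ha2]; exact hs1, by rw [ha2]; exact hs2, by omega⟩⟩, ?_, by omega⟩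
        simpa [List.append_assoc, hu1, hqs, htail] using S'
  refine .seq (step1.mono ?_)
  rintro h2 t2 ⟨hj2, hS2, hR2, hb2, he2, s2, m2, H2, S2, ht2⟩
  refine .seq ((updateLoop_spec (t := t2) hR hK dec dec (by omega) H2.models hj2 hb2 H2.hosts H2.ok S2).mono ?_)
  rintro h3 t3 ⟨f3, s3, m3, hh3, ok3, S3, ht3⟩
  have H3 := H2.frame f3 (by simp) hh3 ok3 (by rw [f3.var _ (by decide)]; exact H2.res) he2
  have hj3 : h3.var vAsg = j := by rw [f3.var _ (by decide), hj2]
  have he3 : ρ = .reset → h3.var epochVar ≠ 0 := by rw [f3.var _ (by decide)]; exact he2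
  refine .seq ((queryTest_spec (t := t3) hR hK H3.models hj3 H3.res hh3 ok3 S3).mono ?_)
  rintro h4 t4 ⟨f4, hr4, hX4, s4, m4, hh4, ok4, S4, ht4⟩
  have H4 := H3.frame f4 (by simp) hh4 ok4 hr4 he3
  have hj4 : h4.var vAsg = j := by rw [f4.var _ (by decide), hj3]
  have hS4 : h4.var vS = h.var vS := by rw [f4.var _ (by decide), f3.var _ (by decide), hS2]
  have hX : h4.var vRes ≠ 0 ↔ h.var vRes ≠ 0 ∨ X := by
    rw [hX4, f3.var _ (by decide), hR2]
  have hb4 : ∀ c < D.M, h4.arr 12 c = lastBits F n lo j c := fun c hc => by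
    rw [← hb2 c hc, show (12 : ℕ) = 4 * 3 from rfl, f4.arr, f3.arr]
  cases ρ with
  | none => exact .skip ⟨hj4, hS4, hX, s4, m4, H4, S4, by omega⟩
  | reset => exact .skip ⟨hj4, hS4, hX, s4, m4, H4, S4, by omega⟩
  | undo =>
    have e : (if dec then A.ins else A.del) = if (!dec) then A.del else A.ins := by cases dec <;> rfl
    simp only [e]
    refine (updateLoop_spec (t := t4) hR hK dec (!dec) (by omega) H4.models hj4 hb4 hh4 ok4 S4).mono ?_
    rintro h5 t5 ⟨f5, s5, m5, hh5, ok5, S5, ht5⟩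
    refine ⟨by rw [f5.var _ (by decide), hj4], by rw [f5.var _ (by decide), hS4],
      by rw [f5.var _ (by decide)]; exact hX, s5, m5, ?_, S5, by omega⟩
    exact H4.frame f5 (by simp) hh5 ok5 (by rw [f5.var _ (by decide)]; exact H4.res) (by simp)

/-- The algorithm for satisfiability that uses the dynamic algorithm `A`. -/
def solver (q two : ℕ) (K : Code) (A : DynAlg) (dec : Bool) (ρ : Rollback) : Prog :=
  .seq (prelude q two) (.seq (K.gen.compile 12) (.seq A.pre.guest (.seq (saveRegs A.regBound)
    (.seq (assign vLo (.var vN₁ + .var vN₂)) (.seq (assign vHi (.var vN)) (.seq (assign vBase 0)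
      (.seq (forLoop vAsg (.var vS) (stageProg K A dec ρ)) (assign 0 (.var vRes)))))))))

/-- The generator writes to array `1`, which is the base contents of array `0` of the guest, so the
instance becomes the input of the guest. The preprocessing runs in epoch zero and works on the base
contents directly; what it leaves there is the snapshot for the resets. -/
theorem solver_run (hR : Room B W) (hB : 100 ≤ B) (hK : K.Good B) (hAB : A.regBound ≤ B) {F : CNF}
    {n q two : ℕ} (hlen : (F.encode n).length ≤ B) (hMB : 2 ^ n * F.length ≤ B) (hnB : 2 ^ n ≤ B)
    (hq : q ≤ B) (htwo : two ≤ 1) (hq2 : 2 ≤ q) (hin : ∀ x ∈ F.encode n, x ≤ B)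
    (hD : D = satData F (n / q) (n / q * two)) {dec : Bool} {ρ : Rollback} {X : ℕ → Prop} {G c₀ c₁ : ℕ}
    (hG : ∀ h : HState, h.Models D → K.gen.cost h ≤ G) (hGB : G ≤ B)
    (hguest : ∀ h : HState, h.Models D → ∃ s₀ c, Run W A.pre (Store.input (K.gen.out 12 h)) s₀ c ∧
      c ≤ c₀ ∧ ∃ c', c' ≤ c₁ ∧ Session A W s₀ s₀ (K.stages D dec ρ
        (lastBits F n (n / q + n / q * two)) X 0 (2 ^ (n - n / q - n / q * two))) c') :
    ∃ s c, Run W (solver q two K A dec ρ) (Store.input (F.encode n)) s c ∧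
      (s.reg 0 ≠ 0 ↔ ∃ j < 2 ^ (n - n / q - n / q * two), X j) ∧
      c ≤ 5 * (c₀ + c₁) + G + (2 ^ (n / q) + 2 ^ (n / q * two) + 2 ^ (n - n / q - n / q * two) + 1) *
        (1000 * (F.encode n).length + 1000 * F.length + 2000 + A.regBound) := by
  have hlB := hR.lt
  set N₁ := n / q with hN₁
  set N₂ := N₁ * two with hN₂
  set S := 2 ^ (n - N₁ - N₂) with hS
  have hN1n : N₁ ≤ n / 2 := Nat.div_le_div_left hq2 (by omega)
  have hN2n : N₂ ≤ N₁ := by rw [hN₂]; exact (Nat.mul_le_mul_left _ htwo).trans (by omega)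
  have hnn : n < 2 ^ n := Nat.lt_two_pow_self
  have hSB : S ≤ B := le_trans (Nat.pow_le_pow_right (by omega) (by omega)) hnB
  have hMB' : F.length ≤ B := (Nat.le_mul_of_pos_left _ (by positivity)).trans hMB
  have hDM : D.M = F.length := by rw [hD]; rfl
  set P := 1000 * (F.encode n).length + 1000 * F.length + 2000 + A.regBound with hP
  suffices h : WP B W (solver q two K A dec ρ) (Store.input (F.encode n)).high 0 fun h' t' =>
      (h'.var 0 ≠ 0 ↔ ∃ j < S, X j) ∧ t' ≤ 5 * (c₀ + c₁) + G + (2 ^ N₁ + 2 ^ N₂ + S + 1) * P by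
    have hbdd : (Store.input (F.encode n)).high.Bdd B := by
      refine ⟨fun i => Nat.zero_le _, fun k _ j => ?_⟩
      simp only [Store.high, Store.input]
      split_ifs
      · rw [List.getD_eq_getElem?_getD]
        cases hx : (F.encode n)[j]? with
        | none => simp
        | some x => exact hin x (List.mem_of_getElem? hx)
      · exact Nat.zero_le _
    obtain ⟨s', c, t', r, ht, -, h1, h2⟩ := h hbdd _ rfl
    exact ⟨s', c, r, h1, by omega⟩
  refine .seq ((prelude_spec hR hB hlen hMB hnB hq htwo hq2).mono ?_)
  rintro h1 t1 ⟨pr, ht1⟩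
  rw [← hN₁, ← hN₂] at ht1 pr
  rw [← hS] at *
  have hM1 : h1.Models D := by rw [hD]; exact pr.models
  refine .seq ((Gen.run hR hK.gen (by omega) (by omega) (by
    rw [pr.zero _ (by omega)]; have := hG h1 hM1; omega)).mono ?_)
  rintro h2 t2 ⟨w2, ht2⟩
  have hG1 := hG h1 hM1
  obtain ⟨s₀, c, rpre, hc, c', hc', sess⟩ := hguest h1 hM1
  have hv2 : ∀ i, i < 12 → h2.var i = h1.var i := fun i hi => w2.var i (.inl hi)
  have ho2 : ∀ k, k ≠ 1 → h2.arr k = h1.arr k := w2.arr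
  have hosts2 : h2.Hosts (Store.input (K.gen.out 12 h1)) := by
    have he : h2.var epochVar = 0 := by
      rw [w2.var _ (.inr (by omega)), pr.zero _ (by omega)]
    refine ⟨fun i => by rw [w2.areg, pr.areg]; rfl, fun k j => ?_, fun k j => ?_⟩
    · rw [he]
      simp only [ne_eq, not_true_eq_false, false_and, if_false]
      by_cases hk : k = 0
      · subst hk
        have := w2.out
        rw [pr.zero _ (by omega)] at this
        simp only [Nat.mul_zero, Nat.zero_add, this, Store.input, writeAt, Nat.zero_le, if_true,
          Nat.sub_zero, pr.arr 1 (by omega) (by omega) (by omega)]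
      · rw [ho2 _ (by omega), pr.arr _ (by omega) (by omega) (by omega)]
        simp [Store.input, hk]
    · rw [ho2 _ (by omega), pr.arr _ (by omega) (by omega) (by omega)]; omega
  refine .seq (.guest hR rpre hosts2 ?_)
  intro h3 t3 hosts3 hv3 ha3 _ ht3
  have hlt0 : ∀ i, s₀.reg i < W := rpre.reg_lt fun i => by
    simp only [Store.input]; omega
  refine .seq ((WP.saveRegs (h := h3) A.regBound (by omega) (fun i => by
    rw [hosts3.reg]; exact hlt0 i)).mono ?_)
  rintro h4 t4 ⟨hv4, ha4, hk4, hs4, ht4⟩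
  have hvar : ∀ i < 12, h4.var i = h1.var i := fun i hi => by rw [hv4, hv3, hv2 i hi]
  refine .seq (.assign hR (by simp) (by simp) (fun _ => ?_) ?_)
  · rw [Exp.eval_add, Exp.eval_var, Exp.eval_var, hvar _ (by omega), hvar _ (by omega), pr.var_N₁,
      pr.var_N₂]
    omega
  refine .seq (.assign hR (by simp) (by simp) (fun _ => ?_) ?_)
  · rw [Exp.eval_var, HState.set_var, if_neg (by omega), hvar _ (by omega), pr.var_n]; omega
  refine .seq (.assign hR (by simp) (by simp) (by simp) ?_)
  rw [Exp.eval_add, Exp.eval_var, Exp.eval_var, Exp.eval_var, HState.set_var, if_neg (by omega),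
    hvar _ (by omega), hvar _ (by omega), hvar _ (by omega), pr.var_n, pr.var_N₁, pr.var_N₂,
    Exp.eval_ofNat]
  set h5 := ((h4.set vLo (N₁ + N₂)).set vHi n).set vBase 0 with hh5
  have hvar5 : ∀ i, i < 12 → h5.var i = h1.var i := fun i hi => by
    simp only [hh5, HState.set_var]
    rw [if_neg (by omega), if_neg (by omega), if_neg (by omega), hvar i hi]
  have he5 : h5.var epochVar = 0 := by
    simp only [hh5, HState.set_var]
    rw [if_neg (by omega), if_neg (by omega), if_neg (by omega), hv4, hv3,
      w2.var _ (.inr (by omega)), pr.zero _ (by omega)]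
  have harr5 : ∀ k, k % 4 = 0 → k ≠ 16 → h5.arr k = h1.arr k := fun k hk hk' => by
    have e : k = 4 * (k / 4) := by omega
    rw [show h5.arr = h4.arr from rfl, hk4 k hk', e, ha3, ho2 _ (by omega)]
  have hosts5 : h5.Hosts s₀ := hosts3.congr ha4 (fun k hk => hk4 k (by omega)) (by
    rw [he5, hv3, w2.var _ (.inr (by omega)), pr.zero _ (by omega)])
  have hM5 : h5.Models D := by
    refine ⟨?_, ?_, ?_, ?_, ?_⟩
    · rw [hvar5 _ (by omega), hM1.M]
    · rw [hvar5 _ (by omega), hM1.A₁]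
    · rw [hvar5 _ (by omega), hM1.A₂]
    · rw [harr5 _ (by omega) (by omega), hM1.T₁]
    · rw [harr5 _ (by omega) (by omega), hM1.T₂]
  have I5 : StageInv A ρ W s₀ F n (N₁ + N₂) D 0 h5 s₀ := by
    refine ⟨hM5, ?_, ?_, ?_, ?_, hosts5, ⟨hlt0, fun _ _ => rfl⟩, ?_, fun _ => ⟨fun k j => ?_,
      fun i hi => ?_, by omega⟩⟩
    · rw [harr5 _ (by omega) (by omega), pr.input]
    · simp [hh5, HState.set_var]
    · simp [hh5, HState.set_var]
    · simp [hh5]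
    · rw [hvar5 _ (by omega), pr.zero _ (by omega)]; omega
    · have := hosts5.arr k j
      rw [he5] at this
      simpa using this.symm
    · rw [show h5.arr = h4.arr from rfl, hs4 i hi, hosts3.reg]
  have hS5 : h5.var vS = S := by rw [hvar5 _ (by omega), pr.S]
  have hr5 : h5.var vRes = 0 := by rw [hvar5 _ (by omega), pr.zero _ (by omega)]
  clear_value h5
  refine .seq (.mono (Q := fun h' t' => (h'.var vRes ≠ 0 ↔ ∃ j < S, X j) ∧ h'.var vRes ≤ 1 ∧
    t' ≤ t4 + 320 + 5 * c₁ + S * P) ?_ ?_)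
  -- The session of the guest is paid for once, by `5 * c₁`; a stage adds only the overhead `P` of
  -- the host.
  · refine .forLoop hR (by simp) (by simp) (N := S) (fun j h' t' => h'.var vAsg = j ∧
      h'.var vS = S ∧ (h'.var vRes ≠ 0 ↔ ∃ i < j, X i) ∧ ∃ s' m',
        StageInv A ρ W s₀ F n (N₁ + N₂) D j h' s' ∧
        Session A W s₀ s' (K.stages D dec ρ (lastBits F n (N₁ + N₂)) X j (S - j)) m' ∧
        t' + 5 * m' ≤ t4 + 320 + 5 * c₁ + j * P) ?_ ?_ ?_ ?_
    · refine ⟨by simp, by simp [HState.set_var, hS5], by simp [HState.set_var, hr5], s₀, c',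
        ⟨⟨?_, ?_, ?_, ?_, ?_⟩, ?_, ?_, ?_, ?_, ?_, I5.ok, ?_, fun hρ => ⟨?_, ?_, ?_⟩⟩, ?_, by omega⟩
      · simp [HState.set_var, hM5.M]
      · simp [HState.set_var, hM5.A₁]
      · simp [HState.set_var, hM5.A₂]
      · exact hM5.T₁
      · exact hM5.T₂
      · exact I5.input
      · simp [HState.set_var, I5.lo]
      · simp [HState.set_var, I5.hi]
      · simp [HState.set_var, I5.base]
      · exact hosts5.congr rfl (fun _ _ => rfl) (by simp [HState.set_var])
      · simpa [HState.set_var] using I5.res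
      · exact (I5.saved hρ).1
      · exact (I5.saved hρ).2.1
      · simpa [HState.set_var] using (I5.saved hρ).2.2
      · rw [Nat.sub_zero]; exact sess
    · rintro j hj h' t' ⟨h1, h2, -⟩
      exact ⟨h1, by simpa using h2, hSB⟩
    · rintro j hj h' t' ⟨hj', hS', hX', s', m', I', S', ht'⟩
      have hrange : List.range' j (S - j) = j :: List.range' (j + 1) (S - (j + 1)) := by
        rw [show S - j = (S - (j + 1)) + 1 by omega, List.range'_succ]
      rw [Code.stages, hrange, List.flatMap_cons] at S'
      refine (stage_spec hR hB hK hAB hlt0 hDM hlen hMB' (by omega) hj' I' S').mono ?_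
      rintro h'' t'' ⟨hj'', hS'', hX'', s'', m'', I'', S'', ht''⟩
      refine ⟨hj'', by simp, by simp [HState.set_var, hS'', hS'], ?_, s'', m'',
        ⟨⟨?_, ?_, ?_, ?_, ?_⟩, ?_, ?_, ?_, ?_, ?_, I''.ok, ?_, fun hρ => ⟨?_, ?_, ?_⟩⟩, S'', ?_⟩
      · simp only [HState.set_var]
        rw [if_neg (by omega), hX'', hX']
        constructor
        · rintro (⟨i, hi, hx⟩ | hx)
          · exact ⟨i, by omega, hx⟩
          · exact ⟨j, by omega, hx⟩
        · rintro ⟨i, hi, hx⟩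
          rcases Nat.lt_succ_iff_lt_or_eq.1 hi with h | rfl
          · exact .inl ⟨i, h, hx⟩
          · exact .inr hx
      · simp [HState.set_var, I''.models.M]
      · simp [HState.set_var, I''.models.A₁]
      · simp [HState.set_var, I''.models.A₂]
      · exact I''.models.T₁
      · exact I''.models.T₂
      · exact I''.input
      · simp [HState.set_var, I''.lo]
      · simp [HState.set_var, I''.hi]
      · simp [HState.set_var, I''.base]
      · exact I''.hosts.congr rfl (fun _ _ => rfl) (by simp [HState.set_var])
      · simpa [HState.set_var] using I''.res
      · exact (I''.saved hρ).1
      · exact (I''.saved hρ).2.1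
      · simpa [HState.set_var] using (I''.saved hρ).2.2
      · have e : (j + 1) * P = j * P + P := Nat.succ_mul j P
        clear_value P
        omega
    · rintro h' t' ⟨-, -, hX', s', m', I', -, ht'⟩
      exact ⟨hX', I'.res, by omega⟩
  · rintro h' t' ⟨hX', hr', ht'⟩
    refine .assign hR (by simp) (by simp) (fun _ => by simp; omega) ⟨by simpa using hX', ?_⟩
    have e1 : (2 ^ N₁ + 2 ^ N₂) * (1000 * (F.encode n).length + 500) ≤ (2 ^ N₁ + 2 ^ N₂) * P :=
      Nat.mul_le_mul_left _ (by omega)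
    have e2 : (2 ^ N₁ + 2 ^ N₂ + S + 1) * P = (2 ^ N₁ + 2 ^ N₂) * P + S * P + P := by ring
    rw [e2]
    omega

end

/-! ## Requests with conditions on the answers -/

/-- From the instance `σ` on, the requests in the list may be made, and correct answers have the
properties in the list. -/
def DynProblem.Spec (P : DynProblem) (μ : Mode) : P.State → List (Request × (ℕ → Prop)) → Prop
  | _, [] => True
  | σ, x :: l => μ.Allows x.1 ∧ P.RequestOK σ x.1 ∧ (∀ a, P.AnswerOK σ a x.1 → x.2 a) ∧
      DynProblem.Spec P μ (P.next σ x.1) l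

theorem DynProblem.Spec.legal {P : DynProblem} {μ : Mode} {σ : P.State}
    {l : List (Request × (ℕ → Prop))} (h : P.Spec μ σ l) : P.Legal μ σ (l.map Prod.fst) := by
  induction l generalizing σ with
  | nil => trivial
  | cons x l ih => exact ⟨h.1, h.2.1, ih h.2.2.2⟩

def Step.ofPair (x : Request × (ℕ → Prop)) : Step := .call x.1 x.2

/-- Correct answers have the required properties, so serving the requests is the beginning of a
session. The store reached after them is unknown; hence the tail must be possible from every store,
as it is when it is empty or begins with a reset. -/
theorem Serves.session {P : DynProblem} {A : DynAlg} {W W' : ℕ} (hW : W' ≤ W) {μ : Mode}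
    {s₀ : Store} {tail : List Step} {n : ℕ} (htail : ∀ s, Session A W s₀ s tail n)
    {l : List (Request × (ℕ → Prop))} {σ : P.State} {s : Store} {cs : List ℕ}
    (h : Serves P A W' σ s (l.map Prod.fst) cs) (hs : P.Spec μ σ l) :
    Session A W s₀ s (l.map Step.ofPair ++ tail) (cs.sum + n) := by
  induction l generalizing σ s cs with
  | nil => cases h; simpa using htail s
  | cons x l ih =>
    cases h with
    | cons hrun hans hrest =>
      rw [List.sum_cons, add_assoc]
      exact .call (hrun.mono hW) (hs.2.2.1 _ hans) (ih hrest hs.2.2.2)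

theorem Serves.length_eq {P : DynProblem} {A : DynAlg} {W : ℕ} {σ : P.State} {s : Store}
    {rs : List Request} {cs : List ℕ} (h : Serves P A W σ s rs cs) : cs.length = rs.length := by
  induction h with
  | nil => rfl
  | cons _ _ _ ih => simp [ih]

theorem DynProblem.SolvableWorstCase.amortized {P : DynProblem} {μ : Mode} {t : ℕ} {e : ℝ}
    (h : P.SolvableWorstCase μ t e) : P.SolvableAmortized μ t e := by
  obtain ⟨A, C, h⟩ := h
  refine ⟨A, C, fun σ L hv he => ?_⟩
  obtain ⟨s, c₀, hrun, hc, h⟩ := h σ L hv he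
  refine ⟨s, c₀, hrun, hc, fun rs hrs => ?_⟩
  obtain ⟨cs, hs, hcs⟩ := h rs hrs
  refine ⟨cs, hs, ?_⟩
  have h1 : (cs.sum : ℝ) ≤ cs.length * (C * (P.m σ : ℝ) ^ e) := by
    clear hs
    induction cs with
    | nil => simp
    | cons c cs ih =>
      have h1 := hcs c (by simp)
      have h2 := ih fun c hc => hcs c (by simp [hc])
      simp only [List.sum_cons, List.length_cons, Nat.cast_add, Nat.cast_one]
      linarith
  rw [hs.length_eq] at h1
  have h2 : (0 : ℝ) ≤ C * (P.n σ : ℝ) ^ t := by positivity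
  linarith

/-! ## The requests of a stage -/

/-- Here `b c` is the truth value of clause `c` under an assignment to the last variables, and the
question is whether this assignment extends to a satisfying one. -/
def SatData.Ext (D : SatData) (b : ℕ → ℕ) : Prop :=
  ∃ a < D.A₁, ∃ a' < D.A₂, ∀ c < D.M, D.T₁ (a * D.M + c) ≠ 0 ∨ D.T₂ (a' * D.M + c) ≠ 0 ∨ b c ≠ 0

/-- For `two = 0` there is no right block: the empty assignment is the only one, and it satisfies no
clause. -/
structure SatData.OK (D : SatData) (two : ℕ) : Prop where
  pos₁ : 0 < D.A₁
  pos₂ : 0 < D.A₂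
  le : D.A₂ ≤ D.A₁
  one : two = 0 → D.A₂ = 1 ∧ ∀ x, D.T₂ x = 0

def Code.pairs (K : Code) (D : SatData) (neg del : Bool) (j : ℕ) (b : ℕ → ℕ) (l : List ℕ) :
    List (Request × (ℕ → Prop)) :=
  l.map fun c => (K.update D neg del j c (b c), fun _ => True)

def Rollback.steps : Rollback → List Step
  | .reset => [.reset]
  | _ => []

/-- The requests of a stage. -/
def Code.calls (K : Code) (D : SatData) (dec : Bool) (ρ : Rollback) (j : ℕ) (b : ℕ → ℕ)
    (X : Prop) : List (Request × (ℕ → Prop)) :=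
  K.pairs D dec dec j b (List.range D.M) ++ (K.ask D j, fun a => K.Accepts D j a ↔ X) ::
    (match ρ with | .undo => K.pairs D dec (!dec) j b (List.range D.M) | _ => [])

theorem Code.stage_eq (K : Code) (D : SatData) (dec : Bool) (ρ : Rollback) (j : ℕ) (b : ℕ → ℕ)
    (X : Prop) : K.stage D dec ρ j b X = ρ.steps ++ (K.calls D dec ρ j b X).map Step.ofPair := by
  cases ρ <;> simp [Code.stage, Code.calls, Rollback.steps, Code.updates, Code.pairs, Step.ofPair,
    Function.comp_def]

theorem Code.length_calls_le (K : Code) (D : SatData) (dec : Bool) (ρ : Rollback) (j : ℕ)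
    (b : ℕ → ℕ) (X : Prop) : (K.calls D dec ρ j b X).length ≤ 2 * D.M + 1 := by
  cases ρ <;> simp [Code.calls, Code.pairs] <;> omega

theorem Code.stages_eq (K : Code) (D : SatData) (dec : Bool) {ρ : Rollback} (hρ : ρ ≠ .reset)
    (b : ℕ → ℕ → ℕ) (X : ℕ → Prop) (i k : ℕ) : K.stages D dec ρ b X i k =
      ((List.range' i k).flatMap fun j => K.calls D dec ρ j (b j) (X j)).map Step.ofPair := by
  rw [Code.stages, List.map_flatMap]
  congr 1
  funext j
  rw [Code.stage_eq]
  cases ρ <;> simp [Rollback.steps] at hρ ⊢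

/-- A reduction of satisfiability to a dynamic problem. -/
structure Gadget (P : DynProblem) (μ : Mode) (dec : Bool) (ρ : Rollback) (two : ℕ) where
  code : Code
  good : ∃ B₀, ∀ B ≥ B₀, code.Good B
  arith : code.gen.BoundsArith
  exponent : ℕ
  offset : ℕ
  state : SatData → P.State
  valid : ∀ D : SatData, D.OK two → P.Valid (state D)
  enc : ∀ (D : SatData) (h : HState), D.OK two → h.Models D →
    P.Enc (state D) (code.gen.out 12 h)
  one_le : ∀ D : SatData, D.OK two → 1 ≤ P.m (state D)
  n_le : ∀ D : SatData, D.OK two → P.n (state D) ≤ P.m (state D)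
  m_le : ∀ D : SatData, D.OK two → P.m (state D) ≤ (D.M + offset) ^ exponent * D.A₁
  spec : ∀ D : SatData, D.OK two → ∀ b : ℕ → ℕ → ℕ, (∀ j c, b j c ≤ 1) → ∀ S : ℕ,
    (ρ = .reset → ∀ j, P.Spec μ (state D) (code.calls D dec ρ j (b j) (D.Ext (b j)))) ∧
    (ρ ≠ .reset → P.Spec μ (state D)
      ((List.range' 0 S).flatMap fun j => code.calls D dec ρ j (b j) (D.Ext (b j))))

/-- The running times for which a gadget with the given way of going back can be used. -/
def Rollback.Suits (ρ : Rollback) (P : DynProblem) (μ : Mode) (t : ℕ) (e : ℝ) : Prop :=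
  (ρ = .reset → P.SolvableWorstCase μ t e) ∧ (ρ ≠ .reset → P.SolvableAmortized μ t e)

/-- With `reset`, each stage is a separate sequence of at most `2 * D.M + 1` requests from `s₀`. An
amortized bound would charge the term `n ^ t` to every stage, so worst case bounds are needed.
Otherwise all stages are one sequence, and this term is charged once. -/
theorem Gadget.sessions {P : DynProblem} {μ : Mode} {dec : Bool} {ρ : Rollback} {two : ℕ}
    (Γ : Gadget P μ dec ρ two) {t : ℕ} {e : ℝ} (h : ρ.Suits P μ t e) :
    ∃ (A : DynAlg) (C : ℕ), ∀ (D : SatData) (S W : ℕ) (b : ℕ → ℕ → ℕ) (X : ℕ → Prop),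
      D.OK two → (∀ j c, b j c ≤ 1) → (∀ j, X j ↔ D.Ext (b j)) →
      ((Γ.state D |> P.n) + (Γ.state D |> P.m) + (S + 1) * (2 * D.M + 1) + 2) ^ C ≤ W →
      ∀ h : HState, h.Models D → ∃ s₀ c,
        Run W A.pre (Store.input (Γ.code.gen.out 12 h)) s₀ c ∧ c ≤ C * P.n (Γ.state D) ^ t ∧
        ∃ c' : ℕ, (c' : ℝ) ≤ C * ((P.n (Γ.state D) : ℝ) ^ t +
          S * (2 * D.M + 1) * (P.m (Γ.state D) : ℝ) ^ e) ∧
          Session A W s₀ s₀ (Γ.code.stages D dec ρ b X 0 S) c' := by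
  by_cases hρ : ρ = .reset
  · subst hρ
    obtain ⟨A, C, H⟩ := h.1 rfl
    refine ⟨A, C, fun D S W b X hD hb hX hW h hM => ?_⟩
    obtain rfl : X = fun j => D.Ext (b j) := funext fun j => propext (hX j)
    obtain ⟨s₀, c, hrun, hc, H⟩ := H _ _ (Γ.valid D hD) (Γ.enc D h hD hM)
    have hspec := (Γ.spec D hD b hb S).1 rfl
    have hpos : (0 : ℝ) ≤ C * (P.m (Γ.state D) : ℝ) ^ e := by positivity
    have hword : ∀ k ≤ (S + 1) * (2 * D.M + 1), P.wordBound C (Γ.state D) k ≤ W := fun k hk =>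
      le_trans (Nat.pow_le_pow_left (by omega) _) hW
    refine ⟨s₀, c, hrun.mono (hword 0 (Nat.zero_le _)), hc, ?_⟩
    -- A stage begins with a reset, so the bound for the `k` stages from `i` on holds from whatever
    -- store they are started in.
    suffices ∀ k i : ℕ, ∀ s, ∃ c' : ℕ, (c' : ℝ) ≤ k * ((2 * D.M + 1) * (C * (P.m (Γ.state D) : ℝ) ^ e)) ∧
        ∀ s, Session A W s₀ s (Γ.code.stages D dec .reset b (fun j => D.Ext (b j)) i k) c' by
      obtain ⟨c', hc', hs⟩ := this S 0 s₀
      refine ⟨c', hc'.trans ?_, hs s₀⟩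
      have : (0 : ℝ) ≤ C * (P.n (Γ.state D) : ℝ) ^ t := by positivity
      nlinarith
    intro k
    induction k with
    | zero => exact fun i s => ⟨0, by simp, fun s => .nil s⟩
    | succ k ih =>
      intro i s
      obtain ⟨c', hc', hs⟩ := ih (i + 1) s
      have hlen := Γ.code.length_calls_le D dec .reset i (b i) (D.Ext (b i))
      obtain ⟨cs, hcs, hsum⟩ := H _ (hspec i).legal
      refine ⟨cs.sum + c', ?_, fun s => ?_⟩
      · have h1 : (cs.sum : ℝ) ≤ cs.length * (C * (P.m (Γ.state D) : ℝ) ^ e) := by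
          clear hcs
          induction cs with
          | nil => simp
          | cons c cs ih =>
            have h1 := hsum c (by simp)
            have h2 := ih fun c hc => hsum c (by simp [hc])
            simp only [List.sum_cons, List.length_cons, Nat.cast_add, Nat.cast_one]
            linarith
        have h2 : (cs.length : ℝ) ≤ 2 * D.M + 1 := by
          rw [hcs.length_eq, List.length_map]; exact_mod_cast hlen
        have h3 := mul_le_mul_of_nonneg_right h2 hpos
        rw [Nat.cast_add, Nat.cast_add, Nat.cast_one, add_mul]
        linarith
      · rw [Code.stages, List.range'_succ, List.flatMap_cons, Code.stage_eq, Rollback.steps,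
          List.append_assoc, List.singleton_append]
        refine .reset (hcs.session (hword _ ?_) hs (hspec i))
        rw [List.length_map]
        exact hlen.trans (Nat.le_mul_of_pos_left _ (by omega))
  · obtain ⟨A, C, H⟩ := h.2 hρ
    refine ⟨A, C, fun D S W b X hD hb hX hW h hM => ?_⟩
    obtain rfl : X = fun j => D.Ext (b j) := funext fun j => propext (hX j)
    obtain ⟨s₀, c, hrun, hc, H⟩ := H _ _ (Γ.valid D hD) (Γ.enc D h hD hM)
    have hspec := (Γ.spec D hD b hb S).2 hρ
    have hword : ∀ k ≤ (S + 1) * (2 * D.M + 1), P.wordBound C (Γ.state D) k ≤ W := fun k hk =>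
      le_trans (Nat.pow_le_pow_left (by omega) _) hW
    refine ⟨s₀, c, hrun.mono (hword 0 (Nat.zero_le _)), hc, ?_⟩
    set l := (List.range' 0 S).flatMap fun j => Γ.code.calls D dec ρ j (b j) (D.Ext (b j)) with hl
    have hlen : l.length ≤ S * (2 * D.M + 1) := by
      rw [hl, List.length_flatMap]
      refine (List.sum_le_card_nsmul _ (2 * D.M + 1) ?_).trans (by simp)
      simp only [List.mem_map]
      rintro _ ⟨j, -, rfl⟩
      exact Γ.code.length_calls_le ..
    obtain ⟨cs, hcs, hsum⟩ := H _ hspec.legal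
    rw [List.length_map] at hsum hcs
    have hlen' : l.length ≤ (S + 1) * (2 * D.M + 1) :=
      hlen.trans (Nat.mul_le_mul_right _ (by omega))
    refine ⟨cs.sum, hsum.trans ?_, ?_⟩
    · have : (l.length : ℝ) ≤ S * (2 * D.M + 1) := by exact_mod_cast hlen
      gcongr
    · have := hcs.session (hword _ hlen') (fun s => .nil s) hspec (s₀ := s₀)
      rw [Code.stages_eq _ _ _ hρ]
      simpa using this

/-! ## Sizes of formulas -/

/-- A clause is determined by at most `k` codes of literals, padded with `0`, and the clauses are
distinct. For fixed `k` the bound is polynomial, which is all that the reduction needs. -/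
theorem CNF.IsKCNF.length_le {F : CNF} {k n : ℕ} (h : F.IsKCNF k n) :
    F.length ≤ (2 * n + 1) ^ k := by
  let f : List (ℕ × Bool) → Fin k → ℕ := fun d i =>
    match d[i.1]? with | none => 0 | some l => 2 * l.1 + l.2.toNat + 1
  have hmem : ∀ c ∈ F.toFinset, f c ∈ Fintype.piFinset fun _ : Fin k => Finset.range (2 * n + 1) := by
    intro d hc
    rw [Fintype.mem_piFinset]
    intro i
    simp only [f, Finset.mem_range]
    cases hi : d[i.1]? with
    | none => simp
    | some l =>
      have h1 := (h.2 d (List.mem_toFinset.1 hc)).2 l (List.mem_of_getElem? hi)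
      have h2 := Bool.toNat_le l.2
      simp only; omega
  have hinj : Set.InjOn f F.toFinset := by
    intro d hc d' hc' hcc
    refine List.ext_getElem? fun i => ?_
    have h1 := (h.2 d (List.mem_toFinset.1 hc)).1
    have h2 := (h.2 d' (List.mem_toFinset.1 hc')).1
    by_cases hi : i < k
    · have := congrFun hcc ⟨i, hi⟩
      simp only [f] at this
      cases e : d[i]? <;> cases e' : d'[i]? <;> rw [e, e'] at this <;> simp only at this
      · omega
      · omega
      · rename_i l l'
        have h3 := Bool.toNat_le l.2
        have h4 := Bool.toNat_le l'.2
        congr 1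
        refine Prod.ext (by omega) ?_
        have : l.2.toNat = l'.2.toNat := by omega
        revert this
        cases l.2 <;> cases l'.2 <;> simp
    · rw [List.getElem?_eq_none (by omega), List.getElem?_eq_none (by omega)]
  have := Finset.card_le_card_of_injOn f hmem hinj
  rw [List.toFinset_card_of_nodup h.1] at this
  simpa [Fintype.card_piFinset] using this

theorem CNF.IsKCNF.length_encode_le {F : CNF} {k n : ℕ} (h : F.IsKCNF k n) :
    (F.encode n).length ≤ 2 + F.length * (k + 1) := by
  simp only [CNF.encode, List.length_cons, List.length_flatMap, List.length_map]
  have : (F.map fun c => c.length + 1).sum ≤ F.length * (k + 1) := by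
    refine (List.sum_le_card_nsmul _ (k + 1) ?_).trans (by simp)
    simp only [List.mem_map]
    rintro _ ⟨c, hc, rfl⟩
    have := (h.2 c hc).1
    omega
  omega

theorem CNF.IsKCNF.encode_le {F : CNF} {k n : ℕ} (h : F.IsKCNF k n) :
    ∀ x ∈ F.encode n, x ≤ 2 * n + 1 + F.length + k := by
  intro x hx
  simp only [CNF.encode, List.mem_cons, List.mem_flatMap, List.mem_map] at hx
  rcases hx with rfl | rfl | ⟨c, hc, rfl | ⟨l, hl, rfl⟩⟩
  · omega
  · omega
  · have := (h.2 c hc).1; omega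
  · have := (h.2 c hc).2 l hl
    have := Bool.toNat_le l.2
    omega

theorem CNF.IsKCNF.exists_bound (k a : ℕ) : ∃ K : ℕ, ∀ (n : ℕ) (F : CNF), F.IsKCNF k n →
    a + (F.encode n).length + F.length + 2 * n + k + 1 ≤ K * (n + 1) ^ K := by
  refine ⟨a + 5 + 2 * k + (k + 2) * 2 ^ k, fun n F hF => ?_⟩
  have h1 := hF.length_le
  have h2 := hF.length_encode_le
  have h3 : (2 * n + 1) ^ k ≤ 2 ^ k * (n + 1) ^ k := by
    rw [← mul_pow]; exact Nat.pow_le_pow_left (by omega) _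
  have h4 : (n + 1) ^ k ≤ (n + 1) ^ (a + 5 + 2 * k + (k + 2) * 2 ^ k) :=
    Nat.pow_le_pow_right (by omega) (by omega)
  have h5 : n + 1 ≤ (n + 1) ^ (a + 5 + 2 * k + (k + 2) * 2 ^ k) := Nat.le_self_pow (by omega) _
  set E := (n + 1) ^ (a + 5 + 2 * k + (k + 2) * 2 ^ k)
  have h6 : F.length ≤ 2 ^ k * E := (h1.trans h3).trans (Nat.mul_le_mul_left _ h4)
  have h7 : F.length * (k + 2) ≤ 2 ^ k * E * (k + 2) := Nat.mul_le_mul_right _ h6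
  have h8 : (a + 3 + k) * 1 ≤ (a + 3 + k) * E := Nat.mul_le_mul_left _ (by omega)
  nlinarith

/-! ## The tables -/

theorem clauseTest_self (F : CNF) (lo a c : ℕ) : clauseTest F lo lo a c = false := by
  simp only [clauseTest, List.any_eq_false, litTest, Bool.and_eq_true, decide_eq_true_eq]
  rintro l - ⟨⟨h1, h2⟩, -⟩
  omega

theorem satData_ok (F : CNF) (N₁ : ℕ) {two : ℕ} (h : two ≤ 1) :
    (satData F N₁ (N₁ * two)).OK two where
  pos₁ := by simp [satData]
  pos₂ := by simp [satData]
  le := Nat.pow_le_pow_right (by omega) (by nlinarith)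
  one := by
    rintro rfl
    refine ⟨by simp [satData], fun x => ?_⟩
    simp [satData, satTable, clauseTest_self]

/-- The table entries are the values of `clauseTest`, so this is the splitting of assignments in
`CNF.satisfiable_iff`. -/
theorem exists_ext_iff {F : CNF} {n N₁ N₂ : ℕ} (hF : ∀ c ∈ F, ∀ l ∈ c, l.1 < n)
    (hN : N₁ + N₂ ≤ n) : (∃ j < 2 ^ (n - N₁ - N₂), (satData F N₁ N₂).Ext (lastBits F n (N₁ + N₂) j)) ↔
      F.Satisfiable := by
  rw [CNF.satisfiable_iff hF hN]
  refine exists_congr fun j => and_congr_right fun hj => exists_congr fun a => and_congr_right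
    fun ha => exists_congr fun a' => and_congr_right fun ha' => forall_congr' fun c =>
    forall_congr' fun hc => ?_
  change satTable F 0 N₁ (2 ^ N₁) (a * F.length + c) ≠ 0 ∨
    satTable F N₁ (N₁ + N₂) (2 ^ N₂) (a' * F.length + c) ≠ 0 ∨
    (clauseTest F (N₁ + N₂) n j c).toNat ≠ 0 ↔ _
  rw [satTable_apply F (N := 2 ^ N₁) ha hc, satTable_apply F (N := 2 ^ N₂) ha' hc]
  simp

/-! ## From gadgets to satisfiability -/

/-- These are the three parts of the running time: powers of `2 ^ N₁` with exponent at most `q / 2`,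
for writing and preprocessing; the number of stages; and the number of stages times the time of a
request, which is two to the power `n - ε * N₁`. As `N₁ + 1` exceeds `n / q`, rounding costs at most
a factor of two. -/
theorem rpow_bounds {n q N₁ two : ℕ} {ε γ : ℝ} (hε : 0 < ε) (hε1 : ε ≤ 1) (hq : 2 ≤ q)
    (hN₁ : N₁ = n / q) (htwo : two ≤ 1) (hγ : γ ≤ ε / q) (hγ2 : γ ≤ 1 / 2) :
    (∀ r : ℕ, 2 * r ≤ q → ((2 : ℝ) ^ N₁) ^ r ≤ 2 * (2 : ℝ) ^ ((1 - γ) * n)) ∧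
      (2 : ℝ) ^ (n - N₁ - N₁ * two) ≤ 2 * (2 : ℝ) ^ ((1 - γ) * n) ∧
      (2 : ℝ) ^ (n - N₁ - N₁ * two) * ((2 : ℝ) ^ N₁) ^ (1 + (two : ℝ) - ε) ≤
        2 * (2 : ℝ) ^ ((1 - γ) * n) := by
  have hq0 : (0 : ℝ) < q := by positivity
  have h1 : N₁ * q ≤ n := by rw [hN₁]; exact Nat.div_mul_le_self n q
  have h1' : n < (N₁ + 1) * q := by rw [hN₁, mul_comm]; exact Nat.lt_mul_div_succ n (by omega)
  have h1r : (N₁ : ℝ) * q ≤ n := by exact_mod_cast h1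
  have h1r' : (n : ℝ) ≤ (N₁ + 1) * q := by exact_mod_cast h1'.le
  have h2n : 2 * N₁ ≤ n := by nlinarith
  have h2 : N₁ + N₁ * two ≤ n := by nlinarith
  have hn0 : (0 : ℝ) ≤ n := by positivity
  have hN0 : (0 : ℝ) ≤ N₁ := by positivity
  have key : ∀ x : ℝ, x ≤ (1 - γ) * n + 1 → (2 : ℝ) ^ x ≤ 2 * (2 : ℝ) ^ ((1 - γ) * n) := by
    intro x hx
    refine (Real.rpow_le_rpow_of_exponent_le (by norm_num) hx).trans ?_
    rw [Real.rpow_add (by norm_num), Real.rpow_one, mul_comm]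
  have hγn : γ * n ≤ ε * (N₁ + 1) := by
    calc γ * n ≤ ε / q * n := mul_le_mul_of_nonneg_right hγ hn0
      _ ≤ ε / q * ((N₁ + 1) * q) := mul_le_mul_of_nonneg_left h1r' (by positivity)
      _ = ε * (N₁ + 1) := by field_simp
  have hsub : ((n - N₁ - N₁ * two : ℕ) : ℝ) = n - N₁ - N₁ * two := by
    rw [Nat.sub_sub, Nat.cast_sub h2]; push_cast; ring
  have htwo0 : (0 : ℝ) ≤ N₁ * two := by positivity
  refine ⟨fun r hr => ?_, ?_, ?_⟩
  · rw [← pow_mul, ← Real.rpow_natCast]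
    apply key
    have h3 : (2 : ℝ) * r ≤ q := by exact_mod_cast hr
    push_cast
    nlinarith
  · rw [← Real.rpow_natCast, hsub]
    apply key
    nlinarith
  · rw [← Real.rpow_natCast, ← Real.rpow_natCast, ← Real.rpow_mul (by norm_num),
      ← Real.rpow_add (by norm_num), hsub]
    apply key
    nlinarith

-- Everything polynomial in `n` is absorbed into powers of one number `z`; what remains are powers
-- of two, to which `rpow_bounds` applies. The formula class enters only through `z`, so `γ` is the
-- same for all `k`.
set_option maxHeartbeats 1000000 in
theorem Gadget.kSATSolvable {P : DynProblem} {μ : Mode} {dec : Bool} {ρ : Rollback} {two : ℕ}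
    (Γ : Gadget P μ dec ρ two) (htwo : two ≤ 1) {A : DynAlg} {CA t q : ℕ} {e ε γ : ℝ}
    (hA : ∀ (D : SatData) (S W : ℕ) (b : ℕ → ℕ → ℕ) (X : ℕ → Prop),
      D.OK two → (∀ j c, b j c ≤ 1) → (∀ j, X j ↔ D.Ext (b j)) →
      ((Γ.state D |> P.n) + (Γ.state D |> P.m) + (S + 1) * (2 * D.M + 1) + 2) ^ CA ≤ W →
      ∀ h : HState, h.Models D → ∃ s₀ c,
        Run W A.pre (Store.input (Γ.code.gen.out 12 h)) s₀ c ∧ c ≤ CA * P.n (Γ.state D) ^ t ∧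
        ∃ c' : ℕ, (c' : ℝ) ≤ CA * ((P.n (Γ.state D) : ℝ) ^ t +
          S * (2 * D.M + 1) * (P.m (Γ.state D) : ℝ) ^ e) ∧
          Session A W s₀ s₀ (Γ.code.stages D dec ρ b X 0 S) c')
    (hε : 0 < ε) (hε1 : ε ≤ 1) (he : e ≤ 1 + two - ε) (hq : 2 * (Γ.code.gen.degree + t + 1) ≤ q)
    (hγ : γ ≤ ε / q) (hγ2 : γ ≤ 1 / 2) (k : ℕ) : KSATSolvable k γ := by
  obtain ⟨B₀, hB₀⟩ := Γ.good
  obtain ⟨deg, hdeg⟩ : ∃ x, x = Γ.code.gen.degree := ⟨_, rfl⟩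
  obtain ⟨g, hg⟩ : ∃ x, x = Γ.exponent := ⟨_, rfl⟩
  -- The first summand collects the constants of the gadget, of the dynamic algorithm and of the
  -- program, so that `z` below dominates these as well.
  obtain ⟨K, hK⟩ := CNF.IsKCNF.exists_bound k
    (400 + Γ.code.gen.maxLit + Γ.offset + A.regBound + B₀ + q + 2)
  obtain ⟨E, hE⟩ : ∃ x, x = g * t + 2 * g + 1 + deg := ⟨_, rfl⟩
  obtain ⟨CW, hCW⟩ : ∃ x, x = (K + 1) * (deg + g + 4) * (61 + CA) := ⟨_, rfl⟩
  obtain ⟨Cf, hCf⟩ : ∃ x, x = 2 * (25 * CA + 4001) * K ^ E + K * E + CW := ⟨_, rfl⟩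
  refine ⟨solver q two Γ.code A dec ρ, Cf, fun n F hF => ?_⟩
  have hz := hK n F hF
  -- `z` bounds all polynomial quantities, and `Y` bounds `z * 2 ^ (n + 1)`. The bound `B` on the
  -- values of the host is a power of `Y` that leaves room for the cost of the generator and for the
  -- word bound of the dynamic algorithm. All of them are `2 ^ O(n)`, so words of `O(n)` bits
  -- suffice.
  obtain ⟨z, hzd⟩ : ∃ x, x = K * (n + 1) ^ K := ⟨_, rfl⟩
  have hnn : n + 1 ≤ 2 ^ n := Nat.lt_two_pow_self
  set N₁ := n / q with hN₁
  set N₂ := N₁ * two with hN₂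
  set S := 2 ^ (n - N₁ - N₂) with hS
  set D := satData F N₁ N₂ with hD
  have hDM : D.M = F.length := rfl
  have hDA : D.A₁ = 2 ^ N₁ := rfl
  have hDA' : D.A₂ = 2 ^ N₂ := rfl
  have hOK : D.OK two := satData_ok F N₁ htwo
  obtain ⟨Y, hY⟩ : ∃ x, x = 2 ^ ((K + 1) * (n + 1)) := ⟨_, rfl⟩
  obtain ⟨B, hB⟩ : ∃ x, x = Y ^ (deg + g + 4) := ⟨_, rfl⟩
  have hN1n : N₁ ≤ n := Nat.div_le_self _ _
  have hNN : N₁ + N₂ ≤ n := by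
    have h1 : N₁ * q ≤ n := by rw [hN₁]; exact Nat.div_mul_le_self n q
    nlinarith
  have hzY : z * 2 ^ (n + 1) ≤ Y := by
    have h1 : (n + 1) ^ K ≤ 2 ^ (n * K) := by rw [pow_mul]; exact Nat.pow_le_pow_left hnn _
    have h2 : K ≤ 2 ^ K := Nat.lt_two_pow_self.le
    calc z * 2 ^ (n + 1) ≤ 2 ^ K * 2 ^ (n * K) * 2 ^ (n + 1) :=
          Nat.mul_le_mul_right _ (hzd.le.trans (Nat.mul_le_mul h2 h1))
      _ = Y := by rw [hY, ← pow_add, ← pow_add]; congr 1; ring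
  have hz1 : 400 ≤ z := by omega
  have hY1 : 1 ≤ Y := by rw [hY]; exact Nat.one_le_two_pow
  have h2n1 : 2 ^ (n + 1) = 2 * 2 ^ n := by rw [pow_succ]; ring
  have h2n0 : 1 ≤ 2 ^ n := Nat.one_le_two_pow
  have hzleY : 2 * z ≤ Y := by nlinarith
  have h2nY : 2 ^ (n + 1) ≤ Y := by nlinarith
  have hYB : Y ≤ B := by rw [hB]; exact Nat.le_self_pow (by omega) _
  have hA1 : D.A₁ ≤ 2 ^ n := Nat.pow_le_pow_right (by omega) hN1n
  have hA0 : 0 < D.A₁ := hOK.pos₁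
  have hzA : z * D.A₁ ≤ Y := le_trans (Nat.mul_le_mul_left _ (by omega)) hzY
  have hSn : S ≤ 2 ^ n := by
    rw [hS]; exact Nat.pow_le_pow_right (by omega) ((Nat.sub_le _ _).trans (Nat.sub_le _ _))
  have hW : B ^ (61 + CA) ≤ 2 ^ (Cf * (n + 1)) := by
    rw [hB, hY, ← pow_mul, ← pow_mul]
    refine Nat.pow_le_pow_right (by omega) ?_
    have : CW * (n + 1) ≤ Cf * (n + 1) := Nat.mul_le_mul_right _ (by omega)
    refine le_trans (le_of_eq ?_) this
    rw [hCW]; ring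
  have hB1 : 2 ≤ B := by omega
  have hR : Room B (2 ^ (Cf * (n + 1))) :=
    ⟨hB1, lt_of_lt_of_le (Nat.pow_lt_pow_right (by omega) (by omega)) hW⟩
  have hm : P.m (Γ.state D) ≤ z ^ g * D.A₁ := by
    rw [hg]
    exact (Γ.m_le D hOK).trans (Nat.mul_le_mul_right _ (Nat.pow_le_pow_left (by omega) _))
  have hn := Γ.n_le D hOK
  have hm1 := Γ.one_le D hOK
  have hword : (P.n (Γ.state D) + P.m (Γ.state D) + (S + 1) * (2 * D.M + 1) + 2) ^ CA ≤
      2 ^ (Cf * (n + 1)) := by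
    refine le_trans (Nat.pow_le_pow_left (m := B) ?_ _)
      (le_trans (Nat.pow_le_pow_right (by omega) (by omega)) hW)
    have h1 : z ^ g * D.A₁ ≤ Y ^ (g + 2) := by
      calc z ^ g * D.A₁ ≤ Y ^ g * Y := Nat.mul_le_mul (Nat.pow_le_pow_left (by omega) _) (by omega)
        _ = Y ^ (g + 1) := (pow_succ _ _).symm
        _ ≤ Y ^ (g + 2) := Nat.pow_le_pow_right hY1 (by omega)
    have h2 : (S + 1) * (2 * D.M + 1) ≤ Y ^ (g + 2) := by
      calc (S + 1) * (2 * D.M + 1) ≤ Y * Y := Nat.mul_le_mul (by omega) (by omega)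
        _ = Y ^ 2 := (sq Y).symm
        _ ≤ Y ^ (g + 2) := Nat.pow_le_pow_right hY1 (by omega)
    have h3 : 2 ≤ Y ^ (g + 2) := le_trans (by omega) (Nat.le_self_pow (n := g + 2) (by omega) Y)
    have h4 : 4 * Y ^ (g + 2) ≤ B := by
      calc 4 * Y ^ (g + 2) ≤ Y * Y ^ (g + 2) := Nat.mul_le_mul_right _ (by omega)
        _ = Y ^ (g + 3) := by rw [pow_succ Y (g + 2), mul_comm]
        _ ≤ B := by rw [hB]; exact Nat.pow_le_pow_right hY1 (by omega)
    omega
  -- The degree `deg` depends on the gadget only, so the choice of `q` keeps this bound on the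
  -- writing time near `2 ^ (n / 2)`.
  obtain ⟨G, hG⟩ : ∃ x, x = (z * D.A₁) ^ deg := ⟨_, rfl⟩
  obtain ⟨c₁, hc₁⟩ : ∃ x, x = ⌊(CA : ℝ) * ((P.n (Γ.state D) : ℝ) ^ t +
          S * (2 * D.M + 1) * (P.m (Γ.state D) : ℝ) ^ e)⌋₊ := ⟨_, rfl⟩
  have hGB : G ≤ B := by
    rw [hG, hB]
    exact (Nat.pow_le_pow_left hzA _).trans (Nat.pow_le_pow_right hY1 (by omega))
  have hcost : ∀ h : HState, h.Models D → Γ.code.gen.cost h ≤ G := by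
    intro h hM
    have hzz : z ≤ z * D.A₁ := Nat.le_mul_of_pos_right _ hA0
    have hAA : D.A₁ ≤ z * D.A₁ := Nat.le_mul_of_pos_left _ (by omega)
    rw [hG, hdeg]
    refine Gen.cost_le (hB₀ B (by omega)).gen Γ.arith (by omega) (fun i hi => ?_) (by omega)
    interval_cases i
    · rw [hM.M]; omega
    · rw [hM.A₁]; exact hAA
    · rw [hM.A₂]; exact hOK.le.trans hAA
  obtain ⟨s, c, hrun, hs, hc⟩ := solver_run (c₀ := CA * P.n (Γ.state D) ^ t) (c₁ := c₁)
    (X := fun j => D.Ext (lastBits F n (N₁ + N₂) j)) (dec := dec) (ρ := ρ) (A := A) (q := q)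
    hR (by omega) (hB₀ B (by omega)) (by omega) (F := F) (n := n) (by omega)
    (by
      calc 2 ^ n * F.length ≤ z * 2 ^ (n + 1) := by rw [mul_comm]; exact Nat.mul_le_mul (by omega) (by omega)
        _ ≤ B := hzY.trans hYB)
    (by omega) (by omega) htwo (by omega) (fun x hx => (hF.encode_le x hx).trans (by omega)) hD
    hcost hGB (by
      intro h hM
      obtain ⟨s₀, c, h1, h2, c', h3, h4⟩ := hA D S _ (lastBits F n (N₁ + N₂))
        (fun j => D.Ext (lastBits F n (N₁ + N₂) j)) hOK (fun j c => Bool.toNat_le _)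
        (fun j => Iff.rfl) hword h hM
      exact ⟨s₀, c, h1, h2, c', by rw [hc₁]; exact Nat.le_floor h3, h4⟩)
  refine ⟨s, c, hrun, hs.trans (exists_ext_iff (fun c hc => (hF.2 c hc).2) hNN), ?_⟩
  obtain ⟨b1, b2, b3⟩ := rpow_bounds (n := n) (N₁ := N₁) hε hε1 (by omega : 2 ≤ q) hN₁ htwo hγ hγ2
  set T : ℝ := 2 * (2 : ℝ) ^ ((1 - γ) * n) with hT
  have hzr : (1 : ℝ) ≤ z := by exact_mod_cast (by omega : 1 ≤ z)
  have hAr : (D.A₁ : ℝ) = 2 ^ N₁ := by rw [hDA]; push_cast; rfl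
  have hSr : (S : ℝ) = 2 ^ (n - N₁ - N₂) := by rw [hS]; push_cast; rfl
  have hmr : (P.m (Γ.state D) : ℝ) ≤ (z : ℝ) ^ g * D.A₁ := by exact_mod_cast hm
  have hnr : (P.n (Γ.state D) : ℝ) ≤ (z : ℝ) ^ g * D.A₁ := by exact_mod_cast hn.trans hm
  have hm1r : (1 : ℝ) ≤ P.m (Γ.state D) := by exact_mod_cast hm1
  have hT0 : 0 ≤ T := by positivity
  have hA1r : (1 : ℝ) ≤ D.A₁ := by exact_mod_cast hA0
  have hnt : (P.n (Γ.state D) : ℝ) ^ t ≤ (z : ℝ) ^ E * T := by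
    calc (P.n (Γ.state D) : ℝ) ^ t ≤ ((z : ℝ) ^ g * D.A₁) ^ t := pow_le_pow_left₀ (by positivity) hnr _
      _ = (z : ℝ) ^ (g * t) * (2 ^ N₁) ^ t := by rw [mul_pow, ← pow_mul, hAr]
      _ ≤ (z : ℝ) ^ E * T := mul_le_mul (pow_le_pow_right₀ hzr (by omega)) (b1 t (by omega))
          (by positivity) (by positivity)
  have hSm : S * (2 * (D.M : ℝ) + 1) * (P.m (Γ.state D) : ℝ) ^ e ≤ 3 * ((z : ℝ) ^ E * T) := by
    -- The exponent is at most `2`, so the polynomial factor `z ^ g` of `m` contributes at most `z ^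
    -- (2 * g)`.
    have h1 : (P.m (Γ.state D) : ℝ) ^ e ≤ (z : ℝ) ^ (2 * g) * ((2 : ℝ) ^ N₁) ^ (1 + (two : ℝ) - ε) := by
      have h0 : (0 : ℝ) ≤ 1 + (two : ℝ) - ε := by
        have : (0 : ℝ) ≤ two := by positivity
        linarith
      have h2 : 1 + (two : ℝ) - ε ≤ 2 := by
        have : (two : ℝ) ≤ 1 := by exact_mod_cast htwo
        linarith
      calc (P.m (Γ.state D) : ℝ) ^ e ≤ (P.m (Γ.state D) : ℝ) ^ (1 + (two : ℝ) - ε) :=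
            Real.rpow_le_rpow_of_exponent_le hm1r he
        _ ≤ ((z : ℝ) ^ g * D.A₁) ^ (1 + (two : ℝ) - ε) :=
            Real.rpow_le_rpow (by positivity) hmr h0
        _ = ((z : ℝ) ^ g) ^ (1 + (two : ℝ) - ε) * (D.A₁ : ℝ) ^ (1 + (two : ℝ) - ε) :=
            Real.mul_rpow (by positivity) (by positivity)
        _ ≤ _ := by
          rw [hAr]
          refine mul_le_mul_of_nonneg_right ?_ (by positivity)
          calc ((z : ℝ) ^ g) ^ (1 + (two : ℝ) - ε) ≤ ((z : ℝ) ^ g) ^ (2 : ℝ) :=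
                Real.rpow_le_rpow_of_exponent_le (one_le_pow₀ hzr) h2
            _ = (z : ℝ) ^ (2 * g) := by
              rw [Real.rpow_ofNat, ← pow_mul, mul_comm]
    have h2 : 2 * (D.M : ℝ) + 1 ≤ 3 * z := by
      exact_mod_cast (by omega : 2 * D.M + 1 ≤ 3 * z)
    calc S * (2 * (D.M : ℝ) + 1) * (P.m (Γ.state D) : ℝ) ^ e
        ≤ S * (3 * z) * ((z : ℝ) ^ (2 * g) * ((2 : ℝ) ^ N₁) ^ (1 + (two : ℝ) - ε)) := by gcongr
      _ = 3 * ((z : ℝ) ^ (2 * g + 1) * (S * ((2 : ℝ) ^ N₁) ^ (1 + (two : ℝ) - ε))) := by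
          rw [pow_succ]; ring
      _ ≤ 3 * ((z : ℝ) ^ E * T) := by
          rw [hSr]
          refine mul_le_mul_of_nonneg_left (mul_le_mul (pow_le_pow_right₀ hzr (by omega)) b3
            (by positivity) (by positivity)) (by norm_num)
  have hc₁r : (c₁ : ℝ) ≤ CA * (4 * ((z : ℝ) ^ E * T)) := by
    rw [hc₁]
    refine (Nat.floor_le (by positivity)).trans (mul_le_mul_of_nonneg_left ?_ (by positivity))
    linarith
  have hGr : (G : ℝ) ≤ (z : ℝ) ^ E * T := by
    rw [hG]
    push_cast
    rw [mul_pow, hAr]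
    exact mul_le_mul (pow_le_pow_right₀ hzr (by omega)) (b1 deg (by omega)) (by positivity)
      (by positivity)
  have hA1T : (2 : ℝ) ^ N₁ ≤ T := by simpa using b1 1 (by omega)
  have hrest : (((2 ^ N₁ + 2 ^ N₂ + S + 1) *
      (1000 * (F.encode n).length + 1000 * F.length + 2000 + A.regBound) : ℕ) : ℝ) ≤
        4000 * ((z : ℝ) ^ E * T) := by
    have h1 : (((1000 * (F.encode n).length + 1000 * F.length + 2000 + A.regBound : ℕ)) : ℝ) ≤
        1000 * (z : ℝ) ^ E := by
      have h2 : 1000 * (F.encode n).length + 1000 * F.length + 2000 + A.regBound ≤ 1000 * z := by omega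
      have h3 : z ≤ z ^ E := Nat.le_self_pow (by omega) _
      exact_mod_cast h2.trans (Nat.mul_le_mul_left _ h3)
    have h2 : ((2 ^ N₁ + 2 ^ N₂ + S + 1 : ℕ) : ℝ) ≤ 4 * T := by
      have h3 : ((2 ^ N₂ : ℕ) : ℝ) ≤ 2 ^ N₁ := by
        rw [← hDA', ← hAr]; exact_mod_cast hOK.le
      have h4 : (1 : ℝ) ≤ 2 ^ N₁ := one_le_pow₀ (by norm_num)
      rw [← hSr] at b2
      push_cast at h3 ⊢
      linarith
    rw [Nat.cast_mul]
    calc _ ≤ 4 * T * (1000 * (z : ℝ) ^ E) := mul_le_mul h2 h1 (Nat.cast_nonneg _) (by positivity)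
      _ = _ := by ring
  have hcr : (c : ℝ) ≤ 5 * ((CA * P.n (Γ.state D) ^ t : ℕ) + (c₁ : ℝ)) + G +
      (((2 ^ N₁ + 2 ^ N₂ + S + 1) *
      (1000 * (F.encode n).length + 1000 * F.length + 2000 + A.regBound) : ℕ) : ℝ) := by
    exact_mod_cast hc
  have hc0r : ((CA * P.n (Γ.state D) ^ t : ℕ) : ℝ) ≤ CA * ((z : ℝ) ^ E * T) := by
    push_cast
    exact mul_le_mul_of_nonneg_left hnt (by positivity)
  have h1 : (c : ℝ) ≤ (25 * CA + 4001) * ((z : ℝ) ^ E * T) := by linarith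
  have h2 : (z : ℝ) ^ E * T = 2 * K ^ E * 2 ^ ((1 - γ) * n) * ((n : ℝ) + 1) ^ (K * E) := by
    rw [hzd, hT, Nat.cast_mul, Nat.cast_pow, Nat.cast_add, Nat.cast_one]; rw [mul_pow, ← pow_mul]; ring
  have hn1 : (1 : ℝ) ≤ (n : ℝ) + 1 := by linarith [(Nat.cast_nonneg n : (0 : ℝ) ≤ n)]
  calc (c : ℝ) ≤ (25 * CA + 4001) * ((z : ℝ) ^ E * T) := h1
    _ = ((2 * (25 * CA + 4001) * K ^ E : ℕ) : ℝ) * (2 : ℝ) ^ ((1 - γ) * n) *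
        ((n : ℝ) + 1) ^ (K * E) := by rw [h2]; push_cast; ring
    _ ≤ (Cf : ℝ) * (2 : ℝ) ^ ((1 - γ) * n) * ((n : ℝ) + 1) ^ Cf := by
      have h3 : ((2 * (25 * CA + 4001) * K ^ E : ℕ) : ℝ) ≤ Cf := by
        exact_mod_cast (by omega : 2 * (25 * CA + 4001) * K ^ E ≤ Cf)
      have h4 : K * E ≤ Cf := by omega
      gcongr

/-- SETH is applied to a `γ` that is fixed before `k` is known, and `Gadget.kSATSolvable` refutes
the resulting `k`. Replacing `ε` by `min ε 1` keeps the exponent of `m` nonnegative. -/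
theorem Gadget.not_seth {P : DynProblem} {μ : Mode} {dec : Bool} {ρ : Rollback} {two : ℕ}
    (Γ : Gadget P μ dec ρ two) (htwo : two ≤ 1) {t : ℕ} {ε : ℝ} (hε : 0 < ε)
    (h : ρ.Suits P μ t (1 + two - ε)) : ¬ SETH := by
  intro seth
  obtain ⟨A, CA, hA⟩ := Γ.sessions h
  set q := 2 * (Γ.code.gen.degree + t + 1) with hq
  have hε' : 0 < min ε 1 := lt_min hε one_pos
  obtain ⟨k, hk⟩ := seth (min (min ε 1 / q) (1 / 2)) (lt_min (by positivity) (by norm_num))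
  exact hk (Γ.kSATSolvable htwo hA hε' (min_le_right _ _)
    (by linarith [min_le_left ε 1]) hq.symm.le (min_le_left _ _) (min_le_right _ _) k)

/-! ## Reductions that switch elements on and off -/

/-- For every clause there are two elements, which can be switched on and off. -/
def SatData.toggles (D : SatData) : Finset (ℕ × ℕ) := Finset.range D.M ×ˢ Finset.range 2

def SatData.chosen (D : SatData) (b : ℕ → ℕ) : Finset (ℕ × ℕ) :=
  (Finset.range D.M).image fun c => (c, b c)

theorem SatData.mem_toggles {D : SatData} {p : ℕ × ℕ} : p ∈ D.toggles ↔ p.1 < D.M ∧ p.2 < 2 := by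
  simp [SatData.toggles]

theorem SatData.mem_chosen {D : SatData} {b : ℕ → ℕ} {p : ℕ × ℕ} :
    p ∈ D.chosen b ↔ p.1 < D.M ∧ p.2 = b p.1 := by
  simp only [SatData.chosen, Finset.mem_image, Finset.mem_range]
  constructor
  · rintro ⟨c, hc, rfl⟩; exact ⟨hc, rfl⟩
  · rintro ⟨hc, h⟩; exact ⟨p.1, hc, by rw [← h]⟩

theorem SatData.chosen_subset {D : SatData} {b : ℕ → ℕ} (hb : ∀ c, b c ≤ 1) :
    D.chosen b ⊆ D.toggles := by
  intro p hp
  rw [SatData.mem_chosen] at hp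
  rw [SatData.mem_toggles]
  have := hb p.1
  omega

theorem SatData.card_toggles (D : SatData) : D.toggles.card = 2 * D.M := by
  simp [SatData.toggles, mul_comm]

/-- A reduction in which the instance depends on the set of elements that are switched on. -/
structure Toggle (P : DynProblem) (two : ℕ) where
  gen : Bool → Gen
  argA : Exp
  argB : Exp
  query : Exp
  thr : Exp
  low : Bool
  good : ∃ B₀, ∀ B ≥ B₀, ∀ dec, Code.Good ⟨gen dec, argA, argB, query, thr, low⟩ B
  arith : ∀ dec, (gen dec).BoundsArith
  exponent : ℕ
  offset : ℕ
  inst : SatData → Finset (ℕ × ℕ) → P.State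
  valid : ∀ (D : SatData) (I : Finset (ℕ × ℕ)), D.OK two → I ⊆ D.toggles → P.Valid (inst D I)
  enc : ∀ (dec : Bool) (D : SatData) (h : HState), D.OK two → h.Models D →
    P.Enc (inst D (if dec then D.toggles else ∅)) ((gen dec).out 12 h)
  one_le : ∀ (D : SatData) (I : Finset (ℕ × ℕ)), D.OK two → 1 ≤ P.m (inst D I)
  n_le : ∀ (D : SatData) (I : Finset (ℕ × ℕ)), D.OK two → P.n (inst D I) ≤ P.m (inst D I)
  m_le : ∀ (D : SatData) (I : Finset (ℕ × ℕ)), D.OK two →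
    P.m (inst D I) ≤ (D.M + offset) ^ exponent * D.A₁
  ins : ∀ (D : SatData) (I : Finset (ℕ × ℕ)) (j c d : ℕ), D.OK two → I ⊆ D.toggles →
    c < D.M → d ≤ 1 → (c, d) ∉ I →
    P.insOK (inst D I) (argA.eval (D.env j c d)) (argB.eval (D.env j c d)) ∧
      P.ins (inst D I) (argA.eval (D.env j c d)) (argB.eval (D.env j c d)) =
        inst D (insert (c, d) I)
  del : ∀ (D : SatData) (I : Finset (ℕ × ℕ)) (j c d : ℕ), D.OK two → I ⊆ D.toggles →
    c < D.M → d ≤ 1 → (c, d) ∈ I →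
    P.delOK (inst D I) (argA.eval (D.env j c d)) (argB.eval (D.env j c d)) ∧
      P.del (inst D I) (argA.eval (D.env j c d)) (argB.eval (D.env j c d)) =
        inst D (I.erase (c, d))
  ask : ∀ (D : SatData) (b : ℕ → ℕ) (j : ℕ), D.OK two → (∀ c, b c ≤ 1) →
    P.askOK (inst D (D.chosen b)) (query.eval (D.env j 0 0)) ∧
      ∀ a, P.good (inst D (D.chosen b)) (query.eval (D.env j 0 0)) a →
        ((if low then a < thr.eval (D.env j 0 0) else thr.eval (D.env j 0 0) ≤ a) ↔ D.Ext b)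

/-! ### From toggles to gadgets, in the three modes -/

namespace Toggle

variable {P : DynProblem} {two : ℕ} (T : Toggle P two) {D : SatData} {μ : Mode}

def code (dec : Bool) : Code := ⟨T.gen dec, T.argA, T.argB, T.query, T.thr, T.low⟩

theorem spec_insert (hD : D.OK two) (hμ : ∀ a b, μ.Allows (.ins a b)) {dec neg : Bool} {j : ℕ}
    {b : ℕ → ℕ} (hb : ∀ c, b c ≤ 1) {l : List ℕ} (hl : ∀ c ∈ l, c < D.M) (hn : l.Nodup)
    {I : Finset (ℕ × ℕ)} (hI : I ⊆ D.toggles)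
    (hd : ∀ c ∈ l, (c, if neg then 1 - b c else b c) ∉ I) {rest : List (Request × (ℕ → Prop))}
    (h : P.Spec μ (T.inst D (I ∪ l.toFinset.image fun c => (c, if neg then 1 - b c else b c))) rest) :
    P.Spec μ (T.inst D I) ((T.code dec).pairs D neg false j b l ++ rest) := by
  induction l generalizing I with
  | nil => simpa [Code.pairs] using h
  | cons c l ih =>
    have hd1 : (if neg then 1 - b c else b c) ≤ 1 := by have := hb c; split_ifs <;> omega
    have hc := hl c (by simp)
    obtain ⟨h1, h2⟩ := T.ins D I j c _ hD hI hc hd1 (hd c (by simp))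
    refine ⟨hμ _ _, h1, fun _ _ => trivial, ?_⟩
    change P.Spec μ (P.ins (T.inst D I) (T.argA.eval (D.env j c _)) (T.argB.eval (D.env j c _))) _
    rw [h2]
    rw [List.nodup_cons] at hn
    refine ih (fun c hc => hl c (by simp [hc])) hn.2 ?_ ?_ ?_
    · exact Finset.insert_subset (SatData.mem_toggles.2 ⟨hc, by simp only; omega⟩) hI
    · intro c' hc'
      rw [Finset.mem_insert, not_or]
      refine ⟨fun he => ?_, hd c' (by simp [hc'])⟩
      rw [Prod.mk.injEq] at he
      exact hn.1 (he.1 ▸ hc')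
    · rwa [List.toFinset_cons, Finset.image_insert, Finset.union_insert,
        ← Finset.insert_union] at h

theorem spec_erase (hD : D.OK two) (hμ : ∀ a b, μ.Allows (.del a b)) {dec neg : Bool} {j : ℕ}
    {b : ℕ → ℕ} (hb : ∀ c, b c ≤ 1) {l : List ℕ} (hl : ∀ c ∈ l, c < D.M) (hn : l.Nodup)
    {I : Finset (ℕ × ℕ)} (hI : I ⊆ D.toggles)
    (hd : ∀ c ∈ l, (c, if neg then 1 - b c else b c) ∈ I) {rest : List (Request × (ℕ → Prop))}
    (h : P.Spec μ (T.inst D (I \ l.toFinset.image fun c => (c, if neg then 1 - b c else b c))) rest) :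
    P.Spec μ (T.inst D I) ((T.code dec).pairs D neg true j b l ++ rest) := by
  induction l generalizing I with
  | nil => simpa [Code.pairs] using h
  | cons c l ih =>
    have hd1 : (if neg then 1 - b c else b c) ≤ 1 := by have := hb c; split_ifs <;> omega
    have hc := hl c (by simp)
    obtain ⟨h1, h2⟩ := T.del D I j c _ hD hI hc hd1 (hd c (by simp))
    refine ⟨hμ _ _, h1, fun _ _ => trivial, ?_⟩
    change P.Spec μ (P.del (T.inst D I) (T.argA.eval (D.env j c _)) (T.argB.eval (D.env j c _))) _
    rw [h2]
    rw [List.nodup_cons] at hn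
    refine ih (fun c hc => hl c (by simp [hc])) hn.2 ((Finset.erase_subset _ _).trans hI) ?_ ?_
    · intro c' hc'
      rw [Finset.mem_erase]
      refine ⟨fun he => ?_, hd c' (by simp [hc'])⟩
      rw [Prod.mk.injEq] at he
      exact hn.1 (he.1 ▸ hc')
    · rwa [List.toFinset_cons, Finset.image_insert, Finset.sdiff_insert,
        ← Finset.erase_sdiff_comm] at h

theorem image_range_toFinset (b : ℕ → ℕ) :
    ((List.range D.M).toFinset.image fun c => (c, if false then 1 - b c else b c)) = D.chosen b := by
  ext; simp [SatData.chosen]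

/-- Starting with all switches off, a stage turns on `(c, b c)` for every clause `c`. With `undo`
the same switches are turned off again, and the remaining requests start from the initial instance.
-/
theorem spec_incremental (hD : D.OK two) {ρ : Rollback} (hμ : ∀ a b, μ.Allows (.ins a b))
    (hμ' : ρ = .undo → ∀ a b, μ.Allows (.del a b)) (hμ'' : ∀ q, μ.Allows (.ask q))
    {j : ℕ} {b : ℕ → ℕ} (hb : ∀ c, b c ≤ 1) {rest : List (Request × (ℕ → Prop))}
    (h : ρ = .undo → P.Spec μ (T.inst D ∅) rest) (h' : ρ ≠ .undo → rest = []) :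
    P.Spec μ (T.inst D ∅) ((T.code false).calls D false ρ j b (D.Ext b) ++ rest) := by
  obtain ⟨h1, h2⟩ := T.ask D b j hD hb
  have h3 : ∀ l, P.Spec μ (T.inst D (D.chosen b)) l → P.Spec μ (T.inst D (D.chosen b))
      (((T.code false).ask D j, fun a => (T.code false).Accepts D j a ↔ D.Ext b) :: l) :=
    fun l hl => ⟨hμ'' _, h1, h2, hl⟩
  unfold Code.calls
  rw [List.append_assoc]
  refine T.spec_insert hD hμ hb (by simp) List.nodup_range (by simp) (by simp) ?_
  rw [image_range_toFinset, Finset.empty_union]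
  refine h3 _ ?_
  cases ρ with
  | none => rw [h' (by simp)]; trivial
  | reset => rw [h' (by simp)]; trivial
  | undo =>
    have h := h rfl
    refine T.spec_erase hD (hμ' rfl) hb (by simp) List.nodup_range (SatData.chosen_subset hb) ?_ ?_
    · intro c hc; simpa [SatData.mem_chosen] using hc
    · rwa [image_range_toFinset, Finset.sdiff_self]

/-- Starting with all switches on, turning off `(c, 1 - b c)` for every clause leaves exactly the
set `D.chosen b` that the incremental stage reaches. This is why there are two switches per clause.
-/
theorem spec_decremental (hD : D.OK two) (hμ : ∀ a b, μ.Allows (.del a b))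
    (hμ'' : ∀ q, μ.Allows (.ask q)) {j : ℕ} {b : ℕ → ℕ} (hb : ∀ c, b c ≤ 1) :
    P.Spec μ (T.inst D D.toggles) ((T.code true).calls D true .reset j b (D.Ext b)) := by
  obtain ⟨h1, h2⟩ := T.ask D b j hD hb
  unfold Code.calls
  refine T.spec_erase hD hμ hb (by simp) List.nodup_range subset_rfl ?_ ?_
  · intro c hc
    have := hb c
    rw [List.mem_range] at hc
    exact SatData.mem_toggles.2 ⟨hc, by simp only [if_true]; omega⟩
  · have : D.toggles \ ((List.range D.M).toFinset.image fun c => (c, if true then 1 - b c else b c)) =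
        D.chosen b := by
      ext ⟨c, d⟩
      have := hb c
      simp only [Finset.mem_sdiff, SatData.mem_toggles, SatData.mem_chosen, Finset.mem_image,
        List.mem_toFinset, List.mem_range, if_true, Prod.mk.injEq]
      constructor
      · rintro ⟨⟨h1, h2⟩, h3⟩
        refine ⟨h1, ?_⟩
        by_contra h4
        exact h3 ⟨c, h1, rfl, by omega⟩
      · rintro ⟨h1, h2⟩
        refine ⟨⟨h1, by omega⟩, ?_⟩
        rintro ⟨c', h3, rfl, h4⟩
        omega
    rw [this]
    exact ⟨hμ'' _, h1, h2, trivial⟩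

/-- The gadget for a toggle, given the requests of a stage. -/
def gadget (dec : Bool) (ρ : Rollback) (μ : Mode)
    (hs : ∀ D : SatData, D.OK two → ∀ b : ℕ → ℕ → ℕ, (∀ j c, b j c ≤ 1) → ∀ S : ℕ,
    (ρ = .reset → ∀ j, P.Spec μ (T.inst D (if dec then D.toggles else ∅))
      ((T.code dec).calls D dec ρ j (b j) (D.Ext (b j)))) ∧
    (ρ ≠ .reset → P.Spec μ (T.inst D (if dec then D.toggles else ∅))
      ((List.range' 0 S).flatMap fun j => (T.code dec).calls D dec ρ j (b j) (D.Ext (b j))))) :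
    Gadget P μ dec ρ two where
  code := T.code dec
  good := let ⟨B₀, h⟩ := T.good; ⟨B₀, fun B hB => h B hB dec⟩
  arith := T.arith dec
  exponent := T.exponent
  offset := T.offset
  state D := T.inst D (if dec then D.toggles else ∅)
  valid D hD := T.valid D _ hD (by split_ifs <;> simp)
  enc D h hD hM := T.enc dec D h hD hM
  one_le D hD := T.one_le D _ hD
  n_le D hD := T.n_le D _ hD
  m_le D hD := T.m_le D _ hD
  spec := hs

theorem not_seth (T : Toggle P two) (htwo : two ≤ 1) {t : ℕ} {ε : ℝ} (hε : 0 < ε)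
    (h : P.Solvable t (1 + two - ε)) : ¬ SETH := by
  rcases h with h | h | h
  · refine (T.gadget false .undo .full fun D hD b hb S => ⟨by simp, fun _ => ?_⟩).not_seth htwo hε
      ⟨by simp, fun _ => h⟩
    -- Every stage starts from the same instance, so the induction is on the number of stages, with
    -- an arbitrary first one.
    generalize 0 = i
    induction S generalizing i with
    | zero => trivial
    | succ S ih =>
      rw [List.range'_succ, List.flatMap_cons]
      exact T.spec_incremental (μ := .full) hD (fun _ _ => trivial) (fun _ _ _ => trivial)
        (fun _ => trivial) (hb i) (fun _ => by simpa using ih (i + 1)) (by simp)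
  · refine (T.gadget false .reset .incremental fun D hD b hb S => ⟨fun _ j => ?_, by simp⟩).not_seth
      htwo hε ⟨fun _ => h, by simp⟩
    rw [← List.append_nil (Code.calls ..)]
    exact T.spec_incremental (μ := .incremental) hD (fun _ _ => trivial) (by simp)
      (fun _ => trivial) (hb j) (by simp) (by simp)
  · refine (T.gadget true .reset .decremental fun D hD b hb S => ⟨fun _ j => ?_, by simp⟩).not_seth
      htwo hε ⟨fun _ => h, by simp⟩
    exact T.spec_decremental (μ := .decremental) hD (fun _ _ => trivial) (fun _ => trivial) (hb j)

end Toggle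

/-! ## Lists of edges -/

/-- The pairs `f i c` with `i < N`, `c < M` and `p i c ≠ 0`. -/
def blockList (N M : ℕ) (p : ℕ → ℕ → ℕ) (f : ℕ → ℕ → ℕ × ℕ) : List (ℕ × ℕ) :=
  (List.range N).flatMap fun i => (List.range M).flatMap fun c => if p i c ≠ 0 then [f i c] else []

theorem mem_blockList {N M : ℕ} {p : ℕ → ℕ → ℕ} {f : ℕ → ℕ → ℕ × ℕ} {e : ℕ × ℕ} :
    e ∈ blockList N M p f ↔ ∃ i < N, ∃ c < M, p i c ≠ 0 ∧ e = f i c := by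
  simp only [blockList, List.mem_flatMap, List.mem_range]
  refine exists_congr fun i => and_congr_right fun _ => exists_congr fun c => and_congr_right
    fun _ => ?_
  split_ifs with h <;> simp [h]

theorem nodup_flatMap_range {α : Type} {N : ℕ} {f : ℕ → List α} (h : ∀ i < N, (f i).Nodup)
    (hd : ∀ i < N, ∀ j < N, ∀ x, x ∈ f i → x ∈ f j → i = j) :
    ((List.range N).flatMap f).Nodup := by
  rw [List.nodup_flatMap]
  refine ⟨fun i hi => h i (List.mem_range.1 hi), ?_⟩
  refine List.nodup_range.imp_of_mem ?_
  intro i j hi hj hij x hx hx'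
  exact hij (hd i (List.mem_range.1 hi) j (List.mem_range.1 hj) x hx hx')

theorem nodup_blockList {N M : ℕ} {p : ℕ → ℕ → ℕ} {f : ℕ → ℕ → ℕ × ℕ}
    (h : ∀ i < N, ∀ c < M, ∀ j < N, ∀ d < M, f i c = f j d → i = j ∧ c = d) :
    (blockList N M p f).Nodup := by
  refine nodup_flatMap_range (fun i hi => nodup_flatMap_range (fun c hc => ?_) ?_) ?_
  · split_ifs <;> simp
  · intro c hc d hd x hx hx'
    split_ifs at hx hx' <;> simp at hx hx'
    exact (h i hi c hc i hi d hd (hx.symm.trans hx')).2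
  · intro i hi j hj x hx hx'
    simp only [List.mem_flatMap, List.mem_range] at hx hx'
    obtain ⟨c, hc, hx⟩ := hx
    obtain ⟨d, hd, hx'⟩ := hx'
    split_ifs at hx hx' <;> simp at hx hx'
    exact (h i hi c hc j hj d hd (hx.symm.trans hx')).1

theorem length_blockList_le (N M : ℕ) (p : ℕ → ℕ → ℕ) (f : ℕ → ℕ → ℕ × ℕ) :
    (blockList N M p f).length ≤ N * M := by
  have key : ∀ (N M : ℕ) (f : ℕ → List (ℕ × ℕ)), (∀ i, (f i).length ≤ M) →
      ((List.range N).flatMap f).length ≤ N * M := by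
    intro N M f hf
    rw [List.length_flatMap]
    refine (List.sum_le_card_nsmul _ M ?_).trans (by simp)
    simp only [List.mem_map]
    rintro _ ⟨i, -, rfl⟩
    exact hf i
  refine key N M _ fun i => (key M 1 _ fun c => ?_).trans (by simp)
  split_ifs <;> simp

def flattenPairs (l : List (ℕ × ℕ)) : List ℕ := l.flatMap fun e => [e.1, e.2]

theorem length_flattenPairs (l : List (ℕ × ℕ)) : (flattenPairs l).length = 2 * l.length := by
  simp [flattenPairs, List.length_flatMap, mul_comm]

/-- The code for a block of pairs. The loops use the variables `12` and `13`. -/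
structure Block where
  N : Exp
  M : Exp
  cond : Exp
  a : Exp
  b : Exp

def Block.gen (β : Block) : Gen :=
  .loop β.N (.loop β.M (.when β.cond (.seq (.emit β.a) (.emit β.b))))

def Block.pairs (β : Block) (h : HState) : List (ℕ × ℕ) :=
  blockList (β.N.eval h) (β.M.eval h) (fun i c => β.cond.eval ((h.set 12 i).set 13 c))
    fun i c => (β.a.eval ((h.set 12 i).set 13 c), β.b.eval ((h.set 12 i).set 13 c))

def Exp.IsBound (B : ℕ) (e : Exp) : Prop := e.Below 3 ∧ e.Fits B ∧ e.size ≤ 50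
def Exp.IsEntry (B : ℕ) (e : Exp) : Prop := e.Below 14 ∧ e.Fits B ∧ e.size ≤ 60

structure Block.Good (B : ℕ) (β : Block) : Prop where
  N : β.N.IsBound B
  M : β.M.IsBound B
  cond : β.cond.IsEntry B
  a : β.a.IsEntry B
  b : β.b.IsEntry B

theorem Block.Good.gen {B : ℕ} {β : Block} (h : β.Good B) (c : Bool) : β.gen.Good B c 12 :=
  ⟨h.N.1, h.N.2.1, h.N.2.2, by norm_num, h.M.1, h.M.2.1, h.M.2.2, by norm_num, h.cond.1, h.cond.2.1,
    h.cond.2.2, ⟨h.a.1, h.a.2.1, h.a.2.2⟩, h.b.1, h.b.2.1, h.b.2.2⟩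

theorem HState.Agree.eval_bound {h h' : HState} (H : h.Agree 12 h') {B : ℕ} {e : Exp} (he : e.IsBound B) :
    e.eval h' = e.eval h := Exp.eval_congr (H.mono (by norm_num)) he.1

theorem Block.out {B : ℕ} {β : Block} (hβ : β.Good B) (h : HState) :
    β.gen.out 12 h = flattenPairs (β.pairs h) := by
  simp only [Block.gen, Gen.out, flattenPairs, Block.pairs, blockList, List.flatMap_assoc]
  congr 1; funext i
  have e : β.M.eval (h.set 12 i) = β.M.eval h :=
    (HState.agree_set h i le_rfl).eval_bound hβ.M
  rw [e]
  congr 1; funext c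
  by_cases hc : β.cond.eval ((h.set 12 i).set 13 c) = 0 <;> simp [hc]

def blocksGen : List Block → Gen
  | [] => .when 0 (.emit 0)
  | β :: l => .seq β.gen (blocksGen l)

theorem blocksGen_out {B : ℕ} {l : List Block} (hl : ∀ β ∈ l, β.Good B) (h : HState) :
    (blocksGen l).out 12 h = flattenPairs (l.flatMap fun β => β.pairs h) := by
  induction l with
  | nil => simp [blocksGen, Gen.out, flattenPairs]
  | cons β l ih =>
    rw [blocksGen, Gen.out, Block.out (hl β (by simp)), ih fun β hβ => hl β (by simp [hβ])]
    simp [flattenPairs]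

theorem blocksGen_good {B : ℕ} {l : List Block} (hl : ∀ β ∈ l, β.Good B) (c : Bool) :
    (blocksGen l).Good B c 12 := by
  induction l with
  | nil => simp [blocksGen, Gen.Good, Exp.Fits]
  | cons β l ih =>
    exact ⟨(hl β (by simp)).gen c, ih fun β hβ => hl β (by simp [hβ])⟩

theorem blocksGen_boundsArith {l : List Block} (hl : ∀ β ∈ l, β.N.Arith ∧ β.M.Arith) :
    (blocksGen l).BoundsArith := by
  induction l with
  | nil => trivial
  | cons β l ih =>
    exact ⟨⟨(hl β (by simp)).1, (hl β (by simp)).2, trivial, trivial⟩, ih fun β hβ => hl β (by simp [hβ])⟩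

/-- The code for a graph. -/
def graphGen (n m : Exp) (l : List Block) : Gen :=
  .seq (.emit n) (.seq (.emit m) (.counted 2 (blocksGen l)))

theorem graphGen_good {B : ℕ} (hB : 2 ≤ B) {n m : Exp} (hn : n.IsBound B) (hm : m.IsBound B) {l : List Block}
    (hl : ∀ β ∈ l, β.Good B) : (graphGen n m l).Good B false 12 := by
  have key : ∀ e : Exp, e.Below 3 → e.Below 12 := by
    intro e
    induction e with
    | var i => simp only [Exp.below_var]; omega
    | lit c => simp
    | bin f a b iha ihb => exact fun h => ⟨iha h.1, ihb h.2⟩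
    | get k e ih => exact ih
  exact ⟨⟨key _ hn.1, hn.2.1, hn.2.2.trans (by norm_num)⟩,
    ⟨key _ hm.1, hm.2.1, hm.2.2.trans (by norm_num)⟩, rfl, hB, blocksGen_good hl _⟩

theorem graphGen_boundsArith {n m : Exp} {l : List Block} (hl : ∀ β ∈ l, β.N.Arith ∧ β.M.Arith) :
    (graphGen n m l).BoundsArith := ⟨trivial, trivial, blocksGen_boundsArith hl⟩

theorem graphGen_enc {B : ℕ} {n m : Exp} {l : List Block} (hl : ∀ β ∈ l, β.Good B) {h : HState}
    {G : DynGraph} (hn : n.eval h = G.n) (hm : m.eval h = G.m)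
    (hd : (l.flatMap fun β => β.pairs h).Nodup)
    (hE : ∀ e, e ∈ (l.flatMap fun β => β.pairs h) ↔ e ∈ G.E) :
    G.Enc ((graphGen n m l).out 12 h) := by
  refine ⟨_, ⟨_, ⟨hd, hE⟩, rfl⟩, ?_⟩
  simp only [graphGen, Gen.out, blocksGen_out hl, hn, hm, length_flattenPairs]
  simp [flattenPairs]

/-! ## Graphs with switches -/

/-- The edges of a graph: the static ones, and those for the elements that are switched on. -/
def edgeSet (st : List (ℕ × ℕ)) (el : ℕ → ℕ → ℕ × ℕ) (I : Finset (ℕ × ℕ)) : Finset (ℕ × ℕ) :=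
  st.toFinset ∪ I.image fun p => el p.1 p.2

/-- These facts make all switches legal updates: the edges of the switches differ from each other
and from the static ones. The inequality is strict because an insertion requires fewer than `m`
edges before it. -/
structure EdgeFacts (ok : ℕ × ℕ → Prop) (D : SatData) (m : ℕ) (st : List (ℕ × ℕ))
    (el : ℕ → ℕ → ℕ × ℕ) : Prop where
  nodup : st.Nodup
  inj : ∀ c < D.M, ∀ d < 2, ∀ c' < D.M, ∀ d' < 2, el c d = el c' d' → c = c' ∧ d = d'
  disj : ∀ c < D.M, ∀ d < 2, el c d ∉ st
  ok_st : ∀ e ∈ st, ok e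
  ok_el : ∀ c < D.M, ∀ d < 2, ok (el c d)
  length : st.length + 2 * D.M < m

theorem mem_edgeSet {st : List (ℕ × ℕ)} {el : ℕ → ℕ → ℕ × ℕ} {I : Finset (ℕ × ℕ)} {e : ℕ × ℕ} :
    e ∈ edgeSet st el I ↔ e ∈ st ∨ ∃ p ∈ I, el p.1 p.2 = e := by
  simp only [edgeSet, Finset.mem_union, List.mem_toFinset, Finset.mem_image]

theorem edgeSet_insert (st : List (ℕ × ℕ)) (el : ℕ → ℕ → ℕ × ℕ) (I : Finset (ℕ × ℕ)) (c d : ℕ) :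
    insert (el c d) (edgeSet st el I) = edgeSet st el (insert (c, d) I) := by
  rw [edgeSet, edgeSet, Finset.image_insert, Finset.union_insert]

namespace EdgeFacts

variable {ok : ℕ × ℕ → Prop} {D : SatData} {m : ℕ} {st : List (ℕ × ℕ)} {el : ℕ → ℕ → ℕ × ℕ}
  {I : Finset (ℕ × ℕ)}

theorem card_lt (H : EdgeFacts ok D m st el) (hI : I ⊆ D.toggles) : (edgeSet st el I).card < m := by
  have h1 := Finset.card_union_le st.toFinset (I.image fun p => el p.1 p.2)
  have h2 := Finset.card_image_le (s := I) (f := fun p => el p.1 p.2)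
  have h3 := Finset.card_le_card hI
  have h4 := List.toFinset_card_le st
  have := H.length
  rw [D.card_toggles] at h3
  rw [edgeSet]
  omega

theorem ok_of_mem (H : EdgeFacts ok D m st el) (hI : I ⊆ D.toggles) {e : ℕ × ℕ}
    (he : e ∈ edgeSet st el I) : ok e := by
  rcases mem_edgeSet.1 he with he | ⟨p, hp, rfl⟩
  · exact H.ok_st e he
  · have := SatData.mem_toggles.1 (hI hp)
    exact H.ok_el _ this.1 _ this.2

theorem mem_iff (H : EdgeFacts ok D m st el) (hI : I ⊆ D.toggles) {c d : ℕ} (hc : c < D.M)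
    (hd : d < 2) : el c d ∈ edgeSet st el I ↔ (c, d) ∈ I := by
  rw [mem_edgeSet]
  constructor
  · rintro (h | ⟨p, hp, h⟩)
    · exact absurd h (H.disj c hc d hd)
    · have := SatData.mem_toggles.1 (hI hp)
      obtain ⟨h1, h2⟩ := H.inj _ this.1 _ this.2 c hc d hd h
      rw [← h1, ← h2]; exact hp
  · exact fun h => .inr ⟨_, h, rfl⟩

theorem erase (H : EdgeFacts ok D m st el) (hI : I ⊆ D.toggles) {c d : ℕ} (hc : c < D.M)
    (hd : d < 2) : (edgeSet st el I).erase (el c d) = edgeSet st el (I.erase (c, d)) := by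
  ext e
  rw [Finset.mem_erase, mem_edgeSet, mem_edgeSet]
  constructor
  · rintro ⟨h1, h | ⟨p, hp, rfl⟩⟩
    · exact .inl h
    · refine .inr ⟨p, Finset.mem_erase.2 ⟨?_, hp⟩, rfl⟩
      rintro rfl; exact h1 rfl
  · rintro (h | ⟨p, hp, rfl⟩)
    · refine ⟨?_, .inl h⟩
      rintro rfl; exact H.disj c hc d hd h
    · rw [Finset.mem_erase] at hp
      refine ⟨fun he => hp.1 ?_, .inr ⟨p, hp.2, rfl⟩⟩
      have := SatData.mem_toggles.1 (hI hp.2)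
      obtain ⟨h1, h2⟩ := H.inj _ this.1 _ this.2 c hc d hd he
      exact Prod.ext h1 h2

/-- The initial edges, in the order in which they are written. -/
theorem enumerates (H : EdgeFacts ok D m st el) (dec : Bool) :
    (st ++ blockList (if dec then D.M else 0) 2 (fun _ _ => 1) el).Nodup ∧
      ∀ e, e ∈ st ++ blockList (if dec then D.M else 0) 2 (fun _ _ => 1) el ↔
        e ∈ edgeSet st el (if dec then D.toggles else ∅) := by
  have hle : ∀ i, i < (if dec then D.M else 0) → i < D.M := by intro i hi; split_ifs at hi <;> omega
  refine ⟨?_, fun e => ?_⟩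
  · rw [List.nodup_append']
    refine ⟨H.nodup, nodup_blockList fun i hi c hc j hj d hd h =>
      H.inj i (hle i hi) c hc j (hle j hj) d hd h, ?_⟩
    intro e he he'
    obtain ⟨i, hi, c, hc, -, rfl⟩ := mem_blockList.1 he'
    exact H.disj i (hle i hi) c hc he
  · rw [List.mem_append, mem_blockList, mem_edgeSet]
    refine or_congr_right ?_
    constructor
    · rintro ⟨i, hi, c, hc, -, rfl⟩
      refine ⟨(i, c), ?_, rfl⟩
      split_ifs at hi ⊢
      · exact SatData.mem_toggles.2 ⟨hi, hc⟩
      · omega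
    · rintro ⟨p, hp, rfl⟩
      split_ifs at hp ⊢
      · have := SatData.mem_toggles.1 hp
        exact ⟨p.1, this.1, p.2, this.2, by simp, rfl⟩
      · simp at hp

end EdgeFacts

/-! ## Toggles for directed graphs -/

/-- The code for a graph with switches; `elA` and `elB` give the edge for a switch. -/
structure EdgeCode where
  n : Exp
  m : Exp
  blocks : List Block
  elA : Exp → Exp → Exp
  elB : Exp → Exp → Exp

def EdgeCode.allBlocks (κ : EdgeCode) (dec : Bool) : List Block :=
  κ.blocks ++ [⟨if dec then .var vM else 0, 2, 1, κ.elA (.var 12) (.var 13), κ.elB (.var 12) (.var 13)⟩]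

def EdgeCode.gen (κ : EdgeCode) (dec : Bool) : Gen := graphGen κ.n κ.m (κ.allBlocks dec)

structure EdgeCode.Good (κ : EdgeCode) (B : ℕ) : Prop where
  two_le : 2 ≤ B
  n : κ.n.IsBound B
  m : κ.m.IsBound B
  blocks : ∀ β ∈ κ.blocks, β.Good B
  elA : (κ.elA (.var 12) (.var 13)).IsEntry B
  elB : (κ.elB (.var 12) (.var 13)).IsEntry B

theorem EdgeCode.Good.allBlocks {κ : EdgeCode} {B : ℕ} (h : κ.Good B) (dec : Bool) :
    ∀ β ∈ κ.allBlocks dec, β.Good B := by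
  intro β hβ
  rw [EdgeCode.allBlocks, List.mem_append, List.mem_singleton] at hβ
  rcases hβ with hβ | rfl
  · exact h.blocks β hβ
  · have h2 := h.two_le
    refine ⟨?_, ?_, ?_, h.elA, h.elB⟩
    · cases dec
      · exact ⟨trivial, Nat.zero_le B, by norm_num⟩
      · exact ⟨by simp, trivial, by norm_num⟩
    · exact ⟨trivial, h2, by norm_num⟩
    · exact ⟨trivial, (by omega : 1 ≤ B), by norm_num⟩

theorem EdgeCode.Good.gen {κ : EdgeCode} {B : ℕ} (h : κ.Good B) (dec : Bool) :
    (κ.gen dec).Good B false 12 := graphGen_good h.two_le h.n h.m (h.allBlocks dec)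

theorem EdgeCode.boundsArith {κ : EdgeCode} (h : ∀ β ∈ κ.blocks, β.N.Arith ∧ β.M.Arith)
    (dec : Bool) : (κ.gen dec).BoundsArith := by
  refine graphGen_boundsArith fun β hβ => ?_
  rw [EdgeCode.allBlocks, List.mem_append, List.mem_singleton] at hβ
  rcases hβ with hβ | rfl
  · exact h β hβ
  · exact ⟨by cases dec <;> trivial, trivial⟩

theorem EdgeCode.enc {κ : EdgeCode} {B : ℕ} (hκ : κ.Good B) {ok : ℕ × ℕ → Prop} {D : SatData}
    {G : DynGraph} {st : List (ℕ × ℕ)} {el : ℕ → ℕ → ℕ × ℕ} (H : EdgeFacts ok D G.m st el)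
    {h : HState} (hM : h.Models D) (hn : κ.n.eval h = G.n) (hm : κ.m.eval h = G.m)
    (hst : (κ.blocks.flatMap fun β => β.pairs h) = st)
    (hel : ∀ c d, ((κ.elA (.var 12) (.var 13)).eval ((h.set 12 c).set 13 d),
      (κ.elB (.var 12) (.var 13)).eval ((h.set 12 c).set 13 d)) = el c d) (dec : Bool)
    (hG : G.E = edgeSet st el (if dec then D.toggles else ∅)) : G.Enc ((κ.gen dec).out 12 h) := by
  have e : ((κ.allBlocks dec).flatMap fun β => β.pairs h) =
      st ++ blockList (if dec then D.M else 0) 2 (fun _ _ => 1) el := by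
    rw [EdgeCode.allBlocks, List.flatMap_append, hst]
    simp only [List.flatMap_cons, List.flatMap_nil, List.append_nil, Block.pairs, hel]
    cases dec <;> simp [hM.M]
  obtain ⟨h1, h2⟩ := H.enumerates dec
  exact graphGen_enc (hκ.allBlocks dec) hn hm (by rw [e]; exact h1) (by rw [e, hG]; exact h2)

def DirectedOK (n : ℕ) (e : ℕ × ℕ) : Prop := e.1 < n ∧ e.2 < n ∧ e.1 ≠ e.2
def UndirectedOK (n : ℕ) (e : ℕ × ℕ) : Prop := e.1 < e.2 ∧ e.2 < n

section simpLemmas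

variable (a b : Exp)

@[simp] theorem Exp.arith_var (i : ℕ) : (Exp.var i).Arith := trivial
@[simp] theorem Exp.arith_lit (c : ℕ) : (Exp.lit c).Arith := trivial
@[simp] theorem Exp.arith_ofNat (c : ℕ) : (ofNat(c) : Exp).Arith := trivial
@[simp] theorem Exp.arith_add : (a + b).Arith ↔ a.Arith ∧ b.Arith := by
  simp [HAdd.hAdd, Add.add, Exp.Arith, BinOp.tame]
@[simp] theorem Exp.arith_sub : (a - b).Arith ↔ a.Arith ∧ b.Arith := by
  simp [HSub.hSub, Sub.sub, Exp.Arith, BinOp.tame]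
@[simp] theorem Exp.arith_mul : (a * b).Arith ↔ a.Arith ∧ b.Arith := by
  simp [HMul.hMul, Mul.mul, Exp.Arith, BinOp.tame]
@[simp] theorem Exp.arith_lt : (Exp.bin .lt a b).Arith ↔ a.Arith ∧ b.Arith := by
  simp [Exp.Arith, BinOp.tame]

end simpLemmas

/-! ## Reachability -/

namespace DynGraph

variable {G : DynGraph}

/-- Unreachability is shown throughout by exhibiting a set that is closed under edges. -/
theorem Reach.closed {S : ℕ → Prop} (hS : ∀ x y, (x, y) ∈ G.E → S x → S y) {u v : Fin G.n}
    (h : G.Reach u v) (hu : S u.1) : S v.1 := by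
  induction h with
  | refl => exact hu
  | tail _ h ih => exact hS _ _ h ih

theorem Reach.of_mem {u v : Fin G.n} (h : (u.1, v.1) ∈ G.E) : G.Reach u v :=
  Relation.ReflTransGen.single h

theorem scc_eq {u v : Fin G.n} (h : G.Reach u v) (h' : G.Reach v u) : G.scc u = G.scc v := by
  ext w
  exact ⟨fun hw => ⟨hw.1.trans h, h'.trans hw.2⟩, fun hw => ⟨hw.1.trans h', h.trans hw.2⟩⟩

theorem mem_scc_self (v : Fin G.n) : v ∈ G.scc v := ⟨.refl, .refl⟩

end DynGraph

theorem card_le_ncard_fin {n : ℕ} {s : Set (Fin n)} {t : Finset ℕ}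
    (h : ∀ x ∈ t, ∃ hx : x < n, (⟨x, hx⟩ : Fin n) ∈ s) : t.card ≤ s.ncard := by
  rw [← Set.ncard_image_of_injective s Fin.val_injective, ← Set.ncard_coe_finset]
  refine Set.ncard_le_ncard ?_ (Set.toFinite _)
  intro x hx
  obtain ⟨hx, hs⟩ := h x hx
  exact ⟨_, hs, rfl⟩

theorem ncard_fin_le {n : ℕ} {s : Set (Fin n)} {t : Finset ℕ} (h : ∀ v ∈ s, v.1 ∈ t) :
    s.ncard ≤ t.card := by
  rw [← Set.ncard_image_of_injective s Fin.val_injective, ← Set.ncard_coe_finset]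
  refine Set.ncard_le_ncard ?_ (Set.toFinite _)
  rintro _ ⟨v, hv, rfl⟩
  exact h v hv

/-! ## Strongly connected components -/

theorem SatData.ext_iff_of_ok {D : SatData} (hD : D.OK 0) (b : ℕ → ℕ) :
    D.Ext b ↔ ∃ a < D.A₁, ∀ c < D.M, D.T₁ (a * D.M + c) ≠ 0 ∨ b c ≠ 0 := by
  obtain ⟨h1, h2⟩ := hD.one rfl
  simp [SatData.Ext, h1, h2]

/-- The source is `0`, the sink `1`, the clauses follow, and then there are `D.M + k + 2` vertices for
each assignment. -/
def sccStatic (k : ℕ) (D : SatData) : List (ℕ × ℕ) :=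
  blockList D.M 1 (fun _ _ => 1) (fun i _ => (2 + i, 0)) ++
  (blockList D.M 1 (fun _ _ => 1) (fun i _ => (1, 2 + i)) ++
  (blockList (D.A₁ * (D.M + (k + 2))) 1 (fun _ _ => 1) (fun i _ => (2 + D.M + i, 0)) ++
  blockList (D.A₁ * (D.M + (k + 2))) D.M
    (fun i c => 1 - D.T₁ (i / (D.M + (k + 2)) * D.M + c)) (fun i c => (2 + c, 2 + D.M + i))))

/-- The switch `(c, 0)` is the edge from the source to clause `c`, and `(c, 1)` is the edge from
clause `c` to the sink. -/
def sccEl (c d : ℕ) : ℕ × ℕ := (d * (2 + c), (1 - d) * (2 + c) + d)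

def sccGraph (k : ℕ) (D : SatData) (I : Finset (ℕ × ℕ)) : DynGraph where
  n := 2 + D.M + D.A₁ * (D.M + (k + 2))
  m := (D.M + (k + 8)) * (D.M + (k + 8)) * (D.M + (k + 8)) * D.A₁
  E := edgeSet (sccStatic k D) sccEl I

def sccCode (k : ℕ) : EdgeCode where
  n := 2 + .var vM + .var vA₁ * (.var vM + .lit (k + 2))
  m := (.var vM + .lit (k + 8)) * (.var vM + .lit (k + 8)) * (.var vM + .lit (k + 8)) * .var vA₁
  blocks := [⟨.var vM, 1, 1, 2 + .var 12, 0⟩, ⟨.var vM, 1, 1, 1, 2 + .var 12⟩,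
    ⟨.var vA₁ * (.var vM + .lit (k + 2)), 1, 1, 2 + .var vM + .var 12, 0⟩,
    ⟨.var vA₁ * (.var vM + .lit (k + 2)), .var vM,
      1 - .get 1 (.var 12 / (.var vM + .lit (k + 2)) * .var vM + .var 13), 2 + .var 13,
      2 + .var vM + .var 12⟩]
  elA c d := d * (2 + c)
  elB c d := (1 - d) * (2 + c) + d

theorem sccCode_good (k : ℕ) {B : ℕ} (hB : k + 8 ≤ B) : (sccCode k).Good B := by
  refine ⟨by omega, ?_, ?_, ?_, ?_, ?_⟩
  · simp [sccCode, Exp.IsBound]; omega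
  · simp [sccCode, Exp.IsBound]; omega
  · intro β hβ
    simp only [sccCode, List.mem_cons, List.not_mem_nil, or_false] at hβ
    rcases hβ with rfl | rfl | rfl | rfl <;> refine ⟨?_, ?_, ?_, ?_, ?_⟩ <;>
      simp [Exp.IsBound, Exp.IsEntry] <;> omega
  · simp [sccCode, Exp.IsEntry]; omega
  · simp [sccCode, Exp.IsEntry]; omega

theorem scc_size (k M : ℕ) {A : ℕ} (hA : 0 < A) :
    M * 1 + (M * 1 + (A * (M + (k + 2)) * 1 + A * (M + (k + 2)) * M)) + 2 * M <
        (M + (k + 8)) * (M + (k + 8)) * (M + (k + 8)) * A ∧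
      2 + M + A * (M + (k + 2)) ≤ (M + (k + 8)) * (M + (k + 8)) * (M + (k + 8)) * A := by
  obtain ⟨x, hx⟩ : ∃ x, x = M + (k + 8) := ⟨_, rfl⟩
  obtain ⟨y, hy⟩ : ∃ y, y = M + (k + 2) := ⟨_, rfl⟩
  rw [← hx, ← hy]
  have h1 : 8 * (x * x) ≤ x * x * x := by nlinarith
  have h2 : 8 * x ≤ x * x := by nlinarith
  have h3 : y * (M + 1) ≤ x * x := Nat.mul_le_mul (by omega) (by omega)
  have h4 : (4 * x + x * x) * A ≤ x * x * x * A := Nat.mul_le_mul_right _ (by omega)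
  have h5 : A * (y * (M + 1)) ≤ A * (x * x) := Nat.mul_le_mul_left _ h3
  have h6 : 4 * x ≤ 4 * x * A := Nat.le_mul_of_pos_right _ hA
  have h7 : 0 < x * x * A := Nat.mul_pos (Nat.mul_pos (by omega) (by omega)) hA
  constructor
  · nlinarith
  · nlinarith

theorem scc_facts (k : ℕ) {D : SatData} (hD : D.OK 0) :
    EdgeFacts (DirectedOK (2 + D.M + D.A₁ * (D.M + (k + 2)))) D
      ((D.M + (k + 8)) * (D.M + (k + 8)) * (D.M + (k + 8)) * D.A₁) (sccStatic k D) sccEl where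
  nodup := by
    simp only [sccStatic, List.nodup_append']
    refine ⟨nodup_blockList ?_, ⟨nodup_blockList ?_, ⟨nodup_blockList ?_, nodup_blockList ?_, ?_⟩,
      ?_⟩, ?_⟩
    · intro i hi c hc j hj d hd h; simp at h; omega
    · intro i hi c hc j hj d hd h; simp at h; omega
    · intro i hi c hc j hj d hd h; simp at h; omega
    · intro i hi c hc j hj d hd h; simp at h; omega
    all_goals
      intro e he he'
      simp only [List.mem_append, mem_blockList] at he he'
      obtain ⟨i, hi, c, hc, -, rfl⟩ := he
      simp only [Prod.mk.injEq] at he'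
      omega
  inj := by
    intro c hc d hd c' hc' d' hd' h
    interval_cases d <;> interval_cases d' <;> simp [sccEl] at h ⊢ <;> omega
  disj := by
    intro c hc d hd h
    simp only [sccStatic, List.mem_append, mem_blockList] at h
    interval_cases d <;> simp only [sccEl, Prod.mk.injEq] at h <;> omega
  ok_st := by
    intro e h
    simp only [sccStatic, List.mem_append, mem_blockList] at h
    rcases h with ⟨i, hi, c, hc, -, rfl⟩ | ⟨i, hi, c, hc, -, rfl⟩ | ⟨i, hi, c, hc, -, rfl⟩ |
      ⟨i, hi, c, hc, -, rfl⟩ <;> simp only [DirectedOK] <;> omega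
  ok_el := by
    intro c hc d hd
    interval_cases d <;> simp only [sccEl, DirectedOK] <;> omega
  length := by
    have := (scc_size k D.M hD.pos₁).1
    refine lt_of_le_of_lt (Nat.add_le_add_right ?_ _) this
    simp only [sccStatic, List.length_append]
    gcongr <;> exact length_blockList_le ..

theorem sccCode_enc (k : ℕ) {D : SatData} (hD : D.OK 0) {h : HState} (hM : h.Models D) (dec : Bool) :
    (sccGraph k D (if dec then D.toggles else ∅)).Enc (((sccCode k).gen dec).out 12 h) := by
  refine EdgeCode.enc (sccCode_good k le_rfl) (scc_facts k hD) hM ?_ ?_ ?_ ?_ dec rfl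
  · simp [sccCode, sccGraph, hM.M, hM.A₁]
  · simp [sccCode, sccGraph, hM.M, hM.A₁]
  · simp [sccCode, sccStatic, Block.pairs, HState.set_var, hM.M, hM.A₁, hM.T₁]
  · intro c d
    simp [sccCode, sccEl, HState.set_var]

theorem mem_sccGraph {k : ℕ} {D : SatData} {b : ℕ → ℕ} (hb : ∀ c, b c ≤ 1) {x y : ℕ} :
    (x, y) ∈ (sccGraph k D (D.chosen b)).E ↔ (∃ c < D.M, x = 2 + c ∧ y = 0) ∨
      (∃ c < D.M, x = 1 ∧ y = 2 + c) ∨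
      (∃ i < D.A₁ * (D.M + (k + 2)), x = 2 + D.M + i ∧ y = 0) ∨
      (∃ i < D.A₁ * (D.M + (k + 2)), ∃ c < D.M,
        D.T₁ (i / (D.M + (k + 2)) * D.M + c) = 0 ∧ x = 2 + c ∧ y = 2 + D.M + i) ∨
      (∃ c < D.M, b c = 0 ∧ x = 0 ∧ y = 2 + c) ∨ (∃ c < D.M, b c = 1 ∧ x = 2 + c ∧ y = 1) := by
  have key : (∃ p ∈ D.chosen b, sccEl p.1 p.2 = (x, y)) ↔
      (∃ c < D.M, b c = 0 ∧ x = 0 ∧ y = 2 + c) ∨ (∃ c < D.M, b c = 1 ∧ x = 2 + c ∧ y = 1) := by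
    constructor
    · rintro ⟨⟨c, d⟩, hp, h⟩
      obtain ⟨h1, h2⟩ := SatData.mem_chosen.1 hp
      simp only at h1 h2 h
      have := hb c
      rcases (by omega : b c = 0 ∨ b c = 1) with hc | hc
      · rw [h2, hc] at h; simp [sccEl] at h; exact .inl ⟨c, h1, hc, by omega, by omega⟩
      · rw [h2, hc] at h; simp [sccEl] at h; exact .inr ⟨c, h1, hc, by omega, by omega⟩
    · rintro (⟨c, h1, h2, rfl, rfl⟩ | ⟨c, h1, h2, rfl, rfl⟩)
      · exact ⟨(c, 0), SatData.mem_chosen.2 ⟨h1, h2.symm⟩, by simp [sccEl]⟩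
      · exact ⟨(c, 1), SatData.mem_chosen.2 ⟨h1, h2.symm⟩, by simp [sccEl]⟩
  simp only [sccGraph, mem_edgeSet, key, sccStatic, List.mem_append, mem_blockList, Prod.mk.injEq,
    Nat.lt_one_iff, exists_eq_left, ne_eq, one_ne_zero, not_false_eq_true, true_and,
    Nat.sub_eq_zero_iff_le, Nat.one_le_iff_ne_zero, not_not, or_assoc]

/-- What the components tell about the extension of assignments. -/
structure SccFacts (k N : ℕ) (G : DynGraph) (X : Prop) : Prop where
  le : 1 + N ≤ G.n
  num_pos : X → k < G.numSCC
  num_neg : ¬ X → G.numSCC = 2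
  max_pos : X → G.maxSCC < 1 + N
  max_neg : ¬ X → 1 + N ≤ G.maxSCC
  reach_pos : X → G.numReach 0 < 1 + N
  reach_neg : ¬ X → 1 + N ≤ G.numReach 0

/-- A clause lies in the component of the source if the assignment to the last variables falsifies
it, and in that of the sink otherwise. Each copy of a left assignment `a` has an edge back to the
source, and the source reaches it exactly if some clause is falsified both by `a` and by the last
variables. Without an extension all copies join the source, and there are two components. If `a`
gives an extension, its `K` copies are components of their own and are not reachable from the
source. As `K = D.M + k + 2` exceeds both `k` and `D.M + 1`, they are more than `k` components, and
losing them outweighs the source, the sink and all clauses in the counts. -/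
theorem sccGraph_facts (k : ℕ) {D : SatData} (hD : D.OK 0) {b : ℕ → ℕ} (hb : ∀ c, b c ≤ 1) :
    SccFacts k (D.A₁ * (D.M + (k + 2))) (sccGraph k D (D.chosen b)) (D.Ext b) := by
  rw [D.ext_iff_of_ok hD]
  obtain ⟨K, hK⟩ : ∃ K, K = D.M + (k + 2) := ⟨_, rfl⟩
  obtain ⟨G, hG⟩ : ∃ G, G = sccGraph k D (D.chosen b) := ⟨_, rfl⟩
  have hn : G.n = 2 + D.M + D.A₁ * K := by rw [hG, hK]; rfl
  have hE := fun x y : ℕ => mem_sccGraph (k := k) (D := D) hb (x := x) (y := y)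
  rw [← hG, ← hK]
  simp only [← hG, ← hK] at hE
  have h0n : 0 < G.n := by omega
  have h1n : 1 < G.n := by omega
  -- the component of the source
  obtain ⟨S, hS⟩ : ∃ S : ℕ → Prop, S = fun x => x = 0 ∨ (∃ c < D.M, x = 2 + c ∧ b c = 0) ∨
    ∃ i < D.A₁ * K, x = 2 + D.M + i ∧ ∃ c < D.M, b c = 0 ∧ D.T₁ (i / K * D.M + c) = 0 := ⟨_, rfl⟩
  have hclosed : ∀ x y, (x, y) ∈ G.E → S x → S y := by
    intro x y hxy hx
    rw [hS] at hx ⊢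
    rcases (hE _ _).1 hxy with ⟨c, hc, rfl, rfl⟩ | ⟨c, hc, rfl, rfl⟩ | ⟨i, hi, rfl, rfl⟩ |
      ⟨i, hi, c, hc, hT, rfl, rfl⟩ | ⟨c, hc, hbc, rfl, rfl⟩ | ⟨c, hc, hbc, rfl, rfl⟩
    · exact .inl rfl
    · rcases hx with h | ⟨c', hc', h, -⟩ | ⟨i', hi', h, -⟩ <;> omega
    · exact .inl rfl
    · rcases hx with h | ⟨c', hc', h, h'⟩ | ⟨i', hi', h, -⟩
      · omega
      · obtain rfl : c = c' := by omega
        exact .inr (.inr ⟨i, hi, rfl, c, hc, h', hT⟩)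
      · omega
    · exact .inr (.inl ⟨c, hc, rfl, hbc⟩)
    · rcases hx with h | ⟨c', hc', h, h'⟩ | ⟨i', hi', h, -⟩
      · omega
      · obtain rfl : c = c' := by omega
        omega
      · omega
  have hS0 : S 0 := by rw [hS]; exact .inl rfl
  by_cases hX : ∃ a < D.A₁, ∀ c < D.M, D.T₁ (a * D.M + c) ≠ 0 ∨ b c ≠ 0
  · obtain ⟨a, ha, hac⟩ := hX
    have haK : a * K + K ≤ D.A₁ * K := by
      have := Nat.mul_le_mul_right K (show a + 1 ≤ D.A₁ from ha); rwa [Nat.succ_mul] at this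
    -- the vertices of the assignment
    have hcopy : ∀ r < K, ¬ S (2 + D.M + (a * K + r)) := by
      intro r hr h
      rw [hS] at h
      rcases h with h | ⟨c, hc, h, -⟩ | ⟨i, hi, h, c, hc, h1, h2⟩
      · omega
      · omega
      · obtain rfl : i = a * K + r := by omega
        rw [mul_comm a K, Nat.mul_add_div (by omega), Nat.div_eq_of_lt hr, add_zero] at h2
        rcases hac c hc with h | h
        · exact h h2
        · exact h h1
    have hfrom : ∀ u : Fin G.n, ∀ r < K, u.1 = 2 + D.M + (a * K + r) → ∀ v, G.Reach u v →
        v = u ∨ S v.1 := by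
      intro u r hr hu v huv
      have := huv.closed (S := fun x => x = u.1 ∨ S x) (fun x y hxy hx => ?_) (.inl rfl)
      · rcases this with h | h
        · exact .inl (Fin.ext h)
        · exact .inr h
      · rcases hx with rfl | hx
        · rcases (hE _ _).1 hxy with ⟨c, hc, h, rfl⟩ | ⟨c, hc, h, rfl⟩ | ⟨i, hi, h, rfl⟩ |
            ⟨i, hi, c, hc, hT, h, rfl⟩ | ⟨c, hc, hbc, h, rfl⟩ | ⟨c, hc, hbc, h, rfl⟩
          · exact .inr hS0
          · omega
          · exact .inr hS0
          all_goals omega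
        · exact .inr (hclosed _ _ hxy hx)
    have hsingle : ∀ u : Fin G.n, ∀ r < K, u.1 = 2 + D.M + (a * K + r) → G.scc u = {u} := by
      intro u r hr hu
      ext v
      rw [Set.mem_singleton_iff]
      constructor
      · rintro ⟨h1, h2⟩
        rcases hfrom u r hr hu v h2 with h | h
        · exact h
        · have := h1.closed hclosed h
          rw [hu] at this
          exact absurd this (hcopy r hr)
      · rintro rfl; exact G.mem_scc_self v
    -- All vertices but the copies of `a`. They number `2 + D.M + D.A₁ * K - K`, which is below `1 +
    -- D.A₁ * K` because `K` exceeds `D.M + 1`.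
    obtain ⟨t, ht⟩ : ∃ t, t = Finset.range (2 + D.M + a * K) ∪
      Finset.Ico (2 + D.M + (a * K + K)) G.n := ⟨_, rfl⟩
    have htcard : t.card < 1 + D.A₁ * K := by
      have := Finset.card_union_le (Finset.range (2 + D.M + a * K))
        (Finset.Ico (2 + D.M + (a * K + K)) G.n)
      rw [Finset.card_range, Nat.card_Ico, ← ht] at this
      omega
    have hnot : ∀ v : Fin G.n, v.1 ∉ t → ∃ r < K, v.1 = 2 + D.M + (a * K + r) := by
      intro v hv
      rw [ht, Finset.mem_union, Finset.mem_range, Finset.mem_Ico] at hv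
      have := v.2
      exact ⟨v.1 - (2 + D.M + a * K), by omega, by omega⟩
    have hX : ∃ a < D.A₁, ∀ c < D.M, D.T₁ (a * D.M + c) ≠ 0 ∨ b c ≠ 0 := ⟨a, ha, hac⟩
    refine ⟨by omega, fun _ => ?_, fun h => absurd hX h, fun _ => ?_, fun h => absurd hX h,
      fun _ => ?_, fun h => absurd hX h⟩
    · obtain ⟨C, hC⟩ : ∃ C : Set (Fin G.n), C = {v | ∃ r < K, v.1 = 2 + D.M + (a * K + r)} := ⟨_, rfl⟩
      have h1 : (Finset.Ico (2 + D.M + a * K) (2 + D.M + a * K + K)).card ≤ C.ncard := by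
        refine card_le_ncard_fin fun x hx => ?_
        rw [Finset.mem_Ico] at hx
        refine ⟨by omega, ?_⟩
        rw [hC]
        exact ⟨x - (2 + D.M + a * K), by omega, by simp only; omega⟩
      rw [Nat.card_Ico, ← Set.ncard_image_of_injective C (Set.singleton_injective)] at h1
      have h2 : (fun v : Fin G.n => ({v} : Set (Fin G.n))) '' C ⊆ Set.range G.scc := by
        rintro _ ⟨v, hv, rfl⟩
        rw [hC] at hv
        obtain ⟨r, hr, hv⟩ := hv
        exact ⟨v, hsingle v r hr hv⟩
      have h3 := Set.ncard_le_ncard h2 (Set.toFinite _)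
      have : K ≤ G.numSCC := le_trans (by omega) (h1.trans h3)
      omega
    · rw [DynGraph.maxSCC, Finset.sup_lt_iff (by simp)]
      intro v _
      by_cases hv : v.1 ∈ t
      · refine lt_of_le_of_lt (ncard_fin_le fun u hu => ?_) htcard
        by_contra hut
        obtain ⟨r, hr, hur⟩ := hnot u hut
        rcases hfrom u r hr hur v hu.1 with h | h
        · rw [h] at hv; exact hut hv
        · have := hu.2.closed hclosed h
          rw [hur] at this
          exact hcopy r hr this
      · obtain ⟨r, hr, hvr⟩ := hnot v hv
        rw [hsingle v r hr hvr, Set.ncard_singleton]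
        have : 0 < D.A₁ * K := by omega
        omega
    · refine lt_of_le_of_lt (ncard_fin_le (t := t) fun u hu => ?_) htcard
      obtain ⟨h0, hu⟩ := hu
      by_contra hut
      obtain ⟨r, hr, hur⟩ := hnot u hut
      have := hu.closed hclosed hS0
      rw [hur] at this
      exact hcopy r hr this
  · have hX' : ∀ a < D.A₁, ∃ c < D.M, b c = 0 ∧ D.T₁ (a * D.M + c) = 0 := by
      intro a ha
      by_contra hcon
      refine hX ⟨a, ha, fun c hc => ?_⟩
      by_contra hcc
      exact hcon ⟨c, hc, by tauto, by tauto⟩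
    have hclause : ∀ c (hc : c < D.M) (hcn : 2 + c < G.n), b c = 0 →
        G.Reach ⟨0, h0n⟩ ⟨2 + c, hcn⟩ ∧ G.Reach ⟨2 + c, hcn⟩ ⟨0, h0n⟩ := fun c hc hcn hbc =>
      ⟨.of_mem ((hE _ _).2 (.inr (.inr (.inr (.inr (.inl ⟨c, hc, hbc, rfl, rfl⟩)))))),
        .of_mem ((hE _ _).2 (.inl ⟨c, hc, rfl, rfl⟩))⟩
    have hclause' : ∀ c (hc : c < D.M) (hcn : 2 + c < G.n), b c = 1 →
        G.Reach ⟨1, h1n⟩ ⟨2 + c, hcn⟩ ∧ G.Reach ⟨2 + c, hcn⟩ ⟨1, h1n⟩ := fun c hc hcn hbc =>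
      ⟨.of_mem ((hE _ _).2 (.inr (.inl ⟨c, hc, rfl, rfl⟩))),
        .of_mem ((hE _ _).2 (.inr (.inr (.inr (.inr (.inr ⟨c, hc, hbc, rfl, rfl⟩))))))⟩
    have hassign : ∀ i (hi : i < D.A₁ * K) (hin : 2 + D.M + i < G.n),
        G.Reach ⟨0, h0n⟩ ⟨2 + D.M + i, hin⟩ ∧ G.Reach ⟨2 + D.M + i, hin⟩ ⟨0, h0n⟩ := by
      intro i hi hin
      obtain ⟨c, hc, hbc, hT⟩ := hX' (i / K) (Nat.div_lt_of_lt_mul (by rwa [mul_comm]))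
      exact ⟨(hclause c hc (by omega) hbc).1.trans
        (DynGraph.Reach.of_mem ((hE _ _).2 (.inr (.inr (.inr (.inl ⟨i, hi, c, hc, hT, rfl, rfl⟩)))))),
        .of_mem ((hE _ _).2 (.inr (.inr (.inl ⟨i, hi, rfl, rfl⟩))))⟩
    have hall : ∀ v : Fin G.n, G.scc v = G.scc ⟨0, h0n⟩ ∨ G.scc v = G.scc ⟨1, h1n⟩ := by
      rintro ⟨x, hx⟩
      by_cases h0 : x = 0
      · subst h0; exact .inl rfl
      by_cases h1 : x = 1
      · subst h1; exact .inr rfl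
      by_cases h2 : x < 2 + D.M
      · obtain ⟨c, rfl⟩ : ∃ c, x = 2 + c := ⟨x - 2, by omega⟩
        have := hb c
        rcases (by omega : b c = 0 ∨ b c = 1) with h | h
        · obtain ⟨h3, h4⟩ := hclause c (by omega) hx h
          exact .inl (G.scc_eq h4 h3)
        · obtain ⟨h3, h4⟩ := hclause' c (by omega) hx h
          exact .inr (G.scc_eq h4 h3)
      · obtain ⟨i, rfl⟩ : ∃ i, x = 2 + D.M + i := ⟨x - (2 + D.M), by omega⟩
        obtain ⟨h3, h4⟩ := hassign i (by omega) hx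
        exact .inl (G.scc_eq h4 h3)
    -- The source and all copies of all assignments: one component contains these, and this is where
    -- the threshold `1 + D.A₁ * K` comes from.
    obtain ⟨t, ht⟩ : ∃ t, t = insert 0 (Finset.Ico (2 + D.M) G.n) := ⟨_, rfl⟩
    have htcard : t.card = 1 + D.A₁ * K := by
      rw [ht, Finset.card_insert_of_notMem (by simp), Nat.card_Ico]; omega
    have htr : ∀ x ∈ t, ∃ hx : x < G.n, G.Reach ⟨0, h0n⟩ ⟨x, hx⟩ ∧ G.Reach ⟨x, hx⟩ ⟨0, h0n⟩ := by
      intro x hx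
      rw [ht, Finset.mem_insert, Finset.mem_Ico] at hx
      rcases hx with rfl | hx
      · exact ⟨h0n, .refl, .refl⟩
      · obtain ⟨i, rfl⟩ : ∃ i, x = 2 + D.M + i := ⟨x - (2 + D.M), by omega⟩
        exact ⟨hx.2, hassign i (by omega) hx.2⟩
    refine ⟨by omega, fun h => absurd h hX, fun _ => ?_, fun h => absurd h hX, fun _ => ?_,
      fun h => absurd h hX, fun _ => ?_⟩
    · have hr : Set.range G.scc = {G.scc ⟨0, h0n⟩, G.scc ⟨1, h1n⟩} := by
        ext s
        constructor
        · rintro ⟨v, rfl⟩; exact hall v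
        · rintro (rfl | rfl)
          · exact ⟨_, rfl⟩
          · exact ⟨_, rfl⟩
      rw [DynGraph.numSCC, hr, Set.ncard_pair]
      intro he
      have h1 : (⟨1, h1n⟩ : Fin G.n) ∈ G.scc ⟨0, h0n⟩ := by rw [he]; exact G.mem_scc_self _
      have := h1.2.closed hclosed hS0
      rw [hS] at this
      simp only at this
      omega
    · rw [← htcard]
      refine le_trans ?_ (Finset.le_sup (f := fun v => (G.scc v).ncard) (Finset.mem_univ ⟨0, h0n⟩))
      refine card_le_ncard_fin fun x hx => ?_
      obtain ⟨hx, h1, h2⟩ := htr x hx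
      exact ⟨hx, h2, h1⟩
    · rw [← htcard]
      refine card_le_ncard_fin fun x hx => ?_
      obtain ⟨hx, h1, h2⟩ := htr x hx
      exact ⟨hx, h0n, h1⟩

/-- The reduction to a problem about the strongly connected components. -/
def sccToggle (k f : ℕ) {Δ : Type} {dataOK : DynGraph → Δ → Prop} {dataEnc : Δ → List ℕ → Prop}
    {askOK : DynGraph → Δ → ℕ → Prop} {good : DynGraph → Δ → ℕ → ℕ → Prop} (δ : Δ)
    (query thr : Exp) (low : Bool) (hq : ∀ B ≥ k + 8, query.Usable B 4 ∧ thr.Usable B 4)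
    (hok : ∀ G : DynGraph, 0 < G.n → dataOK G δ) (henc : dataEnc δ (if f = 0 then [] else [0]))
    (hask : ∀ (D : SatData) (j : ℕ) (G : DynGraph) (X : Prop),
      SccFacts k (D.A₁ * (D.M + (k + 2))) G X → askOK G δ (query.eval (D.env j 0 0)) ∧
        ∀ a, good G δ (query.eval (D.env j 0 0)) a →
          ((if low then a < thr.eval (D.env j 0 0) else thr.eval (D.env j 0 0) ≤ a) ↔ X)) :
    Toggle (directedProblem Δ dataOK dataEnc askOK good) 0 where
  -- The flag `f` decides whether the source, vertex `0`, is appended to the description of the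
  -- graph.
  gen dec := .seq ((sccCode k).gen dec) (.when (.lit f) (.emit 0))
  argA := .var vD * (2 + .var vC)
  argB := (1 - .var vD) * (2 + .var vC) + .var vD
  query := query
  thr := thr
  low := low
  good := by
    refine ⟨k + 8 + f, fun B hB dec => ⟨⟨(sccCode_good k (by omega)).gen dec, ?_⟩, ?_, ?_,
      (hq B (by omega)).1, (hq B (by omega)).2⟩⟩
    · simp [Gen.Good]; omega
    · simp [Exp.Usable]; omega
    · simp [Exp.Usable]; omega
  arith dec := ⟨(sccCode k).boundsArith (by simp [sccCode]) dec, trivial⟩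
  exponent := 3
  offset := k + 8
  inst D I := (sccGraph k D I, δ)
  valid D I hD hI := by
    have h := scc_facts k hD
    refine ⟨⟨?_, (scc_size k D.M hD.pos₁).2, (h.card_lt hI).le, fun e he => h.ok_of_mem hI he⟩,
      hok _ ?_⟩ <;> (change _ < 2 + _ + _; omega)
  enc dec D h hD hM := by
    refine ⟨_, _, sccCode_enc k hD hM dec, henc, ?_⟩
    by_cases hf : f = 0 <;> simp [Gen.out, hf]
  one_le D I hD := le_trans (by omega) (scc_size k D.M hD.pos₁).2
  n_le D I hD := (scc_size k D.M hD.pos₁).2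
  m_le D I hD := le_of_eq (by
    change (D.M + (k + 8)) * (D.M + (k + 8)) * (D.M + (k + 8)) * D.A₁ = _
    ring)
  ins D I j c d hD hI hc hd hn := by
    have h := scc_facts k hD
    have e : ((Exp.var vD * (2 + .var vC)).eval (D.env j c d),
        ((1 - .var vD) * (2 + .var vC) + .var vD : Exp).eval (D.env j c d)) = sccEl c d := by
      simp [SatData.env, sccEl]
    have h1 := h.ok_el c hc d (by omega)
    have h2 := (h.mem_iff hI hc (by omega)).not.2 hn
    have h3 := h.card_lt hI
    have h4 := edgeSet_insert (sccStatic k D) sccEl I c d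
    rw [← e] at h1 h2 h4
    refine ⟨⟨h1.1, h1.2.1, h1.2.2, h2, h3⟩, ?_⟩
    exact congrArg (fun E => ((⟨(sccGraph k D I).n, (sccGraph k D I).m, E⟩ : DynGraph), δ)) h4
  del D I j c d hD hI hc hd hn := by
    have h := scc_facts k hD
    have e : ((Exp.var vD * (2 + .var vC)).eval (D.env j c d),
        ((1 - .var vD) * (2 + .var vC) + .var vD : Exp).eval (D.env j c d)) = sccEl c d := by
      simp [SatData.env, sccEl]
    have h2 := (h.mem_iff hI hc (by omega)).2 hn
    have h4 := h.erase hI hc (by omega : d < 2)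
    rw [← e] at h2 h4
    refine ⟨h2, ?_⟩
    exact congrArg (fun E => ((⟨(sccGraph k D I).n, (sccGraph k D I).m, E⟩ : DynGraph), δ)) h4
  ask D b j hD hb := hask D j _ _ (sccGraph_facts k hD hb)

theorem not_seth_of_SSRCount {t : ℕ} {ε : ℝ} (hε : 0 < ε) (h : SSRCount.Solvable t (1 - ε)) :
    ¬ SETH := by
  -- With `k = 2` every assignment has `D.M + 4` copies, and `ℓ` is one more than the number of all
  -- copies.
  refine (sccToggle 2 1 (0 : ℕ) (1 + .var vA₁ * (.var vM + .lit 4)) 1 false (fun B hB => ?_) (fun G h => h) rfl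
    fun D j G X hX => ?_).not_seth (by norm_num) hε (by simpa [SSRCount] using h)
  · simp [Exp.Usable]; omega
  · have e : (1 + .var vA₁ * (.var vM + .lit 4) : Exp).eval (D.env j 0 0) = 1 + D.A₁ * (D.M + (2 + 2)) := by
      simp [SatData.env]
    rw [e]
    refine ⟨hX.le, fun a ha => ?_⟩
    have : (1 : Exp).eval (D.env j 0 0) = 1 := rfl
    simp only [this, Bool.false_eq_true, if_false, Nat.one_le_iff_ne_zero, ha]
    by_cases h : X
    · simp [h, hX.reach_pos h]
    · have := hX.reach_neg h
      simp [h]; omega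

theorem not_seth_of_AppxSCC {k t : ℕ} {ε : ℝ} (hε : 0 < ε) (hk : 2 ≤ k)
    (h : (AppxSCC k).Solvable t (1 - ε)) : ¬ SETH := by
  refine (sccToggle k 0 () 0 1 false (fun B hB => ?_) (fun G h => trivial) rfl
    fun D j G X hX => ?_).not_seth (by norm_num) hε (by simpa [AppxSCC] using h)
  · simp [Exp.Usable]; omega
  · have e0 : (0 : Exp).eval (D.env j 0 0) = 0 := rfl
    have e1 : (1 : Exp).eval (D.env j 0 0) = 1 := rfl
    rw [e0, e1]
    by_cases h : X
    · have := hX.num_pos h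
      refine ⟨⟨rfl, .inr this⟩, fun a ha => ?_⟩
      simp only [Bool.false_eq_true, if_false, Nat.one_le_iff_ne_zero, ha, this, h]
    · have := hX.num_neg h
      refine ⟨⟨rfl, .inl this⟩, fun a ha => ?_⟩
      simp only [Bool.false_eq_true, if_false, Nat.one_le_iff_ne_zero, ha, this, h]
      simp; omega

theorem not_seth_of_SC2 {t : ℕ} {ε : ℝ} (hε : 0 < ε) (h : SC2.Solvable t (1 - ε)) : ¬ SETH := by
  refine (sccToggle 2 0 () 0 1 false (fun B hB => ?_) (fun G h => trivial) rfl
    fun D j G X hX => ?_).not_seth (by norm_num) hε (by simpa [SC2] using h)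
  · simp [Exp.Usable]; omega
  · have e0 : (0 : Exp).eval (D.env j 0 0) = 0 := rfl
    have e1 : (1 : Exp).eval (D.env j 0 0) = 1 := rfl
    rw [e0, e1]
    refine ⟨rfl, fun a ha => ?_⟩
    simp only [Bool.false_eq_true, if_false, Nat.one_le_iff_ne_zero, ha]
    by_cases h : X
    · simp [h, hX.num_pos h]
    · simp [h, hX.num_neg h]

theorem not_seth_of_MaxSCC {t : ℕ} {ε : ℝ} (hε : 0 < ε) (h : MaxSCC.Solvable t (1 - ε)) :
    ¬ SETH := by
  refine (sccToggle 2 0 () 0 (1 + .var vA₁ * (.var vM + .lit 4)) true (fun B hB => ?_)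
    (fun G h => trivial) rfl fun D j G X hX => ?_).not_seth (by norm_num) hε (by simpa [MaxSCC] using h)
  · simp [Exp.Usable]; omega
  · have e : (1 + .var vA₁ * (.var vM + .lit 4) : Exp).eval (D.env j 0 0) = 1 + D.A₁ * (D.M + (2 + 2)) := by
      simp [SatData.env]
    rw [e]
    refine ⟨rfl, fun a ha => ?_⟩
    subst ha
    rw [if_pos rfl]
    by_cases h : X
    · simp [h, hX.max_pos h]
    · have := hX.max_neg h
      simp [h]; omega

/-! ## Sets -/

/-- The code for the set of the values of `e`, whose last variable runs over the numbers below `N`. -/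
def rangeGen (N e : Exp) : Gen := .counted 1 (.loop N (.emit e))

theorem rangeGen_good {B L : ℕ} (hB : 1 ≤ B) (hL : L < 30) {N e : Exp} (hN : N.IsBound B)
    (he : e.Below (L + 1)) (he' : e.Fits B) (hs : e.size ≤ 60) : (rangeGen N e).Good B false L :=
  ⟨rfl, hB, hN.1, hN.2.1, hN.2.2, hL, he, he', hs⟩

theorem rangeGen_enc {N e : Exp} {L : ℕ} {h : HState} {A : Finset ℕ} {n : ℕ} {f : ℕ → ℕ}
    (hN : N.eval h = n) (he : ∀ i, e.eval (h.set L i) = f i)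
    (hf : ∀ i < n, ∀ j < n, f i = f j → i = j) (hA : ∀ x, x ∈ A ↔ ∃ i < n, x = f i) :
    EncSet A ((rangeGen N e).out L h) := by
  have hl : (Gen.loop N (.emit e)).out L h = (List.range n).map f := by
    simp only [Gen.out, hN, he]
    rw [← List.map_eq_flatMap]
  refine ⟨(List.range n).map f, ⟨?_, fun x => ?_⟩, ?_⟩
  · refine List.Nodup.map_on ?_ List.nodup_range
    intro i hi j hj h
    exact hf i (List.mem_range.1 hi) j (List.mem_range.1 hj) h
  · rw [hA]; simp [eq_comm]
  · rw [rangeGen, Gen.out, hl]; simp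

/-! ## Reachability between two sets -/

/-- The left assignments are followed by the right ones, and then by two vertices for each clause. -/
def stStatic (D : SatData) : List (ℕ × ℕ) :=
  blockList D.A₁ D.M (fun i c => 1 - D.T₁ (i * D.M + c)) (fun i c => (i, D.A₁ + D.A₂ + 2 * c)) ++
  blockList D.A₂ D.M (fun i c => 1 - D.T₂ (i * D.M + c))
    (fun i c => (D.A₁ + D.A₂ + 2 * c + 1, D.A₁ + i))

/-- The switch `(c, 0)` is the edge from the first vertex of clause `c` to the second. Its reverse
`(c, 1)` is a dummy: when it is on, no edge enters the second vertex. -/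
def stEl (D : SatData) (c d : ℕ) : ℕ × ℕ := (D.A₁ + D.A₂ + 2 * c + d, D.A₁ + D.A₂ + 2 * c + (1 - d))

def stGraph (D : SatData) (I : Finset (ℕ × ℕ)) : DynGraph where
  n := D.A₁ + D.A₂ + 2 * D.M
  m := (D.M + 4) * (D.M + 4) * D.A₁
  E := edgeSet (stStatic D) (stEl D) I

def stCode : EdgeCode where
  n := .var vA₁ + .var vA₂ + 2 * .var vM
  m := (.var vM + 4) * (.var vM + 4) * .var vA₁
  blocks := [⟨.var vA₁, .var vM, 1 - .get 1 (.var 12 * .var vM + .var 13), .var 12,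
      .var vA₁ + .var vA₂ + 2 * .var 13⟩,
    ⟨.var vA₂, .var vM, 1 - .get 2 (.var 12 * .var vM + .var 13),
      .var vA₁ + .var vA₂ + 2 * .var 13 + 1, .var vA₁ + .var 12⟩]
  elA c d := .var vA₁ + .var vA₂ + 2 * c + d
  elB c d := .var vA₁ + .var vA₂ + 2 * c + (1 - d)

theorem stCode_good {B : ℕ} (hB : 4 ≤ B) : stCode.Good B := by
  refine ⟨by omega, ?_, ?_, ?_, ?_, ?_⟩
  · simp [stCode, Exp.IsBound]; omega
  · simp [stCode, Exp.IsBound]; omega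
  · intro β hβ
    simp only [stCode, List.mem_cons, List.not_mem_nil, or_false] at hβ
    rcases hβ with rfl | rfl <;> refine ⟨?_, ?_, ?_, ?_, ?_⟩ <;>
      simp [Exp.IsBound, Exp.IsEntry] <;> omega
  · simp [stCode, Exp.IsEntry]; omega
  · simp [stCode, Exp.IsEntry]; omega

theorem st_size (M : ℕ) {A₁ A₂ : ℕ} (hA : 0 < A₁) (hA' : A₂ ≤ A₁) :
    A₁ * M + A₂ * M + 2 * M < (M + 4) * (M + 4) * A₁ ∧
      A₁ + A₂ + 2 * M ≤ (M + 4) * (M + 4) * A₁ := by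
  have h1 : A₂ * M ≤ A₁ * M := Nat.mul_le_mul_right _ hA'
  have h2 : M ≤ A₁ * M := Nat.le_mul_of_pos_left _ hA
  have h3 : (M + 4) * (M + 4) * A₁ = A₁ * M * M + 8 * (A₁ * M) + 16 * A₁ := by ring
  have h4 := Nat.zero_le (A₁ * M * M)
  omega

theorem st_facts {D : SatData} (hD : D.OK 1) :
    EdgeFacts (DirectedOK (D.A₁ + D.A₂ + 2 * D.M)) D ((D.M + 4) * (D.M + 4) * D.A₁) (stStatic D)
      (stEl D) where
  nodup := by
    simp only [stStatic, List.nodup_append']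
    refine ⟨nodup_blockList ?_, nodup_blockList ?_, ?_⟩
    · intro i hi c hc j hj d hd h; simp at h; omega
    · intro i hi c hc j hj d hd h; simp at h; omega
    · intro e he he'
      simp only [mem_blockList] at he he'
      obtain ⟨i, hi, c, hc, -, rfl⟩ := he
      simp only [Prod.mk.injEq] at he'
      omega
  inj := by
    intro c hc d hd c' hc' d' hd' h
    simp only [stEl, Prod.mk.injEq] at h
    omega
  disj := by
    intro c hc d hd h
    simp only [stStatic, List.mem_append, mem_blockList, stEl, Prod.mk.injEq] at h
    omega
  ok_st := by
    intro e h
    simp only [stStatic, List.mem_append, mem_blockList] at h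
    rcases h with ⟨i, hi, c, hc, -, rfl⟩ | ⟨i, hi, c, hc, -, rfl⟩ <;>
      simp only [DirectedOK] <;> omega
  ok_el := by
    intro c hc d hd
    simp only [stEl, DirectedOK]; omega
  length := by
    refine lt_of_le_of_lt (Nat.add_le_add_right ?_ _) (st_size D.M hD.pos₁ hD.le).1
    simp only [stStatic, List.length_append]
    gcongr <;> exact length_blockList_le ..

theorem mem_stGraph {D : SatData} {b : ℕ → ℕ} {x y : ℕ} :
    (x, y) ∈ (stGraph D (D.chosen b)).E ↔
      (∃ i < D.A₁, ∃ c < D.M, D.T₁ (i * D.M + c) = 0 ∧ x = i ∧ y = D.A₁ + D.A₂ + 2 * c) ∨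
      (∃ i < D.A₂, ∃ c < D.M, D.T₂ (i * D.M + c) = 0 ∧ x = D.A₁ + D.A₂ + 2 * c + 1 ∧
        y = D.A₁ + i) ∨
      (∃ c < D.M, x = D.A₁ + D.A₂ + 2 * c + b c ∧ y = D.A₁ + D.A₂ + 2 * c + (1 - b c)) := by
  have key : (∃ p ∈ D.chosen b, stEl D p.1 p.2 = (x, y)) ↔
      (∃ c < D.M, x = D.A₁ + D.A₂ + 2 * c + b c ∧ y = D.A₁ + D.A₂ + 2 * c + (1 - b c)) := by
    constructor
    · rintro ⟨⟨c, d⟩, hp, h⟩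
      obtain ⟨h1, h2⟩ := SatData.mem_chosen.1 hp
      simp only at h1 h2
      simp only [stEl, Prod.mk.injEq, h2] at h
      exact ⟨c, h1, h.1.symm, h.2.symm⟩
    · rintro ⟨c, h1, rfl, rfl⟩
      exact ⟨(c, b c), SatData.mem_chosen.2 ⟨h1, rfl⟩, rfl⟩
  simp only [stGraph, mem_edgeSet, key, stStatic, List.mem_append, mem_blockList, Prod.mk.injEq,
    ne_eq, Nat.sub_eq_zero_iff_le, Nat.one_le_iff_ne_zero, not_not, or_assoc]

/-- A path from a left to a right assignment passes through the two vertices of a clause that both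
of them falsify, and through the edge between these, which is there when the last variables falsify
the clause too. So an unreachable pair is a pair that completes the assignment to a satisfying one.
-/
theorem stGraph_unreachable_iff {D : SatData} {b : ℕ → ℕ} (hb : ∀ c, b c ≤ 1) {G : DynGraph}
    (hG : G = stGraph D (D.chosen b)) :
    (∃ s t : Fin G.n, s.1 < D.A₁ ∧ (∃ i < D.A₂, t.1 = D.A₁ + i) ∧ ¬ G.Reach s t) ↔ D.Ext b := by
  have hE := fun x y : ℕ => mem_stGraph (D := D) (b := b) (x := x) (y := y)
  have hn : G.n = D.A₁ + D.A₂ + 2 * D.M := by rw [hG]; rfl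
  rw [← hG] at hE
  clear hG
  constructor
  · rintro ⟨⟨s, hs⟩, ⟨t, ht⟩, hs1, ⟨i, hi, hti⟩, hr⟩
    simp only at hs1 hti
    subst hti
    refine ⟨s, hs1, i, hi, fun c hc => ?_⟩
    by_contra hcon
    simp only [not_or, not_not] at hcon
    obtain ⟨h1, h2, h3⟩ := hcon
    have hc1 : D.A₁ + D.A₂ + 2 * c < G.n := by omega
    have hc2 : D.A₁ + D.A₂ + 2 * c + 1 < G.n := by omega
    refine hr ((DynGraph.Reach.of_mem (v := ⟨_, hc1⟩) ?_).trans
      ((DynGraph.Reach.of_mem (v := ⟨_, hc2⟩) ?_).trans (DynGraph.Reach.of_mem ?_)))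
    · exact (hE _ _).2 (.inl ⟨s, hs1, c, hc, h1, rfl, rfl⟩)
    · exact (hE _ _).2 (.inr (.inr ⟨c, hc, by rw [h3]; rfl, by rw [h3]⟩))
    · exact (hE _ _).2 (.inr (.inl ⟨i, hi, c, hc, h2, rfl, rfl⟩))
  · rintro ⟨a, ha, a', ha', H⟩
    refine ⟨⟨a, by omega⟩, ⟨D.A₁ + a', by omega⟩, ha, ⟨a', ha', rfl⟩, fun hr => ?_⟩
    -- The vertices reachable from the left assignment `a`; a right assignment is among them only
    -- through a clause that all three parts falsify.
    obtain ⟨S, hS⟩ : ∃ S : ℕ → Prop, S = fun x => x = a ∨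
      (∃ c < D.M, x = D.A₁ + D.A₂ + 2 * c ∧ D.T₁ (a * D.M + c) = 0) ∨
      (∃ c < D.M, x = D.A₁ + D.A₂ + 2 * c + 1 ∧ D.T₁ (a * D.M + c) = 0 ∧ b c = 0) ∨
      (∃ i < D.A₂, x = D.A₁ + i ∧ ∃ c < D.M, D.T₁ (a * D.M + c) = 0 ∧ b c = 0 ∧
        D.T₂ (i * D.M + c) = 0) := ⟨_, rfl⟩
    have hclosed : ∀ x y, (x, y) ∈ G.E → S x → S y := by
      intro x y hxy hx
      rw [hS] at hx ⊢
      rcases (hE _ _).1 hxy with ⟨i, hi, c, hc, hT, rfl, rfl⟩ | ⟨i, hi, c, hc, hT, rfl, rfl⟩ |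
        ⟨c, hc, rfl, rfl⟩
      · rcases hx with rfl | ⟨c', hc', h, h1⟩ | ⟨c', hc', h, h1, h2⟩ | ⟨i', hi', h, -⟩
        · exact .inr (.inl ⟨c, hc, rfl, hT⟩)
        all_goals omega
      · rcases hx with h | ⟨c', hc', h, h1⟩ | ⟨c', hc', h, h1, h2⟩ | ⟨i', hi', h, -⟩
        · omega
        · omega
        · obtain rfl : c = c' := by omega
          exact .inr (.inr (.inr ⟨i, hi, rfl, c, hc, h1, h2, hT⟩))
        · omega
      · have := hb c
        rcases hx with h | ⟨c', hc', h, h1⟩ | ⟨c', hc', h, h1, h2⟩ | ⟨i', hi', h, -⟩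
        · omega
        · obtain rfl : c = c' := by omega
          have h0 : b c = 0 := by omega
          exact .inr (.inr (.inl ⟨c, hc, by omega, h1, h0⟩))
        · obtain rfl : c = c' := by omega
          omega
        · omega
    have := hr.closed hclosed (by rw [hS]; exact .inl rfl)
    rw [hS] at this
    rcases this with h | ⟨c', hc', h, h1⟩ | ⟨c', hc', h, h1, h2⟩ | ⟨i, hi, h, c, hc, h1, h2, h3⟩
    · simp only at h; omega
    · simp only at h; omega
    · simp only at h; omega
    · simp only at h
      obtain rfl : i = a' := by omega
      have := H c hc
      omega

def stData (D : SatData) : Finset ℕ × Finset ℕ :=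
  (Finset.range D.A₁, (Finset.range D.A₂).image (D.A₁ + ·))

noncomputable def stToggle : Toggle STReach 1 where
  gen dec := .seq (stCode.gen dec) (.seq (rangeGen (.var vA₁) (.var 12))
    (rangeGen (.var vA₂) (.var vA₁ + .var 12)))
  argA := .var vA₁ + .var vA₂ + 2 * .var vC + .var vD
  argB := .var vA₁ + .var vA₂ + 2 * .var vC + (1 - .var vD)
  query := 0
  thr := 1
  low := false
  good := by
    refine ⟨4, fun B hB dec => ⟨⟨(stCode_good hB).gen dec, rangeGen_good (by omega) (by norm_num) ?_ ?_ ?_ ?_,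
      rangeGen_good (by omega) (by norm_num) ?_ ?_ ?_ ?_⟩, ?_, ?_, ?_, ?_⟩⟩ <;>
      simp [Exp.Usable, Exp.IsBound] <;> omega
  arith dec := ⟨stCode.boundsArith (by simp [stCode]) dec, ⟨trivial, trivial⟩, trivial, trivial⟩
  exponent := 2
  offset := 4
  inst D I := (stGraph D I, stData D)
  valid D I hD hI := by
    have h := st_facts hD
    have h0 := hD.pos₁
    refine ⟨⟨?_, (st_size D.M hD.pos₁ hD.le).2, (h.card_lt hI).le, fun e he => h.ok_of_mem hI he⟩,
      ?_, ?_⟩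
    · change 1 ≤ D.A₁ + _ + _; omega
    · intro x hx
      change x < D.A₁ + _ + _
      have := Finset.mem_range.1 hx
      omega
    · intro x hx
      change x < D.A₁ + _ + _
      obtain ⟨i, hi, rfl⟩ := Finset.mem_image.1 hx
      have := Finset.mem_range.1 hi
      omega
  enc dec D h hD hM := by
    refine ⟨_, _, EdgeCode.enc (stCode_good le_rfl) (st_facts hD) hM ?_ ?_ ?_ ?_ dec rfl,
      ⟨_, _, rangeGen_enc (n := D.A₁) (f := fun i => i) ?_ ?_ ?_ ?_,
        rangeGen_enc (n := D.A₂) (f := fun i => D.A₁ + i) ?_ ?_ ?_ ?_, rfl⟩, rfl⟩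
    · simp [stCode, stGraph, hM.M, hM.A₁, hM.A₂]
    · simp [stCode, stGraph, hM.M, hM.A₁]
    · simp [stCode, stStatic, Block.pairs, HState.set_var, hM.M, hM.A₁, hM.A₂, hM.T₁, hM.T₂]
    · intro c d
      simp [stCode, stEl, HState.set_var, hM.A₁, hM.A₂]
    · simp [hM.A₁]
    · intro i; simp
    · exact fun i _ j _ h => h
    · simp [stData]
    · simp [hM.A₂]
    · intro i; simp [HState.set_var, hM.A₁]
    · exact fun i _ j _ h => Nat.add_left_cancel h
    · simp [stData, eq_comm]
  one_le D I hD := by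
    have := (st_size D.M hD.pos₁ hD.le).1
    change 1 ≤ (D.M + 4) * (D.M + 4) * D.A₁
    omega
  n_le D I hD := (st_size D.M hD.pos₁ hD.le).2
  m_le D I hD := le_of_eq (by change (D.M + 4) * (D.M + 4) * D.A₁ = _; ring)
  ins D I j c d hD hI hc hd hn := by
    have h := st_facts hD
    have e : ((.var vA₁ + .var vA₂ + 2 * .var vC + .var vD : Exp).eval (D.env j c d),
        (.var vA₁ + .var vA₂ + 2 * .var vC + (1 - .var vD) : Exp).eval (D.env j c d)) =
          stEl D c d := by
      simp [SatData.env, stEl]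
    have h1 := h.ok_el c hc d (by omega)
    have h2 := (h.mem_iff hI hc (by omega)).not.2 hn
    have h3 := h.card_lt hI
    have h4 := edgeSet_insert (stStatic D) (stEl D) I c d
    rw [← e] at h1 h2 h4
    refine ⟨⟨h1.1, h1.2.1, h1.2.2, h2, h3⟩, ?_⟩
    exact congrArg (fun E => ((⟨(stGraph D I).n, (stGraph D I).m, E⟩ : DynGraph), stData D)) h4
  del D I j c d hD hI hc hd hn := by
    have h := st_facts hD
    have e : ((.var vA₁ + .var vA₂ + 2 * .var vC + .var vD : Exp).eval (D.env j c d),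
        (.var vA₁ + .var vA₂ + 2 * .var vC + (1 - .var vD) : Exp).eval (D.env j c d)) =
          stEl D c d := by
      simp [SatData.env, stEl]
    have h2 := (h.mem_iff hI hc (by omega)).2 hn
    have h4 := h.erase hI hc (by omega : d < 2)
    rw [← e] at h2 h4
    refine ⟨h2, ?_⟩
    exact congrArg (fun E => ((⟨(stGraph D I).n, (stGraph D I).m, E⟩ : DynGraph), stData D)) h4
  ask D b j hD hb := by
    refine ⟨rfl, fun a ha => ?_⟩
    have e1 : (1 : Exp).eval (D.env j 0 0) = 1 := rfl
    rw [e1, if_neg (by simp), Nat.one_le_iff_ne_zero, ← stGraph_unreachable_iff hb rfl]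
    refine ha.trans ?_
    simp [stData, eq_comm]

theorem not_seth_of_STReach {t : ℕ} {ε : ℝ} (hε : 0 < ε) (h : STReach.Solvable t (2 - ε)) :
    ¬ SETH :=
  stToggle.not_seth le_rfl hε (by rw [Nat.cast_one, one_add_one_eq_two]; exact h)

/-! ## The diameter -/

/-- The edge from `2` to `0` and `1`, from `2` to the clauses, from `0` to the left and from `1` to
the right assignments, and from the clauses to the assignments that falsify them. -/
def diamStatic (D : SatData) : List (ℕ × ℕ) :=
  blockList 2 1 (fun _ _ => 1) (fun i _ => (i, 2)) ++
  (blockList (2 * D.M) 1 (fun _ _ => 1) (fun i _ => (2, 3 + i)) ++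
  (blockList D.A₁ 1 (fun _ _ => 1) (fun i _ => (0, 3 + 2 * D.M + i)) ++
  (blockList D.A₂ 1 (fun _ _ => 1) (fun i _ => (1, 3 + 2 * D.M + D.A₁ + i)) ++
  (blockList D.A₁ D.M (fun i c => 1 - D.T₁ (i * D.M + c))
    (fun i c => (3 + c, 3 + 2 * D.M + i)) ++
  blockList D.A₂ D.M (fun i c => 1 - D.T₂ (i * D.M + c))
    (fun i c => (3 + D.M + c, 3 + 2 * D.M + D.A₁ + i))))))

/-- The switch `(c, 0)` joins the two vertices of clause `c`. The switch `(c, 1)` joins the first of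
them to vertex `0`; both already have the neighbour `2`, and the potentials below change by at most
one along this edge. -/
def diamEl (D : SatData) (c d : ℕ) : ℕ × ℕ := ((1 - d) * (3 + c), 3 + c + (1 - d) * D.M)

def diamGraph (D : SatData) (I : Finset (ℕ × ℕ)) : DynGraph where
  n := 3 + 2 * D.M + D.A₁ + D.A₂
  m := (D.M + 4) * (D.M + 4) * D.A₁
  E := edgeSet (diamStatic D) (diamEl D) I

def diamCode : EdgeCode where
  n := 3 + 2 * .var vM + .var vA₁ + .var vA₂
  m := (.var vM + 4) * (.var vM + 4) * .var vA₁
  blocks := [⟨2, 1, 1, .var 12, 2⟩, ⟨2 * .var vM, 1, 1, 2, 3 + .var 12⟩,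
    ⟨.var vA₁, 1, 1, 0, 3 + 2 * .var vM + .var 12⟩,
    ⟨.var vA₂, 1, 1, 1, 3 + 2 * .var vM + .var vA₁ + .var 12⟩,
    ⟨.var vA₁, .var vM, 1 - .get 1 (.var 12 * .var vM + .var 13), 3 + .var 13,
      3 + 2 * .var vM + .var 12⟩,
    ⟨.var vA₂, .var vM, 1 - .get 2 (.var 12 * .var vM + .var 13), 3 + .var vM + .var 13,
      3 + 2 * .var vM + .var vA₁ + .var 12⟩]
  elA c d := (1 - d) * (3 + c)
  elB c d := 3 + c + (1 - d) * .var vM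

theorem diamCode_good {B : ℕ} (hB : 4 ≤ B) : diamCode.Good B := by
  refine ⟨by omega, ?_, ?_, ?_, ?_, ?_⟩
  · simp [diamCode, Exp.IsBound]; omega
  · simp [diamCode, Exp.IsBound]; omega
  · intro β hβ
    simp only [diamCode, List.mem_cons, List.not_mem_nil, or_false] at hβ
    rcases hβ with rfl | rfl | rfl | rfl | rfl | rfl <;> refine ⟨?_, ?_, ?_, ?_, ?_⟩ <;>
      simp [Exp.IsBound, Exp.IsEntry] <;> omega
  · simp [diamCode, Exp.IsEntry]; omega
  · simp [diamCode, Exp.IsEntry]; omega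

theorem diam_size (M : ℕ) {A₁ A₂ : ℕ} (hA : 0 < A₁) (hA' : A₂ ≤ A₁) :
    2 * 1 + (2 * M * 1 + (A₁ * 1 + (A₂ * 1 + (A₁ * M + A₂ * M)))) + 2 * M <
        (M + 4) * (M + 4) * A₁ ∧
      3 + 2 * M + A₁ + A₂ ≤ (M + 4) * (M + 4) * A₁ := by
  have h1 : A₂ * M ≤ A₁ * M := Nat.mul_le_mul_right _ hA'
  have h2 : M ≤ A₁ * M := Nat.le_mul_of_pos_left _ hA
  have h3 : (M + 4) * (M + 4) * A₁ = A₁ * M * M + 8 * (A₁ * M) + 16 * A₁ := by ring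
  have h4 := Nat.zero_le (A₁ * M * M)
  omega

theorem diam_facts {D : SatData} (hD : D.OK 1) :
    EdgeFacts (UndirectedOK (3 + 2 * D.M + D.A₁ + D.A₂)) D ((D.M + 4) * (D.M + 4) * D.A₁)
      (diamStatic D) (diamEl D) where
  nodup := by
    simp only [diamStatic, List.nodup_append']
    refine ⟨nodup_blockList ?_, ⟨nodup_blockList ?_, ⟨nodup_blockList ?_, ⟨nodup_blockList ?_,
      ⟨nodup_blockList ?_, nodup_blockList ?_, ?_⟩, ?_⟩, ?_⟩, ?_⟩, ?_⟩
    · intro i hi c hc j hj d hd h; simp at h; omega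
    · intro i hi c hc j hj d hd h; simp at h; omega
    · intro i hi c hc j hj d hd h; simp at h; omega
    · intro i hi c hc j hj d hd h; simp at h; omega
    · intro i hi c hc j hj d hd h; simp at h; omega
    · intro i hi c hc j hj d hd h; simp at h; omega
    all_goals
      intro e he he'
      simp only [List.mem_append, mem_blockList] at he he'
      obtain ⟨i, hi, c, hc, -, rfl⟩ := he
      simp only [Prod.mk.injEq] at he'
      omega
  inj := by
    intro c hc d hd c' hc' d' hd' h
    interval_cases d <;> interval_cases d' <;> simp [diamEl] at h ⊢ <;> omega
  disj := by
    intro c hc d hd h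
    simp only [diamStatic, List.mem_append, mem_blockList] at h
    interval_cases d <;> simp only [diamEl, Prod.mk.injEq] at h <;> omega
  ok_st := by
    intro e h
    simp only [diamStatic, List.mem_append, mem_blockList] at h
    rcases h with ⟨i, hi, c, hc, -, rfl⟩ | ⟨i, hi, c, hc, -, rfl⟩ | ⟨i, hi, c, hc, -, rfl⟩ |
      ⟨i, hi, c, hc, -, rfl⟩ | ⟨i, hi, c, hc, -, rfl⟩ | ⟨i, hi, c, hc, -, rfl⟩ <;>
      simp only [UndirectedOK] <;> omega
  ok_el := by
    intro c hc d hd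
    interval_cases d <;> simp only [diamEl, UndirectedOK] <;> omega
  length := by
    refine lt_of_le_of_lt (Nat.add_le_add_right ?_ _) (diam_size D.M hD.pos₁ hD.le).1
    simp only [diamStatic, List.length_append]
    gcongr <;> exact length_blockList_le ..

theorem mem_diamGraph {D : SatData} {b : ℕ → ℕ} {x y : ℕ} :
    (x, y) ∈ (diamGraph D (D.chosen b)).E ↔
      (∃ i < 2, x = i ∧ y = 2) ∨ (∃ i < 2 * D.M, x = 2 ∧ y = 3 + i) ∨
      (∃ i < D.A₁, x = 0 ∧ y = 3 + 2 * D.M + i) ∨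
      (∃ i < D.A₂, x = 1 ∧ y = 3 + 2 * D.M + D.A₁ + i) ∨
      (∃ i < D.A₁, ∃ c < D.M, D.T₁ (i * D.M + c) = 0 ∧ x = 3 + c ∧ y = 3 + 2 * D.M + i) ∨
      (∃ i < D.A₂, ∃ c < D.M, D.T₂ (i * D.M + c) = 0 ∧ x = 3 + D.M + c ∧
        y = 3 + 2 * D.M + D.A₁ + i) ∨
      (∃ c < D.M, x = (1 - b c) * (3 + c) ∧ y = 3 + c + (1 - b c) * D.M) := by
  have key : (∃ p ∈ D.chosen b, diamEl D p.1 p.2 = (x, y)) ↔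
      (∃ c < D.M, x = (1 - b c) * (3 + c) ∧ y = 3 + c + (1 - b c) * D.M) := by
    constructor
    · rintro ⟨⟨c, d⟩, hp, h⟩
      obtain ⟨h1, h2⟩ := SatData.mem_chosen.1 hp
      simp only at h1 h2
      simp only [diamEl, Prod.mk.injEq, h2] at h
      exact ⟨c, h1, h.1.symm, h.2.symm⟩
    · rintro ⟨c, h1, rfl, rfl⟩
      exact ⟨(c, b c), SatData.mem_chosen.2 ⟨h1, rfl⟩, rfl⟩
  simp only [diamGraph, mem_edgeSet, key, diamStatic, List.mem_append, mem_blockList,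
    Prod.mk.injEq, Nat.lt_one_iff, exists_eq_left, ne_eq, one_ne_zero, not_false_eq_true, true_and,
    Nat.sub_eq_zero_iff_le, Nat.one_le_iff_ne_zero, not_not, or_assoc]

/-- A function that changes by at most one along edges bounds distances from below. -/
theorem DynGraph.le_edist {G : DynGraph} {f : ℕ → ℕ}
    (hf : ∀ x y, (x, y) ∈ G.E → f x ≤ f y + 1 ∧ f y ≤ f x + 1) {u v : Fin G.n} {k : ℕ}
    (hk : f u.1 + k ≤ f v.1) : (k : ℕ∞) ≤ G.toSimpleGraph.edist u v := by
  have key : ∀ {u v : Fin G.n} (p : G.toSimpleGraph.Walk u v), f v.1 ≤ f u.1 + p.length := by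
    intro u v p
    induction p with
    | nil => simp
    | cons h p ih =>
      have : f _ ≤ f _ + 1 := (SimpleGraph.fromRel_adj _ _ _ |>.1 h).2.elim
        (fun h => (hf _ _ h).2) (fun h => (hf _ _ h).1)
      rw [SimpleGraph.Walk.length_cons]
      omega
  by_contra hcon
  rw [not_le] at hcon
  obtain ⟨p, hp⟩ := SimpleGraph.exists_walk_of_edist_ne_top (ne_top_of_lt hcon)
  rw [← hp] at hcon
  have h1 := key p
  have h2 : p.length < k := by exact_mod_cast hcon
  omega

theorem DynGraph.edist_le_one {G : DynGraph} {x y : ℕ} (hx : x < G.n) (hy : y < G.n)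
    (h : (x, y) ∈ G.E ∨ (y, x) ∈ G.E) : G.toSimpleGraph.edist ⟨x, hx⟩ ⟨y, hy⟩ ≤ 1 := by
  rw [SimpleGraph.edist_le_one_iff_adj_or_eq]
  by_cases he : (⟨x, hx⟩ : Fin G.n) = ⟨y, hy⟩
  · exact .inr he
  · exact .inl ((SimpleGraph.fromRel_adj _ _ _).2 ⟨he, h⟩)

theorem edist_le_add {V : Type} {G : SimpleGraph V} {u v w : V} {a b c : ℕ}
    (h : G.edist u v ≤ a) (h' : G.edist v w ≤ b) (hc : a + b ≤ c) : G.edist u w ≤ c :=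
  G.edist_triangle.trans ((add_le_add h h').trans (by exact_mod_cast hc))

/-- Vertex `2` is adjacent to `0`, `1` and all clause vertices, and every assignment is within
distance two of it. So distances are at most four, and only a left and a right assignment can be
that far apart. A clause falsified by all three parts brings these within distance three. The lower
bounds come from potentials, through `DynGraph.le_edist`. -/
theorem ediam_diamGraph {D : SatData} (hD : D.OK 1) {b : ℕ → ℕ} (hb : ∀ c, b c ≤ 1) {G : DynGraph}
    (hG : G = diamGraph D (D.chosen b)) :
    (D.Ext b → G.toSimpleGraph.ediam = 4) ∧ (¬ D.Ext b → G.toSimpleGraph.ediam = 3) := by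
  have hE := fun x y : ℕ => mem_diamGraph (D := D) (b := b) (x := x) (y := y)
  have hn : G.n = 3 + 2 * D.M + D.A₁ + D.A₂ := by rw [hG]; rfl
  rw [← hG] at hE
  clear hG
  have hA₁ := hD.pos₁
  have hA₂ := hD.pos₂
  have h0 : 0 < G.n := by omega
  have h1 : 1 < G.n := by omega
  have h2 : 2 < G.n := by omega
  have d02 : G.toSimpleGraph.edist ⟨0, h0⟩ ⟨2, h2⟩ ≤ (1 : ℕ) :=
    DynGraph.edist_le_one h0 h2 (.inl ((hE _ _).2 (.inl ⟨0, by omega, rfl, rfl⟩)))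
  have d12 : G.toSimpleGraph.edist ⟨1, h1⟩ ⟨2, h2⟩ ≤ (1 : ℕ) :=
    DynGraph.edist_le_one h1 h2 (.inl ((hE _ _).2 (.inl ⟨1, by omega, rfl, rfl⟩)))
  have dc2 : ∀ i, i < 2 * D.M → ∀ hi : 3 + i < G.n,
      G.toSimpleGraph.edist ⟨3 + i, hi⟩ ⟨2, h2⟩ ≤ (1 : ℕ) := fun i hi hin =>
    DynGraph.edist_le_one hin h2 (.inr ((hE _ _).2 (.inr (.inl ⟨i, hi, rfl, rfl⟩))))
  have da0 : ∀ i, i < D.A₁ → ∀ hi : 3 + 2 * D.M + i < G.n,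
      G.toSimpleGraph.edist ⟨3 + 2 * D.M + i, hi⟩ ⟨0, h0⟩ ≤ (1 : ℕ) := fun i hi hin =>
    DynGraph.edist_le_one hin h0 (.inr ((hE _ _).2 (.inr (.inr (.inl ⟨i, hi, rfl, rfl⟩)))))
  have da1 : ∀ i, i < D.A₂ → ∀ hi : 3 + 2 * D.M + D.A₁ + i < G.n,
      G.toSimpleGraph.edist ⟨3 + 2 * D.M + D.A₁ + i, hi⟩ ⟨1, h1⟩ ≤ (1 : ℕ) := fun i hi hin =>
    DynGraph.edist_le_one hin h1 (.inr ((hE _ _).2 (.inr (.inr (.inr (.inl ⟨i, hi, rfl, rfl⟩))))))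
  have near : ∀ x (hx : x < G.n), x < 3 + 2 * D.M →
      G.toSimpleGraph.edist ⟨x, hx⟩ ⟨2, h2⟩ ≤ (1 : ℕ) := by
    intro x hx hx'
    by_cases hx0 : x = 0
    · subst hx0; exact d02
    by_cases hx1 : x = 1
    · subst hx1; exact d12
    by_cases hx2 : x = 2
    · subst hx2; simp
    obtain ⟨i, rfl⟩ : ∃ i, x = 3 + i := ⟨x - 3, by omega⟩
    exact dc2 i (by omega) hx
  have far : ∀ x (hx : x < G.n), G.toSimpleGraph.edist ⟨x, hx⟩ ⟨2, h2⟩ ≤ (2 : ℕ) := by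
    intro x hx
    by_cases hx' : x < 3 + 2 * D.M
    · exact (near x hx hx').trans (by norm_num)
    by_cases hx1 : x < 3 + 2 * D.M + D.A₁
    · obtain ⟨i, rfl⟩ : ∃ i, x = 3 + 2 * D.M + i := ⟨x - (3 + 2 * D.M), by omega⟩
      exact edist_le_add (da0 i (by omega) hx) d02 le_rfl
    · obtain ⟨i, rfl⟩ : ∃ i, x = 3 + 2 * D.M + D.A₁ + i := ⟨x - (3 + 2 * D.M + D.A₁), by omega⟩
      exact edist_le_add (da1 i (by omega) hx) d12 le_rfl
  have comm : ∀ {u v : Fin G.n} {k : ℕ}, G.toSimpleGraph.edist u v ≤ k →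
      G.toSimpleGraph.edist v u ≤ k := fun h => by rwa [SimpleGraph.edist_comm]
  constructor
  · rintro ⟨a, ha, a', ha', H⟩
    refine le_antisymm ?_ ?_
    · refine SimpleGraph.ediam_le_of_edist_le fun u v => ?_
      exact edist_le_add (far u.1 u.2) (comm (far v.1 v.2)) (by norm_num : 2 + 2 ≤ 4)
    -- The potential rises from `0` at the left assignment `a` to `4` at the right assignment `a'`.
    -- Between the two vertices of a clause it jumps by two only if both falsify the clause; then
    -- the last variables satisfy it, and the edge is absent.
    · obtain ⟨f, hf⟩ : ∃ f : ℕ → ℕ, f = fun x => if x = 0 then 1 else if x = 1 then 3 else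
        if x = 2 then 2 else if x < 3 + D.M then (if D.T₁ (a * D.M + (x - 3)) = 0 then 1 else 2) else
        if x < 3 + 2 * D.M then (if D.T₂ (a' * D.M + (x - (3 + D.M))) = 0 then 3 else 2) else
        if x < 3 + 2 * D.M + D.A₁ then (if x = 3 + 2 * D.M + a then 0 else 2) else
        if x = 3 + 2 * D.M + D.A₁ + a' then 4 else 3 := ⟨_, rfl⟩
      have f0 : f 0 = 1 := by rw [hf]; rfl
      have f1 : f 1 = 3 := by rw [hf]; rfl
      have f2 : f 2 = 2 := by rw [hf]; rfl
      have fc : ∀ c < D.M, f (3 + c) = if D.T₁ (a * D.M + c) = 0 then 1 else 2 := by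
        intro c hc
        rw [hf]
        beta_reduce
        rw [if_neg (by omega), if_neg (by omega), if_neg (by omega), if_pos (by omega),
          Nat.add_sub_cancel_left]
      have fc' : ∀ c < D.M, f (3 + D.M + c) = if D.T₂ (a' * D.M + c) = 0 then 3 else 2 := by
        intro c hc
        rw [hf]
        beta_reduce
        rw [if_neg (by omega), if_neg (by omega), if_neg (by omega), if_neg (by omega),
          if_pos (by omega), Nat.add_sub_cancel_left]
      have fa : ∀ i < D.A₁, f (3 + 2 * D.M + i) = if i = a then 0 else 2 := by
        intro i hi
        rw [hf]
        beta_reduce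
        rw [if_neg (by omega), if_neg (by omega), if_neg (by omega), if_neg (by omega),
          if_neg (by omega), if_pos (by omega)]
        simp
      have fa' : ∀ i, f (3 + 2 * D.M + D.A₁ + i) = if i = a' then 4 else 3 := by
        intro i
        rw [hf]
        beta_reduce
        rw [if_neg (by omega), if_neg (by omega), if_neg (by omega), if_neg (by omega),
          if_neg (by omega), if_neg (by omega)]
        simp
      have key := DynGraph.le_edist (G := G) (f := f) ?_ (u := ⟨3 + 2 * D.M + a, by omega⟩)
        (v := ⟨3 + 2 * D.M + D.A₁ + a', by omega⟩) (k := 4) (by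
          simp only [fa a ha, fa', if_true]; norm_num)
      · exact key.trans SimpleGraph.edist_le_ediam
      · intro x y hxy
        rcases (hE _ _).1 hxy with ⟨i, hi, rfl, rfl⟩ | ⟨i, hi, rfl, rfl⟩ | ⟨i, hi, rfl, rfl⟩ |
          ⟨i, hi, rfl, rfl⟩ | ⟨i, hi, c, hc, hT, rfl, rfl⟩ | ⟨i, hi, c, hc, hT, rfl, rfl⟩ |
          ⟨c, hc, rfl, rfl⟩
        · interval_cases x <;> omega
        · rw [f2]
          by_cases hi' : i < D.M
          · rw [fc i hi']; split_ifs <;> omega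
          · obtain ⟨c, rfl⟩ : ∃ c, i = D.M + c := ⟨i - D.M, by omega⟩
            rw [← add_assoc, fc' c (by omega)]; split_ifs <;> omega
        · rw [f0, fa i hi]; split_ifs <;> omega
        · rw [f1, fa' i]; split_ifs <;> omega
        · rw [fc c hc, fa i hi]
          by_cases hia : i = a
          · subst hia; simp [hT]
          · rw [if_neg hia]; split_ifs <;> omega
        · rw [fc' c hc, fa' i]
          by_cases hia : i = a'
          · subst hia; simp [hT]
          · rw [if_neg hia]; split_ifs <;> omega
        · have := hb c
          rcases (by omega : b c = 0 ∨ b c = 1) with h | h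
          · have hH := H c hc
            rw [h, Nat.sub_zero, one_mul, one_mul, fc c hc,
              show 3 + c + D.M = 3 + D.M + c by omega, fc' c hc]
            split_ifs <;> omega
          · rw [h, Nat.sub_self, zero_mul, zero_mul, add_zero, f0, fc c hc]
            split_ifs <;> omega
  · intro hX
    refine le_antisymm ?_ ?_
    · refine SimpleGraph.ediam_le_of_edist_le ?_
      -- The short way leads through the two vertices of a clause that all three parts falsify.
      have cross : ∀ i (hi : i < D.A₁) i' (hi' : i' < D.A₂) (hin : 3 + 2 * D.M + i < G.n)
          (hin' : 3 + 2 * D.M + D.A₁ + i' < G.n),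
          G.toSimpleGraph.edist ⟨3 + 2 * D.M + i, hin⟩ ⟨3 + 2 * D.M + D.A₁ + i', hin'⟩ ≤ (3 : ℕ) := by
        intro i hi i' hi' hin hin'
        have : ∃ c < D.M, D.T₁ (i * D.M + c) = 0 ∧ D.T₂ (i' * D.M + c) = 0 ∧ b c = 0 := by
          by_contra hcon
          refine hX ⟨i, hi, i', hi', fun c hc => ?_⟩
          by_contra hc'
          exact hcon ⟨c, hc, by tauto, by tauto, by tauto⟩
        obtain ⟨c, hc, hT, hT', hbc⟩ := this
        have hc1 : 3 + c < G.n := by omega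
        have hc2 : 3 + D.M + c < G.n := by omega
        have e1 : G.toSimpleGraph.edist ⟨3 + 2 * D.M + i, hin⟩ ⟨3 + c, hc1⟩ ≤ (1 : ℕ) :=
          DynGraph.edist_le_one _ _ (.inr ((hE _ _).2
            (.inr (.inr (.inr (.inr (.inl ⟨i, hi, c, hc, hT, rfl, rfl⟩)))))))
        have e2 : G.toSimpleGraph.edist ⟨3 + c, hc1⟩ ⟨3 + D.M + c, hc2⟩ ≤ (1 : ℕ) :=
          DynGraph.edist_le_one _ _ (.inl ((hE _ _).2
            (.inr (.inr (.inr (.inr (.inr (.inr ⟨c, hc, by rw [hbc]; omega, by rw [hbc]; omega⟩))))))))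
        have e3 : G.toSimpleGraph.edist ⟨3 + D.M + c, hc2⟩ ⟨3 + 2 * D.M + D.A₁ + i', hin'⟩ ≤ (1 : ℕ) :=
          DynGraph.edist_le_one _ _ (.inl ((hE _ _).2
            (.inr (.inr (.inr (.inr (.inr (.inl ⟨i', hi', c, hc, hT', rfl, rfl⟩))))))))
        exact edist_le_add (edist_le_add e1 e2 le_rfl) e3 le_rfl
      rintro ⟨x, hx⟩ ⟨y, hy⟩
      by_cases hx' : x < 3 + 2 * D.M
      · exact edist_le_add (near x hx hx') (comm (far y hy)) (by norm_num : 1 + 2 ≤ 3)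
      by_cases hy' : y < 3 + 2 * D.M
      · exact edist_le_add (far x hx) (comm (near y hy hy')) (by norm_num : 2 + 1 ≤ 3)
      obtain ⟨i, rfl⟩ : ∃ i, x = 3 + 2 * D.M + i := ⟨x - (3 + 2 * D.M), by omega⟩
      obtain ⟨j, rfl⟩ : ∃ j, y = 3 + 2 * D.M + j := ⟨y - (3 + 2 * D.M), by omega⟩
      by_cases hi : i < D.A₁
      · by_cases hj : j < D.A₁
        · exact edist_le_add (da0 i hi hx) (comm (da0 j hj hy)) (by norm_num : 1 + 1 ≤ 3)
        · obtain ⟨j, rfl⟩ : ∃ k, j = D.A₁ + k := ⟨j - D.A₁, by omega⟩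
          have := cross i hi j (by omega) hx (by omega)
          simp only [add_assoc] at this ⊢
          exact this
      · obtain ⟨i, rfl⟩ : ∃ k, i = D.A₁ + k := ⟨i - D.A₁, by omega⟩
        by_cases hj : j < D.A₁
        · have := comm (cross j hj i (by omega) hy (by omega))
          simp only [add_assoc] at this ⊢
          exact this
        · obtain ⟨j, rfl⟩ : ∃ k, j = D.A₁ + k := ⟨j - D.A₁, by omega⟩
          have e1 := da1 i (by omega) (by omega)
          have e2 := da1 j (by omega) (by omega)
          have := edist_le_add e1 (comm e2) (by norm_num : 1 + 1 ≤ 3)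
          simp only [add_assoc] at this ⊢
          exact this
    -- This potential shows that vertex `0` and a right assignment are never closer than three,
    -- whichever switches are on.
    · obtain ⟨f, hf⟩ : ∃ f : ℕ → ℕ, f = fun x => if x = 0 then 0 else if x = 1 then 2 else
        if x < 3 + D.M then 1 else if x < 3 + 2 * D.M then 2 else
        if x < 3 + 2 * D.M + D.A₁ then 1 else 3 := ⟨_, rfl⟩
      have f0 : f 0 = 0 := by rw [hf]; rfl
      have f1 : f 1 = 2 := by rw [hf]; rfl
      have f2 : f 2 = 1 := by
        rw [hf]; beta_reduce
        rw [if_neg (by omega), if_neg (by omega), if_pos (by omega)]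
      have fc : ∀ c < D.M, f (3 + c) = 1 := by
        intro c hc
        rw [hf]; beta_reduce
        rw [if_neg (by omega), if_neg (by omega), if_pos (by omega)]
      have fc' : ∀ c < D.M, f (3 + D.M + c) = 2 := by
        intro c hc
        rw [hf]; beta_reduce
        rw [if_neg (by omega), if_neg (by omega), if_neg (by omega), if_pos (by omega)]
      have fa : ∀ i < D.A₁, f (3 + 2 * D.M + i) = 1 := by
        intro i hi
        rw [hf]; beta_reduce
        rw [if_neg (by omega), if_neg (by omega), if_neg (by omega), if_neg (by omega),
          if_pos (by omega)]
      have fa' : ∀ i, f (3 + 2 * D.M + D.A₁ + i) = 3 := by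
        intro i
        rw [hf]; beta_reduce
        rw [if_neg (by omega), if_neg (by omega), if_neg (by omega), if_neg (by omega),
          if_neg (by omega)]
      have key := DynGraph.le_edist (G := G) (f := f) ?_ (u := ⟨0, h0⟩)
        (v := ⟨3 + 2 * D.M + D.A₁ + 0, by omega⟩) (k := 3) (by
          change f 0 + 3 ≤ f (3 + 2 * D.M + D.A₁ + 0)
          rw [f0, fa'])
      · exact key.trans SimpleGraph.edist_le_ediam
      · intro x y hxy
        rcases (hE _ _).1 hxy with ⟨i, hi, rfl, rfl⟩ | ⟨i, hi, rfl, rfl⟩ | ⟨i, hi, rfl, rfl⟩ |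
          ⟨i, hi, rfl, rfl⟩ | ⟨i, hi, c, hc, hT, rfl, rfl⟩ | ⟨i, hi, c, hc, hT, rfl, rfl⟩ |
          ⟨c, hc, rfl, rfl⟩
        · interval_cases x <;> omega
        · rw [f2]
          by_cases hi' : i < D.M
          · rw [fc i hi']; omega
          · obtain ⟨c, rfl⟩ : ∃ c, i = D.M + c := ⟨i - D.M, by omega⟩
            rw [← add_assoc, fc' c (by omega)]; omega
        · rw [f0, fa i hi]; omega
        · rw [f1, fa' i]; omega
        · rw [fc c hc, fa i hi]; omega
        · rw [fc' c hc, fa' i]; omega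
        have := hb c
        rcases (by omega : b c = 0 ∨ b c = 1) with h | h
        · have e : 3 + c + (1 - 0) * D.M = 3 + D.M + c := by omega
          rw [h, Nat.sub_zero, one_mul, fc c hc]
          rw [Nat.sub_zero] at e
          rw [e, fc' c hc]; omega
        · rw [h, Nat.sub_self, zero_mul, zero_mul, f0, add_zero, fc c hc]; omega

noncomputable def diamToggle : Toggle Diam43 1 where
  gen := diamCode.gen
  argA := (1 - .var vD) * (3 + .var vC)
  argB := 3 + .var vC + (1 - .var vD) * .var vM
  query := 0
  thr := 4
  low := false
  good := by
    refine ⟨4, fun B hB dec => ⟨(diamCode_good hB).gen dec, ?_, ?_, ?_, ?_⟩⟩ <;>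
      simp [Exp.Usable] <;> omega
  arith dec := diamCode.boundsArith (by simp [diamCode]) dec
  exponent := 2
  offset := 4
  inst D I := diamGraph D I
  valid D I hD hI := by
    have h := diam_facts hD
    refine ⟨?_, (diam_size D.M hD.pos₁ hD.le).2, (h.card_lt hI).le, fun e he => h.ok_of_mem hI he⟩
    change 1 ≤ 3 + _ + _ + _; omega
  enc dec D h hD hM := by
    refine EdgeCode.enc (diamCode_good le_rfl) (diam_facts hD) hM ?_ ?_ ?_ ?_ dec rfl
    · simp [diamCode, diamGraph, hM.M, hM.A₁, hM.A₂]
    · simp [diamCode, diamGraph, hM.M, hM.A₁]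
    · simp [diamCode, diamStatic, Block.pairs, HState.set_var, hM.M, hM.A₁, hM.A₂, hM.T₁, hM.T₂]
    · intro c d
      simp [diamCode, diamEl, HState.set_var, hM.M]
  one_le D I hD := le_trans (by omega) (diam_size D.M hD.pos₁ hD.le).2
  n_le D I hD := (diam_size D.M hD.pos₁ hD.le).2
  m_le D I hD := le_of_eq (by change (D.M + 4) * (D.M + 4) * D.A₁ = _; ring)
  ins D I j c d hD hI hc hd hn := by
    have h := diam_facts hD
    have e : (((1 - .var vD) * (3 + .var vC) : Exp).eval (D.env j c d),
        (3 + .var vC + (1 - .var vD) * .var vM : Exp).eval (D.env j c d)) = diamEl D c d := by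
      simp [SatData.env, diamEl]
    have h1 := h.ok_el c hc d (by omega)
    have h2 := (h.mem_iff hI hc (by omega)).not.2 hn
    have h3 := h.card_lt hI
    have h4 := edgeSet_insert (diamStatic D) (diamEl D) I c d
    rw [← e] at h1 h2 h4
    refine ⟨⟨h1.1, h1.2, h2, h3⟩, ?_⟩
    exact congrArg (fun E => (⟨(diamGraph D I).n, (diamGraph D I).m, E⟩ : DynGraph)) h4
  del D I j c d hD hI hc hd hn := by
    have h := diam_facts hD
    have e : (((1 - .var vD) * (3 + .var vC) : Exp).eval (D.env j c d),
        (3 + .var vC + (1 - .var vD) * .var vM : Exp).eval (D.env j c d)) = diamEl D c d := by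
      simp [SatData.env, diamEl]
    have h2 := (h.mem_iff hI hc (by omega)).2 hn
    have h4 := h.erase hI hc (by omega : d < 2)
    rw [← e] at h2 h4
    refine ⟨h2, ?_⟩
    exact congrArg (fun E => (⟨(diamGraph D I).n, (diamGraph D I).m, E⟩ : DynGraph)) h4
  ask D b j hD hb := by
    obtain ⟨h1, h2⟩ := ediam_diamGraph hD hb rfl
    by_cases h : D.Ext b
    · exact ⟨⟨rfl, .inr (h1 h)⟩, fun a ha => iff_of_true (ha.2 (h1 h)) h⟩
    · exact ⟨⟨rfl, .inl (h2 h)⟩, fun a ha => iff_of_false (by have : a ≤ 3 := ha.1 (h2 h); change ¬ 4 ≤ a; omega) h⟩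

theorem not_seth_of_Diam43 {t : ℕ} {ε : ℝ} (hε : 0 < ε) (h : Diam43.Solvable t (2 - ε)) :
    ¬ SETH :=
  diamToggle.not_seth le_rfl hε (by rw [Nat.cast_one, one_add_one_eq_two]; exact h)

/-! ## Sets with switches -/

/-- The numbers below `k`, and those for the elements that are switched on. -/
def switchSet (k : ℕ) (I : Finset (ℕ × ℕ)) : Finset ℕ :=
  Finset.range k ∪ I.image fun p => k + 2 * p.1 + p.2

section switchSet

variable {k c d x : ℕ} {I : Finset (ℕ × ℕ)}

theorem mem_switchSet : x ∈ switchSet k I ↔ x < k ∨ ∃ p ∈ I, k + 2 * p.1 + p.2 = x := by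
  simp only [switchSet, Finset.mem_union, Finset.mem_range, Finset.mem_image]

theorem switchSet_insert : insert (k + 2 * c + d) (switchSet k I) = switchSet k (insert (c, d) I) := by
  rw [switchSet, switchSet, Finset.image_insert, Finset.union_insert]

theorem mem_switchSet_iff {D : SatData} (hI : I ⊆ D.toggles) (hd : d ≤ 1) :
    k + 2 * c + d ∈ switchSet k I ↔ (c, d) ∈ I := by
  rw [mem_switchSet]
  constructor
  · rintro (h | ⟨⟨c', d'⟩, hp, h⟩)
    · omega
    · have := (SatData.mem_toggles.1 (hI hp)).2
      simp only at this h
      obtain ⟨rfl, rfl⟩ : c' = c ∧ d' = d := by omega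
      exact hp
  · exact fun h => .inr ⟨_, h, rfl⟩

theorem switchSet_erase {D : SatData} (hI : I ⊆ D.toggles) (hd : d ≤ 1) :
    (switchSet k I).erase (k + 2 * c + d) = switchSet k (I.erase (c, d)) := by
  ext x
  rw [Finset.mem_erase, mem_switchSet, mem_switchSet]
  constructor
  · rintro ⟨h1, h | ⟨p, hp, rfl⟩⟩
    · exact .inl h
    · refine .inr ⟨p, Finset.mem_erase.2 ⟨?_, hp⟩, rfl⟩
      rintro rfl; exact h1 rfl
  · rintro (h | ⟨⟨c', d'⟩, hp, rfl⟩)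
    · exact ⟨by omega, .inl h⟩
    · rw [Finset.mem_erase] at hp
      refine ⟨fun he => hp.1 ?_, .inr ⟨_, hp.2, rfl⟩⟩
      have := (SatData.mem_toggles.1 (hI hp.2)).2
      simp only at this he
      obtain ⟨rfl, rfl⟩ : c' = c ∧ d' = d := by omega
      rfl

theorem lt_of_mem_switchSet {D : SatData} (hI : I ⊆ D.toggles) (hx : x ∈ switchSet k I) :
    x < k + 2 * D.M := by
  rcases mem_switchSet.1 hx with h | ⟨p, hp, rfl⟩
  · omega
  · have := SatData.mem_toggles.1 (hI hp)
    omega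

theorem mem_switchSet_chosen {D : SatData} {b : ℕ → ℕ} :
    x ∈ switchSet k (D.chosen b) ↔ x < k ∨ ∃ c < D.M, x = k + 2 * c + b c := by
  rw [mem_switchSet]
  refine or_congr_right ⟨?_, ?_⟩
  · rintro ⟨p, hp, rfl⟩
    obtain ⟨h1, h2⟩ := SatData.mem_chosen.1 hp
    exact ⟨p.1, h1, by rw [h2]⟩
  · rintro ⟨c, hc, rfl⟩
    exact ⟨(c, b c), SatData.mem_chosen.2 ⟨hc, rfl⟩, rfl⟩

end switchSet

/-- The code for the initial set. -/
def switchGen (k : Exp) (dec : Bool) : Gen :=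
  rangeGen (k + (if dec then 2 * .var vM else 0)) (.var 12)

theorem switchGen_good {B : ℕ} (hB : 2 ≤ B) {k : Exp} (hk : k.Below 3) (hk' : k.Fits B)
    (hs : k.size ≤ 20) (dec : Bool) : (switchGen k dec).Good B false 12 := by
  refine rangeGen_good (by omega) (by norm_num) ⟨?_, ?_, ?_⟩ (by simp) (by simp) (by simp) <;>
    cases dec <;> simp [hk, hk'] <;> omega

theorem switchGen_boundsArith {k : Exp} (hk : k.Arith) (dec : Bool) :
    (switchGen k dec).BoundsArith := by
  refine ⟨?_, trivial⟩
  cases dec <;> simp [hk]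

theorem switchGen_enc {D : SatData} {h : HState} (hM : h.Models D) {e : Exp} {k : ℕ}
    (hk : e.eval h = k) (dec : Bool) :
    EncSet (switchSet k (if dec then D.toggles else ∅)) ((switchGen e dec).out 12 h) := by
  refine rangeGen_enc (n := k + if dec then 2 * D.M else 0) (f := fun i => i) ?_ ?_ ?_ ?_
  · cases dec <;> simp [hk, hM.M]
  · intro i; simp
  · exact fun i _ j _ h => h
  · intro x
    rw [mem_switchSet]
    cases dec
    · simp
    · simp only [if_true]
      constructor
      · rintro (h | ⟨p, hp, rfl⟩)
        · exact ⟨x, by omega, rfl⟩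
        · have := SatData.mem_toggles.1 hp
          exact ⟨_, by omega, rfl⟩
      · rintro ⟨i, hi, rfl⟩
        by_cases hx : x < k
        · exact .inl hx
        · exact .inr ⟨((x - k) / 2, (x - k) % 2), SatData.mem_toggles.2 (by simp only; omega),
            by simp only; omega⟩

/-! ## Families of sets -/

/-- The generator writes both sets of a clause in the same pass of its loop, so the list of sets has
to be grouped in pairs. -/
theorem range_map_eq_flatMap {α : Type} (M : ℕ) (g : ℕ → α) :
    (List.range (2 * M + 1)).map g =
      ((List.range M).flatMap fun c => [g (2 * c), g (2 * c + 1)]) ++ [g (2 * M)] := by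
  rw [List.range_succ, List.map_append, List.map_singleton]
  congr 1
  induction M with
  | zero => rfl
  | succ M ih =>
    rw [List.range_succ, List.flatMap_append, ← ih, show 2 * (M + 1) = 2 * M + 1 + 1 from rfl,
      List.range_succ, List.range_succ]
    simp

/-- For the clause `c` there are the set of the numbers `a` with `p a c ≠ 0` and the set of the numbers
below `N`; the last set is the universe. -/
def clauseFamily (D : SatData) (p : ℕ → ℕ → ℕ) (N : ℕ) : SetFamily where
  u := D.A₁
  m := (D.M + 4) * (D.M + 4) * D.A₁
  X := (List.range (2 * D.M + 1)).map fun i => if i = 2 * D.M then Finset.range D.A₁ else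
    if i % 2 = 0 then (Finset.range D.A₁).filter fun a => p a (i / 2) ≠ 0 else Finset.range N

section clauseFamily

variable {D : SatData} {p : ℕ → ℕ → ℕ} {N : ℕ}

theorem length_clauseFamily : (clauseFamily D p N).X.length = 2 * D.M + 1 := by
  simp [clauseFamily]

theorem clauseFamily_getD {i : ℕ} (hi : i < 2 * D.M + 1) : (clauseFamily D p N).X.getD i ∅ =
    if i = 2 * D.M then Finset.range D.A₁ else
    if i % 2 = 0 then (Finset.range D.A₁).filter fun a => p a (i / 2) ≠ 0 else Finset.range N := by
  rw [clauseFamily, List.getD_eq_getElem _ _ (by simpa using hi)]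
  simp

theorem clauseFamily_getD_even {c : ℕ} (hc : c < D.M) : (clauseFamily D p N).X.getD (2 * c) ∅ =
    (Finset.range D.A₁).filter fun a => p a c ≠ 0 := by
  rw [clauseFamily_getD (by omega), if_neg (by omega), if_pos (by omega), Nat.mul_div_cancel_left _
    (by norm_num)]

theorem clauseFamily_getD_odd {c : ℕ} (hc : c < D.M) :
    (clauseFamily D p N).X.getD (2 * c + 1) ∅ = Finset.range N := by
  rw [clauseFamily_getD (by omega), if_neg (by omega), if_neg (by omega)]

theorem clauseFamily_getD_last : (clauseFamily D p N).X.getD (2 * D.M) ∅ = Finset.range D.A₁ := by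
  rw [clauseFamily_getD (by omega), if_pos rfl]

theorem family_size (M : ℕ) {A : ℕ} (hA : 0 < A) :
    (2 * M + 1) * A ≤ (M + 4) * (M + 4) * A ∧ A + (2 * M + 1) ≤ (M + 4) * (M + 4) * A := by
  have h2 : M ≤ A * M := Nat.le_mul_of_pos_left _ hA
  have h3 : (M + 4) * (M + 4) * A = A * M * M + 8 * (A * M) + 16 * A := by ring
  have h4 : (2 * M + 1) * A = 2 * (A * M) + A := by ring
  have h5 := Nat.zero_le (A * M * M)
  omega

theorem clauseFamily_n_le (hA : 0 < D.A₁) :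
    (clauseFamily D p N).n ≤ (clauseFamily D p N).m := by
  rw [SetFamily.n, length_clauseFamily]
  exact (family_size D.M hA).2

theorem clauseFamily_valid (hA : 0 < D.A₁) (hN : N ≤ D.A₁) : (clauseFamily D p N).Valid := by
  have hsub : ∀ A ∈ (clauseFamily D p N).X, A ⊆ Finset.range D.A₁ := by
    intro A hA
    simp only [clauseFamily, List.mem_map] at hA
    obtain ⟨i, -, rfl⟩ := hA
    split_ifs
    · exact subset_rfl
    · exact Finset.filter_subset _ _
    · exact Finset.range_subset_range.2 hN
  refine ⟨hA, clauseFamily_n_le hA, ?_, fun A hA x hx => Finset.mem_range.1 (hsub A hA hx)⟩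
  refine (List.sum_le_card_nsmul _ D.A₁ ?_).trans ?_
  · simp only [List.mem_map]
    rintro _ ⟨A, hA, rfl⟩
    exact (Finset.card_le_card (hsub A hA)).trans (by simp)
  · rw [List.length_map, length_clauseFamily, smul_eq_mul]
    exact (family_size D.M hA).1

end clauseFamily

/-- The code for `clauseFamily`. The clause is the variable `12`, the number is the variable `13`. -/
def familyGen (p N : Exp) : Gen :=
  .seq (.emit (.var vA₁)) (.seq (.emit ((.var vM + 4) * (.var vM + 4) * .var vA₁))
    (.seq (.emit (2 * .var vM + 1))
      (.seq (.loop (.var vM) (.seq (.counted 1 (.loop (.var vA₁) (.when p (.emit (.var 13)))))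
        (rangeGen N (.var 13)))) (rangeGen (.var vA₁) (.var 12)))))

theorem familyGen_good {B : ℕ} (hB : 4 ≤ B) {p N : Exp} (hp : p.IsEntry B) (hN : N.IsBound B) :
    (familyGen p N).Good B false 12 := by
  obtain ⟨h1, h2, h3⟩ := hp
  refine ⟨?_, ?_, ?_, ⟨?_, ?_, ?_, ?_, ⟨rfl, ?_, ?_, ?_, ?_, ?_, h1, h2, h3, ?_⟩,
    rangeGen_good (by omega) (by norm_num) hN (by simp) (by simp) (by simp)⟩,
    rangeGen_good (by omega) (by norm_num) ?_ (by simp) (by simp) (by simp)⟩ <;>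
    first | omega | (simp [Gen.Good, Exp.IsBound] <;> omega)

theorem familyGen_boundsArith {p N : Exp} (hN : N.Arith) : (familyGen p N).BoundsArith := by
  exact ⟨trivial, trivial, trivial, ⟨trivial, ⟨trivial, trivial⟩, hN, trivial⟩, trivial, trivial⟩

theorem filterGen_enc {p N : Exp} {L : ℕ} {h : HState} {n : ℕ} {q : ℕ → ℕ} (hN : N.eval h = n)
    (hp : ∀ i, p.eval (h.set L i) = q i) :
    EncSet ((Finset.range n).filter fun i => q i ≠ 0)
      ((Gen.counted 1 (.loop N (.when p (.emit (.var L))))).out L h) := by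
  have hl : (Gen.loop N (.when p (.emit (.var L)))).out L h =
      (List.range n).filter fun i => q i ≠ 0 := by
    simp only [Gen.out, hN, hp, Exp.eval_var, HState.set_var_self]
    induction List.range n with
    | nil => rfl
    | cons i l ih => by_cases hi : q i = 0 <;> simp only [List.flatMap_cons, List.filter_cons, ih] <;> simp [hi]
  refine ⟨_, ⟨List.nodup_range.filter _, fun x => ?_⟩, by rw [Gen.out, hl, Nat.div_one]⟩
  simp

theorem familyGen_enc {D : SatData} {h : HState} (hM : h.Models D) {p N : Exp} {q : ℕ → ℕ → ℕ}
    {n : ℕ} (hp : ∀ a c, p.eval ((h.set 12 c).set 13 a) = q a c) (hN : ∀ c, N.eval (h.set 12 c) = n) :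
    (clauseFamily D q n).Enc ((familyGen p N).out 12 h) := by
  obtain ⟨F, hF⟩ : ∃ F : ℕ → List ℕ, F = fun c =>
    (Gen.counted 1 (.loop (.var vA₁) (.when p (.emit (.var 13))))).out 13 (h.set 12 c) := ⟨_, rfl⟩
  obtain ⟨F', hF'⟩ : ∃ F' : ℕ → List ℕ, F' = fun c =>
    (rangeGen N (.var 13)).out 13 (h.set 12 c) := ⟨_, rfl⟩
  obtain ⟨U, hU⟩ : ∃ U, U = (rangeGen (.var vA₁) (.var 12)).out 12 h := ⟨_, rfl⟩
  refine ⟨_, ⟨(List.range (2 * D.M + 1)).map fun i => if i = 2 * D.M then U else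
    if i % 2 = 0 then F (i / 2) else F' (i / 2), ?_, rfl⟩, ?_⟩
  · rw [clauseFamily, List.forall₂_map_left_iff, List.forall₂_map_right_iff, List.forall₂_same]
    intro i _
    split_ifs
    · rw [hU]
      exact rangeGen_enc (n := D.A₁) (f := fun i => i) (by simp [hM.A₁]) (by simp)
        (fun i _ j _ h => h) (by simp)
    · rw [hF]
      exact filterGen_enc (by simp [HState.set_var, hM.A₁]) (fun a => hp a (i / 2))
    · rw [hF']
      exact rangeGen_enc (n := n) (f := fun i => i) (hN _) (by simp)
        (fun i _ j _ h => h) (by simp)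
  · rw [length_clauseFamily, range_map_eq_flatMap, List.flatten_append, if_pos rfl]
    have e : ((List.range D.M).flatMap fun c => [if 2 * c = 2 * D.M then U else
        if 2 * c % 2 = 0 then F (2 * c / 2) else F' (2 * c / 2), if 2 * c + 1 = 2 * D.M then U else
        if (2 * c + 1) % 2 = 0 then F ((2 * c + 1) / 2) else F' ((2 * c + 1) / 2)]) =
        (List.range D.M).flatMap fun c => [F c, F' c] := by
      refine List.flatMap_congr fun c hc => ?_
      have hc := List.mem_range.1 hc
      rw [if_neg (by omega), if_pos (by omega), if_neg (by omega), if_neg (by omega),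
        Nat.mul_div_cancel_left _ (by norm_num), (by omega : (2 * c + 1) / 2 = c)]
    rw [e]
    have e' : ((List.range D.M).flatMap fun c => [F c, F' c]).flatten =
        (List.range D.M).flatMap fun c => F c ++ F' c := by
      rw [List.flatMap_def, List.flatMap_def, List.flatten_flatten, List.map_map]
      simp [Function.comp_def]
    rw [e', hF, hF', hU]
    simp [familyGen, Gen.out, clauseFamily, hM.A₁, hM.M]

/-! ## Covers -/

/-- The first set of a clause consists of the left assignments that falsify it, and the second is
empty. The last set makes the family cover the universe and is never inserted. -/
def coverFamily (D : SatData) : SetFamily := clauseFamily D (fun a c => 1 - D.T₁ (a * D.M + c)) 0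

/-- The sets switched on are, up to empty ones, those of the clauses that the last variables
falsify. A left assignment outside all of them satisfies all these clauses. -/
theorem cover_iff {D : SatData} (hD : D.OK 0) {b : ℕ → ℕ} (hb : ∀ c, b c ≤ 1) :
    (∀ x < D.A₁, ∃ i ∈ switchSet 0 (D.chosen b), x ∈ (coverFamily D).X.getD i ∅) ↔ ¬ D.Ext b := by
  rw [D.ext_iff_of_ok hD]
  push Not
  refine forall₂_congr fun x hx => ?_
  constructor
  · rintro ⟨i, hi, hxi⟩
    rcases mem_switchSet_chosen.1 hi with h | ⟨c, hc, rfl⟩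
    · omega
    rcases (by have := hb c; omega : b c = 0 ∨ b c = 1) with h | h
    · rw [h, zero_add, add_zero, coverFamily, clauseFamily_getD_even hc, Finset.mem_filter] at hxi
      exact ⟨c, hc, by omega, h⟩
    · rw [h, zero_add, coverFamily, clauseFamily_getD_odd hc] at hxi
      simp at hxi
  · rintro ⟨c, hc, h, h'⟩
    refine ⟨2 * c, mem_switchSet_chosen.2 (.inr ⟨c, hc, by omega⟩), ?_⟩
    rw [coverFamily, clauseFamily_getD_even hc, Finset.mem_filter, Finset.mem_range]
    exact ⟨hx, by omega⟩

def coverToggle : Toggle SubUnion 0 where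
  gen dec := .seq (familyGen (1 - .get 1 (.var 13 * .var vM + .var 12)) 0) (switchGen 0 dec)
  argA := 2 * .var vC + .var vD
  argB := 0
  query := 0
  thr := 1
  low := true
  good := by
    refine ⟨4, fun B hB dec => ⟨⟨familyGen_good hB ?_ ?_, switchGen_good (by omega) ?_ ?_ ?_ dec⟩,
      ?_, ?_, ?_, ?_⟩⟩ <;> simp [Exp.Usable, Exp.IsBound, Exp.IsEntry] <;> omega
  arith dec := ⟨familyGen_boundsArith (N := 0) trivial, switchGen_boundsArith (k := 0) trivial dec⟩
  exponent := 2
  offset := 4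
  inst D I := (coverFamily D, switchSet 0 I)
  valid D I hD hI := by
    refine ⟨clauseFamily_valid hD.pos₁ (Nat.zero_le _), fun x hx => ?_, fun i hi => ?_⟩
    · refine ⟨(coverFamily D).X.getD (2 * D.M) ∅, ?_, ?_⟩
      · have h : 2 * D.M < (coverFamily D).X.length := by
          rw [coverFamily, length_clauseFamily]; omega
        rw [List.getD_eq_getElem _ _ h]
        exact List.getElem_mem h
      · rw [coverFamily, clauseFamily_getD_last]
        exact Finset.mem_range.2 hx
    · have := lt_of_mem_switchSet hI hi
      change i < (coverFamily D).X.length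
      rw [coverFamily, length_clauseFamily]; omega
  enc dec D h hD hM := ⟨_, _, familyGen_enc hM (by simp [HState.set_var, hM.M, hM.T₁]) (by simp),
    switchGen_enc hM (by simp) dec, rfl⟩
  one_le D I hD := le_trans (by omega) (family_size D.M hD.pos₁).2
  n_le D I hD := clauseFamily_n_le hD.pos₁
  m_le D I hD := le_of_eq (by change (D.M + 4) * (D.M + 4) * D.A₁ = _; ring)
  ins D I j c d hD hI hc hd hn := by
    have e : (2 * .var vC + .var vD : Exp).eval (D.env j c d) = 0 + 2 * c + d := by
      simp [SatData.env]
    have h1 := (mem_switchSet_iff (k := 0) hI hd).not.2 hn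
    have h2 := switchSet_insert (k := 0) (c := c) (d := d) (I := I)
    have h3 : 0 + 2 * c + d < (coverFamily D).X.length := by
      rw [coverFamily, length_clauseFamily]; omega
    rw [← e] at h1 h2 h3
    exact ⟨⟨h3, h1, rfl⟩, congrArg (Prod.mk (coverFamily D)) h2⟩
  del D I j c d hD hI hc hd hn := by
    have e : (2 * .var vC + .var vD : Exp).eval (D.env j c d) = 0 + 2 * c + d := by
      simp [SatData.env]
    have h1 := (mem_switchSet_iff (k := 0) hI hd).2 hn
    have h2 := switchSet_erase (k := 0) (c := c) (d := d) hI hd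
    rw [← e] at h1 h2
    exact ⟨⟨h1, rfl⟩, congrArg (Prod.mk (coverFamily D)) h2⟩
  ask D b j hD hb := by
    refine ⟨rfl, fun a ha => ?_⟩
    have e1 : (1 : Exp).eval (D.env j 0 0) = 1 := rfl
    rw [e1, if_pos rfl, Nat.lt_one_iff]
    exact not_iff_not.1 (ha.trans (cover_iff hD hb))

theorem not_seth_of_SubUnion {t : ℕ} {ε : ℝ} (hε : 0 < ε) (h : SubUnion.Solvable t (1 - ε)) :
    ¬ SETH :=
  coverToggle.not_seth (by norm_num) hε (by simpa using h)

/-! ## Connectivity of induced subgraphs -/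

/-- The root is `0`; the assignments follow, and then there are two vertices for each clause. -/
def connStatic (D : SatData) : List (ℕ × ℕ) :=
  blockList D.M 2 (fun _ _ => 1) (fun c d => (0, 1 + D.A₁ + 2 * c + d)) ++
  blockList D.A₁ D.M (fun i c => 1 - D.T₁ (i * D.M + c)) (fun i c => (1 + i, 1 + D.A₁ + 2 * c))

def connGraph (D : SatData) : DynGraph where
  n := 1 + D.A₁ + 2 * D.M
  m := (D.M + 4) * (D.M + 4) * D.A₁
  E := (connStatic D).toFinset

def connBlocks : List Block :=
  [⟨.var vM, 2, 1, 0, 1 + .var vA₁ + 2 * .var 12 + .var 13⟩,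
    ⟨.var vA₁, .var vM, 1 - .get 1 (.var 12 * .var vM + .var 13), 1 + .var 12,
      1 + .var vA₁ + 2 * .var 13⟩]

theorem connBlocks_good {B : ℕ} (hB : 4 ≤ B) : ∀ β ∈ connBlocks, β.Good B := by
  intro β hβ
  simp only [connBlocks, List.mem_cons, List.not_mem_nil, or_false] at hβ
  rcases hβ with rfl | rfl <;> refine ⟨?_, ?_, ?_, ?_, ?_⟩ <;>
    simp [Exp.IsBound, Exp.IsEntry] <;> omega

theorem conn_size (M : ℕ) {A : ℕ} (hA : 0 < A) :
    M * 2 + A * M ≤ (M + 4) * (M + 4) * A ∧ 1 + A + 2 * M ≤ (M + 4) * (M + 4) * A := by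
  have h2 : M ≤ A * M := Nat.le_mul_of_pos_left _ hA
  have h3 : (M + 4) * (M + 4) * A = A * M * M + 8 * (A * M) + 16 * A := by ring
  have h5 := Nat.zero_le (A * M * M)
  omega

theorem connStatic_nodup (D : SatData) : (connStatic D).Nodup := by
  simp only [connStatic, List.nodup_append']
  refine ⟨nodup_blockList ?_, nodup_blockList ?_, ?_⟩
  · intro i hi c hc j hj d hd h; simp at h; omega
  · intro i hi c hc j hj d hd h; simp at h; omega
  · intro e he he'
    simp only [mem_blockList] at he he'
    obtain ⟨i, hi, c, hc, -, rfl⟩ := he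
    simp only [Prod.mk.injEq] at he'
    omega

theorem mem_connGraph {D : SatData} {x y : ℕ} : (x, y) ∈ (connGraph D).E ↔
    (∃ c < D.M, ∃ d < 2, x = 0 ∧ y = 1 + D.A₁ + 2 * c + d) ∨
      ∃ i < D.A₁, ∃ c < D.M, D.T₁ (i * D.M + c) = 0 ∧ x = 1 + i ∧ y = 1 + D.A₁ + 2 * c := by
  simp only [connGraph, List.mem_toFinset, connStatic, List.mem_append, mem_blockList,
    Prod.mk.injEq, ne_eq, Nat.sub_eq_zero_iff_le, Nat.one_le_iff_ne_zero, not_not, one_ne_zero,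
    not_false_eq_true, true_and]

theorem connGraph_valid {D : SatData} (hA : 0 < D.A₁) : (connGraph D).ValidUndirected := by
  refine ⟨?_, (conn_size D.M hA).2, ?_, ?_⟩
  · change 1 ≤ 1 + _ + _; omega
  · refine (List.toFinset_card_le _).trans (le_trans ?_ (conn_size D.M hA).1)
    rw [connStatic, List.length_append]
    exact Nat.add_le_add (length_blockList_le ..) (length_blockList_le ..)
  · rintro ⟨x, y⟩ h
    change x < y ∧ y < 1 + D.A₁ + 2 * D.M
    rcases mem_connGraph.1 h with ⟨c, hc, d, hd, rfl, rfl⟩ | ⟨i, hi, c, hc, -, rfl, rfl⟩ <;> omega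

/-- The root is adjacent to all clause vertices, and a left assignment only to the first vertices of
the clauses that it falsifies. So the subgraph is connected exactly if every left assignment
falsifies a clause whose first vertex is on, that is, one that the last variables falsify as well.
-/
theorem induce_connected_iff {D : SatData} (hD : D.OK 0) {b : ℕ → ℕ} (hb : ∀ c, b c ≤ 1)
    {G : DynGraph} (hG : G = connGraph D) :
    (G.toSimpleGraph.induce {v : Fin G.n | v.1 ∈ switchSet (1 + D.A₁) (D.chosen b)}).Connected ↔
      ¬ D.Ext b := by
  rw [D.ext_iff_of_ok hD]
  have hE := fun x y : ℕ => mem_connGraph (D := D) (x := x) (y := y)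
  have hn : G.n = 1 + D.A₁ + 2 * D.M := by rw [hG]; rfl
  rw [← hG] at hE
  have h0 : 0 ∈ switchSet (1 + D.A₁) (D.chosen b) := mem_switchSet_chosen.2 (.inl (by omega))
  have ha : ∀ i < D.A₁, 1 + i ∈ switchSet (1 + D.A₁) (D.chosen b) :=
    fun i hi => mem_switchSet_chosen.2 (.inl (by omega))
  have hc : ∀ c < D.M, 1 + D.A₁ + 2 * c + b c ∈ switchSet (1 + D.A₁) (D.chosen b) :=
    fun c hc => mem_switchSet_chosen.2 (.inr ⟨c, hc, rfl⟩)
  have adj : ∀ (x y : ℕ) (hx : x < G.n) (hy : y < G.n)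
      (hx' : x ∈ switchSet (1 + D.A₁) (D.chosen b)) (hy' : y ∈ switchSet (1 + D.A₁) (D.chosen b)),
      (G.toSimpleGraph.induce {v : Fin G.n | v.1 ∈ switchSet (1 + D.A₁) (D.chosen b)}).Adj ⟨⟨x, hx⟩, hx'⟩
        ⟨⟨y, hy⟩, hy'⟩ ↔ x ≠ y ∧ ((x, y) ∈ G.E ∨ (y, x) ∈ G.E) := by
    intro x y hx hy hx' hy'
    rw [SimpleGraph.comap_adj]
    simp [DynGraph.toSimpleGraph]
  constructor
  · rintro h ⟨a, haA, hX⟩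
    obtain ⟨p⟩ := h.preconnected ⟨⟨1 + a, by omega⟩, ha a haA⟩ ⟨⟨0, by omega⟩, h0⟩
    -- The first edge of a path from the assignment `a` to the root already leads to a clause vertex
    -- that is on.
    obtain ⟨⟨⟨w, hw⟩, hw'⟩, h, -⟩ := p.exists_eq_cons_of_ne (by simp)
    rcases ((adj _ _ _ _ (ha a haA) hw').1 h).2 with h | h
    · rcases (hE _ _).1 h with ⟨c, hc, d, hd, h1, h2⟩ | ⟨i, hi, c, hcM, h1, h2, h3⟩
      · omega
      · obtain rfl : a = i := by omega
        have hw'' : w ∈ switchSet (1 + D.A₁) (D.chosen b) := hw'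
        simp only at h3
        rcases mem_switchSet_chosen.1 hw'' with h | ⟨c', hc', h⟩
        · omega
        · have := hb c'
          obtain rfl : c = c' := by omega
          have := hX c hcM
          omega
    · rcases (hE _ _).1 h with ⟨c, hc, d, hd, h1, h2⟩ | ⟨i, hi, c, hcM, h1, h2, h3⟩ <;> omega
  · intro h
    push Not at h
    rw [SimpleGraph.connected_iff_exists_forall_reachable]
    refine ⟨⟨⟨0, by omega⟩, h0⟩, ?_⟩
    have key : ∀ c (hcM : c < D.M),
        (G.toSimpleGraph.induce {v : Fin G.n | v.1 ∈ switchSet (1 + D.A₁) (D.chosen b)}).Reachable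
          ⟨⟨0, by omega⟩, h0⟩
          ⟨⟨1 + D.A₁ + 2 * c + b c, by have := hb c; omega⟩, hc c hcM⟩ := by
      intro c hcM
      refine SimpleGraph.Adj.reachable ((adj ..).2 ⟨by omega, .inl ((hE _ _).2 (.inl ?_))⟩)
      exact ⟨c, hcM, b c, by have := hb c; omega, rfl, rfl⟩
    rintro ⟨⟨x, hx⟩, hx'⟩
    rcases mem_switchSet_chosen.1 hx' with hx1 | ⟨c, hcM, hxc⟩
    · simp only at hx1
      by_cases hx0 : x = 0
      · subst hx0; exact .refl _
      · obtain ⟨a, rfl⟩ : ∃ a, x = 1 + a := ⟨x - 1, by omega⟩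
        obtain ⟨c, hcM, h1, h2⟩ := h a (by omega)
        refine (key c hcM).trans (SimpleGraph.Adj.reachable ((adj ..).2
          ⟨by omega, .inr ((hE _ _).2 (.inr ?_))⟩))
        exact ⟨a, by omega, c, hcM, h1, rfl, by omega⟩
    · simp only at hxc
      subst hxc
      exact key c hcM

def connToggle : Toggle ConnSub 0 where
  gen dec := .seq (graphGen (1 + .var vA₁ + 2 * .var vM)
    ((.var vM + 4) * (.var vM + 4) * .var vA₁) connBlocks) (switchGen (1 + .var vA₁) dec)
  argA := 1 + .var vA₁ + 2 * .var vC + .var vD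
  argB := 0
  query := 0
  thr := 1
  low := true
  good := by
    refine ⟨4, fun B hB dec => ⟨⟨graphGen_good (by omega) ?_ ?_ (connBlocks_good hB),
      switchGen_good (by omega) ?_ ?_ ?_ dec⟩, ?_, ?_, ?_, ?_⟩⟩ <;>
      simp [Exp.Usable, Exp.IsBound] <;> omega
  arith dec := ⟨graphGen_boundsArith (by simp [connBlocks]),
    switchGen_boundsArith (k := 1 + .var vA₁) (by simp) dec⟩
  exponent := 2
  offset := 4
  inst D I := (connGraph D, switchSet (1 + D.A₁) I)
  valid D I hD hI := ⟨connGraph_valid hD.pos₁, fun x hx => lt_of_mem_switchSet hI hx⟩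
  enc dec D h hD hM := by
    refine ⟨_, _, graphGen_enc (connBlocks_good le_rfl) ?_ ?_ ?_ ?_,
      switchGen_enc hM (by simp [hM.A₁]) dec, rfl⟩
    · simp [connGraph, hM.M, hM.A₁]
    · simp [connGraph, hM.M, hM.A₁]
    all_goals
      have e : (connBlocks.flatMap fun β => β.pairs h) = connStatic D := by
        simp [connBlocks, connStatic, Block.pairs, HState.set_var, hM.M, hM.A₁, hM.T₁]
      rw [e]
    · exact connStatic_nodup D
    · simp [connGraph]
  one_le D I hD := le_trans (by omega) (conn_size D.M hD.pos₁).2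
  n_le D I hD := (conn_size D.M hD.pos₁).2
  m_le D I hD := le_of_eq (by change (D.M + 4) * (D.M + 4) * D.A₁ = _; ring)
  ins D I j c d hD hI hc hd hn := by
    have e : (1 + .var vA₁ + 2 * .var vC + .var vD : Exp).eval (D.env j c d) =
        1 + D.A₁ + 2 * c + d := by
      simp [SatData.env]
    have h1 := (mem_switchSet_iff (k := 1 + D.A₁) hI hd).not.2 hn
    have h2 := switchSet_insert (k := 1 + D.A₁) (c := c) (d := d) (I := I)
    have h3 : 1 + D.A₁ + 2 * c + d < (connGraph D).n := by change _ < 1 + D.A₁ + 2 * D.M; omega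
    rw [← e] at h1 h2 h3
    exact ⟨⟨h3, h1, rfl⟩, congrArg (Prod.mk (connGraph D)) h2⟩
  del D I j c d hD hI hc hd hn := by
    have e : (1 + .var vA₁ + 2 * .var vC + .var vD : Exp).eval (D.env j c d) =
        1 + D.A₁ + 2 * c + d := by
      simp [SatData.env]
    have h1 := (mem_switchSet_iff (k := 1 + D.A₁) hI hd).2 hn
    have h2 := switchSet_erase (k := 1 + D.A₁) (c := c) (d := d) hI hd
    rw [← e] at h1 h2
    exact ⟨⟨h1, rfl⟩, congrArg (Prod.mk (connGraph D)) h2⟩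
  ask D b j hD hb := by
    refine ⟨⟨rfl, 0, mem_switchSet_chosen.2 (.inl (by omega))⟩, fun a ha => ?_⟩
    have e1 : (1 : Exp).eval (D.env j 0 0) = 1 := rfl
    rw [e1, if_pos rfl, Nat.lt_one_iff]
    exact not_iff_not.1 (ha.trans (induce_connected_iff hD hb rfl))

theorem not_seth_of_ConnSub {t : ℕ} {ε : ℝ} (hε : 0 < ε) (h : ConnSub.Solvable t (1 - ε)) :
    ¬ SETH :=
  connToggle.not_seth (by norm_num) hε (by simpa using h)

/-! ## Emptiness of intersections -/

/-- Here the first set of a clause consists of the left assignments that satisfy it. The second is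
the universe, which is neutral for intersections. -/
def meetFamily (D : SatData) : SetFamily := clauseFamily D (fun a c => D.T₁ (a * D.M + c)) D.A₁

/-- Each set of a stage is intersected with the result of the intersection before it. All earlier
stages together have appended `j * D.M` sets, so after `c > 0` intersections of stage `j` this
result has the index `2 * D.M + (j * D.M + c)`. For `c = 0` one starts from the universe, at index
`2 * D.M`. The query asks about the index for `c = D.M`. -/
noncomputable def meetCode : Code where
  gen := familyGen (.get 1 (.var 13 * .var vM + .var 12)) (.var vA₁)
  argA := 2 * .var vC + .var vD
  argB := 2 * .var vM + .bin .lt 0 (.var vC) * (.var vAsg * .var vM + .var vC)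
  query := 2 * .var vM + .bin .lt 0 (.var vM) * (.var vAsg * .var vM + .var vM)
  thr := 1
  low := true

/-- The left assignments that satisfy the first `i` clauses, together with the assignment to the last
variables. -/
def SatData.meet (D : SatData) (b : ℕ → ℕ) (i : ℕ) : Finset ℕ :=
  (Finset.range D.A₁).filter fun a => ∀ c < i, D.T₁ (a * D.M + c) ≠ 0 ∨ b c ≠ 0

/-- The family after `j` stages and `i` intersections. -/
structure MeetState (D : SatData) (b : ℕ → ℕ) (j i : ℕ) (F : SetFamily) : Prop where
  length : F.X.length = 2 * D.M + 1 + (j * D.M + i)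
  old : ∀ x < 2 * D.M + 1, F.X.getD x ∅ = (meetFamily D).X.getD x ∅
  last : F.X.getD (2 * D.M + (if 0 < i then 1 else 0) * (j * D.M + i)) ∅ = D.meet b i

theorem MeetState.start {D : SatData} {b : ℕ → ℕ} {j : ℕ} {F : SetFamily}
    (h : F.X.length = 2 * D.M + 1 + j * D.M)
    (h' : ∀ x < 2 * D.M + 1, F.X.getD x ∅ = (meetFamily D).X.getD x ∅) : MeetState D b j 0 F where
  length := h
  old := h'
  last := by
    rw [if_neg (lt_irrefl 0), zero_mul, add_zero, h' _ (by omega), meetFamily,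
      clauseFamily_getD_last]
    simp [SatData.meet]

theorem MeetState.next {D : SatData} {b : ℕ → ℕ} (hb : ∀ c, b c ≤ 1) {j i : ℕ} {F : SetFamily}
    (h : MeetState D b j i F) (hi : i < D.M) :
    EmptyPP.insOK F (2 * i + b i) (2 * D.M + (if 0 < i then 1 else 0) * (j * D.M + i)) ∧
      MeetState D b j (i + 1)
        (EmptyPP.ins F (2 * i + b i) (2 * D.M + (if 0 < i then 1 else 0) * (j * D.M + i))) := by
  have hb' := hb i
  have hl := h.length
  have hlt : 2 * D.M + (if 0 < i then 1 else 0) * (j * D.M + i) < F.X.length := by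
    split_ifs <;> omega
  refine ⟨⟨by omega, hlt⟩, ?_, ?_, ?_⟩
  · change (F.X ++ [_]).length = _
    rw [List.length_append, hl]
    simp only [List.length_singleton]
    omega
  · intro x hx
    change (F.X ++ [_]).getD x ∅ = _
    rw [List.getD_append _ _ _ _ (by omega), h.old x hx]
  · change (F.X ++ [_]).getD _ ∅ = _
    rw [if_pos (Nat.succ_pos i), one_mul, List.getD_append_right _ _ _ _ (by omega),
      (by omega : 2 * D.M + (j * D.M + (i + 1)) - F.X.length = 0), List.getD_cons_zero, h.last,
      h.old _ (by omega)]
    ext a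
    simp only [SatData.meet, Finset.mem_inter, Finset.mem_filter, Finset.mem_range,
      Nat.forall_lt_succ_right]
    rcases (by omega : b i = 0 ∨ b i = 1) with h0 | h0
    · rw [h0, add_zero, meetFamily, clauseFamily_getD_even hi, Finset.mem_filter, Finset.mem_range]
      tauto
    · rw [h0, meetFamily, clauseFamily_getD_odd hi, Finset.mem_range]
      simp

theorem meetCode_spec_pairs {μ : Mode} (hμ : ∀ a b, μ.Allows (.ins a b)) {D : SatData} {b : ℕ → ℕ}
    (hb : ∀ c, b c ≤ 1) {j : ℕ} {rest : List (Request × (ℕ → Prop))}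
    (hrest : ∀ F, MeetState D b j D.M F → EmptyPP.Spec μ F rest) (k : ℕ) :
    ∀ (i : ℕ) (F : SetFamily), MeetState D b j i F → i + k = D.M →
      EmptyPP.Spec μ F (meetCode.pairs D false false j b (List.range' i k) ++ rest) := by
  induction k with
  | zero =>
    intro i F hF hi
    obtain rfl : i = D.M := by omega
    exact hrest F hF
  | succ k ih =>
    intro i F hF hi
    obtain ⟨h1, h2⟩ := hF.next hb (by omega)
    have e : meetCode.update D false false j i (b i) =
        .ins (2 * i + b i) (2 * D.M + (if 0 < i then 1 else 0) * (j * D.M + i)) := by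
      simp [Code.update, meetCode, SatData.env]
    rw [List.range'_succ, Code.pairs, List.map_cons, List.cons_append, e]
    exact ⟨hμ _ _, h1, fun _ _ => trivial, ih (i + 1) _ h2 (by omega)⟩

theorem meet_eq_empty_iff {D : SatData} (hD : D.OK 0) {b : ℕ → ℕ} :
    D.meet b D.M = ∅ ↔ ¬ D.Ext b := by
  rw [D.ext_iff_of_ok hD, SatData.meet, Finset.filter_eq_empty_iff]
  simp

/-- The original sets keep their indices, so a new stage can start from the universe while the
results of earlier stages remain in the family. The only trace of these is the length of the family,
which is known. -/
theorem meetCode_spec {μ : Mode} (hμ : ∀ a b, μ.Allows (.ins a b)) (hμ' : ∀ q, μ.Allows (.ask q))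
    {D : SatData} (hD : D.OK 0) {b : ℕ → ℕ → ℕ} (hb : ∀ j c, b j c ≤ 1) (S : ℕ) :
    ∀ (j : ℕ) (F : SetFamily), F.X.length = 2 * D.M + 1 + j * D.M →
      (∀ x < 2 * D.M + 1, F.X.getD x ∅ = (meetFamily D).X.getD x ∅) →
      EmptyPP.Spec μ F ((List.range' j S).flatMap fun j =>
        meetCode.calls D false .none j (b j) (D.Ext (b j))) := by
  induction S with
  | zero => exact fun j F _ _ => trivial
  | succ S ih =>
    intro j F h1 h2
    rw [List.range'_succ, List.flatMap_cons]
    have hcalls : meetCode.calls D false .none j (b j) (D.Ext (b j)) =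
        meetCode.pairs D false false j (b j) (List.range D.M) ++
          [(meetCode.ask D j, fun a => meetCode.Accepts D j a ↔ D.Ext (b j))] := rfl
    rw [hcalls, List.append_assoc, List.range_eq_range']
    refine meetCode_spec_pairs hμ (hb j) ?_ D.M 0 F (.start h1 h2) (by omega)
    intro F hF
    have e : meetCode.ask D j =
        .ask (2 * D.M + (if 0 < D.M then 1 else 0) * (j * D.M + D.M)) := by
      simp [Code.ask, meetCode, SatData.env]
    have hl := hF.length
    refine ⟨hμ' _, ?_, ?_, ?_⟩
    · rw [e]
      change _ < F.X.length
      split_ifs <;> omega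
    · intro a ha
      rw [e] at ha
      have ha' : a ≠ 0 ↔ F.X.getD _ ∅ = ∅ := ha
      rw [hF.last, meet_eq_empty_iff hD, not_iff_not] at ha'
      change (if true then a < 1 else 1 ≤ a) ↔ _
      rw [if_pos rfl, Nat.lt_one_iff]
      exact ha'
    · exact ih (j + 1) F (by rw [hl]; ring) hF.old

noncomputable def meetGadget {μ : Mode} (hμ : ∀ a b, μ.Allows (.ins a b)) (hμ' : ∀ q, μ.Allows (.ask q)) :
    Gadget EmptyPP μ false .none 0 where
  code := meetCode
  good := by
    refine ⟨4, fun B hB => ⟨familyGen_good hB ?_ ?_, ?_, ?_, ?_, ?_⟩⟩ <;>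
      simp [meetCode, Exp.Usable, Exp.IsBound, Exp.IsEntry] <;> omega
  arith := familyGen_boundsArith trivial
  exponent := 2
  offset := 4
  state := meetFamily
  valid D hD := clauseFamily_valid hD.pos₁ le_rfl
  enc D h hD hM := familyGen_enc hM (by simp [HState.set_var, hM.M, hM.T₁])
    (by simp [HState.set_var, hM.A₁])
  one_le D hD := le_trans (by omega) (family_size D.M hD.pos₁).2
  n_le D hD := clauseFamily_n_le hD.pos₁
  m_le D hD := le_of_eq (by change (D.M + 4) * (D.M + 4) * D.A₁ = _; ring)
  spec D hD b hb S := ⟨by simp, fun _ => meetCode_spec hμ hμ' hD hb S 0 _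
    (by rw [meetFamily, length_clauseFamily]; omega) fun _ _ => rfl⟩

/-- No resets are involved, so amortized bounds are enough here even if there are insertions only.
-/
theorem not_seth_of_EmptyPP {μ : Mode} (hμ : ∀ a b, μ.Allows (.ins a b))
    (hμ' : ∀ q, μ.Allows (.ask q)) {t : ℕ} {ε : ℝ} (hε : 0 < ε)
    (h : EmptyPP.SolvableAmortized μ t (1 - ε)) : ¬ SETH :=
  (meetGadget hμ hμ').not_seth (by norm_num) hε ⟨by simp, fun _ => by simpa using h⟩

theorem theorem1 (ε : ℝ) (hε : 0 < ε) (t : ℕ)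
    (h : SSRCount.Solvable t (1 - ε) ∨
      SC2.Solvable t (1 - ε) ∨
      (∃ k : ℕ, 2 ≤ k ∧ (AppxSCC k).Solvable t (1 - ε)) ∨
      MaxSCC.Solvable t (1 - ε) ∨
      SubUnion.Solvable t (1 - ε) ∨
      ConnSub.Solvable t (1 - ε) ∨
      EmptyPP.SolvableAmortized .full t (1 - ε) ∨
      EmptyPP.SolvableWorstCase .incremental t (1 - ε) ∨
      STReach.Solvable t (2 - ε) ∨
      Diam43.Solvable t (2 - ε)) :
    ¬ SETH := by
  rcases h with h | h | ⟨k, hk, h⟩ | h | h | h | h | h | h | h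
  · exact not_seth_of_SSRCount hε h
  · exact not_seth_of_SC2 hε h
  · exact not_seth_of_AppxSCC hε hk h
  · exact not_seth_of_MaxSCC hε h
  · exact not_seth_of_SubUnion hε h
  · exact not_seth_of_ConnSub hε h
  · exact not_seth_of_EmptyPP (μ := .full) (fun _ _ => trivial) (fun _ => trivial) hε h
  · exact not_seth_of_EmptyPP (μ := .incremental) (fun _ _ => trivial) (fun _ => trivial) hε
      h.amortized
  · exact not_seth_of_STReach hε h
  · exact not_seth_of_Diam43 hε h
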